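/- **Setting.** Let $k\ge 1$, let $C\subset\mathbb R^n$ be a cone ($\lambda C\subset C$ for $\lambda>0$) and let $S\subset C$ be a set, also invariant under dilations, such that $\mathcal R:=C\setminus S$ is a nonempty smooth embedded $k$-dimensional submanifold of $\mathbb R^n$ and $\dim_{\mathcal H}S\le k-3$ (so $S=\emptyset$ if $k\le 2$). Write $\mu_j$ for $j$-dimensional Hausdorff measure (normalized to agree with Lebesgue measure on $\mathbb R^j$), $B_r$ for the open ball of radius $r$ about $0$, and $\nabla$, $\operatorname{div}$ for the gradient and divergence on $\mathcal R$. Let $\rho$ be smooth, positive and homogeneous of degree $p\in\mathbb R$ on $\mathcal R$ and locally integrable on $C$ with respect to $\mu_k$. Let $q$ be smooth on $\mathcal R$ and homogeneous of degree $-2$, with $q=\operatorname{div}\mathcal X+\bar q$ on $\mathcal R$, where $\mathcal X$ is a $C^1$ tangential vector field on $\mathcal R$ and $|\mathcal X|^2+|\bar q|\le P$ for a positive function $P$. Consider the quadratic form $$Q(\varphi,\varphi)=\int_C(|\nabla\varphi|^2-q\varphi^2)\,\rho\,d\mu_k .$$ Let $R>0$, and let $u$ be a smooth positive function on $\mathcal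 R\cap B_R$ with $$\int_{C\cap B_R}\big[|\nabla u|^2+(1+|\nabla\log\rho|^2+P)u^2\big]\rho\,d\mu_k<\infty ,$$ which lies in the domain of $Q$: for each $r<R$ there are smooth functions $\varphi_j$ with compact support in $\mathcal R$ such that $\int_{C\cap B_r}[|\nabla (u-\varphi_j)|^2+(1+|\nabla\log\rho|^2+P)(u-\varphi_j)^2]\rho\,d\mu_k\to 0$. Assume that $u$ is a critical point of $Q$ in $B_R$, i.e. $\int_C(\langle\nabla u,\nabla\varphi\rangle-qu\varphi)\rho\,d\mu_k=0$ for all smooth $\varphi$ with compact support in $\mathcal R\cap B_R$. For $0<\sigma<R$ and functions $f,g$ put $$\langle f,g\rangle_\sigma=\int_{C\cap\partial B_\sigma}fg\,\rho\,d\mu_{k-1},\qquad I_\sigma(f)=\langle f,f\rangle_\sigma,\qquad Q_\sigma(u)=\int_{C\cap B_\sigma}(|\nabla u|^2-qu^2)\,\rho\,d\mu_k,\qquad N(\sigma)=\frac{\sigma\,Q_\sigma(u)}{I_\sigma(u)} .$$ Since $qu^2\rho$ need not be absolutely integrable, $Q_\sigma(u)$ is understood through $q=\operatorname{div}\mathcal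 X+\bar q$, as $$Q_\sigma(u)=\lim_{\varepsilon\downarrow0}\int_{C\cap B_\sigma}\Big[\zeta_\varepsilon(|\nabla u|^2-\bar q u^2)+\langle\mathcal X,\nabla(\zeta_\varepsilon u^2)\rangle+\zeta_\varepsilon u^2\langle\mathcal X,\nabla\log\rho\rangle\Big]\rho\,d\mu_k,\qquad \zeta_\varepsilon(x)=\max\{0,\min\{1,(\sigma-|x|)/\varepsilon\}\}.$$ **Theorem 3.6.** 1. For every $\sigma\in(0,R)$ the limit defining $Q_\sigma(u)$ exists; it equals the Lebesgue integral $\int_{C\cap B_\sigma}(|\nabla u|^2-qu^2)\rho\,d\mu_k$ whenever $qu^2\rho$ is integrable on $C\cap B_\sigma$; and $0<I_\sigma(u)<\infty$. So $N$ is well defined on $(0,R)$. 2. $N$ is monotone nondecreasing on $(0,R)$. 3. For almost every $\sigma\in(0,R)$ the functions $u_r^2\rho$ and $u_ru\rho$ are $\mu_{k-1}$-integrable on $C\cap\partial B_\sigma$, where $u_r=\langle\nabla u,x/|x|\rangle$ is the radial derivative, $N$ is differentiable at $\sigma$, and $$N'(\sigma)=\frac{2\sigma}{I_\sigma(u)^2}\Big(I_\sigma(u_r)\,I_\sigma(u)-\langle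 u_r,u\rangle_\sigma^2\Big).$$ 4. The limit $N(0)=\lim_{\sigma\downarrow0}N(\sigma)$ exists and is finite, and $N(\sigma)=N(0)$ for all $\sigma\in(0,R)$ if and only if $u$ is homogeneous of degree $N(0)$, i.e. $u(\lambda x)=\lambda^{N(0)}u(x)$ whenever $\lambda>0$ and $x,\lambda x\in\mathcal R\cap B_R$. -/

import Mathlib

open MeasureTheory Filter Topology Set
open scoped ContDiff

namespace WeightedCone

noncomputable section

/-- The Euclidean space `ℝⁿ`. -/
abbrev Euc (n : ℕ) : Type := EuclideanSpace ℝ (Fin n)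

/-- `M ⊆ ℝⁿ` is a smooth embedded submanifold of dimension `k` (without boundary): near each of its
points there is a smooth diffeomorphism between open subsets of `ℝⁿ` which straightens `M` to a
`k`-dimensional linear subspace. Smoothness of a function on such an `M` is `ContDiffOn ℝ ∞ f M`
(equivalently: `f` extends smoothly to a neighbourhood of each point of `M`). -/
def IsSmoothSubmanifold {n : ℕ} (k : ℕ) (M : Set (Euc n)) : Prop :=
  ∀ x ∈ M, ∃ (e : OpenPartialHomeomorph (Euc n) (Euc n)) (V : Submodule ℝ (Euc n)),
    x ∈ e.source ∧ ContDiffOn ℝ ∞ e e.source ∧ ContDiffOn ℝ ∞ e.symm e.target ∧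
      Module.finrank ℝ V = k ∧ e.source ∩ M = e.source ∩ e ⁻¹' (V : Set (Euc n))

/-- The tangent space `T_x M`, spanned by the limits of secant directions of `M` at `x`. -/
def tangentSpaceAt {n : ℕ} (M : Set (Euc n)) (x : Euc n) : Submodule ℝ (Euc n) :=
  Submodule.span ℝ (tangentConeAt ℝ M x)

/-- The tangential gradient `∇f` on `M`. A derivative of `f` within `M` is determined on `T_x M`,
so the orthogonal projection onto `T_x M` does not depend on the choice made by `fderivWithin`. -/
def tgrad {n : ℕ} (M : Set (Euc n)) (f : Euc n → ℝ) (x : Euc n) : Euc n :=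
  (tangentSpaceAt M x).starProjection
    ((InnerProductSpace.toDual ℝ (Euc n)).symm (fderivWithin ℝ f M x))

/-- The divergence on `M` of a tangential vector field `X`: the trace over `T_x M` of the tangential
part of the derivative of `X`. -/
def tdiv {n : ℕ} (M : Set (Euc n)) (X : Euc n → Euc n) (x : Euc n) : ℝ :=
  LinearMap.trace ℝ (Euc n)
    (((tangentSpaceAt M x).starProjection ∘L fderivWithin ℝ X M x ∘L
      (tangentSpaceAt M x).starProjection : Euc n →L[ℝ] Euc n) : Euc n →ₗ[ℝ] Euc n)

/-- The radial derivative `f_r = ⟨∇f, x / |x|⟩` (on a cone `M`, the radial direction is tangent). -/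
def radialDeriv {n : ℕ} (M : Set (Euc n)) (f : Euc n → ℝ) (x : Euc n) : ℝ :=
  inner ℝ (tgrad M f x) (‖x‖⁻¹ • x)

/-- Smooth functions on `M` whose support is a compact subset of `M ∩ U`. -/
def IsTestFunction {n : ℕ} (M U : Set (Euc n)) (φ : Euc n → ℝ) : Prop :=
  ContDiffOn ℝ ∞ φ M ∧ ∃ K : Set (Euc n), IsCompact K ∧ K ⊆ M ∩ U ∧ ∀ x ∈ M \ K, φ x = 0

/-- The density `[|∇φ|² + (1 + |∇ log ρ|² + P) φ²] ρ` of the square of the form norm. -/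
def formDensity {n : ℕ} (M : Set (Euc n)) (ρ P φ : Euc n → ℝ) (x : Euc n) : ℝ :=
  (‖tgrad M φ x‖ ^ 2 + (1 + ‖tgrad M (fun y => Real.log (ρ y)) x‖ ^ 2 + P x) * φ x ^ 2) * ρ x

/-- On each ball `B_r` with `r < R` the function `u` is a limit, in the form norm, of functions with
compact support in the regular set `C \ S`; that is, `u` belongs (locally in `B_R`) to the domain of
the quadratic form, which is the completion of the compactly supported functions. -/
def MemFormDomain {n : ℕ} (k : ℕ) (C S : Set (Euc n)) (ρ P : Euc n → ℝ) (R : ℝ)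
    (u : Euc n → ℝ) : Prop :=
  ∀ r : ℝ, r < R → ∀ ε : ENNReal, 0 < ε → ∃ φ : Euc n → ℝ, IsTestFunction (C \ S) univ φ ∧
    ∫⁻ x in C ∩ Metric.ball 0 r,
      ENNReal.ofReal (formDensity (C \ S) ρ P (fun y => u y - φ y) x) ∂μHE[k] < ε

/-- `u` is a critical point in `B_R` of `Q(φ, φ) = ∫_C (|∇φ|² - q φ²) ρ`: the first variation
`2 Q(u, φ)` vanishes for all `φ` with compact support in the regular part of `C ∩ B_R`. -/
def IsCriticalPoint {n : ℕ} (k : ℕ) (C S : Set (Euc n)) (ρ q : Euc n → ℝ) (R : ℝ)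
    (u : Euc n → ℝ) : Prop :=
  ∀ φ : Euc n → ℝ, IsTestFunction (C \ S) (Metric.ball 0 R) φ →
    ∫ x in C ∩ Metric.ball 0 R,
      (inner ℝ (tgrad (C \ S) u x) (tgrad (C \ S) φ x) - q x * u x * φ x) * ρ x ∂μHE[k] = 0

/-- The radial cutoff: `1` for `|x| ≤ σ - ε`, `0` for `|x| ≥ σ`, linear in `|x|` in between. -/
def radialCutoff {n : ℕ} (σ ε : ℝ) (x : Euc n) : ℝ :=
  max 0 (min 1 ((σ - ‖x‖) / ε))

/-- The integrand of `∫_C ζ (|∇u|² - q u²) ρ` for a cutoff `ζ` and a potential `q = div X + q̄`, after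
the term with `div X` has been integrated by parts:
`[ζ (|∇u|² - q̄ u²) + ⟨X, ∇(ζ u²)⟩ + ζ u² ⟨X, ∇ log ρ⟩] ρ`. -/
def cutoffDensity {n : ℕ} (M : Set (Euc n)) (ρ qbar : Euc n → ℝ) (X : Euc n → Euc n)
    (ζ u : Euc n → ℝ) (x : Euc n) : ℝ :=
  (ζ x * (‖tgrad M u x‖ ^ 2 - qbar x * u x ^ 2)
    + inner ℝ (X x) (tgrad M (fun y => ζ y * u y ^ 2) x)
    + ζ x * u x ^ 2 * inner ℝ (X x) (tgrad M (fun y => Real.log (ρ y)) x)) * ρ x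

/-- The form `∫_C ζ (|∇u|² - q u²) ρ` with the radial cutoff `ζ` at distance `ε` from `∂B_σ`. -/
def cutoffForm {n : ℕ} (k : ℕ) (C S : Set (Euc n)) (ρ qbar : Euc n → ℝ) (X : Euc n → Euc n)
    (u : Euc n → ℝ) (σ ε : ℝ) : ℝ :=
  ∫ x in C ∩ Metric.ball 0 σ,
    cutoffDensity (C \ S) ρ qbar X (radialCutoff σ ε) u x ∂μHE[k]

/-- `Q_σ(u) = ∫_{C ∩ B_σ} (|∇u|² - q u²) ρ`, the limit of the forms with radial cutoff. Since only
`|X|² + |q̄|` is controlled, `q u² ρ` need not be absolutely integrable near `S`, and the integral is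
understood through `q = div X + q̄`. -/
def localForm {n : ℕ} (k : ℕ) (C S : Set (Euc n)) (ρ qbar : Euc n → ℝ) (X : Euc n → Euc n)
    (u : Euc n → ℝ) (σ : ℝ) : ℝ :=
  limUnder (𝓝[>] (0 : ℝ)) (fun ε => cutoffForm k C S ρ qbar X u σ ε)

/-- `⟨f, g⟩_σ`, the `ρ`-weighted `L²` inner product on `C ∩ ∂B_σ`, taken with respect to the
`(k-1)`-dimensional Hausdorff measure. -/
def sphereInner {n : ℕ} (k : ℕ) (C : Set (Euc n)) (ρ f g : Euc n → ℝ) (σ : ℝ) : ℝ :=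
  ∫ x in C ∩ Metric.sphere 0 σ, f x * g x * ρ x ∂μHE[k - 1]

/-- `I_σ(f) = ∫_{C ∩ ∂B_σ} f² ρ`. -/
def sphereNormSq {n : ℕ} (k : ℕ) (C : Set (Euc n)) (ρ f : Euc n → ℝ) (σ : ℝ) : ℝ :=
  sphereInner k C ρ f f σ

/-- The frequency function `N(σ) = σ Q_σ(u) / I_σ(u)`. -/
def frequency {n : ℕ} (k : ℕ) (C S : Set (Euc n)) (ρ qbar : Euc n → ℝ) (X : Euc n → Euc n)
    (u : Euc n → ℝ) (σ : ℝ) : ℝ :=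
  σ * localForm k C S ρ qbar X u σ / sphereNormSq k C ρ u σ

end

end WeightedCone

/-! ### Curves in a Hilbert space whose Wronskian with every translate vanishes. -/

section HilbertCurve

/-! In the logarithmic radius `x`, the restrictions of `u` to spheres form a curve `V x = u (eˣ ·)`
in `L²(link, ρ)`. The theorem is read off from a single identity, `⟪V x, V y⟫ = ‖V ((x + y) / 2)‖²`:
see `inner_eq_norm_sq_midpoint` and its application in `CriticalData.inner_sliceCurve`.

The identity comes from dilation invariance. Since `ρ` is homogeneous and `q` has degree `-2`, the
function `u (l ·)` solves the same equation as `u`. Hence the field `u (l ·) ∇u - u ∇(u (l ·))` is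
divergence free for the weight `ρ`, with no source on the singular set or at the vertex, and its
flux through almost every sphere is zero. With `l = eᶜ` this reads `⟪V' x, V (x + c)⟫ = ⟪V x, V' (x
+ c)⟫`, so `c ↦ ⟪V (z + c), V (z - c)⟫` has zero derivative.

By Cauchy-Schwarz the identity makes `log ‖V‖²` midpoint convex, so half its derivative, `logRate`,
is nondecreasing. The identity also yields the regularity that is needed: `z ↦ ‖V (z / 2)‖²` equals
`⟪V x, V (z - x)⟫` for every `x`, and choosing `x` among the points where `V` is differentiable
shows that it is `C¹`, and differentiates `logRate` at `x` itself. This is the formula for `N'`. If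
`logRate` is constant, norms are exponential and equality holds in Cauchy-Schwarz, so `V y = e^{N (y
- x)} V x`, which is homogeneity of `u`. The limit at the vertex is finite because a very negative
rate would make `u² ρ` nonintegrable near `0`.

To identify `N` with `logRate`, the equation is tested with a radial cutoff times `u`, which turns
`Q_σ(u)` into the integral of `u u_r ρ` over the sphere. As `q u²` need not be integrable, `q = div
X + q̄` is first integrated by parts on compactly supported functions and the result is extended to
`u` by approximation in the form norm (`CriticalData.integral_fluxDensity`). In the definition of
`Q_σ` the contributions of `X` on the shell then cancel. When `q u²` is integrable, a separate
approximation argument, `CriticalData.integral_flux_of_integrable`, gives agreement with the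
ordinary integral.

The delicate point is the Wronskian. Since `P` is not assumed homogeneous, `u (l ·)` has no
controlled form norm and cannot be paired with `u` by continuity. Positivity of `u` helps: it makes
the form nonnegative on test functions (`CriticalData.formQ_self_nonneg`), so Cauchy-Schwarz for the
form itself is available. A test function `φ` close to `u` satisfies `Q(φ, g)² ≤ C ‖u - φ‖² Q(g, g)`
with a constant independent of `g` (`CriticalData.exists_sq_formQ_le`), and for `g = ζ φ (l ·)` the
value `Q(g, g)` is bounded after scaling back (`CriticalData.exists_sq_formQ_comp_smul_le`).

The geometric input is the area formula, the divergence theorem on the regular part, and polar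
coordinates on a cone. -/

theorem AbsolutelyContinuousOnInterval.of_dist_le {X Y : Type*} [PseudoMetricSpace X]
    [PseudoMetricSpace Y] {f : ℝ → X} {g : ℝ → Y} {a b K : ℝ}
    (hg : AbsolutelyContinuousOnInterval g a b)
    (hfg : ∀ x ∈ uIcc a b, ∀ y ∈ uIcc a b, dist (f x) (f y) ≤ K * dist (g x) (g y)) :
    AbsolutelyContinuousOnInterval f a b := by
  have h := Tendsto.const_mul K hg
  rw [mul_zero] at h
  refine squeeze_zero' (Eventually.of_forall fun E => Finset.sum_nonneg fun i _ => dist_nonneg) ?_ h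
  refine Filter.mem_inf_of_right ?_
  intro E hE
  rw [mem_ofPred_eq, Finset.mul_sum]
  exact Finset.sum_le_sum fun i hi => hfg _ (hE.1 i hi).1 _ (hE.1 i hi).2

theorem AbsolutelyContinuousOnInterval.comp_add_const {X : Type*} [PseudoMetricSpace X]
    {f : ℝ → X} {a b : ℝ} (z : ℝ) (hf : AbsolutelyContinuousOnInterval f (z + a) (z + b)) :
    AbsolutelyContinuousOnInterval (fun c => f (z + c)) a b := by
  rw [absolutelyContinuousOnInterval_iff] at hf ⊢
  intro ε hε
  obtain ⟨δ, hδ, h⟩ := hf ε hε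
  refine ⟨δ, hδ, fun E hE hEδ => ?_⟩
  refine h (E.1, fun i => (z + (E.2 i).1, z + (E.2 i).2)) ⟨fun i hi => ?_, ?_⟩ (by simpa using hEδ)
  · have h1 := hE.1 i hi
    simp only [mem_uIcc] at h1 ⊢
    grind
  · intro i hi j hj hij
    have h1 := hE.2 hi hj hij
    simp only [Function.onFun, Set.disjoint_left, mem_uIoc] at h1 ⊢
    intro t ht
    have := @h1 (t - z)
    grind

theorem AbsolutelyContinuousOnInterval.comp_const_sub {X : Type*} [PseudoMetricSpace X]
    {f : ℝ → X} {a b : ℝ} (z : ℝ) (hf : AbsolutelyContinuousOnInterval f (z - a) (z - b)) :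
    AbsolutelyContinuousOnInterval (fun c => f (z - c)) a b := by
  rw [absolutelyContinuousOnInterval_iff] at hf ⊢
  intro ε hε
  obtain ⟨δ, hδ, h⟩ := hf ε hε
  refine ⟨δ, hδ, fun E hE hEδ => ?_⟩
  refine h (E.1, fun i => (z - (E.2 i).1, z - (E.2 i).2)) ⟨fun i hi => ?_, ?_⟩ (by simpa only [dist_sub_left] using hEδ)
  · have h1 := hE.1 i hi
    simp only [mem_uIcc] at h1 ⊢
    grind
  · intro i hi j hj hij
    have h1 := hE.2 hi hj hij
    simp only [Function.onFun, Set.disjoint_left, uIoc, mem_Ioc] at h1 ⊢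
    intro t ht ht'
    -- Reflection turns half-open intervals `(a, b]` into `[a, b)`, so a common point of the
    -- reflected intervals need not reflect to a common point of the original ones. The smaller of
    -- the two right endpoints is one.
    refine @h1 (min (max (E.2 i).1 (E.2 i).2) (max (E.2 j).1 (E.2 j).2)) ?_ ?_ <;> grind

variable {H : Type*} [NormedAddCommGroup H] [InnerProductSpace ℝ H]

theorem AbsolutelyContinuousOnInterval.inner {f g : ℝ → H} {a b : ℝ}
    (hf : AbsolutelyContinuousOnInterval f a b) (hg : AbsolutelyContinuousOnInterval g a b) :
    AbsolutelyContinuousOnInterval (fun x => Inner.inner ℝ (f x) (g x)) a b := by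
  obtain ⟨C, hC⟩ := hf.exists_bound
  obtain ⟨D, hD⟩ := hg.exists_bound
  have h := (Tendsto.const_mul D hf).add (Tendsto.const_mul C hg)
  rw [mul_zero, mul_zero, add_zero] at h
  refine squeeze_zero' (Eventually.of_forall fun E => Finset.sum_nonneg fun i _ => dist_nonneg) ?_ h
  refine Filter.mem_inf_of_right ?_
  intro E hE
  rw [mem_ofPred_eq, Finset.mul_sum, Finset.mul_sum, ← Finset.sum_add_distrib]
  refine Finset.sum_le_sum fun i hi => ?_
  obtain ⟨h1, h2⟩ := hE.1 i hi
  rw [dist_eq_norm, dist_eq_norm, dist_eq_norm]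
  have : Inner.inner ℝ (f (E.2 i).1) (g (E.2 i).1) - Inner.inner ℝ (f (E.2 i).2) (g (E.2 i).2) =
      Inner.inner ℝ (f (E.2 i).1 - f (E.2 i).2) (g (E.2 i).1) +
        Inner.inner ℝ (f (E.2 i).2) (g (E.2 i).1 - g (E.2 i).2) := by
    rw [inner_sub_left, inner_sub_right]; ring
  rw [this]
  refine (norm_add_le _ _).trans (add_le_add ?_ ?_)
  · refine (norm_inner_le_norm _ _).trans ?_
    rw [mul_comm]
    exact mul_le_mul_of_nonneg_right (hD _ h1) (norm_nonneg _)
  · exact (norm_inner_le_norm _ _).trans (mul_le_mul_of_nonneg_right (hC _ h2) (norm_nonneg _))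

/-- If the Wronskian of a curve and all its translates vanishes, then the inner product
`⟪V x, V y⟫` depends on `x + y` only. -/
theorem inner_eq_norm_sq_midpoint {L : ℝ} {V V' : ℝ → H}
    (hV : ∀ a b, a < L → b < L → AbsolutelyContinuousOnInterval V a b)
    (hd : ∀ᵐ x, x < L → HasDerivAt V (V' x) x)
    (hW : ∀ c : ℝ, ∀ᵐ x, x < L → x + c < L → inner ℝ (V' x) (V (x + c)) = inner ℝ (V x) (V' (x + c)))
    {x y : ℝ} (hx : x < L) (hy : y < L) :
    inner ℝ (V x) (V y) = ‖V ((x + y) / 2)‖ ^ 2 := by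
  obtain ⟨b, hb, hbL⟩ := exists_between (max_lt hx hy)
  have hxb : x < b := (le_max_left _ _).trans_lt hb
  have hyb : y < b := (le_max_right _ _).trans_lt hb
  have hVcont : ContinuousOn V (Iio L) := by
    intro s hs
    obtain ⟨c, hsc, hcL⟩ := exists_between (show s < L from hs)
    have h1 := (hV (s - 1) c (by linarith) hcL).continuousOn
    rw [uIcc_of_le (by linarith)] at h1
    exact (h1.continuousAt (Icc_mem_nhds (by linarith) hsc)).continuousWithinAt
  -- Freezing `V` beyond `b` makes the curve continuous on the whole line, so that `Ψ` is jointly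
  -- continuous on the plane.
  set W : ℝ → H := fun t => V (min t b) with hWdef
  have hWc : Continuous W := by
    have : Continuous fun t : ℝ => min t b := by fun_prop
    exact hVcont.comp_continuous this fun t => (min_le_right t b).trans_lt hbL
  set Ψ : ℝ → ℝ → ℝ := fun z c => inner ℝ (W (z + c)) (W (z - c)) with hΨ
  have hΨc : Continuous (Function.uncurry Ψ) := by
    simp only [hΨ, Function.uncurry_def]
    fun_prop
  have hΨV : ∀ z c, z + c ≤ b → z - c ≤ b → Ψ z c = inner ℝ (V (z + c)) (V (z - c)) := by
    intro z c h1 h2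
    simp only [hΨ, hWdef, min_eq_left h1, min_eq_left h2]
  -- Measurability of the set of pairs at which the `c`-derivative exists and vanishes; it is what
  -- allows the almost everywhere quantifiers to be exchanged.
  have hS := measurableSet_of_differentiableAt_of_isComplete_with_param (𝕜 := ℝ) hΨc
    (K := {0}) isClosed_singleton.isComplete
  have hae : ∀ c, ∀ᵐ z, (z + c < b ∧ z - c < b) →
      (DifferentiableAt ℝ (Ψ z) c ∧ fderiv ℝ (Ψ z) c ∈ ({0} : Set (ℝ →L[ℝ] ℝ))) := by
    intro c
    have q1 := (measurePreserving_add_right volume c).quasiMeasurePreserving.ae hd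
    have q2 := (measurePreserving_add_right volume (-c)).quasiMeasurePreserving.ae hd
    -- The Wronskian hypothesis with shift `-2c` at the point `z + c`, which relates `z + c` to `z -
    -- c`.
    have q3 := (measurePreserving_add_right volume c).quasiMeasurePreserving.ae (hW (-(2 * c)))
    filter_upwards [q1, q2, q3] with z h1 h2 h3 ⟨hz1, hz2⟩
    rw [show z + c + -(2 * c) = z - c by ring] at h3
    rw [← sub_eq_add_neg] at h2
    have e1 := h1 (hz1.trans hbL)
    have e2 := h2 (hz2.trans hbL)
    have e3 := h3 (hz1.trans hbL) (hz2.trans hbL)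
    have d1 : HasDerivAt (fun c => V (z + c)) (V' (z + c)) c := by
      exact HasDerivAt.comp_const_add z c e1
    have d2 : HasDerivAt (fun c => V (z - c)) (-V' (z - c)) c := by
      exact HasDerivAt.comp_const_sub z c e2
    have d3 := d1.inner ℝ d2
    rw [inner_neg_right, e3, neg_add_cancel] at d3
    have d4 : HasDerivAt (Ψ z) 0 c := by
      refine d3.congr_of_eventuallyEq ?_
      have o1 : ∀ᶠ t in 𝓝 c, z + t < b :=
        (continuous_const.add continuous_id).continuousAt.eventually (gt_mem_nhds hz1) |>.mono
          fun t ht => ht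
      have o2 : ∀ᶠ t in 𝓝 c, z - t < b :=
        (continuous_const.sub continuous_id).continuousAt.eventually (gt_mem_nhds hz2) |>.mono
          fun t ht => ht
      filter_upwards [o1, o2] with t ht1 ht2
      exact hΨV z t ht1.le ht2.le
    refine ⟨d4.differentiableAt, ?_⟩
    rw [mem_singleton_iff, d4.hasFDerivAt.fderiv]
    ext; simp
  have hO : MeasurableSet {p : ℝ × ℝ | p.2 + p.1 < b ∧ p.2 - p.1 < b} := by
    exact ((isOpen_Iio.preimage (by fun_prop : Continuous fun p : ℝ × ℝ => p.2 + p.1)).inter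
      (isOpen_Iio.preimage (by fun_prop : Continuous fun p : ℝ × ℝ => p.2 - p.1))).measurableSet
  -- By Fubini, for almost every `z` the `c`-derivative of `Ψ z` vanishes for almost every `c`.
  have hswap := (Measure.ae_ae_comm (μ := (volume : Measure ℝ)) (ν := (volume : Measure ℝ))
    (p := fun c z => (z + c < b ∧ z - c < b) →
      (DifferentiableAt ℝ (Ψ z) c ∧ fderiv ℝ (Ψ z) c ∈ ({0} : Set (ℝ →L[ℝ] ℝ)))) (by
      have := hO.compl.union (measurable_swap hS)
      refine this.congr ?_
      ext p
      simp only [mem_union, mem_compl_iff, mem_ofPred_eq, mem_preimage, Prod.fst_swap,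
        Prod.snd_swap]
      tauto)).1 (ae_of_all _ hae)
  set c₁ := (x - y) / 2 with hc₁
  have hU : IsOpen {z : ℝ | z + c₁ < b ∧ z - c₁ < b} :=
    (isOpen_Iio.preimage (by fun_prop : Continuous fun z : ℝ => z + c₁)).inter
      (isOpen_Iio.preimage (by fun_prop : Continuous fun z : ℝ => z - c₁))
  -- For almost every `z`, `Ψ z` is absolutely continuous with zero derivative, hence constant
  -- between `0` and `c₁`. Continuity in `z` removes the exceptional set.
  have hfin : EqOn (fun z => Ψ z c₁) (fun z => Ψ z 0) {z : ℝ | z + c₁ < b ∧ z - c₁ < b} := by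
    refine Measure.eqOn_open_of_ae_eq (μ := (volume : Measure ℝ)) ?_ hU ?_ ?_
    · rw [EventuallyEq, ae_restrict_iff' hU.measurableSet]
      filter_upwards [hswap] with z hz ⟨hz1, hz2⟩
      have hI : ∀ c ∈ uIcc 0 c₁, z + c < b ∧ z - c < b := by
        intro c hc
        rw [mem_uIcc] at hc
        constructor <;> rcases hc with hc | hc <;> linarith
      have hac : AbsolutelyContinuousOnInterval (fun c => inner ℝ (V (z + c)) (V (z - c))) 0 c₁ := by
        have h0 := hI 0 left_mem_uIcc
        have h1 := hI c₁ right_mem_uIcc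
        exact ((hV _ _ (h0.1.trans hbL) (h1.1.trans hbL)).comp_add_const z).inner
          ((hV _ _ (h0.2.trans hbL) (h1.2.trans hbL)).comp_const_sub z)
      have hac' : AbsolutelyContinuousOnInterval (Ψ z) 0 c₁ := by
        refine hac.of_dist_le (K := 1) fun s hs t ht => ?_
        rw [hΨV z s (hI s hs).1.le (hI s hs).2.le, hΨV z t (hI t ht).1.le (hI t ht).2.le, one_mul]
      obtain ⟨C, hC⟩ := hac'.const_of_ae_hasDerivAt_zero (by
        filter_upwards [hz] with c hc hc'
        obtain ⟨hdiff, hzero⟩ := hc (hI c hc')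
        have := hdiff.hasDerivAt
        rwa [← fderiv_apply_one_eq_deriv, mem_singleton_iff.1 hzero] at this)
      rw [hC _ left_mem_uIcc, hC _ right_mem_uIcc]
    · exact (hΨc.comp (continuous_id.prodMk continuous_const)).continuousOn
    · exact (hΨc.comp (continuous_id.prodMk continuous_const)).continuousOn
  have h1 : (x + y) / 2 + c₁ = x := by rw [hc₁]; ring
  have h2 : (x + y) / 2 - c₁ = y := by rw [hc₁]; ring
  have hm : (x + y) / 2 < b := by linarith
  have h3 := hfin (show (x + y) / 2 ∈ _ from ⟨by rwa [h1], by rwa [h2]⟩)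
  simp only at h3
  rw [hΨV _ _ (by rw [h1]; exact hxb.le) (by rw [h2]; exact hyb.le), h1, h2,
    hΨV _ _ (by rw [add_zero]; exact hm.le) (by rw [sub_zero]; exact hm.le), add_zero, sub_zero,
    real_inner_self_eq_norm_sq] at h3
  exact h3


/-- Midpoint convexity makes increments over consecutive steps of equal length nondecreasing. With
step `(b - a) / (m + 1)`, the first step at `a` is compared with the step starting at `b`, and
dividing by the step length gives both derivatives in the limit. -/
theorem HasDerivAt.le_of_midpoint_convex {f : ℝ → ℝ} {L a b a' b' : ℝ}
    (hf : ∀ x y, x < L → y < L → 2 * f ((x + y) / 2) ≤ f x + f y)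
    (hab : a < b) (hb : b < L) (ha' : HasDerivAt f a' a) (hb' : HasDerivAt f b' b) : a' ≤ b' := by
  set h : ℕ → ℝ := fun m => (b - a) / (m + 1) with hh
  have hpos : ∀ m, 0 < h m := fun m => div_pos (by linarith) (by positivity)
  have hlim : Tendsto h atTop (𝓝[≠] 0) := by
    refine tendsto_nhdsWithin_iff.2 ⟨?_, Eventually.of_forall fun m => (hpos m).ne'⟩
    have := (tendsto_one_div_add_atTop_nhds_zero_nat (𝕜 := ℝ)).const_mul (b - a)
    simpa [hh, div_eq_mul_inv] using this
  have hslope : ∀ {c c' : ℝ}, HasDerivAt f c' c →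
      Tendsto (fun m => (h m)⁻¹ * (f (c + h m) - f c)) atTop (𝓝 c') := by
    intro c c' hc
    exact (hasDerivAt_iff_tendsto_slope_zero.1 hc).comp hlim
  refine le_of_tendsto_of_tendsto (hslope ha') (hslope hb') ?_
  have hev : ∀ᶠ m in atTop, h m < L - b :=
    (hlim.mono_right nhdsWithin_le_nhds).eventually (gt_mem_nhds (by linarith))
  filter_upwards [hev] with m hm
  refine mul_le_mul_of_nonneg_left ?_ (inv_nonneg.2 (hpos m).le)
  -- The value `j = m + 1` is included: that step starts at `b` and ends at `b + h m`, which is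
  -- still below `L` by the choice of `m`.
  have hstep : ∀ j : ℕ, j ≤ m + 1 →
      f (a + h m) - f a ≤ f (a + j * h m + h m) - f (a + j * h m) := by
    intro j hj
    induction j with
    | zero => simp
    | succ j ih =>
      refine (ih (by omega)).trans ?_
      have e1 : ((j : ℝ) + 1) * h m ≤ b - a := by
        have : ((j : ℝ) + 1) ≤ m + 1 := by exact_mod_cast hj
        calc ((j : ℝ) + 1) * h m ≤ (m + 1) * h m := mul_le_mul_of_nonneg_right this (hpos m).le
          _ = b - a := by simp only [hh]; field_simp
      have := hf (a + j * h m) (a + (j + 1) * h m + h m) (by nlinarith [hpos m]) (by linarith)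
      rw [show (a + j * h m + (a + (j + 1) * h m + h m)) / 2 = a + (j + 1) * h m by ring] at this
      push_cast
      rw [show a + (j : ℝ) * h m + h m = a + (j + 1) * h m by ring]
      linarith
  have hb1 : a + ((m + 1 : ℕ) : ℝ) * h m = b := by
    push_cast
    simp only [hh]; field_simp; ring
  have := hstep (m + 1) le_rfl
  rwa [hb1] at this

/-! ### Consequences of the midpoint identity: regularity, log-convexity, rigidity. -/

section MidpointIdentity

variable {L : ℝ} {V : ℝ → H}

/-- In the midpoint identity one slot is kept fixed at `z - x₀` while the other moves through `x₀`.
Thus a single point of differentiability of `V` yields a derivative at every `z < x₀ + L`. -/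
theorem hasDerivAt_norm_sq_half
    (hg : ∀ x y, x < L → y < L → inner ℝ (V x) (V y) = ‖V ((x + y) / 2)‖ ^ 2)
    {x₀ z : ℝ} {v : H} (hx₀ : x₀ < L) (hv : HasDerivAt V v x₀) (hz : z < x₀ + L) :
    HasDerivAt (fun z => ‖V (z / 2)‖ ^ 2) (inner ℝ v (V (z - x₀))) z := by
  have h1 : HasDerivAt (fun z' => V (z' - (z - x₀))) v z := by
    refine HasDerivAt.comp_sub_const z (z - x₀) ?_
    rwa [sub_sub_cancel]
  have h2 : HasDerivAt (fun z' => inner ℝ (V (z' - (z - x₀))) (V (z - x₀)))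
      (inner ℝ v (V (z - x₀))) z := by
    simpa using h1.inner ℝ (hasDerivAt_const z (V (z - x₀)))
  refine h2.congr_of_eventuallyEq ?_
  have : ∀ᶠ z' in 𝓝 z, z' < L + (z - x₀) := gt_mem_nhds (by linarith)
  filter_upwards [this] with z' hz'
  rw [hg _ _ (by linarith) (by linarith)]
  congr 4
  ring

theorem exists_hasDerivAt_between {V' : ℝ → H} (hd : ∀ᵐ x, x < L → HasDerivAt V (V' x) x)
    {a : ℝ} (ha : a < L) : ∃ x, a < x ∧ x < L ∧ HasDerivAt V (V' x) x := by
  have : volume (Ioo a L) ≠ 0 := by simp [ha]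
  have h : ∃ᵐ x ∂(volume : Measure ℝ), x ∈ Ioo a L := by
    rwa [frequently_ae_mem_iff]
  obtain ⟨x, hx, hx'⟩ := (h.and_eventually hd).exists
  exact ⟨x, hx.1, hx.2, hx' hx.2⟩

/-- Half the logarithmic derivative of `x ↦ ‖V x‖²`. -/
noncomputable def logRate (V : ℝ → H) (x : ℝ) : ℝ :=
  deriv (fun z => ‖V (z / 2)‖ ^ 2) (2 * x) / ‖V x‖ ^ 2

variable {V' : ℝ → H}
  (hg : ∀ x y, x < L → y < L → inner ℝ (V x) (V y) = ‖V ((x + y) / 2)‖ ^ 2)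
  (hd : ∀ᵐ x, x < L → HasDerivAt V (V' x) x)
  (hc : ContinuousOn V (Iio L))
  (h0 : ∀ x < L, V x ≠ 0)

include hg hd in
theorem hasDerivAt_norm_sq_half_deriv {z : ℝ} (hz : z < 2 * L) :
    HasDerivAt (fun z => ‖V (z / 2)‖ ^ 2) (deriv (fun z => ‖V (z / 2)‖ ^ 2) z) z := by
  obtain ⟨x, hx1, hx2, hx⟩ := exists_hasDerivAt_between hd (show z - L < L by linarith)
  exact (hasDerivAt_norm_sq_half hg hx2 hx (by linarith)).differentiableAt.hasDerivAt

include hg hd hc in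
-- For a fixed point `x` of differentiability the derivative is `z ↦ ⟪V' x, V (z - x)⟫`, which is as
-- continuous as `V`. So the squared norm is `C¹` although `V` is differentiable only almost
-- everywhere.
theorem continuousAt_deriv_norm_sq_half {z : ℝ} (hz : z < 2 * L) :
    ContinuousAt (deriv (fun z => ‖V (z / 2)‖ ^ 2)) z := by
  obtain ⟨x, hx1, hx2, hx⟩ := exists_hasDerivAt_between hd (show z - L < L by linarith)
  have h1 : ∀ᶠ z' in 𝓝 z, z' < x + L := gt_mem_nhds (by linarith)
  have h2 : (fun z' => inner ℝ (V' x) (V (z' - x))) =ᶠ[𝓝 z]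
      deriv (fun z => ‖V (z / 2)‖ ^ 2) := by
    filter_upwards [h1] with z' hz'
    exact (hasDerivAt_norm_sq_half hg hx2 hx hz').deriv.symm
  refine ContinuousAt.congr ?_ h2
  have h3 : ContinuousAt V (z - x) := hc.continuousAt (Iio_mem_nhds (by linarith))
  have h4 : ContinuousAt (fun z' => V (z' - x)) z :=
    ContinuousAt.comp (f := fun z' : ℝ => z' - x) h3 (by fun_prop)
  exact continuousAt_const.inner h4

include hg h0 in
-- Cauchy-Schwarz, after the squared norm at the midpoint is replaced by the inner product of the
-- endpoints.
theorem log_norm_sq_midpoint_convex {x y : ℝ} (hx : x < L) (hy : y < L) :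
    2 * Real.log (‖V ((x + y) / 2)‖ ^ 2) ≤ Real.log (‖V x‖ ^ 2) + Real.log (‖V y‖ ^ 2) := by
  have px : 0 < ‖V x‖ := norm_pos_iff.2 (h0 x hx)
  have py : 0 < ‖V y‖ := norm_pos_iff.2 (h0 y hy)
  have pm : 0 < ‖V ((x + y) / 2)‖ := norm_pos_iff.2 (h0 _ (by linarith))
  rw [← Real.log_mul (by positivity) (by positivity), ← hg x y hx hy]
  have hle : inner ℝ (V x) (V y) ≤ ‖V x‖ * ‖V y‖ := real_inner_le_norm _ _
  have hpos : 0 < inner ℝ (V x) (V y) := by rw [hg x y hx hy]; positivity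
  rw [show (2 : ℝ) * Real.log (inner ℝ (V x) (V y)) = Real.log (inner ℝ (V x) (V y) ^ 2) by
    rw [Real.log_pow]; norm_num]
  refine Real.log_le_log (by positivity) ?_
  rw [← mul_pow]
  exact pow_le_pow_left₀ hpos.le hle 2

include hg hd h0 in
theorem hasDerivAt_log_norm_sq {x : ℝ} (hx : x < L) :
    HasDerivAt (fun x => Real.log (‖V x‖ ^ 2)) (2 * logRate V x) x := by
  have h1 := hasDerivAt_norm_sq_half_deriv hg hd (show 2 * x < 2 * L by linarith)
  have h2 : HasDerivAt (fun x => ‖V x‖ ^ 2) (2 * deriv (fun z => ‖V (z / 2)‖ ^ 2) (2 * x)) x := by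
    have := h1.comp x ((hasDerivAt_id x).const_mul 2)
    simp only [mul_one] at this
    rw [mul_comm]
    refine this.congr_of_eventuallyEq (Eventually.of_forall fun y => ?_)
    simp
  have px : 0 < ‖V x‖ := norm_pos_iff.2 (h0 x hx)
  have := h2.log (by positivity)
  rwa [mul_div_assoc] at this

include hg hd h0 in
theorem monotoneOn_logRate : MonotoneOn (logRate V) (Iio L) := by
  intro a ha b hb hab
  rcases hab.eq_or_lt with rfl | hab
  · exact le_rfl
  have := HasDerivAt.le_of_midpoint_convex
    (f := fun x => Real.log (‖V x‖ ^ 2)) (L := L)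
    (fun x y hx hy => log_norm_sq_midpoint_convex hg h0 hx hy) hab hb
    (hasDerivAt_log_norm_sq hg hd h0 ha) (hasDerivAt_log_norm_sq hg hd h0 hb)
  linarith

include hg h0 in
-- Near `x` the numerator of the rate is `⟪v, V (2y - x)⟫`, and differentiating it at `y = x` uses
-- `V` only once more at the same point: its derivative is `2 ‖v‖²`. No second derivative of `V` is
-- involved.
theorem hasDerivAt_logRate {x : ℝ} {v : H} (hx : x < L) (hv : HasDerivAt V v x) :
    HasDerivAt (logRate V)
      (2 / (‖V x‖ ^ 2) ^ 2 * (‖v‖ ^ 2 * ‖V x‖ ^ 2 - inner ℝ v (V x) ^ 2)) x := by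
  have px : 0 < ‖V x‖ := norm_pos_iff.2 (h0 x hx)
  have h1 : HasDerivAt (fun y => V (2 * y - x)) ((2 : ℝ) • v) x := by
    have e : HasDerivAt (fun y : ℝ => 2 * y - x) 2 x := by
      simpa using ((hasDerivAt_id x).const_mul 2).sub_const x
    have hv' : HasDerivAt V v (2 * x - x) := by rwa [show 2 * x - x = x by ring]
    exact HasDerivAt.scomp (g₁ := V) (h := fun y : ℝ => 2 * y - x) x hv' e
  have h2 : HasDerivAt (fun y => inner ℝ v (V (2 * y - x))) (2 * ‖v‖ ^ 2) x := by
    have := (hasDerivAt_const x v).inner ℝ h1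
    simpa [inner_smul_right, real_inner_self_eq_norm_sq] using this
  have h3 : HasDerivAt (fun y => ‖V y‖ ^ 2) (2 * inner ℝ v (V x)) x := by
    have := hv.norm_sq
    rwa [real_inner_comm] at this
  have h4 := h2.div h3 (by positivity)
  have h5 : logRate V =ᶠ[𝓝 x] fun y => inner ℝ v (V (2 * y - x)) / ‖V y‖ ^ 2 := by
    have : ∀ᶠ y in 𝓝 x, y < (x + L) / 2 := gt_mem_nhds (by linarith)
    filter_upwards [this] with y hy
    rw [logRate, (hasDerivAt_norm_sq_half hg hx hv (show 2 * y < x + L by linarith)).deriv]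
  refine (h4.congr_of_eventuallyEq h5).congr_deriv ?_
  rw [show 2 * x - x = x by ring]
  field_simp

include hg hd h0 in
/-- If the rate is bounded above by `-K` near `-∞`, then the curve grows at least like `e^{-Kx}`. -/
theorem exp_mul_le_norm_sq_of_logRate_le {x₁ K : ℝ} (hx₁ : x₁ < L)
    (hK : logRate V x₁ ≤ -K) {x : ℝ} (hx : x ≤ x₁) :
    ‖V x₁‖ ^ 2 * Real.exp (2 * K * (x₁ - x)) ≤ ‖V x‖ ^ 2 := by
  have hanti : AntitoneOn (fun x => Real.log (‖V x‖ ^ 2) + 2 * K * x) (Iic x₁) := by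
    have hder : ∀ y < L, HasDerivAt (fun x => Real.log (‖V x‖ ^ 2) + 2 * K * x)
        (2 * logRate V y + 2 * K) y := by
      intro y hy
      refine ((hasDerivAt_log_norm_sq hg hd h0 hy).add
        ((hasDerivAt_id y).const_mul (2 * K))).congr_deriv ?_
      ring
    refine antitoneOn_of_deriv_nonpos (convex_Iic x₁) ?_ ?_ ?_
    · exact fun y hy => (hder y (lt_of_le_of_lt hy hx₁)).continuousAt.continuousWithinAt
    · intro y hy
      rw [interior_Iic] at hy
      exact (hder y (lt_trans hy hx₁)).differentiableAt.differentiableWithinAt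
    · intro y hy
      rw [interior_Iic] at hy
      rw [(hder y (lt_trans hy hx₁)).deriv]
      have := monotoneOn_logRate hg hd h0 (lt_trans hy hx₁) hx₁ (le_of_lt hy)
      linarith
  have h1 := hanti hx (mem_Iic.2 le_rfl) hx
  simp only at h1
  have p1 : 0 < ‖V x₁‖ := norm_pos_iff.2 (h0 _ hx₁)
  have p2 : 0 < ‖V x‖ := norm_pos_iff.2 (h0 _ (lt_of_le_of_lt hx hx₁))
  rw [← Real.log_le_log_iff (by positivity) (by positivity),
    Real.log_mul (by positivity) (by positivity), Real.log_exp]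
  linarith

include hg hd h0 in
-- A constant rate makes the squared norm an exponential, and the midpoint identity then determines
-- the inner product of `V x` and `V y`. It is the one for which equality holds in Cauchy-Schwarz.
theorem eq_exp_smul_of_logRate_eq {N : ℝ} (hN : ∀ x < L, logRate V x = N) {x y : ℝ} (hx : x < L)
    (hy : y < L) : V y = Real.exp (N * (y - x)) • V x := by
  have hlog : ∀ s < L, ∀ t < L, ‖V t‖ ^ 2 = ‖V s‖ ^ 2 * Real.exp (2 * N * (t - s)) := by
    have hconst : ∀ s < L, ∀ t < L, Real.log (‖V s‖ ^ 2) - 2 * N * s =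
        Real.log (‖V t‖ ^ 2) - 2 * N * t := by
      have hder : ∀ y ∈ Iio L, HasDerivAt (fun x => Real.log (‖V x‖ ^ 2) - 2 * N * x) 0 y := by
        intro y hy
        refine ((hasDerivAt_log_norm_sq hg hd h0 hy).sub
          ((hasDerivAt_id y).const_mul (2 * N))).congr_deriv ?_
        rw [hN y hy]; ring
      intro s hs t ht
      exact (convex_Iio L).is_const_of_fderivWithin_eq_zero (𝕜 := ℝ)
        (fun y hy => (hder y hy).differentiableAt.differentiableWithinAt)
        (fun y hy => by
          rw [fderivWithin_of_isOpen isOpen_Iio hy]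
          rw [(hder y hy).hasFDerivAt.fderiv]
          ext; simp) hs ht
    intro s hs t ht
    have p1 : 0 < ‖V s‖ := norm_pos_iff.2 (h0 _ hs)
    have p2 : 0 < ‖V t‖ := norm_pos_iff.2 (h0 _ ht)
    refine Real.log_injOn_pos (mem_Ioi.2 (by positivity)) (mem_Ioi.2 (by positivity)) ?_
    rw [Real.log_mul (by positivity) (by positivity), Real.log_exp]
    linarith [hconst s hs t ht]
  -- The square of the norm of the difference is expanded; all three terms are multiples of `‖V
  -- x‖²`, and they cancel.
  rw [← sub_eq_zero, ← norm_eq_zero, ← sq_eq_zero_iff, norm_sub_sq_real, inner_smul_right,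
    norm_smul, mul_pow, Real.norm_eq_abs, Real.abs_exp, hg y x hy hx,
    hlog x hx y hy, hlog x hx ((y + x) / 2) (by linarith), ← Real.exp_nat_mul]
  have e1 : Real.exp (2 * N * ((y + x) / 2 - x)) = Real.exp (N * (y - x)) := by
    congr 1; ring
  have e2 : Real.exp (2 * N * (y - x)) = Real.exp (N * (y - x)) * Real.exp (N * (y - x)) := by
    rw [← Real.exp_add]; congr 1; ring
  have e3 : Real.exp ((2 : ℕ) * (N * (y - x))) = Real.exp (N * (y - x)) * Real.exp (N * (y - x)) := by
    rw [← Real.exp_add]; congr 1; push_cast; ring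
  rw [e1, e2, e3]
  ring

end MidpointIdentity

end HilbertCurve

/-! ### Families of functions, differentiable in a parameter, as curves in `L²`. -/

section SquareIntegrableCurve

variable {Ω : Type*} [MeasurableSpace Ω] {ν : Measure Ω}

/-- Fatou's lemma applied to `q n + v` gives `2 ‖v‖ ≤ liminf ‖q n + v‖`, and the parallelogram law
converts this, with the upper bound on `‖q n‖`, into smallness of `‖q n - v‖`. -/
theorem MeasureTheory.Lp.tendsto_of_ae_tendsto_of_norm_le {q : ℕ → Lp ℝ 2 ν} {v : Lp ℝ 2 ν}
    {a : ℕ → ℝ} (hq : ∀ᵐ θ ∂ν, Tendsto (fun n => q n θ) atTop (𝓝 (v θ)))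
    (ha : ∀ n, ‖q n‖ ^ 2 ≤ a n) (hlim : Tendsto a atTop (𝓝 (‖v‖ ^ 2))) :
    Tendsto q atTop (𝓝 v) := by
  have hfatou : ∀ c : ℝ, c < 2 * ‖v‖ → ∀ᶠ n in atTop, c < ‖q n + v‖ := by
    intro c hc
    rcases lt_or_ge c 0 with hc0 | hc0
    · exact Eventually.of_forall fun n => hc0.trans_le (norm_nonneg _)
    have h1 : eLpNorm (fun θ => v θ + v θ) 2 ν ≤
        liminf (fun n => eLpNorm (fun θ => q n θ + v θ) 2 ν) atTop := by
      refine Lp.eLpNorm_lim_le_liminf_eLpNorm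
        (fun n => (Lp.aestronglyMeasurable _).add (Lp.aestronglyMeasurable _)) _ ?_
      filter_upwards [hq] with θ hθ using hθ.add_const _
    have h2 : ∀ w : Lp ℝ 2 ν, eLpNorm (fun θ => w θ + v θ) 2 ν = ENNReal.ofReal ‖w + v‖ := by
      intro w
      rw [Lp.norm_def, ENNReal.ofReal_toReal (Lp.eLpNorm_ne_top _)]
      exact eLpNorm_congr_ae (Lp.coeFn_add w v).symm
    simp only [h2] at h1
    have h3 : ENNReal.ofReal c < liminf (fun n => ENNReal.ofReal ‖q n + v‖) atTop := by
      refine lt_of_lt_of_le ?_ h1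
      rw [← two_smul ℝ v, norm_smul, Real.norm_ofNat]
      exact (ENNReal.ofReal_lt_ofReal_iff (hc0.trans_lt hc)).2 hc
    filter_upwards [eventually_lt_of_lt_liminf h3] with n hn
    exact (ENNReal.ofReal_lt_ofReal_iff_of_nonneg hc0).1 hn
  rw [tendsto_iff_norm_sub_tendsto_zero]
  have hsq : Tendsto (fun n => ‖q n - v‖ ^ 2) atTop (𝓝 0) := by
    rw [tendsto_order]
    refine ⟨fun c hc => Eventually.of_forall fun n => hc.trans_le (by positivity), fun c hc => ?_⟩
    -- The maximum with `0` keeps squaring monotone: if `v = 0`, the level `d` is negative.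
    obtain ⟨d, hd, hd'⟩ : ∃ d, d < 2 * ‖v‖ ∧ (2 * ‖v‖) ^ 2 - c / 2 < max d 0 ^ 2 := by
      have hcont : ContinuousAt (fun d : ℝ => max d 0 ^ 2) (2 * ‖v‖) := by fun_prop
      have h0 : max (2 * ‖v‖) 0 = 2 * ‖v‖ := max_eq_left (by positivity)
      have := hcont.eventually (lt_mem_nhds (a := (2 * ‖v‖) ^ 2 - c / 2) (by simp only [h0]; linarith))
      obtain ⟨d, hd1, hd2⟩ := ((this.filter_mono nhdsWithin_le_nhds).and
        (self_mem_nhdsWithin (s := Iio (2 * ‖v‖)))).exists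
      exact ⟨d, hd2, hd1⟩
    have h2 := hlim.eventually (gt_mem_nhds (show ‖v‖ ^ 2 < ‖v‖ ^ 2 + c / 4 by linarith))
    filter_upwards [hfatou d hd, h2] with n h1 h2
    have hp := parallelogram_law_with_norm ℝ (q n) v
    have h3 : max d 0 ^ 2 ≤ ‖q n + v‖ ^ 2 :=
      pow_le_pow_left₀ (le_max_right _ _) (max_le h1.le (norm_nonneg _)) 2
    have := ha n
    nlinarith
  have := hsq.sqrt
  simpa using this

/-- Cauchy-Schwarz in the fundamental theorem of calculus. -/
theorem sq_sub_le_mul_integral_sq {g g' : ℝ → ℝ} {a b : ℝ} (hab : a ≤ b)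
    (hg : ∀ x ∈ Icc a b, HasDerivAt g (g' x) x) (hg' : ContinuousOn g' (Icc a b)) :
    (g b - g a) ^ 2 ≤ (b - a) * ∫ t in a..b, g' t ^ 2 := by
  rcases hab.eq_or_lt with rfl | hab'
  · simp
  have hg'2 : ContinuousOn g' (uIcc a b) := by rwa [uIcc_of_le hab]
  have h1 : ∫ t in a..b, g' t = g b - g a :=
    intervalIntegral.integral_eq_sub_of_hasDerivAt (by rwa [uIcc_of_le hab])
      hg'2.intervalIntegrable
  -- With `c` the mean slope, the inequality is the nonnegativity of the integral of `(g' - c)²`.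
  set c := (g b - g a) / (b - a) with hc
  have h2 : 0 ≤ ∫ t in a..b, (g' t - c) ^ 2 :=
    intervalIntegral.integral_nonneg hab fun t _ => sq_nonneg _
  have h3 : ∫ t in a..b, (g' t - c) ^ 2 = (∫ t in a..b, g' t ^ 2) - 2 * c * (g b - g a) +
      c ^ 2 * (b - a) := by
    have : ∀ t, (g' t - c) ^ 2 = g' t ^ 2 - 2 * c * g' t + c ^ 2 := fun t => by ring
    simp only [this]
    have i1 : IntervalIntegrable (fun t => g' t ^ 2) volume a b := (hg'2.pow 2).intervalIntegrable
    have i2 : IntervalIntegrable (fun t => 2 * c * g' t) volume a b :=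
      (continuousOn_const.mul hg'2).intervalIntegrable
    rw [intervalIntegral.integral_add (i1.sub i2) (by simp), intervalIntegral.integral_sub i1 i2,
      intervalIntegral.integral_const_mul, h1, intervalIntegral.integral_const, smul_eq_mul]
    ring
  have hpos : 0 < b - a := by linarith
  have h4 : c * (b - a) = g b - g a := by rw [hc]; field_simp
  nlinarith

/-- The class in `L²` of a function, or `0` if the function is not square integrable. -/
noncomputable def toL2 (ν : Measure Ω) (f : Ω → ℝ) : Lp ℝ 2 ν :=
  open Classical in if h : MemLp f 2 ν then h.toLp f else 0

theorem toL2_eq {f : Ω → ℝ} (h : MemLp f 2 ν) : toL2 ν f = h.toLp f := by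
  rw [toL2, dif_pos h]

theorem coeFn_toL2 {f : Ω → ℝ} (h : MemLp f 2 ν) : toL2 ν f =ᵐ[ν] f := by
  rw [toL2_eq h]; exact h.coeFn_toLp

theorem inner_toL2 {f g : Ω → ℝ} (hf : MemLp f 2 ν) (hg : MemLp g 2 ν) :
    inner ℝ (toL2 ν f) (toL2 ν g) = ∫ θ, f θ * g θ ∂ν := by
  rw [L2.inner_def]
  refine integral_congr_ae ?_
  filter_upwards [coeFn_toL2 hf, coeFn_toL2 hg] with θ h1 h2
  rw [h1, h2]
  simp [mul_comm]

theorem norm_toL2_sq {f : Ω → ℝ} (hf : MemLp f 2 ν) : ‖toL2 ν f‖ ^ 2 = ∫ θ, f θ ^ 2 ∂ν := by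
  rw [← real_inner_self_eq_norm_sq, inner_toL2 hf hf]
  simp only [sq]

variable [SigmaFinite ν] {L : ℝ} {f f' : ℝ → Ω → ℝ}
  (hf : ∀ᵐ θ ∂ν, ∀ x < L, HasDerivAt (fun x => f x θ) (f' x θ) x)
  (hf'c : ∀ᵐ θ ∂ν, ContinuousOn (fun x => f' x θ) (Iio L))
  (hfm : ∀ x < L, AEStronglyMeasurable (f x) ν)
  (hfm' : ∀ x < L, AEStronglyMeasurable (f' x) ν)
  (hfi : ∀ a b, a < b → b < L →
    Integrable (fun p : ℝ × Ω => f p.1 p.2 ^ 2) ((volume.restrict (Ioc a b)).prod ν))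
  (hfi' : ∀ a b, a < b → b < L →
    Integrable (fun p : ℝ × Ω => f' p.1 p.2 ^ 2) ((volume.restrict (Ioc a b)).prod ν))

include hf hf'c hfm hfi' in
-- Cauchy-Schwarz in the fundamental theorem of calculus on each fibre, followed by Fubini. The
-- difference of two slices is square integrable before either slice is known to be.
theorem memLp_sub_and_integral_sq_le {a b : ℝ} (hab : a < b) (hb : b < L) :
    MemLp (fun θ => f b θ - f a θ) 2 ν ∧
      ∫ θ, (f b θ - f a θ) ^ 2 ∂ν ≤ (b - a) * ∫ t in a..b, ∫ θ, f' t θ ^ 2 ∂ν := by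
  have hi := hfi' a b hab hb
  have hm : AEStronglyMeasurable (fun θ => f b θ - f a θ) ν :=
    (hfm b hb).sub (hfm a (hab.trans hb))
  have hswap : Integrable (fun θ => ∫ t in a..b, f' t θ ^ 2) ν := by
    simpa only [intervalIntegral.integral_of_le hab.le] using hi.integral_prod_right
  have hle : ∀ᵐ θ ∂ν, (f b θ - f a θ) ^ 2 ≤ (b - a) * ∫ t in a..b, f' t θ ^ 2 := by
    filter_upwards [hf, hf'c] with θ h1 h2
    exact sq_sub_le_mul_integral_sq hab.le (fun x hx => h1 x (hx.2.trans_lt hb))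
      (h2.mono fun x hx => hx.2.trans_lt hb)
  have hint : Integrable (fun θ => (f b θ - f a θ) ^ 2) ν := by
    refine (hswap.const_mul (b - a)).mono' (hm.pow 2) ?_
    filter_upwards [hle] with θ hθ
    rwa [Real.norm_eq_abs, abs_of_nonneg (sq_nonneg _)]
  refine ⟨(memLp_two_iff_integrable_sq hm).2 hint, ?_⟩
  calc ∫ θ, (f b θ - f a θ) ^ 2 ∂ν ≤ ∫ θ, (b - a) * (∫ t in a..b, f' t θ ^ 2) ∂ν :=
        integral_mono_ae hint (hswap.const_mul _) hle
    _ = (b - a) * ∫ θ, (∫ t in a..b, f' t θ ^ 2) ∂ν := integral_const_mul _ _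
    _ = (b - a) * ∫ t in a..b, ∫ θ, f' t θ ^ 2 ∂ν := by
        simp only [intervalIntegral.integral_of_le hab.le]
        rw [integral_integral_swap]
        exact hi.swap

include hf hf'c hfm hfi hfi' in
-- Fubini gives square integrability of almost every slice. One such slice in `(x - 1, x)` and the
-- estimate for differences give it at `x` itself.
theorem memLp_two_of_integrable_prod {x : ℝ} (hx : x < L) : MemLp (f x) 2 ν := by
  have h1 : ∀ᵐ s ∂(volume.restrict (Ioc (x - 1) x)), Integrable (fun θ => f s θ ^ 2) ν :=
    (hfi (x - 1) x (by linarith) hx).prod_right_ae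
  have h2 : ∃ s ∈ Ioo (x - 1) x, Integrable (fun θ => f s θ ^ 2) ν := by
    have h3 : ∃ᵐ s ∂(volume : Measure ℝ), s ∈ Ioo (x - 1) x := by
      rw [frequently_ae_mem_iff]; simp
    obtain ⟨s, hs, hs'⟩ := (h3.and_eventually ((ae_restrict_iff' measurableSet_Ioc).1 h1)).exists
    exact ⟨s, hs, hs' (Ioo_subset_Ioc_self hs)⟩
  obtain ⟨s, hs, hsi⟩ := h2
  have h4 := (memLp_two_iff_integrable_sq (hfm s (hs.2.trans hx))).2 hsi
  have h5 := (memLp_sub_and_integral_sq_le hf hf'c hfm hfi' hs.2 hx).1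
  refine (h4.add h5).ae_eq (Eventually.of_forall fun θ => ?_)
  simp

include hf hf'c hfm hfi hfi' in
theorem norm_toL2_sub_sq_le {a b : ℝ} (hab : a < b) (hb : b < L) :
    ‖toL2 ν (f b) - toL2 ν (f a)‖ ^ 2 ≤ (b - a) * ∫ t in a..b, ∫ θ, f' t θ ^ 2 ∂ν := by
  have ha := memLp_two_of_integrable_prod hf hf'c hfm hfi hfi' (hab.trans hb)
  have hb' := memLp_two_of_integrable_prod hf hf'c hfm hfi hfi' hb
  have h1 : toL2 ν (f b) - toL2 ν (f a) = toL2 ν (fun θ => f b θ - f a θ) := by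
    rw [toL2_eq ha, toL2_eq hb', ← MemLp.toLp_sub, toL2_eq]
    rfl
  have h2 : MemLp (fun θ => f b θ - f a θ) 2 ν := hb'.sub ha
  rw [h1, norm_toL2_sq h2]
  exact (memLp_sub_and_integral_sq_le hf hf'c hfm hfi' hab hb).2

include hfi' in
theorem intervalIntegrable_integral_sq {a b : ℝ} (ha : a < L) (hb : b < L) :
    IntervalIntegrable (fun t => ∫ θ, f' t θ ^ 2 ∂ν) volume a b := by
  rcases lt_trichotomy a b with hab | rfl | hab
  · rw [intervalIntegrable_iff_integrableOn_Ioc_of_le hab.le]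
    exact (hfi' a b hab hb).integral_prod_left
  · simp
  · refine IntervalIntegrable.symm ?_
    rw [intervalIntegrable_iff_integrableOn_Ioc_of_le hab.le]
    exact (hfi' b a hab ha).integral_prod_left

include hf hf'c hfm hfi hfi' in
-- From `‖V t - V s‖² ≤ (t - s) ∫ ‖f'‖²` one gets `‖V t - V s‖ ≤ ∫ (1 + ‖f'‖²)` over `[s, t]`, so
-- the distances are dominated by the increments of an absolutely continuous primitive.
theorem absolutelyContinuousOnInterval_toL2 {a b : ℝ} (ha : a < L) (hb : b < L) :
    AbsolutelyContinuousOnInterval (fun x => toL2 ν (f x)) a b := by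
  have hlt : ∀ x ∈ uIcc a b, x < L := fun x hx => by
    rw [mem_uIcc] at hx; rcases hx with hx | hx <;> linarith
  have hw : ∀ s t, s < L → t < L → IntervalIntegrable (fun t => 1 + ∫ θ, f' t θ ^ 2 ∂ν) volume s t :=
    fun s t hs ht => (by simp : IntervalIntegrable (fun _ => (1 : ℝ)) volume s t).add
      (intervalIntegrable_integral_sq hfi' hs ht)
  refine ((hw a b ha hb).absolutelyContinuousOnInterval_intervalIntegral
    (c := a) left_mem_uIcc).of_dist_le (K := 1) ?_
  have key : ∀ s t, s < L → t < L → s < t → dist (toL2 ν (f s)) (toL2 ν (f t)) ≤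
      1 * dist (∫ t in a..s, (1 + ∫ θ, f' t θ ^ 2 ∂ν)) (∫ t in a..t, (1 + ∫ θ, f' t θ ^ 2 ∂ν)) := by
    intro s t hs ht hst
    have h1 := norm_toL2_sub_sq_le hf hf'c hfm hfi hfi' hst ht
    have hn : 0 ≤ ∫ t in s..t, ∫ θ, f' t θ ^ 2 ∂ν :=
      intervalIntegral.integral_nonneg hst.le fun t _ => integral_nonneg fun θ => sq_nonneg _
    rw [one_mul, dist_comm, dist_comm (∫ t in a..s, _), dist_eq_norm, Real.dist_eq,
      intervalIntegral.integral_interval_sub_left (hw a t ha ht) (hw a s ha hs),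
      intervalIntegral.integral_add (by simp) (intervalIntegrable_integral_sq hfi' hs ht)]
    simp only [intervalIntegral.integral_const, smul_eq_mul, mul_one]
    rw [abs_of_nonneg (by linarith)]
    refine abs_le_of_sq_le_sq' ?_ (by linarith) |>.2
    nlinarith
  intro s hs t ht
  rcases lt_trichotomy s t with h | rfl | h
  · exact key s t (hlt s hs) (hlt t ht) h
  · simp
  · rw [dist_comm, dist_comm (∫ t in a..s, _)]
    exact key t s (hlt t ht) (hlt s hs) h

include hf hf'c hfm hfm' hfi hfi' in
-- At a Lebesgue point of `t ↦ ∫ (f' t)²`, the difference quotients of the curve converge pointwise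
-- to `f' x`, while their squared norms are bounded by the difference quotients of the primitive,
-- which tend to `‖f' x‖²`. Pointwise convergence together with this control of norms is convergence
-- in `L²`.
theorem ae_hasDerivAt_toL2 :
    ∀ᵐ x, x < L → MemLp (f' x) 2 ν ∧ HasDerivAt (fun x => toL2 ν (f x)) (toL2 ν (f' x)) x := by
  -- Integrability is assumed only on intervals whose closure lies below `L`, so the half-line is
  -- exhausted by countably many of them.
  have hcount : ∀ᵐ x, ∀ n : ℕ, x ∈ Ioo (L - (n + 1)) (L - 1 / (n + 1)) →
      (Integrable (fun θ => f' x θ ^ 2) ν ∧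
      HasDerivAt (fun x => ∫ t in (L - (n + 1))..x, ∫ θ, f' t θ ^ 2 ∂ν) (∫ θ, f' x θ ^ 2 ∂ν) x) := by
    rw [ae_all_iff]
    intro n
    have hn : (0 : ℝ) < n + 1 := by positivity
    rcases le_or_gt (L - 1 / ((n : ℝ) + 1)) (L - (n + 1)) with h | h
    · refine Eventually.of_forall fun x hx => ?_
      exact absurd (hx.1.trans hx.2) (not_lt.2 h)
    have hb : L - 1 / ((n : ℝ) + 1) < L := by
      have : 0 < 1 / ((n : ℝ) + 1) := by positivity
      linarith
    have h1 := (ae_restrict_iff' measurableSet_Ioc).1 (hfi' _ _ h hb).prod_right_ae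
    have h2 := (intervalIntegrable_integral_sq hfi' (by linarith : L - ((n : ℝ) + 1) < L)
      hb).ae_hasDerivAt_integral
    filter_upwards [h1, h2] with x hx1 hx2 hx
    rw [uIcc_of_le h.le] at hx2
    exact ⟨hx1 (Ioo_subset_Ioc_self hx), hx2 (Ioo_subset_Icc_self hx) _ (left_mem_Icc.2 h.le)⟩
  filter_upwards [hcount] with x hx hxL
  obtain ⟨n, hn⟩ : ∃ n : ℕ, x ∈ Ioo (L - ((n : ℝ) + 1)) (L - 1 / (n + 1)) := by
    obtain ⟨n, hn⟩ := exists_nat_one_div_lt (show 0 < L - x by linarith)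
    obtain ⟨m, hm⟩ := exists_nat_gt (L - x)
    refine ⟨max n m, ?_, ?_⟩
    · have : (m : ℝ) ≤ (max n m : ℕ) := by exact_mod_cast le_max_right _ _
      linarith
    · have : 1 / (((max n m : ℕ) : ℝ) + 1) ≤ 1 / ((n : ℝ) + 1) := by
        apply one_div_le_one_div_of_le (by positivity)
        have : (n : ℝ) ≤ (max n m : ℕ) := by exact_mod_cast le_max_left _ _
        linarith
      linarith
  obtain ⟨hi, hder⟩ := hx n hn
  have hmem : MemLp (f' x) 2 ν := (memLp_two_iff_integrable_sq (hfm' x hxL)).2 hi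
  refine ⟨hmem, ?_⟩
  set a := L - ((n : ℝ) + 1)
  rw [hasDerivAt_iff_tendsto_slope]
  refine tendsto_of_seq_tendsto fun s hs => ?_
  have hslope := (hasDerivAt_iff_tendsto_slope.1 hder).comp hs
  obtain ⟨hs1, hs2⟩ := tendsto_nhdsWithin_iff.1 hs
  have hsL : ∀ᶠ m in atTop, s m < L := hs1.eventually (gt_mem_nhds hxL)
  obtain ⟨m₀, hm₀⟩ := eventually_atTop.1 (hsL.and hs2)
  -- After discarding finitely many terms, every point of the sequence lies below `L` and differs
  -- from `x`, as the bounds on the quotients require.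
  rw [← tendsto_add_atTop_iff_nat m₀]
  simp only [Function.comp_apply]
  have hVmem := fun (y : ℝ) (hy : y < L) => memLp_two_of_integrable_prod hf hf'c hfm hfi hfi' hy
  refine Lp.tendsto_of_ae_tendsto_of_norm_le (a := fun m =>
    slope (fun x => ∫ t in a..x, ∫ θ, f' t θ ^ 2 ∂ν) x (s (m + m₀))) ?_ ?_ ?_
  · have hco : ∀ᵐ θ ∂ν, ∀ m, (slope (fun x => toL2 ν (f x)) x (s (m + m₀)) : Lp ℝ 2 ν) θ =
        slope (fun y => f y θ) x (s (m + m₀)) := by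
      rw [ae_all_iff]
      intro m
      have hy := (hm₀ (m + m₀) (by omega)).1
      simp only [slope_def_module]
      filter_upwards [Lp.coeFn_smul ((s (m + m₀) - x)⁻¹)
        (toL2 ν (f (s (m + m₀))) - toL2 ν (f x)),
        Lp.coeFn_sub (toL2 ν (f (s (m + m₀)))) (toL2 ν (f x)), coeFn_toL2 (hVmem _ hy),
        coeFn_toL2 (hVmem _ hxL)] with θ h1 h2 h3 h4
      rw [h1, Pi.smul_apply, h2, Pi.sub_apply, h3, h4]
    filter_upwards [hco, hf, coeFn_toL2 hmem] with θ h1 h2 h3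
    simp only [h1, h3]
    exact ((hasDerivAt_iff_tendsto_slope.1 (h2 x hxL)).comp hs).comp (tendsto_add_atTop_nat m₀)
  · intro m
    obtain ⟨hy, hne⟩ := hm₀ (m + m₀) (by omega)
    set y := s (m + m₀)
    have hne' : y ≠ x := hne
    have haL : a < L := by simp only [a]; have : (0 : ℝ) < n + 1 := by positivity
                           linarith
    rw [slope_def_module, slope_def_module, norm_smul, mul_pow, Real.norm_eq_abs, sq_abs,
      intervalIntegral.integral_interval_sub_left (intervalIntegrable_integral_sq hfi' haL hy)
      (intervalIntegrable_integral_sq hfi' haL hxL), smul_eq_mul]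
    rcases lt_or_gt_of_ne hne' with h | h
    · have h1 := norm_toL2_sub_sq_le hf hf'c hfm hfi hfi' h hxL
      have hpos : 0 < x - y := by linarith
      rw [norm_sub_rev, intervalIntegral.integral_symm,
        show (y - x)⁻¹ = -(x - y)⁻¹ by rw [← inv_neg, neg_sub], neg_sq, neg_mul_neg, inv_pow,
        inv_mul_le_iff₀ (by positivity)]
      refine h1.trans (le_of_eq ?_)
      field_simp
    · have h1 := norm_toL2_sub_sq_le hf hf'c hfm hfi hfi' h hy
      have hpos : 0 < y - x := by linarith
      rw [inv_pow, inv_mul_le_iff₀ (by positivity)]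
      refine h1.trans (le_of_eq ?_)
      field_simp
  · rw [norm_toL2_sq hmem]
    exact hslope.comp (tendsto_add_atTop_nat m₀)

end SquareIntegrableCurve

/-! ### The area formula for injective `C¹` immersions. -/

section AreaFormula

set_option linter.unusedSectionVars false

/-- Local domination of a countably subadditive set function by a countably superadditive one is
global. -/
theorem le_of_locally_le {X : Type*} [TopologicalSpace X] [SecondCountableTopology X]
    [MeasurableSpace X] [OpensMeasurableSpace X] {U : Set X} {m₁ m₂ : Set X → ENNReal}
    (h₀ : m₁ ∅ = 0)
    (h₁ : ∀ A : ℕ → Set X, (∀ n, MeasurableSet (A n)) → (∀ n, A n ⊆ U) → Pairwise (Disjoint.onFun A) →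
      m₁ (⋃ n, A n) ≤ ∑' n, m₁ (A n))
    (h₂ : ∀ A : ℕ → Set X, (∀ n, MeasurableSet (A n)) → (∀ n, A n ⊆ U) → Pairwise (Disjoint.onFun A) →
      ∑' n, m₂ (A n) ≤ m₂ (⋃ n, A n))
    (hloc : ∀ x ∈ U, ∃ O : Set X, IsOpen O ∧ x ∈ O ∧
      ∀ s, MeasurableSet s → s ⊆ O ∩ U → m₁ s ≤ m₂ s)
    {s : Set X} (hs : MeasurableSet s) (hsU : s ⊆ U) : m₁ s ≤ m₂ s := by
  rcases s.eq_empty_or_nonempty with rfl | ⟨x₀, hx₀⟩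
  · rw [h₀]; exact zero_le
  choose! O hOo hxO hO using hloc
  obtain ⟨t, htU, htc, hcov⟩ := TopologicalSpace.countable_cover_nhdsWithin (f := O) (s := s)
    (fun x hx => mem_nhdsWithin_of_mem_nhds ((hOo x (hsU hx)).mem_nhds (hxO x (hsU hx))))
  have htne : t.Nonempty := by
    by_contra h
    rw [not_nonempty_iff_eq_empty] at h
    have := hcov hx₀
    simp [h] at this
  obtain ⟨e, rfl⟩ := htc.exists_eq_range htne
  set B : ℕ → Set X := fun n => O (e n) ∩ s with hB
  have hBm : ∀ n, MeasurableSet (B n) := fun n =>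
    (hOo _ (hsU (htU (mem_range_self n)))).measurableSet.inter hs
  have hBs : ⋃ n, B n = s := by
    apply Subset.antisymm
    · exact iUnion_subset fun n => inter_subset_right
    · intro x hx
      obtain ⟨n, hn⟩ : ∃ n, x ∈ O (e n) := by simpa using hcov hx
      exact mem_iUnion.2 ⟨n, hn, hx⟩
  have hdB : ∀ n, disjointed B n ⊆ O (e n) ∩ U := fun n x hx =>
    ⟨(disjointed_subset B n hx).1, hsU (disjointed_subset B n hx).2⟩
  have hdm : ∀ n, MeasurableSet (disjointed B n) := fun n => MeasurableSet.disjointed hBm n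
  rw [← hBs, ← iUnion_disjointed]
  calc m₁ (⋃ n, disjointed B n) ≤ ∑' n, m₁ (disjointed B n) :=
        h₁ _ hdm (fun n => (hdB n).trans inter_subset_right) (disjoint_disjointed B)
    _ ≤ ∑' n, m₂ (disjointed B n) := ENNReal.tsum_le_tsum fun n =>
        hO _ (hsU (htU (mem_range_self n))) _ (hdm n) (hdB n)
    _ ≤ _ := h₂ _ hdm (fun n => (hdB n).trans inter_subset_right) (disjoint_disjointed B)

/-- The hypothesis forces `f` to be constant on the fibres of `g` in `s`, so `f` factors through a
`K`-Lipschitz map on `g '' s`, and the scaling of Hausdorff measure under Lipschitz maps applies. -/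
theorem euclideanHausdorffMeasure_image_le_of_dist_le {α X Y : Type*} [MetricSpace X]
    [MeasurableSpace X] [BorelSpace X] [MetricSpace Y] [MeasurableSpace Y] [BorelSpace Y]
    {f : α → X} {g : α → Y} {s : Set α} {K : NNReal} (m : ℕ)
    (h : ∀ x ∈ s, ∀ y ∈ s, dist (f x) (f y) ≤ K * dist (g x) (g y)) :
    μHE[m] (f '' s) ≤ (K : ENNReal) ^ m * μHE[m] (g '' s) := by
  rcases s.eq_empty_or_nonempty with rfl | ⟨a, ha⟩
  · simp
  have : Nonempty α := ⟨a⟩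
  set i := Function.invFunOn g s
  have hi : ∀ x ∈ s, i (g x) ∈ s ∧ g (i (g x)) = g x := fun x hx =>
    ⟨Function.invFunOn_mem ⟨x, hx, rfl⟩, Function.invFunOn_eq ⟨x, hx, rfl⟩⟩
  have hfi : ∀ x ∈ s, f (i (g x)) = f x := by
    intro x hx
    have := h _ (hi x hx).1 x hx
    rw [(hi x hx).2, dist_self, mul_zero] at this
    exact dist_le_zero.1 this
  have hL : LipschitzOnWith K (fun y => f (i y)) (g '' s) := by
    refine LipschitzOnWith.of_dist_le_mul ?_
    rintro _ ⟨x, hx, rfl⟩ _ ⟨y, hy, rfl⟩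
    rw [hfi x hx, hfi y hy]
    exact h x hx y hy
  have himg : (fun y => f (i y)) '' (g '' s) = f '' s := by
    rw [image_image]
    exact image_congr fun x hx => hfi x hx
  have := hL.hausdorffMeasure_image_le (d := (m : ℝ)) (by positivity)
  rw [himg, ENNReal.rpow_natCast] at this
  simp only [Measure.euclideanHausdorffMeasure_def, Measure.smul_apply, ENNReal.smul_def,
    smul_eq_mul]
  rw [mul_left_comm]
  exact mul_le_mul_right this _

variable {E : Type*} [NormedAddCommGroup E] [InnerProductSpace ℝ E] [FiniteDimensional ℝ E]
  {F : Type*} [NormedAddCommGroup F] [InnerProductSpace ℝ F] [FiniteDimensional ℝ F]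

theorem ContinuousLinearMap.normDet_eq_sqrt_det (A : F →L[ℝ] E) :
    (A : F →ₗ[ℝ] E).normDet = Real.sqrt (ContinuousLinearMap.adjoint A ∘L A).det := by
  have h := A.normDet_sq
  simp only [RCLike.ofReal_real_eq_id, id_eq] at h
  rw [← h, Real.sqrt_sq (LinearMap.normDet_nonneg _)]

theorem ContinuousLinearMap.continuous_normDet :
    Continuous fun A : F →L[ℝ] E => (A : F →ₗ[ℝ] E).normDet := by
  simp only [ContinuousLinearMap.normDet_eq_sqrt_det]
  refine Real.continuous_sqrt.comp (ContinuousLinearMap.continuous_det.comp ?_)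
  exact (ContinuousLinearMap.adjoint.continuous).clm_comp continuous_id

theorem ContinuousLinearMap.normDet_pos {A : F →L[ℝ] E} (hA : Function.Injective A) :
    0 < (A : F →ₗ[ℝ] E).normDet := by
  refine lt_of_le_of_ne (LinearMap.normDet_nonneg _) (Ne.symm ?_)
  exact ((LinearMap.normDet_ne_zero_tfae (A : F →ₗ[ℝ] E)).out 0 4).2 hA

/-- The Jacobian `√det(Dψᵀ Dψ)` of a map between Euclidean spaces. -/
noncomputable def areaDensity (ψ : F → E) (y : F) : ℝ := (fderiv ℝ ψ y : F →ₗ[ℝ] E).normDet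

theorem areaDensity_nonneg (ψ : F → E) (y : F) : 0 ≤ areaDensity ψ y := LinearMap.normDet_nonneg _

variable [MeasurableSpace E] [BorelSpace E] {m : ℕ} {ψ : EuclideanSpace ℝ (Fin m) → E}
  {U : Set (EuclideanSpace ℝ (Fin m))} (hU : IsOpen U) (hψ : ContDiffOn ℝ 1 ψ U)
  (hinj : InjOn ψ U) (himm : ∀ y ∈ U, Function.Injective (fderiv ℝ ψ y))

include hU hψ in
theorem continuousOn_areaDensity : ContinuousOn (areaDensity ψ) U :=
  ContinuousLinearMap.continuous_normDet.comp_continuousOn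
    (hψ.continuousOn_fderiv_of_isOpen hU le_rfl)

include hU hψ himm in
-- Near `y₀` the map `ψ` is a perturbation of its linearization `A` with relative error `δ`, and the
-- Jacobian changes by factors between `1 - δ` and `1 + δ`. Both estimates follow by comparison with
-- `A`, for which the area formula is linear algebra.
theorem exists_open_area_estimate {y₀ : EuclideanSpace ℝ (Fin m)} (hy₀ : y₀ ∈ U) {δ : NNReal}
    (hδ : 0 < δ) (hδ1 : δ < 1) :
    ∃ O : Set (EuclideanSpace ℝ (Fin m)), IsOpen O ∧ y₀ ∈ O ∧ ∀ s, MeasurableSet s → s ⊆ O ∩ U →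
      (μHE[m] (ψ '' s) ≤ ((1 + δ : NNReal) : ENNReal) ^ m *
          (((1 - δ)⁻¹ : NNReal) * ∫⁻ y in s, ENNReal.ofReal (areaDensity ψ y))) ∧
      ((∫⁻ y in s, ENNReal.ofReal (areaDensity ψ y)) ≤
        ((1 + δ : NNReal) : ENNReal) * ((((1 - δ)⁻¹ : NNReal) : ENNReal) ^ m * μHE[m] (ψ '' s))) := by
  set A := fderiv ℝ ψ y₀ with hA
  have hAinj : Function.Injective A := himm y₀ hy₀
  obtain ⟨K, hK0, hK⟩ := (A : EuclideanSpace ℝ (Fin m) →ₗ[ℝ] E).injective_iff_antilipschitz.1 hAinj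
  have hKle : ∀ y y', ‖y - y'‖ ≤ K * ‖A y - A y'‖ := fun y y' => by
    simpa [dist_eq_norm] using hK.le_mul_dist y y'
  have hstrict : HasStrictFDerivAt ψ A y₀ :=
    (hψ.contDiffAt (hU.mem_nhds hy₀)).hasStrictFDerivAt one_ne_zero
  -- `A` expands distances by at least `1 / K`, so an error of `δ / K` relative to `‖y - y'‖` is an
  -- error of `δ` relative to `‖A y - A y'‖`.
  have hc : 0 < δ / K := by positivity
  obtain ⟨O₁, hO₁, happ⟩ := hstrict.approximates_deriv_on_nhds (Or.inr hc)
  have hJ0 : 0 < areaDensity ψ y₀ := ContinuousLinearMap.normDet_pos hAinj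
  have hJc : ContinuousAt (areaDensity ψ) y₀ :=
    (continuousOn_areaDensity hU hψ).continuousAt (hU.mem_nhds hy₀)
  have hδ' : (0 : ℝ) < δ := hδ
  have hδ1' : (δ : ℝ) < 1 := by exact_mod_cast hδ1
  have hJ1 : ∀ᶠ y in 𝓝 y₀, areaDensity ψ y < (1 + δ) * areaDensity ψ y₀ :=
    hJc.eventually (gt_mem_nhds (by nlinarith))
  have hJ2 : ∀ᶠ y in 𝓝 y₀, (1 - δ) * areaDensity ψ y₀ < areaDensity ψ y :=
    hJc.eventually (lt_mem_nhds (by nlinarith))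
  obtain ⟨O, hOsub, hOo, hyO⟩ := mem_nhds_iff.1 (Filter.inter_mem hO₁ (hJ1.and hJ2))
  have hsub : ((1 - δ : NNReal) : ℝ) = 1 - δ := NNReal.coe_sub hδ1.le
  refine ⟨O, hOo, hyO, fun s hs hsO => ?_⟩
  have hdist : ∀ y ∈ s, ∀ y' ∈ s, ‖ψ y - ψ y' - (A y - A y')‖ ≤ δ * ‖A y - A y'‖ := by
    intro y hy y' hy'
    have h1 := happ y (hOsub (hsO hy).1).1 y' (hOsub (hsO hy').1).1
    rw [map_sub] at h1
    refine h1.trans ?_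
    have h2 := hKle y y'
    calc ((δ / K : NNReal) : ℝ) * ‖y - y'‖ ≤ (δ / K : NNReal) * (K * ‖A y - A y'‖) := by gcongr
      _ = δ * ‖A y - A y'‖ := by
        push_cast
        have : (K : ℝ) ≠ 0 := by exact_mod_cast hK0.ne'
        field_simp
  have hvol : μHE[m] (A '' s) = ENNReal.ofReal (areaDensity ψ y₀) * volume s := by
    have := LinearMap.euclideanHausdorffMeasure_image_eq_normDet_mul_volume
      (A : EuclideanSpace ℝ (Fin m) →ₗ[ℝ] E) s
    rw [finrank_euclideanSpace_fin] at this
    exact this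
  have hlow : ENNReal.ofReal (areaDensity ψ y₀) * volume s ≤
      ((1 - δ)⁻¹ : NNReal) * ∫⁻ y in s, ENNReal.ofReal (areaDensity ψ y) := by
    rw [← setLIntegral_const, ← lintegral_const_mul' _ _ ENNReal.coe_ne_top]
    refine setLIntegral_mono_ae' hs (Eventually.of_forall fun y hy => ?_)
    rw [← ENNReal.ofReal_coe_nnreal, ← ENNReal.ofReal_mul NNReal.zero_le_coe]
    refine ENNReal.ofReal_le_ofReal ?_
    rw [NNReal.coe_inv, hsub, inv_mul_eq_div, le_div_iff₀ (by linarith), mul_comm]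
    exact (hOsub (hsO hy).1).2.2.le
  have hupp : (∫⁻ y in s, ENNReal.ofReal (areaDensity ψ y)) ≤
      ((1 + δ : NNReal) : ENNReal) * (ENNReal.ofReal (areaDensity ψ y₀) * volume s) := by
    rw [← setLIntegral_const, ← lintegral_const_mul' _ _ ENNReal.coe_ne_top]
    refine setLIntegral_mono_ae' hs (Eventually.of_forall fun y hy => ?_)
    rw [← ENNReal.ofReal_coe_nnreal, ← ENNReal.ofReal_mul NNReal.zero_le_coe]
    exact ENNReal.ofReal_le_ofReal (by push_cast; exact (hOsub (hsO hy).1).2.1.le)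
  constructor
  · refine (euclideanHausdorffMeasure_image_le_of_dist_le (f := ψ) (g := A) (K := 1 + δ) m ?_).trans ?_
    · intro y hy y' hy'
      rw [dist_eq_norm, dist_eq_norm]
      have h1 := hdist y hy y' hy'
      have h2 := norm_add_le (ψ y - ψ y' - (A y - A y')) (A y - A y')
      rw [sub_add_cancel] at h2
      push_cast
      linarith
    · rw [hvol]
      exact mul_le_mul_right hlow _
  · refine hupp.trans (mul_le_mul_right ?_ _)
    rw [← hvol]
    refine euclideanHausdorffMeasure_image_le_of_dist_le (f := A) (g := ψ) m ?_
    intro y hy y' hy'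
    rw [dist_eq_norm, dist_eq_norm, NNReal.coe_inv, hsub, inv_mul_eq_div, le_div_iff₀ (by linarith)]
    have h1 := hdist y hy y' hy'
    have h2 := norm_sub_norm_le (A y - A y') (ψ y - ψ y')
    rw [norm_sub_rev (A y - A y')] at h2
    linarith

include hU hψ hinj in
theorem measurableSet_image_chart {s : Set (EuclideanSpace ℝ (Fin m))} (hs : MeasurableSet s)
    (hsU : s ⊆ U) : MeasurableSet (ψ '' s) :=
  hs.image_of_continuousOn_injOn (hψ.continuousOn.mono hsU) (hinj.mono hsU)

include hU hψ hinj himm in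
/-- The area formula for the image of a measurable set under a `C¹` injective immersion. -/
theorem euclideanHausdorffMeasure_image_eq_lintegral {s : Set (EuclideanSpace ℝ (Fin m))}
    (hs : MeasurableSet s) (hsU : s ⊆ U) :
    μHE[m] (ψ '' s) = ∫⁻ y in s, ENNReal.ofReal (areaDensity ψ y) := by
  have hadd₁ : ∀ A : ℕ → Set (EuclideanSpace ℝ (Fin m)), (∀ n, MeasurableSet (A n)) →
      (∀ n, A n ⊆ U) → Pairwise (Disjoint.onFun A) →
      μHE[m] (ψ '' (⋃ n, A n)) = ∑' n, μHE[m] (ψ '' (A n)) := by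
    intro A hA hAU hAd
    rw [image_iUnion, measure_iUnion]
    · intro i j hij
      refine Set.disjoint_left.2 ?_
      rintro _ ⟨y, hy, rfl⟩ ⟨z, hz, hzy⟩
      rw [hinj (hAU j hz) (hAU i hy) hzy] at hz
      exact Set.disjoint_left.1 (hAd hij) hy hz
    · exact fun n => measurableSet_image_chart hU hψ hinj (hA n) (hAU n)
  have hadd₂ : ∀ A : ℕ → Set (EuclideanSpace ℝ (Fin m)), (∀ n, MeasurableSet (A n)) →
      (∀ n, A n ⊆ U) → Pairwise (Disjoint.onFun A) →
      ∫⁻ y in ⋃ n, A n, ENNReal.ofReal (areaDensity ψ y) =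
        ∑' n, ∫⁻ y in A n, ENNReal.ofReal (areaDensity ψ y) := by
    intro A hA _ hAd
    exact lintegral_iUnion hA hAd _
  -- The shift by `2` keeps `δ n` strictly below `1` from `n = 0` on, so `1 - δ n` stays invertible.
  set δ : ℕ → NNReal := fun n => 1 / (n + 2) with hδ
  have hδ0 : ∀ n, 0 < δ n := fun n => by positivity
  have hδ1 : ∀ n, δ n < 1 := fun n => by
    rw [hδ, div_lt_one (by positivity)]
    have : (0 : NNReal) ≤ n := zero_le
    calc (1 : NNReal) < 2 := by norm_num
      _ ≤ n + 2 := le_add_of_nonneg_left this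
  have hδlim : Tendsto δ atTop (𝓝 0) := by
    have : Tendsto (fun n : ℕ => 1 / ((n + 1 : ℕ) + 1 : NNReal)) atTop (𝓝 0) :=
      (tendsto_one_div_add_atTop_nhds_zero_nat (𝕜 := NNReal)).comp (tendsto_add_atTop_nat 1)
    refine this.congr fun n => ?_
    simp only [hδ]; push_cast; ring
  have l1 : Tendsto (fun n => ((1 + δ n : NNReal) : ENNReal)) atTop (𝓝 1) := by
    have := hδlim.const_add 1
    rw [add_zero] at this
    rw [← ENNReal.coe_one]; exact ENNReal.tendsto_coe.2 this
  have l2 : Tendsto (fun n => (((1 - δ n)⁻¹ : NNReal) : ENNReal)) atTop (𝓝 1) := by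
    have h1 : Tendsto (fun n => 1 - δ n) atTop (𝓝 (1 - 0)) := tendsto_const_nhds.sub hδlim
    rw [tsub_zero] at h1
    have := h1.inv₀ one_ne_zero
    rw [inv_one] at this
    rw [← ENNReal.coe_one]; exact ENNReal.tendsto_coe.2 this
  have hlim : ∀ (i j : ℕ) (c : ENNReal), Tendsto (fun n => ((1 + δ n : NNReal) : ENNReal) ^ i *
      ((((1 - δ n)⁻¹ : NNReal) : ENNReal) ^ j * c)) atTop (𝓝 c) := by
    intro i j c
    have h1 := (ENNReal.Tendsto.pow (n := i) l1)
    have h2 := (ENNReal.Tendsto.pow (n := j) l2)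
    have h3 := ENNReal.Tendsto.mul_const h2 (b := c) (Or.inl (by simp))
    rw [one_pow, one_mul] at h3
    have h4 := ENNReal.Tendsto.mul h1 (Or.inl (by simp)) h3 (Or.inr (by simp))
    rwa [one_pow, one_mul] at h4
  -- Each inequality is globalized from the local estimates by `le_of_locally_le`, for every `δ n`,
  -- and the constants then tend to `1`.
  apply le_antisymm
  · refine ge_of_tendsto' (hlim m 1 _) fun n => ?_
    refine le_of_locally_le (U := U) (m₁ := fun s => μHE[m] (ψ '' s))
      (m₂ := fun s => ((1 + δ n : NNReal) : ENNReal) ^ m * ((((1 - δ n)⁻¹ : NNReal) : ENNReal) ^ 1 *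
        ∫⁻ y in s, ENNReal.ofReal (areaDensity ψ y)))
      (by simp) (fun A hA hAU hAd => (hadd₁ A hA hAU hAd).le) (fun A hA hAU hAd => ?_) (fun y hy => ?_) hs hsU
    · simp only [hadd₂ A hA hAU hAd, ENNReal.tsum_mul_left]
      exact le_rfl
    · obtain ⟨O, hO1, hO2, hO3⟩ := exists_open_area_estimate hU hψ himm hy (hδ0 n) (hδ1 n)
      exact ⟨O, hO1, hO2, fun s hs hsO => by rw [pow_one]; exact (hO3 s hs hsO).1⟩
  · refine ge_of_tendsto' (hlim 1 m _) fun n => ?_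
    refine le_of_locally_le (U := U) (m₁ := fun s => ∫⁻ y in s, ENNReal.ofReal (areaDensity ψ y))
      (m₂ := fun s => ((1 + δ n : NNReal) : ENNReal) ^ 1 *
        ((((1 - δ n)⁻¹ : NNReal) : ENNReal) ^ m * μHE[m] (ψ '' s)))
      (by simp) (fun A hA hAU hAd => (hadd₂ A hA hAU hAd).le) (fun A hA hAU hAd => ?_) (fun y hy => ?_) hs hsU
    · simp only [hadd₁ A hA hAU hAd, ENNReal.tsum_mul_left]
      exact le_rfl
    · obtain ⟨O, hO1, hO2, hO3⟩ := exists_open_area_estimate hU hψ himm hy (hδ0 n) (hδ1 n)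
      exact ⟨O, hO1, hO2, fun s hs hsO => by rw [pow_one]; exact (hO3 s hs hsO).2⟩

include hU hψ hinj himm in
-- The area formula for sets recast as an equality of measures. Since the chart is a measurable
-- embedding, integrals are then transported without measurability assumptions on the integrand.
theorem map_withDensity_areaDensity :
    Measure.map (U.domRestrict ψ)
      (Measure.comap (↑) (volume.withDensity fun y => ENNReal.ofReal (areaDensity ψ y))) =
      μHE[m].restrict (ψ '' U) := by
  have hc : Continuous (U.domRestrict ψ) := hψ.continuousOn.domRestrict
  refine Measure.ext fun t ht => ?_
  rw [Measure.map_apply hc.measurable ht, Measure.restrict_apply ht,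
    comap_subtype_coe_apply hU.measurableSet]
  have hset : ((↑) '' (U.domRestrict ψ ⁻¹' t) : Set (EuclideanSpace ℝ (Fin m))) = U ∩ ψ ⁻¹' t := by
    ext y
    simp only [mem_image, mem_preimage, domRestrict_apply, Subtype.exists, exists_and_right,
      exists_eq_right, mem_inter_iff]
    constructor
    · rintro ⟨hy, hyt⟩; exact ⟨hy, hyt⟩
    · rintro ⟨hy, hyt⟩; exact ⟨hy, hyt⟩
  have hm : MeasurableSet (U ∩ ψ ⁻¹' t) := by
    rw [← hset]
    exact (MeasurableEmbedding.subtype_coe hU.measurableSet).measurableSet_image.2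
      (hc.measurable ht)
  rw [hset, withDensity_apply _ hm, ← euclideanHausdorffMeasure_image_eq_lintegral hU hψ hinj himm hm
    inter_subset_left, image_inter_preimage, inter_comm]

include hU hψ hinj in
theorem measurableEmbedding_chart : MeasurableEmbedding (U.domRestrict ψ) :=
  hψ.continuousOn.measurableEmbedding hU.measurableSet hinj

include hU hψ hinj himm in
theorem lintegral_image_areaDensity (g : E → ENNReal) :
    ∫⁻ x in ψ '' U, g x ∂μHE[m] =
      ∫⁻ y in U, ENNReal.ofReal (areaDensity ψ y) * g (ψ y) := by
  have hm : AEMeasurable (fun y => ENNReal.ofReal (areaDensity ψ y)) (volume.restrict U) :=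
    ((continuousOn_areaDensity hU hψ).aemeasurable hU.measurableSet).ennreal_ofReal
  rw [← map_withDensity_areaDensity hU hψ hinj himm,
    (measurableEmbedding_chart hU hψ hinj).lintegral_map]
  simp only [Set.domRestrict_apply, ← Function.comp_apply (f := g)]
  rw [← (MeasurableEmbedding.subtype_coe hU.measurableSet).lintegral_map,
    map_comap_subtype_coe hU.measurableSet,
    setLIntegral_withDensity_eq_setLIntegral_mul_non_measurable₀ _ hm _ hU.measurableSet]
  · simp only [Pi.mul_apply]
  · simp

include hU hψ hinj himm in
theorem integral_image_areaDensity (g : E → ℝ) :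
    ∫ x in ψ '' U, g x ∂μHE[m] = ∫ y in U, areaDensity ψ y * g (ψ y) := by
  have hm : AEMeasurable (fun y => (areaDensity ψ y).toNNReal) (volume.restrict U) :=
    ((continuousOn_areaDensity hU hψ).aemeasurable hU.measurableSet).real_toNNReal
  rw [← map_withDensity_areaDensity hU hψ hinj himm,
    (measurableEmbedding_chart hU hψ hinj).integral_map]
  simp only [Set.domRestrict_apply, ← Function.comp_apply (f := g), ENNReal.ofReal]
  rw [← (MeasurableEmbedding.subtype_coe hU.measurableSet).integral_map,
    map_comap_subtype_coe hU.measurableSet,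
    setIntegral_withDensity_eq_setIntegral_smul₀ hm _ hU.measurableSet]
  congr with y
  rw [NNReal.smul_def, Real.coe_toNNReal _ (areaDensity_nonneg ψ y), smul_eq_mul]

end AreaFormula

namespace WeightedCone

/-! ### Parametrizations of a submanifold. -/

section Parametrization

variable {n k : ℕ}

/-- `ψ : U → M ∩ W` is a smooth parametrization of the open piece `M ∩ W` of `M`, with a left
inverse `e` that is smooth on the open set `W`. -/
structure IsParam (M : Set (Euc n)) (W : Set (Euc n)) (U : Set (Euc k)) (ψ : Euc k → Euc n)
    (e : Euc n → Euc k) : Prop where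
  isOpen_target : IsOpen W
  isOpen_source : IsOpen U
  contDiffOn : ContDiffOn ℝ ∞ ψ U
  contDiffOn_inv : ContDiffOn ℝ ∞ e W
  mapsTo : ∀ y ∈ U, ψ y ∈ M ∩ W
  inv_mem : ∀ x ∈ M ∩ W, e x ∈ U
  right_inv : ∀ x ∈ M ∩ W, ψ (e x) = x
  left_inv : ∀ y ∈ U, e (ψ y) = y

/-- The inverse of a straightening diffeomorphism is restricted to the model subspace. The left
inverse is the diffeomorphism followed by orthogonal projection on that subspace, hence smooth on an
open set of the ambient space and not only on `M`. -/
theorem IsSmoothSubmanifold.exists_isParam {M : Set (Euc n)} (hM : IsSmoothSubmanifold k M)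
    {x : Euc n} (hx : x ∈ M) :
    ∃ (W : Set (Euc n)) (U : Set (Euc k)) (ψ : Euc k → Euc n) (e : Euc n → Euc k),
      IsParam M W U ψ e ∧ x ∈ W := by
  obtain ⟨e, V, hxe, he, hes, hV, hMV⟩ := hM x hx
  set ι : Euc k ≃ₗᵢ[ℝ] V := ((stdOrthonormalBasis ℝ V).reindex (finCongr hV)).repr.symm with hι
  have hsub : ∀ z ∈ e.source, z ∈ M ↔ e z ∈ V := by
    intro z hz
    have : z ∈ e.source ∩ M ↔ z ∈ e.source ∩ e ⁻¹' (V : Set (Euc n)) := by rw [hMV]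
    simpa [hz] using this
  have hιc : ContDiff ℝ ∞ (fun y => (ι y : Euc n)) :=
    (V.subtypeL ∘L (ι : Euc k →L[ℝ] V)).contDiff
  refine ⟨e.source, (fun y => (ι y : Euc n)) ⁻¹' e.target, fun y => e.symm (ι y : Euc n),
    fun z => ι.symm (V.orthogonalProjectionOnto (e z)), ⟨e.open_source,
      e.open_target.preimage hιc.continuous, ?_, ?_, ?_, ?_, ?_, ?_⟩, hxe⟩
  · exact hes.comp hιc.contDiffOn (fun y hy => hy)
  · exact ((ι.symm : V →L[ℝ] Euc k) ∘L V.orthogonalProjectionOnto).contDiff.comp_contDiffOn he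
  · intro y hy
    have h1 : e.symm (ι y : Euc n) ∈ e.source := e.map_target hy
    exact ⟨(hsub _ h1).2 (by rw [e.right_inv hy]; exact (ι y).2), h1⟩
  · rintro z ⟨hzM, hz⟩
    have h1 : e z ∈ V := (hsub z hz).1 hzM
    simp only [mem_preimage, LinearIsometryEquiv.apply_symm_apply]
    have h2 : (V.orthogonalProjectionOnto (e z) : Euc n) = e z :=
      Submodule.starProjection_eq_self_iff.2 h1
    rw [h2]
    exact e.map_source hz
  · rintro z ⟨hzM, hz⟩
    have h1 : e z ∈ V := (hsub z hz).1 hzM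
    have h2 : (V.orthogonalProjectionOnto (e z) : Euc n) = e z :=
      Submodule.starProjection_eq_self_iff.2 h1
    simp only [LinearIsometryEquiv.apply_symm_apply, h2]
    exact e.left_inv hz
  · intro y hy
    rw [e.right_inv hy]
    have h2 : V.orthogonalProjectionOnto (ι y : Euc n) = ι y :=
      Submodule.orthogonalProjectionOnto_mem_subspace_eq_self (ι y)
    rw [h2, LinearIsometryEquiv.symm_apply_apply]

namespace IsParam

variable {M W : Set (Euc n)} {U : Set (Euc k)} {ψ : Euc k → Euc n} {e : Euc n → Euc k}
  (h : IsParam M W U ψ e)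

include h

theorem image_eq : ψ '' U = M ∩ W := by
  apply Subset.antisymm
  · rintro _ ⟨y, hy, rfl⟩; exact h.mapsTo y hy
  · exact fun x hx => ⟨e x, h.inv_mem x hx, h.right_inv x hx⟩

theorem injOn : InjOn ψ U := fun y hy z hz hyz => by
  rw [← h.left_inv y hy, hyz, h.left_inv z hz]

theorem contDiffOn_one : ContDiffOn ℝ 1 ψ U := h.contDiffOn.of_le (by exact_mod_cast le_top)

theorem hasFDerivAt {y : Euc k} (hy : y ∈ U) : HasFDerivAt ψ (fderiv ℝ ψ y) y :=
  ((h.contDiffOn.contDiffAt (h.isOpen_source.mem_nhds hy)).differentiableAt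
    (by simp)).hasFDerivAt

theorem hasFDerivAt_inv {x : Euc n} (hx : x ∈ W) : HasFDerivAt e (fderiv ℝ e x) x :=
  ((h.contDiffOn_inv.contDiffAt (h.isOpen_target.mem_nhds hx)).differentiableAt
    (by simp)).hasFDerivAt

theorem fderiv_inv_comp {y : Euc k} (hy : y ∈ U) :
    fderiv ℝ e (ψ y) ∘L fderiv ℝ ψ y = ContinuousLinearMap.id ℝ (Euc k) := by
  have h1 := (h.hasFDerivAt_inv (h.mapsTo y hy).2).comp y (h.hasFDerivAt hy)
  have h2 : HasFDerivAt (e ∘ ψ) (ContinuousLinearMap.id ℝ (Euc k)) y := by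
    refine (hasFDerivAt_id y).congr_of_eventuallyEq ?_
    filter_upwards [h.isOpen_source.mem_nhds hy] with z hz using h.left_inv z hz
  exact h1.unique h2

theorem fderiv_inv_apply {y : Euc k} (hy : y ∈ U) (v : Euc k) :
    fderiv ℝ e (ψ y) (fderiv ℝ ψ y v) = v := by
  have := congrArg (fun A : Euc k →L[ℝ] Euc k => A v) (h.fderiv_inv_comp hy)
  simpa using this

theorem injective_fderiv : ∀ y ∈ U, Function.Injective (fderiv ℝ ψ y) := fun y hy =>
  Function.LeftInverse.injective (g := fderiv ℝ e (ψ y)) (h.fderiv_inv_apply hy)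

theorem comp_eventuallyEq {F : Type*} (f : Euc n → F) {x : Euc n} (hx : x ∈ M ∩ W) :
    f =ᶠ[𝓝[M] x] fun z => f (ψ (e z)) := by
  filter_upwards [self_mem_nhdsWithin,
    mem_nhdsWithin_of_mem_nhds (h.isOpen_target.mem_nhds hx.2)] with z hz1 hz2
  rw [h.right_inv z ⟨hz1, hz2⟩]

/-- On `M`, the function agrees near the point with `f ∘ ψ ∘ e`, where `e` is differentiable in the
ambient space; differentiability within `M` is thus reduced to the chart. -/
theorem hasFDerivWithinAt {F : Type*} [NormedAddCommGroup F] [NormedSpace ℝ F] {f : Euc n → F}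
    {g' : Euc k →L[ℝ] F} {y : Euc k} (hy : y ∈ U)
    (hf : HasFDerivAt (fun z => f (ψ z)) g' y) :
    HasFDerivWithinAt f (g' ∘L fderiv ℝ e (ψ y)) M (ψ y) := by
  have hx := h.mapsTo y hy
  have h1 : HasFDerivAt (fun z => f (ψ (e z))) (g' ∘L fderiv ℝ e (ψ y)) (ψ y) := by
    refine HasFDerivAt.comp (g := fun z => f (ψ z)) (ψ y) ?_ (h.hasFDerivAt_inv hx.2)
    rwa [h.left_inv y hy]
  refine h1.hasFDerivWithinAt.congr_of_eventuallyEq (h.comp_eventuallyEq f hx) ?_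
  rw [h.left_inv y hy]

theorem tangentSpaceAt_eq {y : Euc k} (hy : y ∈ U) :
    tangentSpaceAt M (ψ y) = LinearMap.range (fderiv ℝ ψ y : Euc k →ₗ[ℝ] Euc n) := by
  apply le_antisymm
  · refine Submodule.span_le.2 fun w hw => ?_
    -- The identity map has two derivatives within `M`, namely `id` and `Dψ ∘ De`. They agree on
    -- tangent directions, which are therefore in the range of `Dψ`.
    have h1 : HasFDerivWithinAt (fun z : Euc n => z) (fderiv ℝ ψ y ∘L fderiv ℝ e (ψ y)) M (ψ y) :=
      h.hasFDerivWithinAt (f := fun z => z) hy (h.hasFDerivAt hy)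
    have h2 := h1.unique_on (hasFDerivWithinAt_id (ψ y) M) hw
    rw [ContinuousLinearMap.id_apply] at h2
    rw [← h2]
    exact ⟨fderiv ℝ e (ψ y) w, rfl⟩
  · rintro _ ⟨v, rfl⟩
    refine Submodule.subset_span ?_
    have h1 := (h.hasFDerivAt hy).hasFDerivWithinAt (s := U)
    have h2 := h1.mapsTo_tangent_cone (x := y) (show v ∈ tangentConeAt ℝ U y by
      rw [tangentConeAt_of_mem_nhds (h.isOpen_source.mem_nhds hy)]; trivial)
    refine tangentConeAt_mono ?_ h2
    rw [h.image_eq]; exact inter_subset_left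

end IsParam

end Parametrization

/-! ### Rules of calculus for the tangential gradient. -/

section TangentialCalculus

variable {n k : ℕ} {M : Set (Euc n)} {x : Euc n}

theorem HasFDerivWithinAt.eqOn_tangentSpaceAt {F : Type*} [NormedAddCommGroup F] [NormedSpace ℝ F]
    {f : Euc n → F} {f' g' : Euc n →L[ℝ] F} (hf : HasFDerivWithinAt f f' M x)
    (hg : HasFDerivWithinAt f g' M x) {w : Euc n} (hw : w ∈ tangentSpaceAt M x) : f' w = g' w := by
  have h := hf.unique_on hg
  exact LinearMap.eqOn_span (f := (f' : Euc n →ₗ[ℝ] F)) (g := (g' : Euc n →ₗ[ℝ] F)) h hw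

theorem tgrad_mem (M : Set (Euc n)) (f : Euc n → ℝ) (x : Euc n) :
    tgrad M f x ∈ tangentSpaceAt M x := Submodule.starProjection_apply_mem _ _

theorem inner_tgrad {f : Euc n → ℝ} {f' : Euc n →L[ℝ] ℝ} (hf : HasFDerivWithinAt f f' M x)
    {w : Euc n} (hw : w ∈ tangentSpaceAt M x) : inner ℝ (tgrad M f x) w = f' w := by
  rw [tgrad, Submodule.inner_starProjection_left_eq_right,
    Submodule.starProjection_eq_self_iff.2 hw, InnerProductSpace.toDual_symm_apply]
  exact HasFDerivWithinAt.eqOn_tangentSpaceAt hf.differentiableWithinAt.hasFDerivWithinAt hf hw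

/-- A tangent vector is determined by its inner products with tangent vectors. The rules below are
proved by checking those against any derivative within `M`, whose values off the tangent space are
immaterial. -/
theorem eq_tgrad {f : Euc n → ℝ} {f' : Euc n →L[ℝ] ℝ} (hf : HasFDerivWithinAt f f' M x) {g : Euc n}
    (hg : g ∈ tangentSpaceAt M x) (h : ∀ w ∈ tangentSpaceAt M x, inner ℝ g w = f' w) :
    tgrad M f x = g := by
  rw [← sub_eq_zero, ← inner_self_eq_zero (𝕜 := ℝ)]
  have hmem := Submodule.sub_mem _ (tgrad_mem M f x) hg
  rw [inner_sub_left, inner_tgrad hf hmem, h _ hmem, sub_self]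

theorem tgrad_eq {f : Euc n → ℝ} {f' : Euc n →L[ℝ] ℝ} (hf : HasFDerivWithinAt f f' M x) :
    tgrad M f x = (tangentSpaceAt M x).starProjection
      ((InnerProductSpace.toDual ℝ (Euc n)).symm f') := by
  refine eq_tgrad hf (Submodule.starProjection_apply_mem _ _) fun w hw => ?_
  rw [Submodule.inner_starProjection_left_eq_right, Submodule.starProjection_eq_self_iff.2 hw,
    InnerProductSpace.toDual_symm_apply]

theorem tgrad_congr {f g : Euc n → ℝ} (hfg : f =ᶠ[𝓝[M] x] g) (hx : f x = g x) :
    tgrad M f x = tgrad M g x := by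
  rw [tgrad, tgrad, hfg.fderivWithin_eq hx]

theorem tgrad_add {f g : Euc n → ℝ} (hf : DifferentiableWithinAt ℝ f M x)
    (hg : DifferentiableWithinAt ℝ g M x) :
    tgrad M (fun y => f y + g y) x = tgrad M f x + tgrad M g x := by
  have hf' := hf.hasFDerivWithinAt
  have hg' := hg.hasFDerivWithinAt
  refine eq_tgrad (hf'.add hg') (Submodule.add_mem _ (tgrad_mem _ _ _) (tgrad_mem _ _ _))
    fun w hw => ?_
  rw [inner_add_left, inner_tgrad hf' hw, inner_tgrad hg' hw, _root_.add_apply]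

theorem tgrad_sub {f g : Euc n → ℝ} (hf : DifferentiableWithinAt ℝ f M x)
    (hg : DifferentiableWithinAt ℝ g M x) :
    tgrad M (fun y => f y - g y) x = tgrad M f x - tgrad M g x := by
  have hf' := hf.hasFDerivWithinAt
  have hg' := hg.hasFDerivWithinAt
  refine eq_tgrad (hf'.sub hg') (Submodule.sub_mem _ (tgrad_mem _ _ _) (tgrad_mem _ _ _))
    fun w hw => ?_
  rw [inner_sub_left, inner_tgrad hf' hw, inner_tgrad hg' hw, _root_.sub_apply]

theorem tgrad_mul {f g : Euc n → ℝ} (hf : DifferentiableWithinAt ℝ f M x)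
    (hg : DifferentiableWithinAt ℝ g M x) :
    tgrad M (fun y => f y * g y) x = f x • tgrad M g x + g x • tgrad M f x := by
  have hf' := hf.hasFDerivWithinAt
  have hg' := hg.hasFDerivWithinAt
  refine eq_tgrad (hf'.mul hg') (Submodule.add_mem _ (Submodule.smul_mem _ _ (tgrad_mem _ _ _))
    (Submodule.smul_mem _ _ (tgrad_mem _ _ _))) fun w hw => ?_
  simp [inner_add_left, inner_smul_left, inner_tgrad hf' hw, inner_tgrad hg' hw]

theorem tgrad_comp {f : Euc n → ℝ} {T : ℝ → ℝ} {T' : ℝ} (hT : HasDerivAt T T' (f x))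
    (hf : DifferentiableWithinAt ℝ f M x) :
    tgrad M (fun y => T (f y)) x = T' • tgrad M f x := by
  have hf' := hf.hasFDerivWithinAt
  refine eq_tgrad (hT.comp_hasFDerivWithinAt x hf') (Submodule.smul_mem _ _ (tgrad_mem _ _ _))
    fun w hw => ?_
  simp [inner_smul_left, inner_tgrad hf' hw]

theorem tgrad_pow_two {f : Euc n → ℝ} (hf : DifferentiableWithinAt ℝ f M x) :
    tgrad M (fun y => f y ^ 2) x = (2 * f x) • tgrad M f x := by
  have h := tgrad_comp (T := fun t => t ^ 2) (hasDerivAt_pow 2 (f x)) hf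
  simpa using h

theorem tgrad_div {f g : Euc n → ℝ} (hf : DifferentiableWithinAt ℝ f M x)
    (hg : DifferentiableWithinAt ℝ g M x) (hgx : g x ≠ 0) :
    g x • tgrad M (fun y => f y / g y) x = tgrad M f x - (f x / g x) • tgrad M g x := by
  have h1 : DifferentiableWithinAt ℝ (fun y => (g y)⁻¹) M x := hg.inv hgx
  have h2 := tgrad_comp (T := fun t => t⁻¹) (hasDerivAt_inv hgx) hg
  simp only [div_eq_mul_inv]
  rw [tgrad_mul hf h1, h2, smul_add, smul_smul, smul_smul, smul_smul]
  rw [mul_inv_cancel₀ hgx, one_smul, add_comm, sub_eq_add_neg, ← neg_smul]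
  congr 2
  field_simp

/-- The tangential gradient of a radial function on a set whose tangent space contains `x`. -/
theorem tgrad_radial {η : ℝ → ℝ} {η' : ℝ} (hη : HasDerivAt η η' ‖x‖) (hx : x ≠ 0)
    (hxT : x ∈ tangentSpaceAt M x) : tgrad M (fun y => η ‖y‖) x = (η' * ‖x‖⁻¹) • x := by
  have hn : HasFDerivAt (fun y : Euc n => ‖y‖) (‖x‖⁻¹ • innerSL ℝ x) x := by
    have h1 : HasFDerivAt (fun y : Euc n => Real.sqrt (‖y‖ ^ 2)) _ x :=
      (hasStrictFDerivAt_norm_sq x).hasFDerivAt.sqrt (by simpa using hx)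
    simp only [Real.sqrt_sq (norm_nonneg _)] at h1
    refine h1.congr_fderiv ?_
    ext w
    have : ‖x‖ ≠ 0 := norm_ne_zero_iff.2 hx
    simp
    field_simp
  refine eq_tgrad (hη.comp_hasFDerivAt x hn).hasFDerivWithinAt (Submodule.smul_mem _ _ hxT)
    fun w _ => ?_
  simp [inner_smul_left, mul_assoc]

end TangentialCalculus

end WeightedCone

/-! ### Jacobi's formula and Gram operators. -/

section DetCalculus

/-- Differentiating the Leibniz expansion one column at a time leaves determinants of the identity
matrix with one column replaced, and such a determinant is the diagonal entry of that column. -/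
theorem Matrix.hasDerivAt_det_of_eq_one {ι : Type*} [Fintype ι] [DecidableEq ι]
    {A : ℝ → Matrix ι ι ℝ} {A' : Matrix ι ι ℝ} {t : ℝ}
    (hA : ∀ i j, HasDerivAt (fun s => A s i j) (A' i j) t) (h1 : A t = 1) :
    HasDerivAt (fun s => (A s).det) A'.trace t := by
  have h : HasDerivAt (fun s => ∑ σ : Equiv.Perm ι, ((Equiv.Perm.sign σ : ℤ) : ℝ) *
      ∏ i, A s (σ i) i) (∑ σ : Equiv.Perm ι, ((Equiv.Perm.sign σ : ℤ) : ℝ) *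
        ∑ i, (∏ j ∈ Finset.univ.erase i, A t (σ j) j) • A' (σ i) i) t :=
    HasDerivAt.fun_sum fun σ _ => (HasDerivAt.fun_finsetProd fun i _ => hA (σ i) i).const_mul _
  simp only [Matrix.det_apply']
  refine h.congr_deriv ?_
  have h2 : ∀ i, Matrix.det ((1 : Matrix ι ι ℝ).updateCol i (fun j => A' j i)) = A' i i := by
    intro i
    rw [← Matrix.cramer_apply, Matrix.cramer_one]; rfl
  simp only [Matrix.trace, Matrix.diag, ← h2, Matrix.det_apply', Finset.mul_sum]
  rw [Finset.sum_comm]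
  refine Finset.sum_congr rfl fun i _ => Finset.sum_congr rfl fun σ _ => ?_
  rw [← Finset.mul_prod_erase Finset.univ _ (Finset.mem_univ i), Matrix.updateCol_self, h1,
    smul_eq_mul, mul_comm (∏ j ∈ _, _)]
  congr 2
  refine Finset.prod_congr rfl fun j hj => ?_
  rw [Matrix.updateCol_ne (Finset.ne_of_mem_erase hj)]

variable {F : Type*} [NormedAddCommGroup F] [NormedSpace ℝ F] [FiniteDimensional ℝ F]

theorem ContinuousLinearMap.contDiff_det {N : WithTop ℕ∞} :
    ContDiff ℝ N (fun A : F →L[ℝ] F => A.det) := by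
  have b := Module.finBasis ℝ F
  have h : (fun A : F →L[ℝ] F => A.det) =
      fun A : F →L[ℝ] F => (LinearMap.toMatrix b b (A : F →ₗ[ℝ] F)).det := by
    ext A; rw [LinearMap.det_toMatrix]
  rw [h]
  simp only [Matrix.det_apply']
  refine ContDiff.sum fun σ _ => contDiff_const.mul (contDiff_prod fun i _ => ?_)
  simp only [LinearMap.toMatrix_apply]
  exact ((b.coord (σ i)).toContinuousLinearMap ∘L
    (ContinuousLinearMap.apply ℝ F (b i))).contDiff

/-- Factoring out `G t` reduces the claim to a curve of operators passing through the identity. -/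
theorem HasDerivAt.clm_det {G : ℝ → F →L[ℝ] F} {G' : F →L[ℝ] F} {t : ℝ} (hG : HasDerivAt G G' t)
    (hu : IsUnit (G t)) : HasDerivAt (fun s => (G s).det)
      ((G t).det * LinearMap.trace ℝ F ((Ring.inverse (G t) * G' : F →L[ℝ] F) : F →ₗ[ℝ] F)) t := by
  have b := Module.finBasis ℝ F
  set H := Ring.inverse (G t) with hH
  have hGH : G t * H = 1 := Ring.mul_inverse_cancel _ hu
  have hHG : H * G t = 1 := Ring.inverse_mul_cancel _ hu
  have h1 : ∀ s, (G s).det = (G t).det * (LinearMap.toMatrix b b ((H * G s : F →L[ℝ] F) :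
      F →ₗ[ℝ] F)).det := by
    intro s
    rw [LinearMap.det_toMatrix]
    have : G s = G t * (H * G s) := by rw [← mul_assoc, hGH, one_mul]
    conv_lhs => rw [this]
    exact LinearMap.det_comp _ _
  rw [funext h1]
  have h2 : HasDerivAt (fun s => (LinearMap.toMatrix b b ((H * G s : F →L[ℝ] F) :
      F →ₗ[ℝ] F)).det) (LinearMap.toMatrix b b ((H * G' : F →L[ℝ] F) : F →ₗ[ℝ] F)).trace t := by
    refine Matrix.hasDerivAt_det_of_eq_one (fun i j => ?_) ?_
    · simp only [LinearMap.toMatrix_apply]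
      exact ((b.coord i).toContinuousLinearMap ∘L (ContinuousLinearMap.apply ℝ F (b j)) ∘L
        (ContinuousLinearMap.compL ℝ F F F H)).hasFDerivAt.comp_hasDerivAt t hG
    · rw [hHG]; exact LinearMap.toMatrix_one b
  refine (h2.const_mul (G t).det).congr_deriv ?_
  rw [← LinearMap.trace_eq_matrix_trace]

end DetCalculus

section Gram

variable {F E : Type*} [NormedAddCommGroup F] [InnerProductSpace ℝ F] [FiniteDimensional ℝ F]
  [NormedAddCommGroup E] [InnerProductSpace ℝ E] [FiniteDimensional ℝ E]

/-- The Gram operator `A†A`. -/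
noncomputable def gramOp (A : F →L[ℝ] E) : F →L[ℝ] F := ContinuousLinearMap.adjoint A ∘L A

/-- The Moore-Penrose inverse `(A†A)⁻¹A†` of an injective operator `A`. -/
noncomputable def pinv (A : F →L[ℝ] E) : E →L[ℝ] F :=
  Ring.inverse (gramOp A) ∘L ContinuousLinearMap.adjoint A

theorem inner_gramOp (A : F →L[ℝ] E) (v w : F) : inner ℝ (gramOp A v) w = inner ℝ (A v) (A w) := by
  rw [gramOp, ContinuousLinearMap.comp_apply, ContinuousLinearMap.adjoint_inner_left]

theorem isUnit_gramOp {A : F →L[ℝ] E} (hA : Function.Injective A) : IsUnit (gramOp A) := by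
  have hinj : Function.Injective (gramOp A) := by
    rw [injective_iff_map_eq_zero]
    intro v hv
    have h := inner_gramOp A v v
    rw [hv, inner_zero_left, eq_comm, inner_self_eq_zero] at h
    exact (map_eq_zero_iff A hA).1 h
  rw [ContinuousLinearMap.isUnit_iff_bijective]
  exact ⟨hinj, (LinearMap.injective_iff_surjective (f := (gramOp A : F →ₗ[ℝ] F))).1 hinj⟩

theorem pinv_comp {A : F →L[ℝ] E} (hA : Function.Injective A) :
    pinv A ∘L A = ContinuousLinearMap.id ℝ F := by
  rw [pinv, ContinuousLinearMap.comp_assoc]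
  exact Ring.inverse_mul_cancel _ (isUnit_gramOp hA)

theorem starProjection_range_eq {A : F →L[ℝ] E} (hA : Function.Injective A) :
    (LinearMap.range (A : F →ₗ[ℝ] E)).starProjection = A ∘L pinv A := by
  ext x
  refine (Submodule.eq_starProjection_of_mem_of_inner_eq_zero ⟨pinv A x, rfl⟩ ?_)
  rintro _ ⟨v, rfl⟩
  have h1 : gramOp A (pinv A x) = ContinuousLinearMap.adjoint A x := by
    have := congrArg (fun B : F →L[ℝ] F => B (ContinuousLinearMap.adjoint A x))
      (Ring.mul_inverse_cancel _ (isUnit_gramOp hA))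
    simpa [pinv] using this
  have h2 := inner_gramOp A (pinv A x) v
  rw [h1, ContinuousLinearMap.adjoint_inner_left] at h2
  rw [inner_sub_left]
  simp only [ContinuousLinearMap.coe_coe, ContinuousLinearMap.comp_apply]
  rw [h2, sub_self]

theorem gramOp_contDiff {N : WithTop ℕ∞} : ContDiff ℝ N (gramOp : (F →L[ℝ] E) → F →L[ℝ] F) :=
  ((ContinuousLinearMap.adjoint (𝕜 := ℝ) (E := F) (F := E)).toContinuousLinearEquiv.contDiff).clm_comp
    contDiff_id

theorem contDiffAt_pinv {N : WithTop ℕ∞} {A : F →L[ℝ] E} (hA : Function.Injective A) :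
    ContDiffAt ℝ N (pinv : (F →L[ℝ] E) → E →L[ℝ] F) A := by
  obtain ⟨g, hg⟩ := isUnit_gramOp hA
  have h1 : ContDiffAt ℝ N (Ring.inverse : (F →L[ℝ] F) → F →L[ℝ] F) (gramOp A) := by
    rw [← hg]; exact contDiffAt_ringInverse ℝ g
  exact (h1.comp A gramOp_contDiff.contDiffAt).clm_comp
    ((ContinuousLinearMap.adjoint (𝕜 := ℝ) (E := F) (F := E)).toContinuousLinearEquiv.contDiff.contDiffAt)

theorem ContinuousLinearMap.trace_adjoint (T : F →L[ℝ] F) :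
    LinearMap.trace ℝ F (ContinuousLinearMap.adjoint T : F →ₗ[ℝ] F) =
      LinearMap.trace ℝ F (T : F →ₗ[ℝ] F) := by
  rw [LinearMap.trace_eq_sum_inner _ (stdOrthonormalBasis ℝ F),
    LinearMap.trace_eq_sum_inner _ (stdOrthonormalBasis ℝ F)]
  refine Finset.sum_congr rfl fun i _ => ?_
  simp only [ContinuousLinearMap.coe_coe]
  rw [ContinuousLinearMap.adjoint_inner_right, real_inner_comm]

/-- The two halves of the derivative of `A†A` have equal traces: since the inverse Gram operator is
self-adjoint, taking the adjoint and permuting cyclically exchanges them. The factor `2` is later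
absorbed by the square root in the Jacobian. -/
theorem trace_gramOp_deriv (A A' : F →L[ℝ] E) :
    LinearMap.trace ℝ F ((Ring.inverse (gramOp A) * (ContinuousLinearMap.adjoint A' ∘L A +
      ContinuousLinearMap.adjoint A ∘L A') : F →L[ℝ] F) : F →ₗ[ℝ] F) =
      2 * LinearMap.trace ℝ F ((pinv A ∘L A' : F →L[ℝ] F) : F →ₗ[ℝ] F) := by
  have hstar : ContinuousLinearMap.adjoint (Ring.inverse (gramOp A)) = Ring.inverse (gramOp A) := by
    have h1 : star (gramOp A) = gramOp A := by
      rw [ContinuousLinearMap.star_eq_adjoint, gramOp, ContinuousLinearMap.adjoint_comp,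
        ContinuousLinearMap.adjoint_adjoint]
    rw [← ContinuousLinearMap.star_eq_adjoint, ← Ring.inverse_star, h1]
  have h1 : LinearMap.trace ℝ F ((Ring.inverse (gramOp A) ∘L (ContinuousLinearMap.adjoint A' ∘L A) :
      F →L[ℝ] F) : F →ₗ[ℝ] F) =
      LinearMap.trace ℝ F ((pinv A ∘L A' : F →L[ℝ] F) : F →ₗ[ℝ] F) := by
    have h2 : ContinuousLinearMap.adjoint (Ring.inverse (gramOp A) ∘L
        (ContinuousLinearMap.adjoint A' ∘L A)) =
        (ContinuousLinearMap.adjoint A ∘L A') ∘L Ring.inverse (gramOp A) := by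
      rw [ContinuousLinearMap.adjoint_comp, ContinuousLinearMap.adjoint_comp,
        ContinuousLinearMap.adjoint_adjoint, hstar]
    rw [← ContinuousLinearMap.trace_adjoint, h2]
    exact LinearMap.trace_comp_comm' ((Ring.inverse (gramOp A) : F →L[ℝ] F) : F →ₗ[ℝ] F)
      ((ContinuousLinearMap.adjoint A ∘L A' : F →L[ℝ] F) : F →ₗ[ℝ] F)
  have h2 : (Ring.inverse (gramOp A) * (ContinuousLinearMap.adjoint A' ∘L A +
      ContinuousLinearMap.adjoint A ∘L A') : F →L[ℝ] F) =
      Ring.inverse (gramOp A) ∘L (ContinuousLinearMap.adjoint A' ∘L A) + pinv A ∘L A' := by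
    rw [mul_add]; rfl
  rw [h2, ContinuousLinearMap.toLinearMap_add, map_add, h1, two_mul]

/-- Jacobi's formula for the Jacobian `√det(A†A)`. -/
theorem HasDerivAt.clm_normDet {A : ℝ → F →L[ℝ] E} {A' : F →L[ℝ] E} {t : ℝ}
    (hA : HasDerivAt A A' t) (hi : Function.Injective (A t)) :
    HasDerivAt (fun s => (A s : F →ₗ[ℝ] E).normDet) ((A t : F →ₗ[ℝ] E).normDet *
      LinearMap.trace ℝ F ((pinv (A t) ∘L A' : F →L[ℝ] F) : F →ₗ[ℝ] F)) t := by
  simp only [ContinuousLinearMap.normDet_eq_sqrt_det]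
  have h1 : HasDerivAt (fun s => gramOp (A s)) (ContinuousLinearMap.adjoint A' ∘L A t +
      ContinuousLinearMap.adjoint (A t) ∘L A') t := by
    have h := (ContinuousLinearMap.adjoint (𝕜 := ℝ) (E := F) (F := E)).toContinuousLinearEquiv.hasFDerivAt.comp_hasDerivAt t hA
    exact h.clm_comp hA
  have h2 := h1.clm_det (isUnit_gramOp hi)
  rw [trace_gramOp_deriv] at h2
  have hpos : 0 < (gramOp (A t)).det := by
    have := ContinuousLinearMap.normDet_pos hi
    rw [ContinuousLinearMap.normDet_eq_sqrt_det] at this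
    exact Real.sqrt_pos.1 this
  refine (h2.sqrt hpos.ne').congr_deriv ?_
  have h3 : Real.sqrt (gramOp (A t)).det ≠ 0 := (Real.sqrt_pos.2 hpos).ne'
  change _ = Real.sqrt (gramOp (A t)).det * _
  field_simp
  rw [Real.sq_sqrt hpos.le, mul_comm]

theorem contDiffAt_normDet {N : WithTop ℕ∞} {A : F →L[ℝ] E} (hA : Function.Injective A) :
    ContDiffAt ℝ N (fun A : F →L[ℝ] E => (A : F →ₗ[ℝ] E).normDet) A := by
  simp only [ContinuousLinearMap.normDet_eq_sqrt_det]
  refine ContDiffAt.sqrt (ContinuousLinearMap.contDiff_det.comp gramOp_contDiff).contDiffAt ?_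
  have := ContinuousLinearMap.normDet_pos hA
  rw [ContinuousLinearMap.normDet_eq_sqrt_det] at this
  exact (Real.sqrt_pos.1 this).ne'

end Gram

namespace WeightedCone

/-! ### Gradient and divergence in a parametrization. -/

section ChartCalculus

variable {n k : ℕ} {M W : Set (Euc n)} {U : Set (Euc k)} {ψ : Euc k → Euc n} {e : Euc n → Euc k}

namespace IsParam

variable (h : IsParam M W U ψ e)

include h

theorem isOpen_inter_preimage {O : Set (Euc n)} (hO : IsOpen O) : IsOpen (U ∩ ψ ⁻¹' O) :=
  h.contDiffOn.continuousOn.isOpen_inter_preimage h.isOpen_source hO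

theorem contDiffOn_comp {F : Type*} [NormedAddCommGroup F] [NormedSpace ℝ F] {f : Euc n → F}
    {N : WithTop ℕ∞} (hN : N ≤ ∞) {O : Set (Euc n)} (hf : ContDiffOn ℝ N f (M ∩ O)) :
    ContDiffOn ℝ N (fun y => f (ψ y)) (U ∩ ψ ⁻¹' O) :=
  hf.comp ((h.contDiffOn.of_le hN).mono inter_subset_left) fun y hy => ⟨(h.mapsTo y hy.1).1, hy.2⟩

theorem tgrad_eq {f : Euc n → ℝ} {y : Euc k} (hy : y ∈ U)
    (hf : DifferentiableAt ℝ (fun z => f (ψ z)) y) :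
    tgrad M f (ψ y) = fderiv ℝ ψ y (Ring.inverse (gramOp (fderiv ℝ ψ y))
      ((InnerProductSpace.toDual ℝ (Euc k)).symm (fderiv ℝ (fun z => f (ψ z)) y))) := by
  set g := (InnerProductSpace.toDual ℝ (Euc k)).symm (fderiv ℝ (fun z => f (ψ z)) y) with hg
  have hT := h.tangentSpaceAt_eq hy
  refine eq_tgrad (h.hasFDerivWithinAt hy hf.hasFDerivAt) (by rw [hT]; exact ⟨_, rfl⟩) fun w hw => ?_
  rw [hT] at hw
  obtain ⟨v, rfl⟩ := hw
  have h1 : gramOp (fderiv ℝ ψ y) (Ring.inverse (gramOp (fderiv ℝ ψ y)) g) = g :=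
    congrArg (fun B : Euc k →L[ℝ] Euc k => B g)
      (Ring.mul_inverse_cancel _ (isUnit_gramOp (h.injective_fderiv y hy)))
  simp only [ContinuousLinearMap.coe_coe, ContinuousLinearMap.comp_apply]
  rw [← inner_gramOp, h1, h.fderiv_inv_apply hy, hg, InnerProductSpace.toDual_symm_apply]

/-- With `A = Dψ`, the projection on the tangent space is `A ∘ pinv A`, so the trace over the
ambient space moves to the parameter space by cyclicity. -/
theorem tdiv_eq {X : Euc n → Euc n} {y : Euc k} (hy : y ∈ U)
    (hX : DifferentiableAt ℝ (fun z => X (ψ z)) y) :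
    tdiv M X (ψ y) = LinearMap.trace ℝ (Euc k) ((pinv (fderiv ℝ ψ y) ∘L
      fderiv ℝ (fun z => X (ψ z)) y : Euc k →L[ℝ] Euc k) : Euc k →ₗ[ℝ] Euc k) := by
  set A := fderiv ℝ ψ y with hA
  have hi := h.injective_fderiv y hy
  set D := fderiv ℝ (fun z => X (ψ z)) y with hD
  have hP : (tangentSpaceAt M (ψ y)).starProjection = A ∘L pinv A := by
    rw [← starProjection_range_eq hi]
    congr 1
    exact h.tangentSpaceAt_eq hy
  have h1 : fderivWithin ℝ X M (ψ y) ∘L (A ∘L pinv A) = D ∘L pinv A := by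
    ext1 x
    have hd := h.hasFDerivWithinAt hy hX.hasFDerivAt
    have h2 := HasFDerivWithinAt.eqOn_tangentSpaceAt
      hd.differentiableWithinAt.hasFDerivWithinAt hd (w := A (pinv A x))
      (by rw [h.tangentSpaceAt_eq hy]; exact ⟨_, rfl⟩)
    simp only [ContinuousLinearMap.comp_apply] at h2 ⊢
    rw [h2, h.fderiv_inv_apply hy]
  rw [tdiv, hP, h1]
  have h3 : (A ∘L pinv A) ∘L D ∘L pinv A = (A ∘L (pinv A ∘L D)) ∘L pinv A := by
    simp only [ContinuousLinearMap.comp_assoc]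
  rw [h3]
  have h4 := LinearMap.trace_comp_comm' (pinv A : Euc n →ₗ[ℝ] Euc k)
    ((A ∘L (pinv A ∘L D) : Euc k →L[ℝ] Euc n) : Euc k →ₗ[ℝ] Euc n)
  refine h4.trans ?_
  have h5 : (pinv A) ∘L (A ∘L (pinv A ∘L D)) = pinv A ∘L D := by
    rw [← ContinuousLinearMap.comp_assoc, pinv_comp hi, ContinuousLinearMap.id_comp]
  exact congrArg (fun T : Euc k →L[ℝ] Euc k => LinearMap.trace ℝ (Euc k) (T : Euc k →ₗ[ℝ] Euc k)) h5

theorem continuousOn_fderiv : ContinuousOn (fderiv ℝ ψ) U :=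
  h.contDiffOn.continuousOn_fderiv_of_isOpen h.isOpen_source (by simp)

theorem continuousOn_of_comp {F : Type*} [TopologicalSpace F] {g : Euc n → F} {O : Set (Euc n)}
    (hg : ContinuousOn (fun y => g (ψ y)) (U ∩ ψ ⁻¹' O)) : ContinuousOn g (M ∩ O ∩ W) := by
  have h1 : ContinuousOn (fun x => g (ψ (e x))) (M ∩ O ∩ W) := by
    refine hg.comp (h.contDiffOn_inv.continuousOn.mono inter_subset_right) fun x hx => ?_
    refine ⟨h.inv_mem x ⟨hx.1.1, hx.2⟩, ?_⟩
    rw [mem_preimage, h.right_inv x ⟨hx.1.1, hx.2⟩]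
    exact hx.1.2
  refine h1.congr fun x hx => ?_
  simp only [h.right_inv x ⟨hx.1.1, hx.2⟩]

theorem continuousOn_tgrad_comp {f : Euc n → ℝ} {O : Set (Euc n)} (hO : IsOpen O)
    (hf : ContDiffOn ℝ 1 f (M ∩ O)) :
    ContinuousOn (fun y => tgrad M f (ψ y)) (U ∩ ψ ⁻¹' O) := by
  have hUO := h.isOpen_inter_preimage hO
  have hc := h.contDiffOn_comp (by exact_mod_cast le_top) hf
  have h1 : ContinuousOn (fun y => fderiv ℝ ψ y (Ring.inverse (gramOp (fderiv ℝ ψ y))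
      ((InnerProductSpace.toDual ℝ (Euc k)).symm (fderiv ℝ (fun z => f (ψ z)) y))))
      (U ∩ ψ ⁻¹' O) := by
    have h2 := h.continuousOn_fderiv.mono (inter_subset_left (t := ψ ⁻¹' O))
    refine h2.clm_apply (ContinuousOn.clm_apply (fun y hy => ?_) ?_)
    · obtain ⟨g, hg⟩ := isUnit_gramOp (h.injective_fderiv y hy.1)
      have h3 : ContinuousAt Ring.inverse (gramOp (fderiv ℝ ψ y)) := by
        rw [← hg]; exact NormedRing.inverse_continuousAt g
      exact (h3.comp (gramOp_contDiff (N := 0)).continuous.continuousAt).comp_continuousWithinAt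
        (h2 y hy)
    · exact (InnerProductSpace.toDual ℝ (Euc k)).symm.continuous.comp_continuousOn
        (hc.continuousOn_fderiv_of_isOpen hUO le_rfl)
  refine h1.congr fun y hy => ?_
  exact h.tgrad_eq hy.1 ((hc.contDiffAt (hUO.mem_nhds hy)).differentiableAt (by simp))

theorem continuousOn_tdiv_comp {X : Euc n → Euc n} (hX : ContDiffOn ℝ 1 X M) :
    ContinuousOn (fun y => tdiv M X (ψ y)) U := by
  have hc := h.contDiffOn_comp (O := univ) (N := 1) (by exact_mod_cast le_top) (by simpa using hX)
  simp only [preimage_univ, inter_univ] at hc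
  have h1 : ContinuousOn (fun y => LinearMap.trace ℝ (Euc k) ((pinv (fderiv ℝ ψ y) ∘L
      fderiv ℝ (fun z => X (ψ z)) y : Euc k →L[ℝ] Euc k) : Euc k →ₗ[ℝ] Euc k)) U := by
    have h2 : Continuous (fun T : Euc k →L[ℝ] Euc k =>
        LinearMap.trace ℝ (Euc k) (T : Euc k →ₗ[ℝ] Euc k)) :=
      LinearMap.continuous_of_finiteDimensional
        ((LinearMap.trace ℝ (Euc k)) ∘ₗ ContinuousLinearMap.coeLM ℝ)
    refine h2.comp_continuousOn (ContinuousOn.clm_comp (fun y hy => ?_)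
      (hc.continuousOn_fderiv_of_isOpen h.isOpen_source le_rfl))
    exact (contDiffAt_pinv (N := 0) (h.injective_fderiv y hy)).continuousAt.comp_continuousWithinAt
      (h.continuousOn_fderiv y hy)
  refine h1.congr fun y hy => ?_
  exact h.tdiv_eq hy ((hc.contDiffAt (h.isOpen_source.mem_nhds hy)).differentiableAt (by simp))

end IsParam

end ChartCalculus

/-! ### Measure theory on a parametrizable set. -/

section Parametrizable

variable {n k : ℕ} {M : Set (Euc n)}

/-- Every point of `M` lies in an open piece of `M` with a smooth parametrization. -/
def IsParametrizable (k : ℕ) (M : Set (Euc n)) : Prop :=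
  ∀ x ∈ M, ∃ (W : Set (Euc n)) (U : Set (Euc k)) (ψ : Euc k → Euc n) (e : Euc n → Euc k),
    IsParam M W U ψ e ∧ x ∈ W

theorem IsSmoothSubmanifold.isParametrizable (hM : IsSmoothSubmanifold k M) :
    IsParametrizable k M := fun _ hx => hM.exists_isParam hx

theorem differentiableWithinAt_of_contDiffOn_inter {O : Set (Euc n)}
    (hO : IsOpen O) {F : Type*} [NormedAddCommGroup F] [NormedSpace ℝ F] {f : Euc n → F}
    (hf : ContDiffOn ℝ 1 f (M ∩ O)) {x : Euc n} (hx : x ∈ M ∩ O) :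
    DifferentiableWithinAt ℝ f M x :=
  ((hf.differentiableOn (by simp)) x hx).mono_of_mem_nhdsWithin
    (inter_mem_nhdsWithin M (hO.mem_nhds hx.2))

theorem IsParametrizable.continuousOn_of_local {F : Type*} [TopologicalSpace F]
    (hM : IsParametrizable k M) {g : Euc n → F} {O : Set (Euc n)}
    (hg : ∀ W U ψ e, IsParam M W U ψ e → ContinuousOn (fun y : Euc k => g (ψ y)) (U ∩ ψ ⁻¹' O)) :
    ContinuousOn g (M ∩ O) := by
  intro x hx
  obtain ⟨W, U, ψ, e, h, hxW⟩ := hM x hx.1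
  exact (continuousWithinAt_inter (h.isOpen_target.mem_nhds hxW)).1
    (h.continuousOn_of_comp (hg W U ψ e h) x ⟨hx, hxW⟩)

theorem IsParametrizable.continuousOn_tgrad (hM : IsParametrizable k M) {f : Euc n → ℝ}
    {O : Set (Euc n)} (hO : IsOpen O) (hf : ContDiffOn ℝ 1 f (M ∩ O)) :
    ContinuousOn (tgrad M f) (M ∩ O) :=
  hM.continuousOn_of_local fun _ _ _ _ h => h.continuousOn_tgrad_comp hO hf

theorem IsParametrizable.continuousOn_tdiv (hM : IsParametrizable k M) {X : Euc n → Euc n}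
    (hX : ContDiffOn ℝ 1 X M) : ContinuousOn (tdiv M X) M := by
  have := hM.continuousOn_of_local (O := univ) (g := tdiv M X) fun W U ψ e h => by
    simpa using h.continuousOn_tdiv_comp hX
  simpa using this

/-- Countably many charts suffice, by second countability, and each chart image is Borel as the
injective continuous image of an open set. -/
theorem IsParametrizable.measurableSet (hM : IsParametrizable k M) : MeasurableSet M := by
  choose! W U ψ e h hW using hM
  obtain ⟨t, htM, htc, ht⟩ := TopologicalSpace.countable_cover_nhdsWithin (s := M) (f := W)
    fun x hx => mem_nhdsWithin_of_mem_nhds ((h x hx).isOpen_target.mem_nhds (hW x hx))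
  have h1 : M = ⋃ x ∈ t, ψ x '' U x := by
    apply Subset.antisymm
    · intro z hz
      obtain ⟨x, hx, hzx⟩ := mem_iUnion₂.1 (ht hz)
      refine mem_iUnion₂.2 ⟨x, hx, ?_⟩
      rw [(h x (htM hx)).image_eq]
      exact ⟨hz, hzx⟩
    · refine iUnion₂_subset fun x hx => ?_
      rw [(h x (htM hx)).image_eq]
      exact inter_subset_left
  rw [h1]
  exact MeasurableSet.biUnion htc fun x hx => measurableSet_image_chart
    (h x (htM hx)).isOpen_source (h x (htM hx)).contDiffOn_one (h x (htM hx)).injOn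
    (h x (htM hx)).isOpen_source.measurableSet le_rfl

theorem IsParametrizable.exists_finite_nhdsWithin (hM : IsParametrizable k M) {x : Euc n}
    (hx : x ∈ M) : ∃ O, IsOpen O ∧ x ∈ O ∧ μHE[k] (M ∩ O) < ⊤ := by
  obtain ⟨W, U, ψ, e, h, hxW⟩ := hM x hx
  have hex := h.inv_mem x ⟨hx, hxW⟩
  obtain ⟨r, hr, hrU⟩ := Metric.nhds_basis_closedBall.mem_iff.1 (h.isOpen_source.mem_nhds hex)
  have hO : IsOpen (W ∩ e ⁻¹' Metric.ball (e x) r) :=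
    h.contDiffOn_inv.continuousOn.isOpen_inter_preimage h.isOpen_target Metric.isOpen_ball
  refine ⟨W ∩ e ⁻¹' Metric.ball (e x) r, hO, ⟨hxW, by simpa using hr⟩, ?_⟩
  have hsub : M ∩ (W ∩ e ⁻¹' Metric.ball (e x) r) ⊆ ψ '' Metric.ball (e x) r := by
    rintro z ⟨hzM, hzW, hze⟩
    exact ⟨e z, hze, h.right_inv z ⟨hzM, hzW⟩⟩
  refine (measure_mono hsub).trans_lt ?_
  rw [euclideanHausdorffMeasure_image_eq_lintegral h.isOpen_source h.contDiffOn_one h.injOn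
    h.injective_fderiv Metric.isOpen_ball.measurableSet (Metric.ball_subset_closedBall.trans hrU)]
  have hint : IntegrableOn (areaDensity ψ) (Metric.closedBall (e x) r) :=
    ((continuousOn_areaDensity h.isOpen_source h.contDiffOn_one).mono hrU).integrableOn_compact
      (isCompact_closedBall _ _)
  exact lt_of_le_of_lt (lintegral_mono fun y => Real.ofReal_le_enorm _)
    (hint.mono_set Metric.ball_subset_closedBall).2

theorem IsParametrizable.measure_lt_top (hM : IsParametrizable k M) {K : Set (Euc n)}
    (hK : IsCompact K) (hKM : K ⊆ M) : μHE[k] K < ⊤ := by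
  refine hK.measure_lt_top_of_nhdsWithin fun x hx => ?_
  obtain ⟨O, hO, hxO, hfin⟩ := hM.exists_finite_nhdsWithin (hKM hx)
  refine ⟨K ∩ O, inter_mem_nhdsWithin K (hO.mem_nhds hxO), ?_⟩
  exact (measure_mono (inter_subset_inter_left O hKM)).trans_lt hfin

theorem IsParametrizable.sigmaFinite (hM : IsParametrizable k M) :
    SigmaFinite (μHE[k].restrict M) := by
  have hMm := hM.measurableSet
  choose! O hO hxO hfin using fun x hx => hM.exists_finite_nhdsWithin (x := x) hx
  obtain ⟨t, htM, htc, ht⟩ := TopologicalSpace.countable_cover_nhdsWithin (s := M) (f := O)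
    fun x hx => mem_nhdsWithin_of_mem_nhds ((hO x hx).mem_nhds (hxO x hx))
  have hS : (insert Mᶜ (O '' t)).Countable := (htc.image O).insert _
  refine Measure.sigmaFinite_of_countable (S := insert Mᶜ (O '' t)) hS ?_ ?_
  · rintro s (rfl | ⟨x, hx, rfl⟩)
    · rw [Measure.restrict_apply hMm.compl]; simp
    · rw [Measure.restrict_apply (hO x (htM hx)).measurableSet, inter_comm]
      exact hfin x (htM hx)
  · rw [sUnion_insert, sUnion_image, eq_univ_iff_forall]
    intro z
    by_cases hz : z ∈ M
    · exact Or.inr (ht hz)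
    · exact Or.inl hz

theorem IsParametrizable.integrableOn_of_compact (hM : IsParametrizable k M) {K : Set (Euc n)}
    (hK : IsCompact K) (hKM : K ⊆ M) {f : Euc n → ℝ} (hf : ContinuousOn f K)
    (hf0 : ∀ x ∈ M \ K, f x = 0) : IntegrableOn f M μHE[k] := by
  have h1 : IntegrableOn f K μHE[k] := by
    have : IsFiniteMeasure (μHE[k].restrict K) :=
      ⟨by rw [Measure.restrict_apply_univ]; exact hM.measure_lt_top hK hKM⟩
    obtain ⟨B, hB⟩ := hK.exists_bound_of_continuousOn hf
    exact Integrable.of_bound (hf.aestronglyMeasurable hK.measurableSet) B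
      ((ae_restrict_iff' hK.measurableSet).2 (ae_of_all _ hB))
  exact h1.of_forall_sdiff_eq_zero hM.measurableSet hf0

end Parametrizable

/-! ### The divergence theorem for compactly supported functions. -/

section Divergence

variable {n k : ℕ}

theorem one_add_one_le_infty : (1 + 1 : WithTop ℕ∞) ≤ ∞ := by
  have h : ((2 : ℕ∞) : WithTop ℕ∞) ≤ ∞ := WithTop.coe_le_coe.2 le_top
  exact le_trans (le_of_eq (by norm_num)) h

theorem integral_trace_fderiv_eq_zero {Y : Euc k → Euc k} (hY : ContDiff ℝ 1 Y)
    (hc : HasCompactSupport Y) :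
    ∫ y, LinearMap.trace ℝ (Euc k) (fderiv ℝ Y y : Euc k →ₗ[ℝ] Euc k) = 0 := by
  have hcont : Continuous (fderiv ℝ Y) := hY.continuous_fderiv (by simp)
  have hsupp : HasCompactSupport (fderiv ℝ Y) := hc.fderiv ℝ
  have h1 : ∀ i, Integrable fun y => fderiv ℝ Y y (EuclideanSpace.single i 1) i := by
    intro i
    refine Continuous.integrable_of_hasCompactSupport (by fun_prop) ?_
    exact hsupp.comp_left (g := fun A : Euc k →L[ℝ] Euc k => A (EuclideanSpace.single i 1) i) (by simp)
  have h2 : ∀ y, LinearMap.trace ℝ (Euc k) (fderiv ℝ Y y : Euc k →ₗ[ℝ] Euc k) =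
      ∑ i, fderiv ℝ Y y (EuclideanSpace.single i 1) i := by
    intro y
    rw [LinearMap.trace_eq_sum_inner _ (EuclideanSpace.basisFun (Fin k) ℝ)]
    refine Finset.sum_congr rfl fun i _ => ?_
    simp [EuclideanSpace.inner_single_left]
  simp only [h2]
  rw [integral_finsetSum _ fun i _ => h1 i]
  refine Finset.sum_eq_zero fun i _ => ?_
  have h3 : ∀ y, fderiv ℝ (fun z => Y z i) y (EuclideanSpace.single i 1) =
      fderiv ℝ Y y (EuclideanSpace.single i 1) i := by
    intro y
    have := ((EuclideanSpace.proj i : Euc k →L[ℝ] ℝ).hasFDerivAt.comp y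
      (hY.differentiable (by simp) y).hasFDerivAt).fderiv
    have h4 : (fun z => Y z i) = (EuclideanSpace.proj i : Euc k →L[ℝ] ℝ) ∘ Y := rfl
    rw [h4, this]; rfl
  simp only [← h3]
  have h5 := integral_mul_fderiv_eq_neg_fderiv_mul_of_integrable (μ := volume) (f := fun _ : Euc k => (1 : ℝ))
    (g := fun z => Y z i) (v := EuclideanSpace.single i 1) (by simp) (by simpa [h3] using h1 i)
    (by
      simp only [one_mul]
      refine Continuous.integrable_of_hasCompactSupport (by have := hY.continuous; fun_prop) ?_
      exact hc.comp_left (g := fun v : Euc k => v i) (by simp)) (by simp)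
    (fun x _ => ((EuclideanSpace.proj i : Euc k →L[ℝ] ℝ).differentiableAt.comp x
      (hY.differentiable (by simp) x)))
  simpa using h5

theorem contDiff_indicator_of_compact {F G : Type*} [NormedAddCommGroup F] [NormedSpace ℝ F]
    [NormedAddCommGroup G] [NormedSpace ℝ G] {N : WithTop ℕ∞} {U K : Set F} (hU : IsOpen U)
    (hK : IsCompact K) (hKU : K ⊆ U) {Y : F → G} (hY : ContDiffOn ℝ N Y U)
    (h0 : ∀ y ∈ U \ K, Y y = 0) :
    ContDiff ℝ N (U.indicator Y) ∧ HasCompactSupport (U.indicator Y) := by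
  have hz : ∀ y ∉ K, U.indicator Y y = 0 := by
    intro y hy
    by_cases hyU : y ∈ U
    · rw [indicator_of_mem hyU]; exact h0 y ⟨hyU, hy⟩
    · exact indicator_of_notMem hyU _
  refine ⟨contDiff_iff_contDiffAt.2 fun y => ?_, HasCompactSupport.intro hK hz⟩
  by_cases hy : y ∈ U
  · refine (hY.contDiffAt (hU.mem_nhds hy)).congr_of_eventuallyEq ?_
    filter_upwards [hU.mem_nhds hy] with z hz using indicator_of_mem hz _
  · refine (contDiffAt_const (c := (0 : G))).congr_of_eventuallyEq ?_
    filter_upwards [hK.isClosed.isOpen_compl.mem_nhds fun h => hy (hKU h)] with z h using hz z h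

variable {M W : Set (Euc n)} {U : Set (Euc k)} {ψ : Euc k → Euc n} {e : Euc n → Euc k}

theorem tgrad_eq_zero_of_compact {f : Euc n → ℝ} {K : Set (Euc n)}
    (hK : IsCompact K) (hf0 : ∀ x ∈ M \ K, f x = 0) {x : Euc n} (hx : x ∈ M \ K) :
    tgrad M f x = 0 := by
  have h1 : tgrad M f x = tgrad M (fun _ => 0) x := by
    refine tgrad_congr ?_ (hf0 x hx)
    filter_upwards [self_mem_nhdsWithin, mem_nhdsWithin_of_mem_nhds
      (hK.isClosed.isOpen_compl.mem_nhds hx.2)] with z hz1 hz2 using hf0 z ⟨hz1, hz2⟩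
  rw [h1, tgrad]; simp

/-- The coordinates of a vector field in a parametrization. -/
noncomputable def pullbackField (ψ : Euc k → Euc n) (e : Euc n → Euc k) (X : Euc n → Euc n)
    (y : Euc k) : Euc k := fderiv ℝ e (ψ y) (X (ψ y))

namespace IsParam

variable (h : IsParam M W U ψ e) {X : Euc n → Euc n} (hX : ContDiffOn ℝ 1 X M)
  (hXt : ∀ x ∈ M, X x ∈ tangentSpaceAt M x)

include h hXt in
theorem fderiv_pullbackField {y : Euc k} (hy : y ∈ U) :
    fderiv ℝ ψ y (pullbackField ψ e X y) = X (ψ y) := by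
  have h1 := hXt (ψ y) (h.mapsTo y hy).1
  rw [h.tangentSpaceAt_eq hy] at h1
  obtain ⟨v, hv⟩ := h1
  rw [ContinuousLinearMap.coe_coe] at hv
  rw [pullbackField, ← hv, h.fderiv_inv_apply hy]

include h in
theorem contDiffOn_comp_field (hX : ContDiffOn ℝ 1 X M) : ContDiffOn ℝ 1 (fun y => X (ψ y)) U := by
  have := h.contDiffOn_comp (O := univ) (N := 1) (by exact_mod_cast le_top) (by simpa using hX)
  simpa using this

include h hX in
theorem contDiffOn_pullbackField : ContDiffOn ℝ 1 (pullbackField ψ e X) U := by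
  have h1 : ContDiffOn ℝ 1 (fderiv ℝ e) W :=
    h.contDiffOn_inv.fderiv_of_isOpen h.isOpen_target one_add_one_le_infty
  exact (h1.comp h.contDiffOn_one fun y hy => (h.mapsTo y hy).2).clm_apply
    (h.contDiffOn_comp_field hX)

include h in
theorem contDiffOn_areaDensity : ContDiffOn ℝ 1 (areaDensity ψ) U := by
  have h1 : ContDiffOn ℝ 1 (fderiv ℝ ψ) U :=
    h.contDiffOn.fderiv_of_isOpen h.isOpen_source one_add_one_le_infty
  intro y hy
  exact (contDiffAt_normDet (h.injective_fderiv y hy)).comp_contDiffWithinAt y (h1 y hy)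

include h in
theorem hasFDerivAt_fderiv {y : Euc k} (hy : y ∈ U) :
    HasFDerivAt (fderiv ℝ ψ) (fderiv ℝ (fderiv ℝ ψ) y) y := by
  have h1 : ContDiffOn ℝ 1 (fderiv ℝ ψ) U :=
    h.contDiffOn.fderiv_of_isOpen h.isOpen_source one_add_one_le_infty
  exact ((h1.contDiffAt (h.isOpen_source.mem_nhds hy)).differentiableAt (by simp)).hasFDerivAt

include h in
-- Jacobi's formula for the Jacobian along the line through `y` in direction `v`.
theorem fderiv_areaDensity {y : Euc k} (hy : y ∈ U) (v : Euc k) :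
    fderiv ℝ (areaDensity ψ) y v = areaDensity ψ y * LinearMap.trace ℝ (Euc k)
      ((pinv (fderiv ℝ ψ y) ∘L fderiv ℝ (fderiv ℝ ψ) y v : Euc k →L[ℝ] Euc k) :
        Euc k →ₗ[ℝ] Euc k) := by
  have hl : HasDerivAt (fun t : ℝ => y + t • v) v 0 := by
    simpa using ((hasDerivAt_id (0 : ℝ)).smul_const v).const_add y
  have hy0 : y + (0 : ℝ) • v = y := by simp
  have h1 : HasDerivAt (fun t : ℝ => fderiv ℝ ψ (y + t • v)) (fderiv ℝ (fderiv ℝ ψ) y v) 0 :=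
    HasFDerivAt.comp_hasDerivAt (0 : ℝ) (by rw [hy0]; exact h.hasFDerivAt_fderiv hy) hl
  have h2 := h1.clm_normDet (by rw [hy0]; exact h.injective_fderiv y hy)
  have h3 : HasFDerivAt (areaDensity ψ) (fderiv ℝ (areaDensity ψ) y) y :=
    ((h.contDiffOn_areaDensity.contDiffAt (h.isOpen_source.mem_nhds hy)).differentiableAt
      (by simp)).hasFDerivAt
  have h4 : HasDerivAt (fun t : ℝ => areaDensity ψ (y + t • v)) (fderiv ℝ (areaDensity ψ) y v) 0 :=
    HasFDerivAt.comp_hasDerivAt (l := areaDensity ψ) (0 : ℝ) (by rw [hy0]; exact h3) hl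
  have h5 := h4.unique h2
  simp only [hy0] at h5
  exact h5

include h hX hXt in
-- This is `J div X = div (J Z)` in the chart, with the right side expanded and `Z` the coordinates
-- of `X`. Differentiating `X ∘ ψ = Dψ Z` produces a second derivative of `ψ`; by its symmetry this
-- is the derivative of `Dψ` in direction `Z`, and its trace is the logarithmic derivative of `J`.
theorem tdiv_eq_trace {y : Euc k} (hy : y ∈ U) :
    areaDensity ψ y * tdiv M X (ψ y) = fderiv ℝ (areaDensity ψ) y (pullbackField ψ e X y) +
      areaDensity ψ y * LinearMap.trace ℝ (Euc k)
        (fderiv ℝ (pullbackField ψ e X) y : Euc k →ₗ[ℝ] Euc k) := by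
  have hn := h.isOpen_source.mem_nhds hy
  set Z := pullbackField ψ e X with hZ
  have hZd : HasFDerivAt Z (fderiv ℝ Z y) y :=
    (((h.contDiffOn_pullbackField hX).contDiffAt hn).differentiableAt (by simp)).hasFDerivAt
  have hXd := ((h.contDiffOn_comp_field hX).contDiffAt hn).differentiableAt (by simp)
  have h1 : fderiv ℝ (fun z => X (ψ z)) y =
      fderiv ℝ (fderiv ℝ ψ) y (Z y) + fderiv ℝ ψ y ∘L fderiv ℝ Z y := by
    have h2 : HasFDerivAt (fun z => fderiv ℝ ψ z (Z z)) _ y :=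
      (h.hasFDerivAt_fderiv hy).clm_apply hZd
    have h3 : (fun z => X (ψ z)) =ᶠ[𝓝 y] fun z => fderiv ℝ ψ z (Z z) := by
      filter_upwards [hn] with z hz using (h.fderiv_pullbackField hXt hz).symm
    rw [h3.fderiv_eq, h2.fderiv, add_comm]
    congr 1
    ext1 v
    have hs : IsSymmSndFDerivAt ℝ ψ y :=
      (h.contDiffOn.contDiffAt hn).isSymmSndFDerivAt (by simpa [one_add_one_eq_two] using one_add_one_le_infty)
    rw [ContinuousLinearMap.flip_apply]
    exact hs v (Z y)
  rw [h.tdiv_eq hy hXd, h1, ContinuousLinearMap.comp_add, ContinuousLinearMap.toLinearMap_add,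
    map_add, h.fderiv_areaDensity hy, ← ContinuousLinearMap.comp_assoc,
    pinv_comp (h.injective_fderiv y hy), ContinuousLinearMap.id_comp, mul_add]

include h hX hXt in
-- In the chart the integrand becomes the Euclidean divergence of the field `f J Z`, which is
-- compactly supported in `U`.
theorem integral_div_eq_zero {f : Euc n → ℝ} (hf : ContDiffOn ℝ 1 f M) {K : Set (Euc n)}
    (hK : IsCompact K) (hKM : K ⊆ M ∩ W) (hf0 : ∀ x ∈ M \ K, f x = 0) (hMm : MeasurableSet M) :
    ∫ x in M, (inner ℝ (X x) (tgrad M f x) + f x * tdiv M X x) ∂μHE[k] = 0 := by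
  have hfd0 : ∀ x ∈ M, x ∉ K → tgrad M f x = 0 := fun x hxM hxK =>
    tgrad_eq_zero_of_compact hK hf0 ⟨hxM, hxK⟩
  have h0 : ∫ x in M, (inner ℝ (X x) (tgrad M f x) + f x * tdiv M X x) ∂μHE[k] =
      ∫ x in M ∩ W, (inner ℝ (X x) (tgrad M f x) + f x * tdiv M X x) ∂μHE[k] := by
    refine (setIntegral_eq_of_subset_of_forall_sdiff_eq_zero (μ := μHE[k])
      (f := fun x => inner ℝ (X x) (tgrad M f x) + f x * tdiv M X x) hMm inter_subset_left ?_)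
    rintro x ⟨hxM, hxW⟩
    have hxK : x ∉ K := fun hx => hxW ⟨hxM, (hKM hx).2⟩
    simp [hfd0 x hxM hxK, hf0 x ⟨hxM, hxK⟩]
  rw [h0, ← h.image_eq, integral_image_areaDensity h.isOpen_source h.contDiffOn_one h.injOn
    h.injective_fderiv]
  set Z := pullbackField ψ e X with hZ
  have hfc : ContDiffOn ℝ 1 (fun y => f (ψ y)) U := by
    have := h.contDiffOn_comp (O := univ) (N := 1) (by exact_mod_cast le_top) (by simpa using hf)
    simpa using this
  set g : Euc k → ℝ := fun y => areaDensity ψ y * f (ψ y) with hg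
  have hgc : ContDiffOn ℝ 1 g U := h.contDiffOn_areaDensity.mul hfc
  have hYc : ContDiffOn ℝ 1 (fun y => g y • Z y) U := hgc.smul (h.contDiffOn_pullbackField hX)
  have hKU : e '' K ⊆ U := by rintro _ ⟨x, hx, rfl⟩; exact h.inv_mem x (hKM hx)
  have hKc : IsCompact (e '' K) :=
    hK.image_of_continuousOn (h.contDiffOn_inv.continuousOn.mono fun x hx => (hKM hx).2)
  obtain ⟨hY1, hY2⟩ := contDiff_indicator_of_compact h.isOpen_source hKc hKU hYc (by
    rintro y ⟨hyU, hyK⟩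
    have : f (ψ y) = 0 := hf0 _ ⟨(h.mapsTo y hyU).1, fun hK' => hyK ⟨ψ y, hK', h.left_inv y hyU⟩⟩
    simp [hg, this])
  have hmain := integral_trace_fderiv_eq_zero hY1 hY2
  rw [← setIntegral_eq_integral_of_forall_compl_eq_zero (s := U)] at hmain
  · rw [← hmain]
    refine setIntegral_congr_fun h.isOpen_source.measurableSet fun y hy => ?_
    have hn := h.isOpen_source.mem_nhds hy
    have hfd : HasFDerivAt (fun y => f (ψ y)) (fderiv ℝ (fun y => f (ψ y)) y) y :=
      ((hfc.contDiffAt hn).differentiableAt (by simp)).hasFDerivAt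
    have hJd : HasFDerivAt (areaDensity ψ) (fderiv ℝ (areaDensity ψ) y) y :=
      ((h.contDiffOn_areaDensity.contDiffAt hn).differentiableAt (by simp)).hasFDerivAt
    have hZd : HasFDerivAt Z (fderiv ℝ Z y) y :=
      (((h.contDiffOn_pullbackField hX).contDiffAt hn).differentiableAt (by simp)).hasFDerivAt
    have h1 : fderiv ℝ (U.indicator fun y => g y • Z y) y = fderiv ℝ (fun y => g y • Z y) y := by
      refine Filter.EventuallyEq.fderiv_eq ?_
      filter_upwards [hn] with z hz using indicator_of_mem hz _
    have h2 := ((hJd.mul hfd).smul hZd).fderiv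
    have h3 : inner ℝ (X (ψ y)) (tgrad M f (ψ y)) = fderiv ℝ (fun y => f (ψ y)) y (Z y) := by
      rw [real_inner_comm, inner_tgrad (h.hasFDerivWithinAt hy hfd) (hXt _ (h.mapsTo y hy).1)]
      rfl
    rw [h1]
    erw [h2]
    rw [ContinuousLinearMap.toLinearMap_add, map_add, h3]
    have h4 := h.tdiv_eq_trace hX hXt hy
    rw [ContinuousLinearMap.toLinearMap_smul, map_smul]
    erw [LinearMap.trace_smulRight]
    simp only [smul_eq_mul, ContinuousLinearMap.coe_coe, _root_.add_apply, Pi.mul_apply,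
      _root_.smul_apply]
    rw [← hZ] at h4
    linear_combination (f (ψ y)) * h4
  · intro y hy
    have : fderiv ℝ (U.indicator fun y => g y • Z y) y = 0 := by
      have h5 : (U.indicator fun y => g y • Z y) =ᶠ[𝓝 y] fun _ => 0 := by
        filter_upwards [hKc.isClosed.isOpen_compl.mem_nhds fun h => hy (hKU h)] with z hzK
        by_cases hzU : z ∈ U
        · rw [indicator_of_mem hzU]
          have : f (ψ z) = 0 :=
            hf0 _ ⟨(h.mapsTo z hzU).1, fun hK' => hzK ⟨ψ z, hK', h.left_inv z hzU⟩⟩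
          simp [hg, this]
        · exact indicator_of_notMem hzU _
      rw [h5.fderiv_eq]; simp
    rw [this]; simp

end IsParam

theorem continuousOn_div_integrand (hM : IsParametrizable k M) {X : Euc n → Euc n}
    (hX : ContDiffOn ℝ 1 X M) {f : Euc n → ℝ} (hf : ContDiffOn ℝ 1 f M) :
    ContinuousOn (fun x => inner ℝ (X x) (tgrad M f x) + f x * tdiv M X x) M := by
  have h1 : ContinuousOn (tgrad M f) M := by
    simpa using hM.continuousOn_tgrad isOpen_univ (by simpa using hf)
  exact (hX.continuousOn.inner h1).add (hf.continuousOn.mul (hM.continuousOn_tdiv hX))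

/-- The divergence theorem for compactly supported functions on a submanifold. -/
theorem IsParametrizable.integral_div_eq_zero (hM : IsParametrizable k M) {X : Euc n → Euc n}
    (hX : ContDiffOn ℝ 1 X M) (hXt : ∀ x ∈ M, X x ∈ tangentSpaceAt M x) {f : Euc n → ℝ}
    (hf : ContDiffOn ℝ 1 f M) {K : Set (Euc n)} (hK : IsCompact K) (hKM : K ⊆ M)
    (hf0 : ∀ x ∈ M \ K, f x = 0) :
    ∫ x in M, (inner ℝ (X x) (tgrad M f x) + f x * tdiv M X x) ∂μHE[k] = 0 := by
  have hMm := hM.measurableSet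
  choose! W U ψ e h hW using hM
  have hKW : ∀ x ∈ K, W x ∈ 𝓝 x := fun x hx => (h x (hKM hx)).isOpen_target.mem_nhds (hW x (hKM hx))
  obtain ⟨t, htK, htc⟩ := hK.elim_nhds_subcover W hKW
  -- A partition of unity on the support, subordinate to finitely many charts, reduces the claim to
  -- a single chart.
  obtain ⟨χ, hχ⟩ := SmoothPartitionOfUnity.exists_isSubordinate (modelWithCornersSelf ℝ (Euc n))
    hK.isClosed (fun i : t => W i) (fun i => (h i (hKM (htK i i.2))).isOpen_target)
    (fun x hx => by
      obtain ⟨y, hy, hxy⟩ := mem_iUnion₂.1 (htc hx)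
      exact mem_iUnion.2 ⟨⟨y, hy⟩, hxy⟩)
  have hχs : ∀ i, ContDiff ℝ 1 (χ i) := fun i =>
    ((χ i).contMDiff.contDiff).of_le (by exact_mod_cast le_top)
  have hfi : ∀ i : t, ContDiffOn ℝ 1 (fun x => χ i x * f x) M := fun i =>
    (hχs i).contDiffOn.mul hf
  have hi : ∀ i : t,
      ∫ x in M, (inner ℝ (X x) (tgrad M (fun x => χ i x * f x) x) +
        (χ i x * f x) * tdiv M X x) ∂μHE[k] = 0 := by
    intro i
    refine (h i (hKM (htK i i.2))).integral_div_eq_zero hX hXt (hfi i)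
      (K := K ∩ tsupport (χ i)) (hK.inter_right (isClosed_tsupport _))
      (fun x hx => ⟨hKM hx.1, hχ i hx.2⟩) ?_ hMm
    rintro x ⟨hxM, hx⟩
    by_cases hxK : x ∈ K
    · rw [image_eq_zero_of_notMem_tsupport fun hx' => hx ⟨hxK, hx'⟩, zero_mul]
    · rw [hf0 x ⟨hxM, hxK⟩, mul_zero]
  have hM' : IsParametrizable k M := fun x hx => ⟨W x, U x, ψ x, e x, h x hx, hW x hx⟩
  have hint : ∀ i : t, IntegrableOn (fun x => inner ℝ (X x) (tgrad M (fun x => χ i x * f x) x) +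
        (χ i x * f x) * tdiv M X x) M μHE[k] := by
    intro i
    have hz : ∀ x ∈ M \ K, χ i x * f x = 0 := fun x hx => by rw [hf0 x hx, mul_zero]
    refine hM'.integrableOn_of_compact hK hKM
      ((continuousOn_div_integrand hM' hX (hfi i)).mono hKM) fun x hx => ?_
    simp [tgrad_eq_zero_of_compact hK hz hx, hz x hx]
  rw [← Finset.sum_eq_zero (s := Finset.univ) fun i _ => hi i, ← integral_finsetSum _ fun i _ => hint i]
  refine setIntegral_congr_fun hMm fun x hx => ?_
  have hd : ∀ {g : Euc n → ℝ}, ContDiffOn ℝ 1 g M → DifferentiableWithinAt ℝ g M x :=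
    fun hg => (hg.differentiableOn (by simp)) x hx
  have hsum : ∀ s : Finset t, tgrad M (fun x => (∑ i ∈ s, χ i x) * f x) x =
      ∑ i ∈ s, tgrad M (fun x => χ i x * f x) x := by
    intro s
    induction s using Finset.induction_on with
    | empty =>
      simp only [Finset.sum_empty, zero_mul]
      rw [tgrad]; simp
    | insert i s his ih =>
      rw [Finset.sum_insert his, ← ih, ← tgrad_add (hd (hfi i))
        (hd ((ContDiff.sum fun i _ => hχs i).contDiffOn.mul hf))]
      simp only [Finset.sum_insert his, add_mul]
  -- The cutoffs sum to `1` only on `K`; this is enough because `f` vanishes on `M` outside `K`.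
  have hone : ∀ z ∈ M, (∑ i, χ i z) * f z = f z := by
    intro z hz
    by_cases hzK : z ∈ K
    · have := χ.sum_eq_one hzK
      rw [finsum_eq_sum_of_fintype] at this
      rw [this, one_mul]
    · rw [hf0 z ⟨hz, hzK⟩, mul_zero]
  have h1 : tgrad M f x = ∑ i, tgrad M (fun x => χ i x * f x) x := by
    rw [← hsum]
    refine tgrad_congr ?_ (hone x hx).symm
    filter_upwards [self_mem_nhdsWithin] with z hz using (hone z hz).symm
  rw [Finset.sum_add_distrib, ← inner_sum, ← h1, ← Finset.sum_mul, ← Finset.sum_mul, hone x hx]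

end Divergence

/-- Invariance under positive dilations. -/
def IsCone {n : ℕ} (M : Set (Euc n)) : Prop := ∀ x ∈ M, ∀ l : ℝ, 0 < l → l • x ∈ M

/-! ### Dilations and the geometry of a smooth cone. -/

section Cone

variable {n k : ℕ} {M : Set (Euc n)} (hc : IsCone M)

include hc

theorem IsCone.self_mem_tangentSpaceAt {x : Euc n} (hx : x ∈ M) : x ∈ tangentSpaceAt M x := by
  have h1 : HasFDerivWithinAt (fun s : ℝ => s • x) ((1 : ℝ →L[ℝ] ℝ).smulRight x) (Ioi 0) 1 :=
    ((hasDerivAt_id (1 : ℝ)).smul_const x).hasFDerivAt.hasFDerivWithinAt.congr_fderiv (by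
      ext; simp)
  have h2 := h1.mapsTo_tangent_cone (x := 1) (show (1 : ℝ) ∈ tangentConeAt ℝ (Ioi 0) (1 : ℝ) by
    rw [tangentConeAt_of_mem_nhds (Ioi_mem_nhds one_pos)]; trivial)
  refine Submodule.subset_span ?_
  have h3 : (fun s : ℝ => s • x) '' Ioi 0 ⊆ M := by
    rintro _ ⟨s, hs, rfl⟩; exact hc x hx s hs
  have h4 := tangentConeAt_mono h3 h2
  simpa using h4

theorem IsCone.tangentSpaceAt_le {x : Euc n} {l : ℝ} (hl : 0 < l) :
    tangentSpaceAt M x ≤ tangentSpaceAt M (l • x) := by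
  refine Submodule.span_le.2 fun w hw => ?_
  have h1 : HasFDerivWithinAt (fun z : Euc n => l • z) (l • ContinuousLinearMap.id ℝ (Euc n)) M x :=
    ((hasFDerivAt_id x).const_smul l).hasFDerivWithinAt
  have h2 := h1.mapsTo_tangent_cone hw
  have h3 : (fun z : Euc n => l • z) '' M ⊆ M := by
    rintro _ ⟨s, hs, rfl⟩; exact hc s hs l hl
  have h4 : l • w ∈ tangentSpaceAt M (l • x) := Submodule.subset_span (tangentConeAt_mono h3 h2)
  have h5 := Submodule.smul_mem _ l⁻¹ h4
  rwa [inv_smul_smul₀ hl.ne'] at h5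

theorem IsCone.tangentSpaceAt_smul {x : Euc n} {l : ℝ} (hl : 0 < l) :
    tangentSpaceAt M (l • x) = tangentSpaceAt M x := by
  refine le_antisymm ?_ (hc.tangentSpaceAt_le hl)
  have := hc.tangentSpaceAt_le (x := l • x) (inv_pos.2 hl)
  rwa [inv_smul_smul₀ hl.ne'] at this

theorem IsCone.tgrad_comp_smul {f : Euc n → ℝ} {x : Euc n} {l : ℝ} (hl : 0 < l)
    (hf : DifferentiableWithinAt ℝ f M (l • x)) :
    tgrad M (fun y => f (l • y)) x = l • tgrad M f (l • x) := by
  have h1 : HasFDerivWithinAt (fun z : Euc n => l • z) (l • ContinuousLinearMap.id ℝ (Euc n)) M x :=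
    ((hasFDerivAt_id x).const_smul l).hasFDerivWithinAt
  have h2 : HasFDerivWithinAt (fun y => f (l • y)) _ M x :=
    hf.hasFDerivWithinAt.comp x h1 fun z hz => hc z hz l hl
  refine eq_tgrad h2 (Submodule.smul_mem _ _ ?_) fun w hw => ?_
  · rw [← hc.tangentSpaceAt_smul hl]; exact tgrad_mem _ _ _
  · rw [inner_smul_left, inner_tgrad hf.hasFDerivWithinAt (by rwa [hc.tangentSpaceAt_smul hl])]
    simp

theorem IsCone.hasDerivAt_ray {f : Euc n → ℝ} {x : Euc n} {r : ℝ} (hr : 0 < r) (hx : x ∈ M)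
    (hf : DifferentiableWithinAt ℝ f M (r • x)) :
    HasDerivAt (fun s => f (s • x)) (inner ℝ (tgrad M f (r • x)) x) r := by
  have h1 : HasDerivWithinAt (fun s : ℝ => s • x) x (Ioi 0) r := by
    simpa using ((hasDerivAt_id r).smul_const x).hasDerivWithinAt
  have h2 : HasDerivWithinAt (fun s => f (s • x)) _ (Ioi 0) r :=
    hf.hasFDerivWithinAt.comp_hasDerivWithinAt r h1 fun s hs => hc x hx s hs
  have h3 := h2.hasDerivAt (Ioi_mem_nhds hr)
  rwa [inner_tgrad hf.hasFDerivWithinAt]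
  rw [hc.tangentSpaceAt_smul hr]
  exact hc.self_mem_tangentSpaceAt hx

omit hc in
theorem radialDeriv_smul {f : Euc n → ℝ} {x : Euc n} {r : ℝ} (hr : 0 < r) (hx : ‖x‖ = 1) :
    radialDeriv M f (r • x) = inner ℝ (tgrad M f (r • x)) x := by
  rw [radialDeriv, norm_smul, hx, mul_one, Real.norm_of_nonneg hr.le, inv_smul_smul₀ hr.ne']

end Cone

/-! ### The link of a cone as a submanifold of one dimension less. -/

section Link

variable {n m : ℕ} {M W : Set (Euc n)} {U : Set (Euc (m + 1))} {ψ : Euc (m + 1) → Euc n}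
  {e : Euc n → Euc (m + 1)}

/-- The link of a cone: its intersection with the unit sphere. -/
def link (M : Set (Euc n)) : Set (Euc n) := M ∩ Metric.sphere 0 1

theorem norm_of_mem_link {x : Euc n} (hx : x ∈ link M) : ‖x‖ = 1 := by simpa using hx.2

/-- The inverse function theorem, with the source shrunk to points of invertible derivative so that
the inverse is smooth on an entire open set and not merely at the image of `p`. -/
theorem exists_contDiffOn_inverse {E F : Type*} [NormedAddCommGroup E] [NormedSpace ℝ E]
    [FiniteDimensional ℝ E] [NormedAddCommGroup F] [NormedSpace ℝ F] [FiniteDimensional ℝ F]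
    (hdim : Module.finrank ℝ E = Module.finrank ℝ F) {Φ : E → F} {D : Set E} (hDo : IsOpen D)
    (hΦc : ContDiffOn ℝ ∞ Φ D) {p : E} (hp : p ∈ D) {L : E →L[ℝ] F} (hL : HasFDerivAt Φ L p)
    (hLinj : Function.Injective L) :
    ∃ (S : Set E) (T : Set F) (g : F → E), IsOpen S ∧ IsOpen T ∧ p ∈ S ∧ S ⊆ D ∧
      ContDiffOn ℝ ∞ g T ∧ (∀ q ∈ S, Φ q ∈ T ∧ g (Φ q) = q) ∧ ∀ z ∈ T, g z ∈ S ∧ Φ (g z) = z := by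
  have hE : CompleteSpace E := FiniteDimensional.complete ℝ E
  set Le : E ≃L[ℝ] F := (LinearEquiv.ofInjectiveOfFinrankEq (L : E →ₗ[ℝ] F) hLinj
      hdim).toContinuousLinearEquiv with hLe
  have hLeL : (Le : E →L[ℝ] F) = L := ContinuousLinearMap.ext fun p => rfl
  have hΦa : ContDiffAt ℝ ∞ Φ p := hΦc.contDiffAt (hDo.mem_nhds hp)
  have hn0 : (∞ : WithTop ℕ∞) ≠ 0 := by simp
  have hLd' : HasFDerivAt Φ (Le : E →L[ℝ] F) p := by rwa [hLeL]
  set f := hΦa.toOpenPartialHomeomorph Φ hLd' hn0 with hf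
  have hfΦ : ∀ p, f p = Φ p := fun p => rfl
  have hfd : ContinuousOn (fderiv ℝ Φ) D := hΦc.continuousOn_fderiv_of_isOpen hDo (by simp)
  -- Invertible operators form an open set and the derivative is continuous on `D`, so invertibility
  -- persists near `p`.
  set S : Set E := f.source ∩ (D ∩ fderiv ℝ Φ ⁻¹' range ((↑) : (E ≃L[ℝ] F) → (E →L[ℝ] F))) with hS
  have hSo : IsOpen S :=
    f.open_source.inter (hfd.isOpen_inter_preimage hDo ContinuousLinearEquiv.isOpen)
  have h0S : p ∈ S :=
    ⟨ContDiffAt.mem_toOpenPartialHomeomorph_source hΦa hLd' hn0, hp, Le, hLd'.fderiv.symm⟩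
  set T : Set F := f.target ∩ f.symm ⁻¹' S with hT
  have hTo : IsOpen T := f.symm.isOpen_inter_preimage hSo
  refine ⟨S, T, f.symm, hSo, hTo, h0S, fun q hq => hq.2.1, ?_, fun q hq => ?_, fun z hz =>
    ⟨hz.2, f.right_inv hz.1⟩⟩
  · rintro z ⟨hz1, hz2⟩
    obtain ⟨A, hA⟩ := hz2.2.2
    refine (f.contDiffAt_symm (f₀' := A) hz1 ?_ ?_).contDiffWithinAt
    · rw [hA]
      exact ((hΦc.contDiffAt (hDo.mem_nhds hz2.2.1)).differentiableAt (by simp)).hasFDerivAt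
    · exact hΦc.contDiffAt (hDo.mem_nhds hz2.2.1)
  · refine ⟨⟨f.map_source hq.1, ?_⟩, f.left_inv hq.1⟩
    rw [mem_preimage, ← hfΦ, f.left_inv hq.1]; exact hq

theorem IsParam.fderiv_inv_self (h : IsParam M W U ψ e) (hc : IsCone M) {x : Euc n}
    (hx : x ∈ M) (hxW : x ∈ W) : fderiv ℝ ψ (e x) (fderiv ℝ e x x) = x := by
  have hU := h.inv_mem x ⟨hx, hxW⟩
  have hψ := h.right_inv x ⟨hx, hxW⟩
  have h1 := hc.self_mem_tangentSpaceAt hx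
  conv at h1 => rw [← hψ, h.tangentSpaceAt_eq hU]
  obtain ⟨v, hv⟩ := h1
  rw [ContinuousLinearMap.coe_coe, hψ] at hv
  have h2 := h.fderiv_inv_apply hU v
  rw [hv, hψ] at h2
  rw [h2, hv]

theorem injective_smulRight_add {G F : Type*} [NormedAddCommGroup G] [NormedSpace ℝ G]
    [NormedAddCommGroup F] [InnerProductSpace ℝ F] {z : F} (hz : z ≠ 0) {ι : G →L[ℝ] F}
    (hι : ∀ v, ι v ∈ (ℝ ∙ z)ᗮ) (hιi : ∀ v, ι v = 0 → v = 0) : Function.Injective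
      ((ContinuousLinearMap.fst ℝ ℝ G).smulRight z + ι ∘L ContinuousLinearMap.snd ℝ ℝ G) := by
  rw [injective_iff_map_eq_zero]
  rintro ⟨s, v⟩ hsv
  have h1 : s • z + ι v = 0 := by simpa using hsv
  have h2 : inner ℝ z (ι v) = 0 := (Submodule.mem_orthogonal_singleton_iff_inner_right).1 (hι v)
  have h3 : inner ℝ z (s • z + ι v) = 0 := by rw [h1, inner_zero_right]
  rw [inner_add_right, h2, inner_smul_right, add_zero, real_inner_self_eq_norm_sq] at h3
  have h4 : s = 0 := by
    rcases mul_eq_zero.1 h3 with h | h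
    · exact h
    · exact absurd (by simpa using h) hz
  rw [h4, zero_smul, zero_add] at h1
  rw [h4, hιi v h1]; rfl

theorem hasFDerivAt_comp_smul {G E F : Type*} [NormedAddCommGroup G] [NormedSpace ℝ G]
    [NormedAddCommGroup E] [NormedSpace ℝ E] [NormedAddCommGroup F] [NormedSpace ℝ F] {g : G → E}
    {g' : G →L[ℝ] E} {e : E → F} {e' : E →L[ℝ] F} {x : E} {v : G} (hg : HasFDerivAt g g' v)
    (hx : g v = x) (he : HasFDerivAt e e' x) :
    HasFDerivAt (fun p : ℝ × G => e (p.1 • g p.2))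
      ((ContinuousLinearMap.fst ℝ ℝ G).smulRight (e' x) +
        (e' ∘L g') ∘L ContinuousLinearMap.snd ℝ ℝ G) ((1 : ℝ), v) := by
  have hgs : HasFDerivAt (fun p : ℝ × G => g p.2) (g' ∘L ContinuousLinearMap.snd ℝ ℝ G)
      ((1 : ℝ), v) := HasFDerivAt.comp (g := g) ((1 : ℝ), v) hg hasFDerivAt_snd
  have h1 : HasFDerivAt (fun p : ℝ × G => p.1 • g p.2) _ ((1 : ℝ), v) :=
    hasFDerivAt_fst.fun_smul hgs
  have h2 : HasFDerivAt e e' (((1 : ℝ), v).1 • g ((1 : ℝ), v).2) := by simpa [hx] using he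
  refine (h2.comp ((1 : ℝ), v) h1).congr_fderiv ?_
  refine ContinuousLinearMap.ext fun p => ?_
  simp [hx, add_comm]

/-- In parameter space, the hyperplane through `e x` orthogonal to the coordinates `z₀` of the
radial direction gives a slice of the cone transverse to the rays. By the inverse function theorem,
radius times slice is a local coordinate system of the cone, and normalizing the slice to length one
parametrizes the link. -/
theorem IsParam.exists_isParam_link (h : IsParam M W U ψ e) (hc : IsCone M) {x : Euc n}
    (hx : x ∈ link M) (hxW : x ∈ W) :
    ∃ (W' : Set (Euc n)) (U' : Set (Euc m)) (γ : Euc m → Euc n) (e' : Euc n → Euc m),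
      IsParam (link M) W' U' γ e' ∧ x ∈ W' := by
  have hx1 := norm_of_mem_link hx
  set y₀ := e x with hy₀
  have hy₀U : y₀ ∈ U := h.inv_mem x ⟨hx.1, hxW⟩
  have hψy₀ : ψ y₀ = x := h.right_inv x ⟨hx.1, hxW⟩
  set z₀ := fderiv ℝ e x x with hz₀
  have hDz : fderiv ℝ ψ y₀ z₀ = x := h.fderiv_inv_self hc hx.1 hxW
  have hz₀0 : z₀ ≠ 0 := by
    intro h0
    rw [h0, map_zero] at hDz
    rw [← hDz, norm_zero] at hx1
    exact zero_ne_one hx1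
  have hfin : Fact (Module.finrank ℝ (Euc (m + 1)) = m + 1) := ⟨by simp⟩
  set V := (ℝ ∙ z₀)ᗮ with hV
  have hVd : Module.finrank ℝ V = m := Submodule.finrank_orthogonal_span_singleton hz₀0
  set ι : Euc m ≃ₗᵢ[ℝ] V := ((stdOrthonormalBasis ℝ V).reindex (finCongr hVd)).repr.symm with hι
  set ιL : Euc m →L[ℝ] Euc (m + 1) := V.subtypeL ∘L (ι : Euc m →L[ℝ] V) with hιL
  have hιV : ∀ v, ιL v ∈ V := fun v => (ι v).2
  have hιinj : ∀ v, ιL v = 0 → v = 0 := fun v hv => by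
    have : ι v = 0 := Subtype.ext hv
    exact (map_eq_zero_iff ι ι.injective).1 this
  set g : Euc m → Euc n := fun y => ψ (y₀ + ιL y) with hg
  have haff : ContDiff ℝ ∞ (fun y : Euc m => y₀ + ιL y) := contDiff_const.add ιL.contDiff
  set D1 : Set (Euc m) := (fun y => y₀ + ιL y) ⁻¹' U with hD1
  have hD1o : IsOpen D1 := h.isOpen_source.preimage haff.continuous
  have hgc : ContDiffOn ℝ ∞ g D1 := h.contDiffOn.comp haff.contDiffOn fun y hy => hy
  set Θ : ℝ × Euc m → Euc n := fun p => p.1 • g p.2 with hΘ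
  have hΘc : ContDiffOn ℝ ∞ Θ (Ioi (0 : ℝ) ×ˢ D1) :=
    contDiff_fst.contDiffOn.smul (hgc.comp contDiff_snd.contDiffOn fun p hp => hp.2)
  set D : Set (ℝ × Euc m) := (Ioi (0 : ℝ) ×ˢ D1) ∩ Θ ⁻¹' W with hD
  have hDo : IsOpen D :=
    hΘc.continuousOn.isOpen_inter_preimage (isOpen_Ioi.prod hD1o) h.isOpen_target
  set Φ : ℝ × Euc m → Euc (m + 1) := fun p => e (Θ p) with hΦ
  have hΦc : ContDiffOn ℝ ∞ Φ D := h.contDiffOn_inv.comp (hΘc.mono inter_subset_left)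
    fun p hp => hp.2
  have hg0 : g 0 = x := by simp [hg, hψy₀]
  have h0D : ((1 : ℝ), (0 : Euc m)) ∈ D := by
    refine ⟨⟨show (0 : ℝ) < 1 from one_pos, ?_⟩, ?_⟩
    · simp [hD1, hy₀U]
    · simp [hΘ, hg0, hxW]
  set L : ℝ × Euc m →L[ℝ] Euc (m + 1) :=
    ((ContinuousLinearMap.fst ℝ ℝ (Euc m)).smulRight z₀) +
      ιL ∘L ContinuousLinearMap.snd ℝ ℝ (Euc m) with hL
  have hLd : HasFDerivAt Φ L (1, 0) := by
    have hgd : HasFDerivAt g (fderiv ℝ ψ y₀ ∘L ιL) 0 := by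
      have h1 : HasFDerivAt (fun y : Euc m => y₀ + ιL y) ιL 0 := ιL.hasFDerivAt.const_add y₀
      exact HasFDerivAt.comp (g := ψ) 0 (by simpa using h.hasFDerivAt hy₀U) h1
    have h2 : fderiv ℝ e x ∘L (fderiv ℝ ψ y₀ ∘L ιL) = ιL := by
      have h3 := h.fderiv_inv_comp hy₀U
      rw [hψy₀] at h3
      rw [← ContinuousLinearMap.comp_assoc, h3, ContinuousLinearMap.id_comp]
    have h1 := hasFDerivAt_comp_smul hgd hg0 (h.hasFDerivAt_inv hxW)
    rw [h2] at h1
    exact h1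
  have hdim : Module.finrank ℝ (ℝ × Euc m) = Module.finrank ℝ (Euc (m + 1)) := by
    simp [add_comm]
  obtain ⟨S, T, f, hSo, hTo, h0S, hSD, hfc, hST, hTS⟩ := exists_contDiffOn_inverse hdim hDo hΦc h0D
    hLd (injective_smulRight_add hz₀0 hιV hιinj)
  set D2 : Set (Euc m) := D1 ∩ g ⁻¹' {0}ᶜ with hD2
  have hD2o : IsOpen D2 :=
    hgc.continuousOn.isOpen_inter_preimage hD1o isOpen_compl_singleton
  have hnc : ContDiffOn ℝ ∞ (fun y => ‖g y‖⁻¹) D2 :=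
    ((hgc.mono inter_subset_left).norm ℝ fun y hy => hy.2).inv fun y hy => norm_ne_zero_iff.2 hy.2
  set U' : Set (Euc m) := D2 ∩ (fun y => (‖g y‖⁻¹, y)) ⁻¹' S with hU'
  have hU'o : IsOpen U' :=
    (hnc.continuousOn.prodMk continuousOn_id).isOpen_inter_preimage hD2o hSo
  -- A point of the link in these coordinates is `s • g y`, and unit length forces `s = ‖g y‖⁻¹`.
  have key : ∀ z ∈ link M ∩ (W ∩ e ⁻¹' T), (f (e z)).2 ∈ U' ∧
      ‖g (f (e z)).2‖⁻¹ • g (f (e z)).2 = z := by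
    rintro z ⟨hz, hzW, hzT⟩
    set p := f (e z) with hp
    have hpS : p ∈ S := (hTS _ hzT).1
    have h1 : e (Θ p) = e z := (hTS _ hzT).2
    have hpr : 0 < p.1 := (hSD hpS).1.1
    have hΘM : Θ p ∈ M ∩ W := ⟨hc _ (h.mapsTo _ (hSD hpS).1.2).1 _ hpr, (hSD hpS).2⟩
    have h2 : Θ p = z := by
      rw [← h.right_inv _ hΘM, h1, h.right_inv z ⟨hz.1, hzW⟩]
    have h3 : p.1 * ‖g p.2‖ = 1 := by
      rw [← norm_of_mem_link hz, ← h2]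
      simp [hΘ, norm_smul, abs_of_pos hpr]
    have h4 : g p.2 ≠ 0 := by
      intro h0; rw [h0, norm_zero, mul_zero] at h3; exact zero_ne_one h3
    have h5 : ‖g p.2‖⁻¹ = p.1 := by
      rw [inv_eq_one_div, div_eq_iff (norm_ne_zero_iff.2 h4), h3]
    refine ⟨⟨⟨(hSD hpS).1.2, h4⟩, ?_⟩, ?_⟩
    · rw [mem_preimage, h5]; exact hpS
    · rw [h5]; exact h2
  refine ⟨W ∩ e ⁻¹' T, U', fun y => ‖g y‖⁻¹ • g y, fun z => (f (e z)).2, ⟨?_, hU'o, ?_, ?_, ?_,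
    ?_, ?_, ?_⟩, hxW, ?_⟩
  · exact h.contDiffOn_inv.continuousOn.isOpen_inter_preimage h.isOpen_target hTo
  · exact (hnc.mono inter_subset_left).smul (hgc.mono fun y hy => hy.1.1)
  · exact contDiff_snd.comp_contDiffOn
      (hfc.comp (h.contDiffOn_inv.mono inter_subset_left) fun z hz => hz.2)
  · intro y hy
    have hgy : 0 < ‖g y‖ := norm_pos_iff.2 hy.1.2
    refine ⟨⟨hc _ (h.mapsTo _ hy.1.1).1 _ (inv_pos.2 hgy), ?_⟩, (hSD hy.2).2, (hST _ hy.2).1⟩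
    rw [mem_sphere_zero_iff_norm, norm_smul, norm_inv, norm_norm, inv_mul_cancel₀ hgy.ne']
  · exact fun z hz => (key z hz).1
  · exact fun z hz => (key z hz).2
  · intro y hy
    have hgy : 0 < ‖g y‖ := norm_pos_iff.2 hy.1.2
    change (f (Φ (‖g y‖⁻¹, y))).2 = y
    rw [(hST _ hy.2).2]
  · have h1 : Φ (1, 0) = y₀ := by simp [hΦ, hΘ, hg0, hy₀]
    rw [mem_preimage, ← hy₀, ← h1]
    exact (hST _ h0S).1

theorem IsParametrizable.isParametrizable_link (hM : IsParametrizable (m + 1) M) (hc : IsCone M) :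
    IsParametrizable m (link M) := fun x hx => by
  obtain ⟨W, U, ψ, e, h, hxW⟩ := hM x hx.1
  exact h.exists_isParam_link hc hx hxW

end Link

/-! ### Polar coordinates on a cone. -/

section PolarChart

variable {n m : ℕ}

/-- Splitting off the first coordinate of a Euclidean space. -/
noncomputable def headTail (m : ℕ) : Euc (m + 1) ≃ᵐ ℝ × Euc m :=
  ((MeasurableEquiv.toLp 2 (Fin (m + 1) → ℝ)).symm.trans
    (MeasurableEquiv.piFinSuccAbove (fun _ => ℝ) 0)).trans
      ((MeasurableEquiv.refl ℝ).prodCongr (MeasurableEquiv.toLp 2 (Fin m → ℝ)))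

theorem headTail_fst (z : Euc (m + 1)) : (headTail m z).1 = z 0 := rfl

theorem headTail_snd (z : Euc (m + 1)) (i : Fin m) : (headTail m z).2 i = z i.succ := rfl

theorem measurePreserving_headTail : MeasurePreserving (headTail m) := by
  have h1 : MeasurePreserving (MeasurableEquiv.toLp 2 (Fin (m + 1) → ℝ)).symm :=
    PiLp.volume_preserving_ofLp (Fin (m + 1))
  have h2 := volume_preserving_piFinSuccAbove (fun _ : Fin (m + 1) => ℝ) 0
  have h3 : MeasurePreserving (MeasurableEquiv.toLp 2 (Fin m → ℝ)) := PiLp.volume_preserving_toLp (Fin m)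
  exact ((MeasurePreserving.id (volume : Measure ℝ)).prod h3).comp (h2.comp h1)

/-- The projection of a Euclidean space on its last coordinates. -/
noncomputable def tailL (m : ℕ) : Euc (m + 1) →L[ℝ] Euc m :=
  LinearMap.toContinuousLinearMap
    { toFun := fun z => (headTail m z).2
      map_add' := fun _ _ => rfl
      map_smul' := fun _ _ => rfl }

theorem tailL_apply (z : Euc (m + 1)) : tailL m z = (headTail m z).2 := rfl

theorem tailL_single_zero : tailL m (EuclideanSpace.single 0 1) = 0 := by
  ext i; simp [tailL_apply, headTail_snd]

theorem tailL_single_succ (i : Fin m) :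
    tailL m (EuclideanSpace.single i.succ 1) = EuclideanSpace.single i 1 := by
  ext j; simp [tailL_apply, headTail_snd]

/-- The parametrization of a cone by radius and a parametrization of the link. -/
noncomputable def polarMap (γ : Euc m → Euc n) (z : Euc (m + 1)) : Euc n := z 0 • γ (tailL m z)

variable {M W : Set (Euc n)} {U : Set (Euc m)} {γ : Euc m → Euc n} {e : Euc n → Euc m}

/-- The domain of the parametrization of a cone by radius and a parametrization of the link. -/
def polarDomain (U : Set (Euc m)) : Set (Euc (m + 1)) := {z | 0 < z 0 ∧ tailL m z ∈ U}

theorem isOpen_polarDomain (hU : IsOpen U) : IsOpen (polarDomain U) := by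
  have h1 : Continuous fun z : Euc (m + 1) => z 0 := (EuclideanSpace.proj 0 : Euc (m + 1) →L[ℝ] ℝ).continuous
  exact (isOpen_lt continuous_const h1).inter (hU.preimage (tailL m).continuous)

theorem hasFDerivAt_polarMap (hγ : ContDiffOn ℝ 1 γ U) (hU : IsOpen U) {z : Euc (m + 1)}
    (hz : tailL m z ∈ U) :
    HasFDerivAt (polarMap γ) (z 0 • (fderiv ℝ γ (tailL m z) ∘L tailL m) +
      (EuclideanSpace.proj 0 : Euc (m + 1) →L[ℝ] ℝ).smulRight (γ (tailL m z))) z := by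
  have h1 : HasFDerivAt γ (fderiv ℝ γ (tailL m z)) (tailL m z) :=
    ((hγ.contDiffAt (hU.mem_nhds hz)).differentiableAt (by simp)).hasFDerivAt
  have h2 := h1.comp z (tailL m).hasFDerivAt
  have h3 : HasFDerivAt (fun z : Euc (m + 1) => z 0) (EuclideanSpace.proj 0 : Euc (m + 1) →L[ℝ] ℝ) z :=
    (EuclideanSpace.proj 0 : Euc (m + 1) →L[ℝ] ℝ).hasFDerivAt
  exact h3.fun_smul h2

theorem contDiffOn_polarMap (hγ : ContDiffOn ℝ 1 γ U) : ContDiffOn ℝ 1 (polarMap γ) (polarDomain U) :=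
  ContDiffOn.smul (EuclideanSpace.proj 0 : Euc (m + 1) →L[ℝ] ℝ).contDiff.contDiffOn
    (hγ.comp (tailL m).contDiff.contDiffOn fun _ hz => hz.2)

variable (hU : IsOpen U) (hγ : ContDiffOn ℝ 1 γ U) (hγ1 : ∀ y ∈ U, ‖γ y‖ = 1)

include hU hγ hγ1 in
theorem inner_fderiv_eq_zero {y : Euc m} (hy : y ∈ U) (v : Euc m) :
    inner ℝ (γ y) (fderiv ℝ γ y v) = 0 := by
  have h1 : HasFDerivAt γ (fderiv ℝ γ y) y :=
    ((hγ.contDiffAt (hU.mem_nhds hy)).differentiableAt (by simp)).hasFDerivAt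
  have h2 : HasFDerivAt (fun y => ‖γ y‖ ^ 2) (0 : Euc m →L[ℝ] ℝ) y := by
    refine (hasFDerivAt_const (1 : ℝ) y).congr_of_eventuallyEq ?_
    filter_upwards [hU.mem_nhds hy] with z hz
    rw [hγ1 z hz, one_pow]
  have h3 := congrArg (fun A : Euc m →L[ℝ] ℝ => A v) (h1.norm_sq.unique h2)
  simpa using h3

include hU hγ hγ1 in
-- The radial direction has length one and is orthogonal to the tangent vectors of the link, which
-- are scaled by the radius. The Gram determinant, expanded along its first row, is therefore that
-- of the link times the radius to the power `2m`.
theorem areaDensity_polarMap {z : Euc (m + 1)} (hz : z ∈ polarDomain U) :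
    areaDensity (polarMap γ) z = z 0 ^ m * areaDensity γ (tailL m z) := by
  have hz0 : 0 < z 0 := hz.1
  have hsq : areaDensity (polarMap γ) z ^ 2 = (z 0 ^ m * areaDensity γ (tailL m z)) ^ 2 := by
    have h1 := (fderiv ℝ (polarMap γ) z : Euc (m + 1) →ₗ[ℝ] Euc n).normDet_sq_eq_det_gram
      (EuclideanSpace.basisFun (Fin (m + 1)) ℝ)
    have h2 := (fderiv ℝ γ (tailL m z) : Euc m →ₗ[ℝ] Euc n).normDet_sq_eq_det_gram
      (EuclideanSpace.basisFun (Fin m) ℝ)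
    simp only [RCLike.ofReal_real_eq_id, id_eq, EuclideanSpace.basisFun_apply,
      ContinuousLinearMap.coe_coe] at h1 h2
    set B := fderiv ℝ (polarMap γ) z with hB
    have hB0 : B (EuclideanSpace.single 0 1) = γ (tailL m z) := by
      rw [hB, (hasFDerivAt_polarMap hγ hU hz.2).fderiv]
      simp [tailL_single_zero]
    have hBs : ∀ i : Fin m, B (EuclideanSpace.single i.succ 1) =
        z 0 • fderiv ℝ γ (tailL m z) (EuclideanSpace.single i 1) := by
      intro i
      have : (0 : Fin (m + 1)) ≠ i.succ := (Fin.succ_ne_zero i).symm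
      rw [hB, (hasFDerivAt_polarMap hγ hU hz.2).fderiv]
      simp [tailL_single_succ, this]
    have h3 : ∀ v, inner ℝ (γ (tailL m z)) (fderiv ℝ γ (tailL m z) v) = 0 :=
      inner_fderiv_eq_zero hU hγ hγ1 hz.2
    rw [mul_pow, areaDensity, areaDensity, h1, h2, Matrix.det_succ_row_zero, Fin.sum_univ_succ,
      Finset.sum_eq_zero, add_zero]
    · have h4 : (Matrix.gram ℝ fun i => B (EuclideanSpace.single i 1)).submatrix Fin.succ
          (Fin.succAbove 0) =
          (z 0 ^ 2) • Matrix.gram ℝ fun i => fderiv ℝ γ (tailL m z) (EuclideanSpace.single i 1) := by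
        ext i j
        simp only [Matrix.gram_apply, Matrix.submatrix_apply, Fin.succAbove_zero, hBs,
          inner_smul_left, inner_smul_right, Matrix.smul_apply, smul_eq_mul, conj_trivial]
        ring
      rw [h4, Matrix.det_smul, Matrix.gram_apply, hB0, real_inner_self_eq_norm_sq, hγ1 _ hz.2]
      simp only [Fin.val_zero, pow_zero, one_pow, one_mul, Fintype.card_fin]
      ring
    · intro i _
      rw [Matrix.gram_apply, hB0, hBs, inner_smul_right, h3]
      ring
  rw [← sq_eq_sq₀ (areaDensity_nonneg _ _)
    (mul_nonneg (pow_nonneg hz0.le _) (areaDensity_nonneg _ _)), hsq]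

theorem image_polarMap (h : IsParam (link M) W U γ e) (hc : IsCone M) :
    polarMap γ '' polarDomain U = {x | x ∈ M \ {0} ∧ ‖x‖⁻¹ • x ∈ W} := by
  have hn : ∀ y ∈ U, ‖γ y‖ = 1 := fun y hy => norm_of_mem_link (h.mapsTo y hy).1
  ext x
  constructor
  · rintro ⟨z, ⟨hz0, hzU⟩, rfl⟩
    have h1 := h.mapsTo _ hzU
    have h2 : ‖z 0 • γ (tailL m z)‖ = z 0 := by
      rw [norm_smul, hn _ hzU, mul_one, Real.norm_of_nonneg hz0.le]
    refine ⟨⟨hc _ h1.1.1 _ hz0, ?_⟩, ?_⟩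
    · rw [polarMap, mem_singleton_iff, ← norm_eq_zero, h2]; exact hz0.ne'
    · rw [polarMap, h2, inv_smul_smul₀ hz0.ne']; exact h1.2
  · rintro ⟨⟨hxM, hx0⟩, hxW⟩
    have hx : 0 < ‖x‖ := norm_pos_iff.2 hx0
    have hl : ‖x‖⁻¹ • x ∈ link M ∩ W := by
      refine ⟨⟨hc x hxM _ (inv_pos.2 hx), ?_⟩, hxW⟩
      rw [mem_sphere_zero_iff_norm, norm_smul, norm_inv, norm_norm, inv_mul_cancel₀ hx.ne']
    set z : Euc (m + 1) := (headTail m).symm (‖x‖, e (‖x‖⁻¹ • x)) with hz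
    have hz1 : headTail m z = (‖x‖, e (‖x‖⁻¹ • x)) := (headTail m).apply_symm_apply _
    have hz2 : z 0 = ‖x‖ := by rw [← headTail_fst, hz1]
    have hz3 : tailL m z = e (‖x‖⁻¹ • x) := by rw [tailL_apply, hz1]
    refine ⟨z, ⟨by rw [hz2]; exact hx, by rw [hz3]; exact h.inv_mem _ hl⟩, ?_⟩
    rw [polarMap, hz2, hz3, h.right_inv _ hl, smul_inv_smul₀ hx.ne']

theorem injOn_polarMap (hinj : InjOn γ U) (hγ1 : ∀ y ∈ U, ‖γ y‖ = 1) :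
    InjOn (polarMap γ) (polarDomain U) := by
  have hn : ∀ z ∈ polarDomain U, ‖polarMap γ z‖ = z 0 := fun z hz => by
    rw [polarMap, norm_smul, hγ1 _ hz.2, mul_one, Real.norm_of_nonneg hz.1.le]
  intro z hz w hw hzw
  have h0 : z 0 = w 0 := by rw [← hn z hz, hzw, hn w hw]
  have h1 : tailL m z = tailL m w := by
    apply hinj hz.2 hw.2
    rw [polarMap, polarMap, h0] at hzw
    exact smul_right_injective _ hw.1.ne' hzw
  exact (headTail m).injective (Prod.ext h0 h1)

include hU hγ hγ1 in
theorem injective_fderiv_polarMap (himm : ∀ y ∈ U, Function.Injective (fderiv ℝ γ y)) :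
    ∀ z ∈ polarDomain U, Function.Injective (fderiv ℝ (polarMap γ) z) := by
  intro z hz
  have h1 : 0 < areaDensity (polarMap γ) z := by
    rw [areaDensity_polarMap hU hγ hγ1 hz]
    exact mul_pos (pow_pos hz.1 _) (ContinuousLinearMap.normDet_pos (himm _ hz.2))
  exact ((LinearMap.normDet_ne_zero_tfae (fderiv ℝ (polarMap γ) z : Euc (m + 1) →ₗ[ℝ] Euc n)).out 0 4).1
    h1.ne'

theorem IsParam.lintegral_polar (h : IsParam (link M) W U γ e) {g : Euc n → ENNReal}
    (hg : Measurable g) :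
    ∫⁻ x in polarMap γ '' polarDomain U, g x ∂μHE[m + 1] =
      ∫⁻ r in Ioi (0 : ℝ), ENNReal.ofReal (r ^ m) *
        ∫⁻ θ in link M ∩ W, g (r • θ) ∂μHE[m] := by
  have hn : ∀ y ∈ U, ‖γ y‖ = 1 := fun y hy => norm_of_mem_link (h.mapsTo y hy).1
  have hγ := h.contDiffOn_one
  have hU := h.isOpen_source
  rw [lintegral_image_areaDensity (isOpen_polarDomain hU) (contDiffOn_polarMap hγ)
    (injOn_polarMap h.injOn hn) (injective_fderiv_polarMap hU hγ hn h.injective_fderiv)]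
  set F : ℝ × Euc m → ENNReal := fun p => ENNReal.ofReal (p.1 ^ m) *
    (ENNReal.ofReal (areaDensity γ p.2) * g (p.1 • γ p.2)) with hF
  have h1 : ∫⁻ z in polarDomain U, ENNReal.ofReal (areaDensity (polarMap γ) z) * g (polarMap γ z) =
      ∫⁻ z in headTail m ⁻¹' (Ioi (0 : ℝ) ×ˢ U), F (headTail m z) := by
    refine setLIntegral_congr_fun (isOpen_polarDomain hU).measurableSet fun z hz => ?_
    rw [areaDensity_polarMap hU hγ hn hz, ENNReal.ofReal_mul (pow_nonneg hz.1.le _), mul_assoc]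
    rfl
  rw [h1, measurePreserving_headTail.setLIntegral_comp_preimage_emb (headTail m).measurableEmbedding,
    Measure.volume_eq_prod, ← Measure.prod_restrict]
  have hγm : AEMeasurable γ (volume.restrict U) :=
    hγ.continuousOn.aemeasurable hU.measurableSet
  have hJm : AEMeasurable (areaDensity γ) (volume.restrict U) :=
    (continuousOn_areaDensity hU hγ).aemeasurable hU.measurableSet
  have hFm : AEMeasurable F ((volume.restrict (Ioi (0 : ℝ))).prod (volume.restrict U)) := by
    have h2 : AEMeasurable (fun p : ℝ × Euc m => γ p.2)
        ((volume.restrict (Ioi (0 : ℝ))).prod (volume.restrict U)) := hγm.comp_snd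
    have h3 : AEMeasurable (fun p : ℝ × Euc m => areaDensity γ p.2)
        ((volume.restrict (Ioi (0 : ℝ))).prod (volume.restrict U)) := hJm.comp_snd
    exact ((measurable_fst.pow_const m).ennreal_ofReal.aemeasurable).mul
      (h3.ennreal_ofReal.mul (hg.comp_aemeasurable (measurable_fst.aemeasurable.smul h2)))
  rw [lintegral_prod _ hFm]
  refine lintegral_congr fun r => ?_
  rw [hF]
  simp only
  rw [lintegral_const_mul' _ _ ENNReal.ofReal_ne_top]
  congr 1
  rw [← h.image_eq, lintegral_image_areaDensity hU hγ h.injOn h.injective_fderiv]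

end PolarChart

section Polar

variable {n m : ℕ} {M : Set (Euc n)}

theorem inv_norm_smul_mem_link (hc : IsCone M) {x : Euc n} (hx : x ∈ M \ {0}) :
    ‖x‖⁻¹ • x ∈ link M := by
  have hx0 : 0 < ‖x‖ := norm_pos_iff.2 hx.2
  refine ⟨hc x hx.1 _ (inv_pos.2 hx0), ?_⟩
  rw [mem_sphere_zero_iff_norm, norm_smul, norm_inv, norm_norm, inv_mul_cancel₀ hx0.ne']

/-- Integration in polar coordinates on a smooth cone. -/
theorem IsParametrizable.lintegral_polar (hM : IsParametrizable (m + 1) M) (hc : IsCone M)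
    {g : Euc n → ENNReal} (hg : Measurable g) :
    ∫⁻ x in M \ {0}, g x ∂μHE[m + 1] =
      ∫⁻ r in Ioi (0 : ℝ), ENNReal.ofReal (r ^ m) * ∫⁻ θ in link M, g (r • θ) ∂μHE[m] := by
  have hl := hM.isParametrizable_link hc
  have hlm := hl.measurableSet
  have hMm := hM.measurableSet
  have hsf := hl.sigmaFinite
  rcases (link M).eq_empty_or_nonempty with he | ⟨θ₀, hθ₀⟩
  · have : M \ {0} = ∅ := by
      rw [eq_empty_iff_forall_notMem]
      intro x hx
      have := inv_norm_smul_mem_link hc hx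
      rw [he] at this; exact this
    simp [this, he]
  choose! W U γ e h hW using hl
  obtain ⟨t, htM, htc, ht⟩ := TopologicalSpace.countable_cover_nhdsWithin (s := link M) (f := W)
    fun x hx => mem_nhdsWithin_of_mem_nhds ((h x hx).isOpen_target.mem_nhds (hW x hx))
  have htne : t.Nonempty := by
    obtain ⟨x, hx, -⟩ := mem_iUnion₂.1 (ht hθ₀); exact ⟨x, hx⟩
  obtain ⟨s, rfl⟩ := htc.exists_eq_range htne
  have hs : ∀ i, s i ∈ link M := fun i => htM ⟨i, rfl⟩
  -- Disjoint measurable pieces of the link, each inside one chart. The cone over a piece is its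
  -- preimage under the radial projection, so the pieces can be summed.
  set D : ℕ → Set (Euc n) := disjointed fun i => W (s i) with hD
  have hDm : ∀ i, MeasurableSet (D i) :=
    MeasurableSet.disjointed fun i => (h _ (hs i)).isOpen_target.measurableSet
  have hDd : Pairwise (Disjoint.onFun D) := disjoint_disjointed _
  have hDW : ∀ i, D i ⊆ W (s i) := fun i => disjointed_subset _ i
  have hDU : link M ⊆ ⋃ i, D i := by
    rw [hD, iUnion_disjointed]
    intro x hx
    obtain ⟨_, ⟨i, rfl⟩, hx'⟩ := mem_iUnion₂.1 (ht hx)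
    exact mem_iUnion.2 ⟨i, hx'⟩
  set N : Euc n → Euc n := fun x => ‖x‖⁻¹ • x with hN
  have hNm : Measurable N := by fun_prop
  have hpiece : ∀ i, ∫⁻ x in (M \ {0}) ∩ N ⁻¹' D i, g x ∂μHE[m + 1] =
      ∫⁻ r in Ioi (0 : ℝ), ENNReal.ofReal (r ^ m) * ∫⁻ θ in link M ∩ D i, g (r • θ) ∂μHE[m] := by
    intro i
    have h1 : (M \ {0}) ∩ N ⁻¹' D i = (polarMap (γ (s i)) '' polarDomain (U (s i))) ∩ N ⁻¹' D i := by
      rw [image_polarMap (h _ (hs i)) hc]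
      ext x
      simp only [mem_inter_iff, mem_ofPred_eq, mem_preimage]
      constructor
      · rintro ⟨h1, h2⟩; exact ⟨⟨h1, hDW i h2⟩, h2⟩
      · rintro ⟨⟨h1, -⟩, h2⟩; exact ⟨h1, h2⟩
    rw [h1, inter_comm, ← setLIntegral_indicator (hNm (hDm i)),
      (h _ (hs i)).lintegral_polar (hg.indicator (hNm (hDm i)))]
    refine setLIntegral_congr_fun measurableSet_Ioi fun r hr => ?_
    simp only
    congr 1
    have h2 : link M ∩ D i = D i ∩ (link M ∩ W (s i)) := by
      ext x
      simp only [mem_inter_iff]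
      constructor
      · rintro ⟨h1, h2⟩; exact ⟨h2, h1, hDW i h2⟩
      · rintro ⟨h1, h2, -⟩; exact ⟨h2, h1⟩
    rw [h2, ← setLIntegral_indicator (hDm i)]
    refine setLIntegral_congr_fun (hlm.inter (h _ (hs i)).isOpen_target.measurableSet) fun θ hθ => ?_
    have h3 : N (r • θ) = θ := by
      rw [hN]
      simp only
      rw [norm_smul, norm_of_mem_link hθ.1, mul_one, Real.norm_of_nonneg (le_of_lt hr),
        inv_smul_smul₀ (ne_of_gt hr)]
    by_cases hθD : θ ∈ D i
    · rw [indicator_of_mem (by rw [mem_preimage, h3]; exact hθD), indicator_of_mem hθD]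
    · rw [indicator_of_notMem (by rw [mem_preimage, h3]; exact hθD), indicator_of_notMem hθD]
  have hU1 : M \ {0} = ⋃ i, (M \ {0}) ∩ N ⁻¹' D i := by
    rw [← inter_iUnion, eq_comm, inter_eq_left]
    intro x hx
    obtain ⟨i, hi⟩ := mem_iUnion.1 (hDU (inv_norm_smul_mem_link hc hx))
    exact mem_iUnion.2 ⟨i, hi⟩
  have hU2 : link M = ⋃ i, link M ∩ D i := by
    rw [← inter_iUnion, eq_comm, inter_eq_left]; exact hDU
  have h2 : ∀ r : ℝ, ∫⁻ θ in link M, g (r • θ) ∂μHE[m] =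
      ∑' i, ∫⁻ θ in link M ∩ D i, g (r • θ) ∂μHE[m] := by
    intro r
    conv_lhs => rw [hU2]
    exact lintegral_iUnion (fun i => hlm.inter (hDm i))
      (fun i j hij => (hDd hij).mono inter_subset_right inter_subset_right) _
  conv_lhs => rw [hU1]
  rw [lintegral_iUnion (fun i => (hMm.diff (measurableSet_singleton 0)).inter (hNm (hDm i)))
    (fun i j hij => ((hDd hij).preimage N).mono inter_subset_right inter_subset_right)]
  simp only [hpiece, h2, ← ENNReal.tsum_mul_left]
  rw [lintegral_tsum]
  intro i
  have h3 : SFinite (μHE[m].restrict (link M ∩ D i)) := by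
    rw [inter_comm, ← Measure.restrict_restrict (hDm i)]; infer_instance
  have h4 : Measurable fun p : ℝ × Euc n => g (p.1 • p.2) := hg.comp (by fun_prop)
  exact ((measurable_id.pow_const m).ennreal_ofReal.mul
    (h4.lintegral_prod_right' (ν := μHE[m].restrict (link M ∩ D i)))).aemeasurable

/-- Polar integration of indicator functions, read as an equality of measures. The vertex is removed
because it may or may not belong to the cone. -/
theorem IsParametrizable.restrict_eq_map (hM : IsParametrizable (m + 1) M) (hc : IsCone M) :
    μHE[m + 1].restrict (M \ {0}) = Measure.map (fun p : ℝ × Euc n => p.1 • p.2)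
      (((volume.restrict (Ioi (0 : ℝ))).withDensity fun r => ENNReal.ofReal (r ^ m)).prod
        (μHE[m].restrict (link M))) := by
  have hsf := (hM.isParametrizable_link hc).sigmaFinite
  have hmul : Measurable fun p : ℝ × Euc n => p.1 • p.2 := by fun_prop
  refine Measure.ext fun A hA => ?_
  have h1 := hM.lintegral_polar hc (g := A.indicator 1) (measurable_one.indicator hA)
  rw [lintegral_indicator_one hA] at h1
  rw [h1, Measure.map_apply hmul hA, Measure.prod_apply (hmul hA),
    lintegral_withDensity_eq_lintegral_mul _ (by fun_prop)
      (measurable_measure_prodMk_left (hmul hA))]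
  refine lintegral_congr fun r => ?_
  simp only [Pi.mul_apply]
  congr 1
  rw [← lintegral_indicator_one (measurable_prodMk_left (hmul hA))]
  rfl

end Polar

/-! ### Dilations of Hausdorff measures. -/

section Scaling

open scoped Pointwise

variable {n d : ℕ} {l : ℝ} (hl : 0 < l)

/-- The dilation by a positive number, as a measurable equivalence. -/
noncomputable def dilation (n : ℕ) (l : ℝ) (hl : 0 < l) : Euc n ≃ᵐ Euc n :=
  (Homeomorph.smulOfNeZero l hl.ne').toMeasurableEquiv

theorem dilation_apply (x : Euc n) : dilation n l hl x = l • x := rfl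

theorem map_dilation : Measure.map (dilation n l hl) μHE[d] =
    (ENNReal.ofReal (l ^ d))⁻¹ • (μHE[d] : Measure (Euc n)) := by
  refine Measure.ext fun s hs => ?_
  have h1 : dilation n l hl ⁻¹' s = l⁻¹ • s := by
    ext x
    rw [mem_preimage, dilation_apply, Set.mem_inv_smul_set_iff₀ hl.ne']
  rw [(dilation n l hl).map_apply, h1, Measure.euclideanHausdorffMeasure_smul₀ d (inv_ne_zero hl.ne'),
    Measure.smul_apply, ENNReal.smul_def, smul_eq_mul, smul_eq_mul]
  congr 1
  rw [← ENNReal.ofReal_inv_of_pos (pow_pos hl d), ENNReal.ofReal, ← inv_pow]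
  congr 1
  ext
  rw [Real.coe_toNNReal _ (by positivity)]
  simp [abs_of_pos hl]

theorem restrict_image_dilation (A : Set (Euc n)) :
    Measure.map (dilation n l hl) (μHE[d].restrict A) =
      (ENNReal.ofReal (l ^ d))⁻¹ • μHE[d].restrict ((fun x => l • x) '' A) := by
  have h1 := (dilation n l hl).restrict_map (μHE[d] : Measure (Euc n)) ((fun x => l • x) '' A)
  have h2 : dilation n l hl ⁻¹' ((fun x => l • x) '' A) = A :=
    preimage_image_eq A (dilation n l hl).injective
  rw [h2, map_dilation hl, Measure.restrict_smul] at h1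
  exact h1.symm

include hl in
theorem setIntegral_image_dilation (A : Set (Euc n)) (g : Euc n → ℝ) :
    ∫ x in (fun x => l • x) '' A, g x ∂μHE[d] = l ^ d * ∫ x in A, g (l • x) ∂μHE[d] := by
  have h1 := (dilation n l hl).measurableEmbedding.integral_map (μ := μHE[d].restrict A) g
  rw [restrict_image_dilation hl, integral_smul_measure] at h1
  simp only [dilation_apply, ENNReal.toReal_inv] at h1
  rw [← h1, ENNReal.toReal_ofReal (by positivity), smul_eq_mul,
    mul_inv_cancel_left₀ (by positivity)]

include hl in
theorem integrableOn_image_dilation {A : Set (Euc n)} {g : Euc n → ℝ} :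
    IntegrableOn g ((fun x => l • x) '' A) μHE[d] ↔ IntegrableOn (fun x => g (l • x)) A μHE[d] := by
  have h1 := (dilation n l hl).measurableEmbedding.integrable_map_iff (μ := μHE[d].restrict A) (g := g)
  rw [restrict_image_dilation hl, integrable_smul_measure (by simp) (by simp; positivity)] at h1
  exact h1

end Scaling

/-- Hypotheses on a smooth cone `M` of dimension `m + 1`, a homogeneous weight `ρ` and a
homogeneous potential `q = div X + q̄` with `|X|² + |q̄| ≤ P`. -/
structure ConeData {n : ℕ} (m : ℕ) (M : Set (Euc n)) (ρ : Euc n → ℝ) (p : ℝ) (q : Euc n → ℝ)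
    (X : Euc n → Euc n) (qbar P : Euc n → ℝ) : Prop where
  param : IsParametrizable (m + 1) M
  cone : IsCone M
  rho_smooth : ContDiffOn ℝ ∞ ρ M
  rho_pos : ∀ x ∈ M, 0 < ρ x
  rho_hom : ∀ x ∈ M, ∀ l : ℝ, 0 < l → ρ (l • x) = l ^ p * ρ x
  q_smooth : ContDiffOn ℝ ∞ q M
  q_hom : ∀ x ∈ M, ∀ l : ℝ, 0 < l → q (l • x) = (l ^ 2)⁻¹ * q x
  X_smooth : ContDiffOn ℝ 1 X M
  X_tan : ∀ x ∈ M, X x ∈ tangentSpaceAt M x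
  q_eq : ∀ x ∈ M, q x = tdiv M X x + qbar x
  P_pos : ∀ x ∈ M, 0 < P x
  X_le : ∀ x ∈ M, ‖X x‖ ^ 2 + |qbar x| ≤ P x

/-- The measure `ρ μ` on `M`. -/
noncomputable def weightMeasure {n : ℕ} (k : ℕ) (M : Set (Euc n)) (ρ : Euc n → ℝ) :
    Measure (Euc n) :=
  (μHE[k].restrict M).withDensity fun x => ENNReal.ofReal (ρ x)

/-! ### The weighted measure `ρ μ`. -/

section WeightMeasure

variable {n k : ℕ} {M : Set (Euc n)} {ρ : Euc n → ℝ}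

theorem weightMeasure_absolutelyContinuous : weightMeasure k M ρ ≪ μHE[k].restrict M :=
  withDensity_absolutelyContinuous _ _

theorem ae_mem_weightMeasure (hM : MeasurableSet M) : ∀ᵐ x ∂(weightMeasure k M ρ), x ∈ M :=
  weightMeasure_absolutelyContinuous.ae_le (ae_restrict_mem hM)

theorem restrict_weightMeasure {A : Set (Euc n)} (hA : MeasurableSet A) :
    (weightMeasure k M ρ).restrict A = weightMeasure k (M ∩ A) ρ := by
  rw [weightMeasure, restrict_withDensity hA, Measure.restrict_restrict hA, inter_comm, weightMeasure]

variable (hM : MeasurableSet M) (hρ : ContinuousOn ρ M) (hρ0 : ∀ x ∈ M, 0 ≤ ρ x)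

include hM hρ hρ0

theorem integral_weightMeasure (f : Euc n → ℝ) :
    ∫ x, f x ∂(weightMeasure k M ρ) = ∫ x in M, f x * ρ x ∂μHE[k] := by
  have hm : AEMeasurable (fun x => ENNReal.ofReal (ρ x)) (μHE[k].restrict M) :=
    (hρ.aemeasurable hM).ennreal_ofReal
  rw [weightMeasure, integral_withDensity_eq_integral_toReal_smul₀ hm (ae_of_all _ fun _ =>
    ENNReal.ofReal_lt_top)]
  refine setIntegral_congr_fun hM fun x hx => ?_
  simp only [ENNReal.toReal_ofReal (hρ0 x hx), smul_eq_mul, mul_comm]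

theorem integrable_weightMeasure {f : Euc n → ℝ} :
    Integrable f (weightMeasure k M ρ) ↔ IntegrableOn (fun x => f x * ρ x) M μHE[k] := by
  have hm : AEMeasurable (fun x => ENNReal.ofReal (ρ x)) (μHE[k].restrict M) :=
    (hρ.aemeasurable hM).ennreal_ofReal
  rw [weightMeasure, integrable_withDensity_iff_integrable_smul₀' hm (ae_of_all _ fun _ =>
    ENNReal.ofReal_lt_top)]
  refine integrableOn_congr_fun (fun x hx => ?_) hM
  simp only [ENNReal.toReal_ofReal (hρ0 x hx), smul_eq_mul, mul_comm]

theorem setIntegral_weightMeasure {A : Set (Euc n)} (hA : MeasurableSet A) (f : Euc n → ℝ) :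
    ∫ x in A, f x ∂(weightMeasure k M ρ) = ∫ x in M ∩ A, f x * ρ x ∂μHE[k] := by
  rw [restrict_weightMeasure hA, integral_weightMeasure (hM.inter hA) (hρ.mono inter_subset_left)
    fun x hx => hρ0 x hx.1]

theorem integrableOn_weightMeasure {A : Set (Euc n)} (hA : MeasurableSet A) {f : Euc n → ℝ} :
    IntegrableOn f A (weightMeasure k M ρ) ↔ IntegrableOn (fun x => f x * ρ x) (M ∩ A) μHE[k] := by
  rw [IntegrableOn, restrict_weightMeasure hA,
    integrable_weightMeasure (hM.inter hA) (hρ.mono inter_subset_left) fun x hx => hρ0 x hx.1]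

omit hρ0 in
theorem sigmaFinite_weightMeasure (hsf : SigmaFinite (μHE[k].restrict M)) :
    SigmaFinite (weightMeasure k M ρ) := by
  have hm : AEMeasurable (fun x => ENNReal.ofReal (ρ x)) (μHE[k].restrict M) :=
    (hρ.aemeasurable hM).ennreal_ofReal
  exact SigmaFinite.withDensity_of_ne_top (ae_of_all _ fun _ => ENNReal.ofReal_ne_top)

end WeightMeasure

theorem aestronglyMeasurable_weightMeasure {n k : ℕ} {M O : Set (Euc n)} {ρ : Euc n → ℝ}
    (hM : MeasurableSet M) (hO : MeasurableSet O) {F : Type*} [TopologicalSpace F]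
    [TopologicalSpace.PseudoMetrizableSpace F] [SecondCountableTopology F] {f : Euc n → F}
    (hf : ContinuousOn f (M ∩ O)) :
    AEStronglyMeasurable f ((weightMeasure k M ρ).restrict O) := by
  rw [restrict_weightMeasure hO]
  let _ := borel F
  have : BorelSpace F := ⟨rfl⟩
  exact (hf.aestronglyMeasurable (hM.inter hO)).mono_ac weightMeasure_absolutelyContinuous

namespace ConeData

variable {n m : ℕ} {M : Set (Euc n)} {ρ : Euc n → ℝ} {p : ℝ} {q : Euc n → ℝ}
    {X : Euc n → Euc n} {qbar P : Euc n → ℝ} (h : ConeData m M ρ p q X qbar P)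

include h

theorem measurableSet : MeasurableSet M := h.param.measurableSet

theorem rho_nonneg : ∀ x ∈ M, 0 ≤ ρ x := fun x hx => (h.rho_pos x hx).le

theorem integral_eq (f : Euc n → ℝ) :
    ∫ x, f x ∂(weightMeasure (m + 1) M ρ) = ∫ x in M, f x * ρ x ∂μHE[m + 1] :=
  integral_weightMeasure h.measurableSet h.rho_smooth.continuousOn h.rho_nonneg f

theorem integrable_of_compact {K : Set (Euc n)} (hK : IsCompact K) (hKM : K ⊆ M) {f : Euc n → ℝ}
    (hf : ContinuousOn f K) (hf0 : ∀ x ∈ M \ K, f x = 0) :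
    Integrable f (weightMeasure (m + 1) M ρ) := by
  rw [integrable_weightMeasure h.measurableSet h.rho_smooth.continuousOn h.rho_nonneg]
  refine h.param.integrableOn_of_compact hK hKM (hf.mul (h.rho_smooth.continuousOn.mono hKM)) ?_
  intro x hx; rw [hf0 x hx, zero_mul]

theorem integral_comp_smul {l : ℝ} (hl : 0 < l) (g : Euc n → ℝ) :
    ∫ x, g (l • x) ∂(weightMeasure (m + 1) M ρ) =
      (l ^ ((m : ℝ) + 1 + p))⁻¹ * ∫ x, g x ∂(weightMeasure (m + 1) M ρ) := by
  have himg : (fun x : Euc n => l • x) '' M = M := by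
    apply Subset.antisymm
    · rintro _ ⟨x, hx, rfl⟩; exact h.cone x hx l hl
    · intro x hx
      exact ⟨l⁻¹ • x, h.cone x hx _ (inv_pos.2 hl), smul_inv_smul₀ hl.ne' x⟩
  rw [h.integral_eq, h.integral_eq]
  conv_rhs => rw [← himg, setIntegral_image_dilation hl]
  rw [← integral_const_mul, ← integral_const_mul]
  refine setIntegral_congr_fun h.measurableSet fun x hx => ?_
  rw [h.rho_hom x hx l hl, Real.rpow_add hl, ← Nat.cast_add_one, Real.rpow_natCast]
  have h1 : l ^ p ≠ 0 := (Real.rpow_pos_of_pos hl p).ne'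
  have h2 : l ^ (m + 1) ≠ 0 := (pow_pos hl _).ne'
  field_simp

theorem integrable_comp_smul {l : ℝ} (hl : 0 < l) {g : Euc n → ℝ} :
    Integrable (fun x => g (l • x)) (weightMeasure (m + 1) M ρ) ↔
      Integrable g (weightMeasure (m + 1) M ρ) := by
  have himg : (fun x : Euc n => l • x) '' M = M := by
    apply Subset.antisymm
    · rintro _ ⟨x, hx, rfl⟩; exact h.cone x hx l hl
    · intro x hx
      exact ⟨l⁻¹ • x, h.cone x hx _ (inv_pos.2 hl), smul_inv_smul₀ hl.ne' x⟩
  rw [integrable_weightMeasure h.measurableSet h.rho_smooth.continuousOn h.rho_nonneg,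
    integrable_weightMeasure h.measurableSet h.rho_smooth.continuousOn h.rho_nonneg]
  conv_rhs => rw [← himg, integrableOn_image_dilation hl]
  have h1 : IntegrableOn (fun x => g (l • x) * ρ (l • x)) M μHE[m + 1] ↔
      IntegrableOn (fun x => l ^ p * (g (l • x) * ρ x)) M μHE[m + 1] :=
    integrableOn_congr_fun (fun x hx => by rw [h.rho_hom x hx l hl]; ring) h.measurableSet
  rw [h1, IntegrableOn, IntegrableOn,
    integrable_const_mul_iff (Real.rpow_pos_of_pos hl p).ne'.isUnit]

/-- Integration by parts against the potential `q = div X + q̄`. -/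
theorem integral_q_mul {f : Euc n → ℝ} (hf : ContDiffOn ℝ 1 f M) {K : Set (Euc n)}
    (hK : IsCompact K) (hKM : K ⊆ M) (hf0 : ∀ x ∈ M \ K, f x = 0) :
    ∫ x, q x * f x ∂(weightMeasure (m + 1) M ρ) =
      ∫ x, (qbar x * f x - inner ℝ (X x) (tgrad M f x) -
        f x * inner ℝ (X x) (tgrad M (fun y => Real.log (ρ y)) x))
          ∂(weightMeasure (m + 1) M ρ) := by
  have hρ1 : ContDiffOn ℝ 1 ρ M := h.rho_smooth.of_le (by exact_mod_cast le_top)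
  have hlog : ContDiffOn ℝ 1 (fun y => Real.log (ρ y)) M :=
    hρ1.log fun x hx => (h.rho_pos x hx).ne'
  -- The divergence theorem is applied to `f ρ`; factoring out `ρ` turns the gradient of the weight
  -- into `∇ log ρ`.
  have hfρ : ContDiffOn ℝ 1 (fun x => f x * ρ x) M := hf.mul hρ1
  have hz : ∀ x ∈ M \ K, f x * ρ x = 0 := fun x hx => by rw [hf0 x hx, zero_mul]
  have hdiv := h.param.integral_div_eq_zero h.X_smooth h.X_tan hfρ hK hKM hz
  have hgf : ContinuousOn (tgrad M f) M := by
    simpa using h.param.continuousOn_tgrad isOpen_univ (by simpa using hf)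
  have hgl : ContinuousOn (tgrad M fun y => Real.log (ρ y)) M := by
    simpa using h.param.continuousOn_tgrad isOpen_univ (by simpa using hlog)
  rw [← sub_eq_zero, h.integral_eq, h.integral_eq, ← integral_sub]
  · rw [← hdiv]
    refine setIntegral_congr_fun h.measurableSet fun x hx => ?_
    have hfd := hf.differentiableOn (by simp) x hx
    have hρd := hρ1.differentiableOn (by simp) x hx
    have h1 : tgrad M (fun y => Real.log (ρ y)) x = (ρ x)⁻¹ • tgrad M ρ x :=
      tgrad_comp (Real.hasDerivAt_log (h.rho_pos x hx).ne') hρd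
    have h2 := (h.rho_pos x hx).ne'
    rw [tgrad_mul hfd hρd, h1, h.q_eq x hx, inner_add_right, inner_smul_right, inner_smul_right,
      inner_smul_right]
    field_simp
    ring
  · rw [← IntegrableOn, ← integrable_weightMeasure h.measurableSet h.rho_smooth.continuousOn
      h.rho_nonneg]
    refine h.integrable_of_compact hK hKM
      ((h.q_smooth.continuousOn.mul hf.continuousOn).mono hKM) fun x hx => ?_
    rw [hf0 x hx, mul_zero]
  · rw [← IntegrableOn, ← integrable_weightMeasure h.measurableSet h.rho_smooth.continuousOn
      h.rho_nonneg]
    refine h.integrable_of_compact hK hKM ?_ fun x hx => ?_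
    · have hqb : ContinuousOn qbar M := by
        refine (h.q_smooth.continuousOn.sub (h.param.continuousOn_tdiv h.X_smooth)).congr ?_
        intro x hx
        simp only [Pi.sub_apply, h.q_eq x hx]; ring
      exact (((hqb.mul hf.continuousOn).sub (h.X_smooth.continuousOn.inner hgf)).sub
        (hf.continuousOn.mul (h.X_smooth.continuousOn.inner hgl))).mono hKM
    · rw [tgrad_eq_zero_of_compact hK hf0 hx, hf0 x hx]; simp

end ConeData

/-! ### Test functions and the form norm. -/

section TestFunctions

variable {n k : ℕ} {M U : Set (Euc n)} {f g φ : Euc n → ℝ}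

theorem IsTestFunction.of_contDiffOn {K : Set (Euc n)} (hU : IsOpen U) (hf : ContDiffOn ℝ ∞ f (M ∩ U))
    (hK : IsCompact K) (hKM : K ⊆ M ∩ U) (h0 : ∀ x ∈ M \ K, f x = 0) : IsTestFunction M U f := by
  refine ⟨fun x hx => ?_, K, hK, hKM, h0⟩
  by_cases hxU : x ∈ U
  · exact (hf x ⟨hx, hxU⟩).mono_of_mem_nhdsWithin (inter_mem_nhdsWithin M (hU.mem_nhds hxU))
  · have hxK : x ∉ K := fun h => hxU (hKM h).2
    refine (contDiffWithinAt_const (c := (0 : ℝ))).congr_of_eventuallyEq ?_ (h0 x ⟨hx, hxK⟩)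
    filter_upwards [self_mem_nhdsWithin, mem_nhdsWithin_of_mem_nhds
      (hK.isClosed.isOpen_compl.mem_nhds hxK)] with z hz1 hz2 using h0 z ⟨hz1, hz2⟩

theorem IsTestFunction.mono {V : Set (Euc n)} (hf : IsTestFunction M U f) (hUV : U ⊆ V) :
    IsTestFunction M V f := by
  obtain ⟨h1, K, hK, hKM, h0⟩ := hf
  exact ⟨h1, K, hK, hKM.trans (inter_subset_inter_right M hUV), h0⟩

theorem IsTestFunction.mul (hf : IsTestFunction M U f) (hU : IsOpen U)
    (hg : ContDiffOn ℝ ∞ g (M ∩ U)) : IsTestFunction M U fun x => g x * f x := by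
  obtain ⟨h1, K, hK, hKM, h0⟩ := hf
  exact .of_contDiffOn hU (hg.mul (h1.mono inter_subset_left)) hK hKM fun x hx => by
    rw [h0 x hx, mul_zero]

theorem IsTestFunction.add (hf : IsTestFunction M U f) (hg : IsTestFunction M U g) :
    IsTestFunction M U fun x => f x + g x := by
  obtain ⟨h1, K, hK, hKM, h0⟩ := hf
  obtain ⟨h1', K', hK', hKM', h0'⟩ := hg
  refine ⟨h1.add h1', K ∪ K', hK.union hK', union_subset hKM hKM', fun x hx => ?_⟩
  change f x + g x = 0
  rw [h0 x ⟨hx.1, fun h => hx.2 (Or.inl h)⟩, h0' x ⟨hx.1, fun h => hx.2 (Or.inr h)⟩, add_zero]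

theorem IsTestFunction.const_mul (hf : IsTestFunction M U f) (c : ℝ) :
    IsTestFunction M U fun x => c * f x := by
  obtain ⟨h1, K, hK, hKM, h0⟩ := hf
  exact ⟨contDiffOn_const.mul h1, K, hK, hKM, fun x hx => by
    change c * f x = 0
    rw [h0 x hx, mul_zero]⟩

theorem IsTestFunction.sub (hf : IsTestFunction M U f) (hg : IsTestFunction M U g) :
    IsTestFunction M U fun x => f x - g x := by
  have := hf.add (hg.const_mul (-1))
  simpa [← sub_eq_add_neg] using this

/-- A smooth function multiplied with a test function is supported where both are. -/
theorem IsTestFunction.cutoff_mul {V : Set (Euc n)} {ζ : Euc n → ℝ} (hφ : IsTestFunction M U φ)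
    (hζ : ContDiff ℝ ∞ ζ) (hV : tsupport ζ ⊆ V) : IsTestFunction M (U ∩ V) fun x => ζ x * φ x := by
  obtain ⟨h1, K, hK, hKM, h0⟩ := hφ
  refine ⟨hζ.contDiffOn.mul h1, K ∩ tsupport ζ, hK.inter_right (isClosed_tsupport _),
    fun x hx => ⟨(hKM hx.1).1, (hKM hx.1).2, hV hx.2⟩, fun x hx => ?_⟩
  change ζ x * φ x = 0
  by_cases hxK : x ∈ K
  · rw [image_eq_zero_of_notMem_tsupport fun h => hx.2 ⟨hxK, h⟩, zero_mul]
  · rw [h0 x ⟨hx.1, hxK⟩, mul_zero]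

theorem IsTestFunction.contDiffOn_one (hf : IsTestFunction M U f) : ContDiffOn ℝ 1 f M :=
  hf.1.of_le (by exact_mod_cast le_top)

theorem IsTestFunction.differentiableWithinAt (hf : IsTestFunction M U f) {x : Euc n} (hx : x ∈ M) :
    DifferentiableWithinAt ℝ f M x := hf.contDiffOn_one.differentiableOn (by simp) x hx

theorem norm_tgrad_le {x : Euc n} (hf : DifferentiableAt ℝ f x) : ‖tgrad M f x‖ ≤ ‖fderiv ℝ f x‖ := by
  rw [tgrad_eq hf.hasFDerivAt.hasFDerivWithinAt]
  refine (Submodule.norm_starProjection_apply_le _ _).trans ?_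
  rw [LinearIsometryEquiv.norm_map]

theorem tgrad_eq_zero_of_notMem_tsupport {x : Euc n} (hx : x ∉ tsupport f) : tgrad M f x = 0 := by
  have h1 : f =ᶠ[𝓝 x] fun _ => 0 := notMem_tsupport_iff_eventuallyEq.1 hx
  rw [tgrad_congr (h1.filter_mono nhdsWithin_le_nhds) h1.eq_of_nhds, tgrad]
  simp

theorem exists_bound_cutoff {ζ : Euc n → ℝ} (hζ : ContDiff ℝ ∞ ζ) (hc : HasCompactSupport ζ) :
    ∃ c : ℝ, 0 < c ∧ ∀ (M : Set (Euc n)) x, |ζ x| ≤ c ∧ ‖tgrad M ζ x‖ ≤ c := by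
  obtain ⟨c1, h1⟩ := hζ.continuous.bounded_above_of_compact_support hc
  obtain ⟨c2, h2⟩ := (hζ.continuous_fderiv (by simp)).bounded_above_of_compact_support (hc.fderiv ℝ)
  have h0 : 0 ≤ c1 := (norm_nonneg _).trans (h1 0)
  have h0' : 0 ≤ c2 := (norm_nonneg _).trans (h2 0)
  refine ⟨c1 + c2 + 1, by positivity, fun M x => ⟨?_, ?_⟩⟩
  · have := h1 x
    rw [Real.norm_eq_abs] at this
    linarith
  · have := (norm_tgrad_le (M := M) (hζ.differentiable (by simp) x)).trans (h2 x)
    linarith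

end TestFunctions

/-- The density of the square of the form norm with respect to `ρ μ`. -/
noncomputable def energy {n : ℕ} (M : Set (Euc n)) (ρ P f : Euc n → ℝ) (x : Euc n) : ℝ :=
  ‖tgrad M f x‖ ^ 2 + (1 + ‖tgrad M (fun y => Real.log (ρ y)) x‖ ^ 2 + P x) * f x ^ 2

/-- The bilinear form `∫ (⟨∇f, ∇g⟩ - q f g) ρ`. -/
noncomputable def formQ {n : ℕ} (m : ℕ) (M : Set (Euc n)) (ρ q f g : Euc n → ℝ) : ℝ :=
  ∫ x, (inner ℝ (tgrad M f x) (tgrad M g x) - q x * f x * g x) ∂(weightMeasure (m + 1) M ρ)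

/-- A positive critical point `u` in `B_R` of the quadratic form, which lies in its domain. -/
structure CriticalData {n : ℕ} (m : ℕ) (M : Set (Euc n)) (ρ : Euc n → ℝ) (p : ℝ) (q : Euc n → ℝ)
    (X : Euc n → Euc n) (qbar P : Euc n → ℝ) (R : ℝ) (u : Euc n → ℝ) : Prop
    extends ConeData m M ρ p q X qbar P where
  R_pos : 0 < R
  u_smooth : ContDiffOn ℝ ∞ u (M ∩ Metric.ball 0 R)
  u_pos : ∀ x ∈ M ∩ Metric.ball 0 R, 0 < u x
  integrable : IntegrableOn (energy M ρ P u) (Metric.ball 0 R) (weightMeasure (m + 1) M ρ)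
  dom : ∀ r < R, ∀ ε > 0, ∃ φ, IsTestFunction M univ φ ∧
    IntegrableOn (energy M ρ P fun x => u x - φ x) (Metric.ball 0 r) (weightMeasure (m + 1) M ρ) ∧
    ∫ x in Metric.ball 0 r, energy M ρ P (fun x => u x - φ x) x ∂(weightMeasure (m + 1) M ρ) < ε
  crit : ∀ φ, IsTestFunction M (Metric.ball 0 R) φ → formQ m M ρ q u φ = 0

/-- The choice `δ = τ²` and `τ → 0`. The bound is what Cauchy-Schwarz in its weighted
arithmetic-geometric form gives when one factor has energy below an arbitrary `δ`. -/
theorem eq_zero_of_abs_le_mul_add_div {A C E : ℝ}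
    (h : ∀ δ > 0, ∀ τ > 0, |A| ≤ C * (τ * E + δ / τ)) : A = 0 := by
  have h1 : Tendsto (fun τ : ℝ => C * (τ * E + τ)) (𝓝[>] 0) (𝓝 (C * (0 * E + 0))) := by
    have : Continuous fun τ : ℝ => C * (τ * E + τ) := by fun_prop
    exact (this.tendsto 0).mono_left nhdsWithin_le_nhds
  have h2 : |A| ≤ C * (0 * E + 0) := by
    refine ge_of_tendsto h1 ?_
    filter_upwards [self_mem_nhdsWithin] with τ hτ
    have := h (τ ^ 2) (pow_pos hτ 2) τ hτ
    rwa [pow_two, mul_div_assoc, div_self (ne_of_gt hτ), mul_one] at this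
  simpa using h2

theorem mul_le_amgm {s t τ : ℝ} (hτ : 0 < τ) : s * t ≤ τ * s ^ 2 + t ^ 2 / τ := by
  have h1 : s * t = (τ * s) * (t / τ) := by field_simp
  have h2 : τ * s ^ 2 + t ^ 2 / τ = ((τ * s) ^ 2 + t ^ 2) / τ := by field_simp
  rw [h2, le_div_iff₀ hτ]
  nlinarith [sq_nonneg (τ * s - t), sq_nonneg (τ * s), sq_nonneg t]

/-! ### Pointwise bounds by the energy density. -/

section EnergyBounds

variable {n : ℕ} {M : Set (Euc n)} {ρ P f : Euc n → ℝ} {x : Euc n}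

theorem energy_nonneg (hP : 0 ≤ P x) : 0 ≤ energy M ρ P f x := by rw [energy]; positivity

theorem norm_tgrad_le_sqrt_energy (hP : 0 ≤ P x) : ‖tgrad M f x‖ ≤ √(energy M ρ P f x) := by
  refine Real.le_sqrt_of_sq_le ?_
  rw [energy]
  have : 0 ≤ (1 + ‖tgrad M (fun y => Real.log (ρ y)) x‖ ^ 2 + P x) * f x ^ 2 := by positivity
  linarith

theorem mul_abs_le_sqrt_energy {a : ℝ}
    (ha : a ^ 2 ≤ 1 + ‖tgrad M (fun y => Real.log (ρ y)) x‖ ^ 2 + P x) :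
    a * |f x| ≤ √(energy M ρ P f x) := by
  refine Real.le_sqrt_of_sq_le ?_
  rw [energy, mul_pow, sq_abs]
  have h1 := mul_le_mul_of_nonneg_right ha (sq_nonneg (f x))
  have h2 := sq_nonneg ‖tgrad M f x‖
  linarith

theorem abs_le_sqrt_energy (hP : 0 ≤ P x) : |f x| ≤ √(energy M ρ P f x) := by
  have := mul_abs_le_sqrt_energy (M := M) (ρ := ρ) (f := f) (a := 1) (by
    have := sq_nonneg ‖tgrad M (fun y => Real.log (ρ y)) x‖; linarith)
  simpa using this

end EnergyBounds

namespace ConeData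

variable {n m : ℕ} {M : Set (Euc n)} {ρ : Euc n → ℝ} {p : ℝ} {q : Euc n → ℝ}
    {X : Euc n → Euc n} {qbar P : Euc n → ℝ} (h : ConeData m M ρ p q X qbar P)

include h

theorem norm_X_le {x : Euc n} (hx : x ∈ M) : ‖X x‖ ^ 2 ≤ P x := by
  have h1 := h.X_le x hx
  have h2 := abs_nonneg (qbar x)
  linarith

theorem abs_qbar_le {x : Euc n} (hx : x ∈ M) : |qbar x| ≤ √(P x) ^ 2 := by
  rw [Real.sq_sqrt (h.P_pos x hx).le]
  have h1 := h.X_le x hx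
  have h2 := sq_nonneg ‖X x‖
  linarith

theorem norm_X_mul_le {x : Euc n} (hx : x ∈ M) (f : Euc n → ℝ) :
    ‖X x‖ * |f x| ≤ √(energy M ρ P f x) :=
  mul_abs_le_sqrt_energy (by
    have h1 := h.norm_X_le hx
    have := sq_nonneg ‖tgrad M (fun y => Real.log (ρ y)) x‖; linarith)

theorem sqrt_P_mul_le {x : Euc n} (hx : x ∈ M) (f : Euc n → ℝ) :
    √(P x) * |f x| ≤ √(energy M ρ P f x) :=
  mul_abs_le_sqrt_energy (by
    rw [Real.sq_sqrt (h.P_pos x hx).le]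
    have := sq_nonneg ‖tgrad M (fun y => Real.log (ρ y)) x‖; linarith)

theorem norm_log_mul_le {x : Euc n} (hx : x ∈ M) (f : Euc n → ℝ) :
    ‖tgrad M (fun y => Real.log (ρ y)) x‖ * |f x| ≤ √(energy M ρ P f x) :=
  mul_abs_le_sqrt_energy (by
    have h1 := (h.P_pos x hx).le; linarith)

theorem continuousOn_tgrad {O : Set (Euc n)} (hO : IsOpen O) {f : Euc n → ℝ}
    (hf : ContDiffOn ℝ ∞ f (M ∩ O)) : ContinuousOn (tgrad M f) (M ∩ O) :=
  h.param.continuousOn_tgrad hO (hf.of_le (by exact_mod_cast le_top))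

/-- Integrability of products of smooth functions with test functions. -/
theorem integrable_test {O : Set (Euc n)} {φ : Euc n → ℝ} (hφ : IsTestFunction M O φ)
    {F : Euc n → ℝ} (hF : ContinuousOn F (M ∩ O))
    (h0 : ∀ x ∈ M, φ x = 0 → tgrad M φ x = 0 → F x = 0) :
    Integrable F (weightMeasure (m + 1) M ρ) := by
  obtain ⟨-, K, hK, hKM, hφ0⟩ := hφ
  exact h.integrable_of_compact hK (fun x hx => (hKM hx).1) (hF.mono hKM) fun x hx =>
    h0 x hx.1 (hφ0 x hx) (tgrad_eq_zero_of_compact hK hφ0 hx)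

theorem integrable_formQ {O : Set (Euc n)} (hO : IsOpen O) {f φ : Euc n → ℝ}
    (hf : ContDiffOn ℝ ∞ f (M ∩ O)) (hφ : IsTestFunction M O φ) :
    Integrable (fun x => inner ℝ (tgrad M f x) (tgrad M φ x) - q x * f x * φ x)
      (weightMeasure (m + 1) M ρ) := by
  refine h.integrable_test hφ ?_ fun x _ h1 h2 => by rw [h1, h2]; simp
  exact ((h.continuousOn_tgrad hO hf).inner (h.continuousOn_tgrad hO (hφ.1.mono inter_subset_left))).sub
    (((h.q_smooth.continuousOn.mono inter_subset_left).mul hf.continuousOn).mul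
      (hφ.1.continuousOn.mono inter_subset_left))

theorem integral_q_mul_test {O : Set (Euc n)} {f : Euc n → ℝ} (hf : IsTestFunction M O f) :
    ∫ x, q x * f x ∂(weightMeasure (m + 1) M ρ) =
      ∫ x, (qbar x * f x - inner ℝ (X x) (tgrad M f x) -
        f x * inner ℝ (X x) (tgrad M (fun y => Real.log (ρ y)) x))
          ∂(weightMeasure (m + 1) M ρ) := by
  have h1 := hf.contDiffOn_one
  obtain ⟨-, K, hK, hKM, h0⟩ := hf
  exact h.integral_q_mul h1 hK (fun x hx => (hKM hx).1) h0

theorem rho_log_smooth : ContDiffOn ℝ ∞ (fun y => Real.log (ρ y)) M :=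
  h.rho_smooth.log fun x hx => (h.rho_pos x hx).ne'

theorem continuousOn_tgrad_log : ContinuousOn (tgrad M fun y => Real.log (ρ y)) M := by
  simpa using h.continuousOn_tgrad isOpen_univ (by simpa using h.rho_log_smooth)

theorem continuousOn_qbar : ContinuousOn qbar M := by
  refine (h.q_smooth.continuousOn.sub (h.param.continuousOn_tdiv h.X_smooth)).congr ?_
  intro x hx
  simp only [Pi.sub_apply, h.q_eq x hx]; ring

theorem integrable_parts {O : Set (Euc n)} {f : Euc n → ℝ} (hf : IsTestFunction M O f) :
    Integrable (fun x => qbar x * f x - inner ℝ (X x) (tgrad M f x) -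
        f x * inner ℝ (X x) (tgrad M (fun y => Real.log (ρ y)) x)) (weightMeasure (m + 1) M ρ) := by
  refine h.integrable_test hf (ContinuousOn.mono ?_ inter_subset_left) fun x _ h1 h2 => by
    rw [h1, h2]; simp
  have hg : ContinuousOn (tgrad M f) M := by
    simpa using h.continuousOn_tgrad isOpen_univ (by simpa using hf.1)
  exact ((h.continuousOn_qbar.mul hf.1.continuousOn).sub (h.X_smooth.continuousOn.inner hg)).sub
    (hf.1.continuousOn.mul (h.X_smooth.continuousOn.inner h.continuousOn_tgrad_log))

end ConeData

/-! ### The flux identity for a critical point. -/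

namespace CriticalData

variable {n m : ℕ} {M : Set (Euc n)} {ρ : Euc n → ℝ} {p : ℝ} {q : Euc n → ℝ}
    {X : Euc n → Euc n} {qbar P : Euc n → ℝ} {R : ℝ} {u : Euc n → ℝ}
    (h : CriticalData m M ρ p q X qbar P R u)

include h

theorem differentiableWithinAt {x : Euc n} (hx : x ∈ M ∩ Metric.ball 0 R) :
    DifferentiableWithinAt ℝ u M x :=
  differentiableWithinAt_of_contDiffOn_inter Metric.isOpen_ball
    (h.u_smooth.of_le (by exact_mod_cast le_top)) hx

/-- The integrand of the flux identity, polarized. -/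
theorem flux_test {ζ : Euc n → ℝ} (hζ : ContDiff ℝ ∞ ζ) (hζR : tsupport ζ ⊆ Metric.ball 0 R)
    {φ : Euc n → ℝ} (hφ : IsTestFunction M univ φ) :
    ∫ x, (inner ℝ (tgrad M u x) (tgrad M (fun y => ζ y * φ y) x) -
      (qbar x * (ζ x * (u x * φ x)) - inner ℝ (X x) (tgrad M (fun y => ζ y * (u y * φ y)) x) -
        ζ x * (u x * φ x) * inner ℝ (X x) (tgrad M (fun y => Real.log (ρ y)) x)))
          ∂(weightMeasure (m + 1) M ρ) = 0 := by
  have hB := Metric.isOpen_ball (x := (0 : Euc n)) (ε := R)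
  have h1 : IsTestFunction M (Metric.ball 0 R) fun x => ζ x * φ x := by
    simpa using hφ.cutoff_mul hζ hζR
  have h2 : IsTestFunction M (Metric.ball 0 R) fun x => ζ x * (u x * φ x) := by
    have := h1.mul hB h.u_smooth
    refine (funext fun x => ?_ : (fun x => u x * (ζ x * φ x)) = fun x => ζ x * (u x * φ x)) ▸ this
    ring
  have h3 := h.crit _ h1
  have h4 := h.integral_q_mul_test h2
  have h5 : Integrable (fun x => inner ℝ (tgrad M u x) (tgrad M (fun y => ζ y * φ y) x))
      (weightMeasure (m + 1) M ρ) := by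
    refine h.integrable_test h1 ?_ fun x _ h1 h2 => by rw [h2]; simp
    exact (h.continuousOn_tgrad hB h.u_smooth).inner
      (h.continuousOn_tgrad hB (h1.1.mono inter_subset_left))
  have h6 : Integrable (fun x => q x * (ζ x * (u x * φ x))) (weightMeasure (m + 1) M ρ) :=
    h.integrable_test h2 (((h.q_smooth.continuousOn).mul h2.1.continuousOn).mono inter_subset_left)
      fun x _ h1 _ => by rw [h1, mul_zero]
  rw [integral_sub h5 (h.integrable_parts h2), ← h4, ← integral_sub h5 h6, ← h3, formQ]
  refine integral_congr_ae (ae_of_all _ fun x => ?_)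
  simp only
  ring

end CriticalData

/-- The density of the polarized flux identity, for a cutoff with value `z` and gradient `w`. -/
noncomputable def fluxDensity {n : ℕ} (M : Set (Euc n)) (ρ qbar : Euc n → ℝ) (X : Euc n → Euc n)
    (u f : Euc n → ℝ) (z : ℝ) (w x : Euc n) : ℝ :=
  z * inner ℝ (tgrad M u x) (tgrad M f x) + f x * inner ℝ (tgrad M u x) w
    - qbar x * (z * (u x * f x))
    + inner ℝ (X x) ((z * u x) • tgrad M f x + (z * f x) • tgrad M u x + (u x * f x) • w)
    + z * (u x * f x) * inner ℝ (X x) (tgrad M (fun y => Real.log (ρ y)) x)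

theorem abs_mul_inner_le {n : ℕ} {a b c e e' : ℝ} {v w : Euc n} (ha : |a| ≤ c)
    (hv : |b| * ‖v‖ ≤ e) (hw : ‖w‖ ≤ e') : |a * (b * inner ℝ v w)| ≤ c * (e * e') := by
  have h0 : 0 ≤ |b| * ‖v‖ := by positivity
  have h1 : 0 ≤ |a| := abs_nonneg a
  rw [abs_mul, abs_mul]
  calc |a| * (|b| * |inner ℝ v w|) ≤ |a| * (|b| * (‖v‖ * ‖w‖)) := by
        gcongr; exact abs_real_inner_le_norm v w
    _ = |a| * ((|b| * ‖v‖) * ‖w‖) := by ring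
    _ ≤ c * (e * e') := by
        refine mul_le_mul ha (mul_le_mul hv hw (norm_nonneg _) (h0.trans hv)) (by positivity)
          (h1.trans ha)

/-- There are seven terms, and in each the lower order coefficients can be shared between the two
functions: `|q̄|` is split as `√P · √P`, and `X` or `∇ log ρ` is attached to one function. The bound
involves a product of square roots of energies, so it is small as soon as one of the functions has
small energy. -/
theorem ConeData.abs_fluxDensity_le {n m : ℕ} {M : Set (Euc n)} {ρ : Euc n → ℝ} {p : ℝ}
    {q : Euc n → ℝ} {X : Euc n → Euc n} {qbar P : Euc n → ℝ} (h : ConeData m M ρ p q X qbar P)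
    (u f : Euc n → ℝ) {z c : ℝ} {w x : Euc n} (hx : x ∈ M) (hz : |z| ≤ c) (hw : ‖w‖ ≤ c) :
    |fluxDensity M ρ qbar X u f z w x| ≤
      7 * c * (√(energy M ρ P u x) * √(energy M ρ P f x)) := by
  have hP := (h.P_pos x hx).le
  set e := √(energy M ρ P u x)
  set e' := √(energy M ρ P f x)
  have a1 : ‖tgrad M u x‖ ≤ e := norm_tgrad_le_sqrt_energy hP
  have a1' : ‖tgrad M f x‖ ≤ e' := norm_tgrad_le_sqrt_energy hP
  have a2' : |f x| ≤ e' := abs_le_sqrt_energy hP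
  have a3 : ‖X x‖ * |u x| ≤ e := h.norm_X_mul_le hx u
  have a3' : ‖X x‖ * |f x| ≤ e' := h.norm_X_mul_le hx f
  have a4 : √(P x) * |u x| ≤ e := h.sqrt_P_mul_le hx u
  have a4' : √(P x) * |f x| ≤ e' := h.sqrt_P_mul_le hx f
  have a5' : ‖tgrad M (fun y => Real.log (ρ y)) x‖ * |f x| ≤ e' := h.norm_log_mul_le hx f
  have a6 := h.abs_qbar_le hx
  have e0 : 0 ≤ e := Real.sqrt_nonneg _
  have e0' : 0 ≤ e' := Real.sqrt_nonneg _
  have c0 : 0 ≤ c := (abs_nonneg z).trans hz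
  have b1 : |z * (1 * inner ℝ (tgrad M u x) (tgrad M f x))| ≤ c * (e * e') :=
    abs_mul_inner_le hz (by simpa using a1) a1'
  have b2 : |1 * (1 * inner ℝ (tgrad M u x) (f x • w))| ≤ c * (e * e') := by
    have h1 : ‖f x • w‖ ≤ e' * c := by
      rw [norm_smul, Real.norm_eq_abs]; exact mul_le_mul a2' hw (norm_nonneg _) e0'
    have := abs_mul_inner_le (a := 1) (b := 1) (c := 1) (by simp) (by simpa using a1) h1
    calc _ ≤ _ := this
      _ = _ := by ring
  have b3 : |z * (qbar x * (u x * f x))| ≤ c * (e * e') := by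
    rw [abs_mul, abs_mul, abs_mul]
    refine mul_le_mul hz ?_ (by positivity) c0
    calc |qbar x| * (|u x| * |f x|) ≤ √(P x) ^ 2 * (|u x| * |f x|) := by gcongr
      _ = (√(P x) * |u x|) * (√(P x) * |f x|) := by ring
      _ ≤ e * e' := mul_le_mul a4 a4' (by positivity) e0
  have b4 : |z * (u x * inner ℝ (X x) (tgrad M f x))| ≤ c * (e * e') :=
    abs_mul_inner_le hz (by rwa [mul_comm]) a1'
  have b5 : |z * (f x * inner ℝ (X x) (tgrad M u x))| ≤ c * (e * e') := by
    rw [mul_comm e e']; exact abs_mul_inner_le hz (by rwa [mul_comm]) a1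
  have b6 : |1 * (u x * inner ℝ (X x) (f x • w))| ≤ c * (e * e') := by
    have h1 : ‖f x • w‖ ≤ e' * c := by
      rw [norm_smul, Real.norm_eq_abs]; exact mul_le_mul a2' hw (norm_nonneg _) e0'
    have := abs_mul_inner_le (a := 1) (b := u x) (c := 1) (v := X x) (by simp)
      (by rwa [mul_comm] : |u x| * ‖X x‖ ≤ e) h1
    calc _ ≤ _ := this
      _ = _ := by ring
  have b7 : |z * (u x * inner ℝ (X x) (f x • tgrad M (fun y => Real.log (ρ y)) x))| ≤
      c * (e * e') := by
    refine abs_mul_inner_le hz (by rwa [mul_comm]) ?_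
    rw [norm_smul, Real.norm_eq_abs, mul_comm]; exact a5'
  simp only [inner_smul_right] at b2 b6 b7
  simp only [fluxDensity, inner_add_right, inner_smul_right]
  rw [abs_le] at *
  constructor
  · linarith [b1.1, b2.1, b3.2, b4.1, b5.1, b6.1, b7.1]
  · linarith [b1.2, b2.2, b3.1, b4.2, b5.2, b6.2, b7.2]

namespace CriticalData

variable {n m : ℕ} {M : Set (Euc n)} {ρ : Euc n → ℝ} {p : ℝ} {q : Euc n → ℝ}
    {X : Euc n → Euc n} {qbar P : Euc n → ℝ} {R : ℝ} {u : Euc n → ℝ}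
    (h : CriticalData m M ρ p q X qbar P R u)

include h

theorem continuousOn_fluxDensity {f z : Euc n → ℝ} {w : Euc n → Euc n}
    (hf : ContDiffOn ℝ ∞ f (M ∩ Metric.ball 0 R)) (hz : ContinuousOn z (M ∩ Metric.ball 0 R))
    (hw : ContinuousOn w (M ∩ Metric.ball 0 R)) :
    ContinuousOn (fun x => fluxDensity M ρ qbar X u f (z x) (w x) x) (M ∩ Metric.ball 0 R) := by
  have hB := Metric.isOpen_ball (x := (0 : Euc n)) (ε := R)
  have g1 := h.continuousOn_tgrad hB h.u_smooth
  have g2 := h.continuousOn_tgrad hB hf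
  have g3 := h.continuousOn_tgrad_log.mono (inter_subset_left (t := Metric.ball 0 R))
  have g4 := h.X_smooth.continuousOn.mono (inter_subset_left (t := Metric.ball 0 R))
  have g5 := h.continuousOn_qbar.mono (inter_subset_left (t := Metric.ball 0 R))
  have g6 := h.u_smooth.continuousOn
  have g7 := hf.continuousOn
  exact ((((hz.mul (g1.inner g2)).add (g7.mul (g1.inner hw))).sub
    (g5.mul (hz.mul (g6.mul g7)))).add (g4.inner ((((hz.mul g6).smul g2).add
      ((hz.mul g7).smul g1)).add ((g6.mul g7).smul hw)))).add
        ((hz.mul (g6.mul g7)).mul (g4.inner g3))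

/-- The flux density of `u` is integrable for bounded cutoffs. -/
theorem integrableOn_fluxDensity {z : Euc n → ℝ} {w : Euc n → Euc n} {c : ℝ}
    (hm : AEStronglyMeasurable (fun x => fluxDensity M ρ qbar X u u (z x) (w x) x)
      ((weightMeasure (m + 1) M ρ).restrict (Metric.ball 0 R)))
    (hz : ∀ x ∈ M ∩ Metric.ball 0 R, |z x| ≤ c) (hw : ∀ x ∈ M ∩ Metric.ball 0 R, ‖w x‖ ≤ c) :
    IntegrableOn (fun x => fluxDensity M ρ qbar X u u (z x) (w x) x) (Metric.ball 0 R)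
      (weightMeasure (m + 1) M ρ) := by
  refine (h.integrable.const_mul (7 * c)).mono' hm ?_
  filter_upwards [ae_restrict_of_ae (ae_mem_weightMeasure h.measurableSet),
    ae_restrict_mem Metric.isOpen_ball.measurableSet] with x hx hxR
  have := h.abs_fluxDensity_le u u hx (hz x ⟨hx, hxR⟩) (hw x ⟨hx, hxR⟩)
  rwa [Real.mul_self_sqrt (energy_nonneg (h.P_pos x hx).le)] at this

theorem tgrad_cutoff_mul {ζ f : Euc n → ℝ} (hζ : ContDiff ℝ ∞ ζ)
    (hf : ∀ x ∈ M ∩ Metric.ball 0 R, DifferentiableWithinAt ℝ f M x) {x : Euc n}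
    (hx : x ∈ M ∩ Metric.ball 0 R) :
    tgrad M (fun y => ζ y * (u y * f y)) x =
      (ζ x * u x) • tgrad M f x + (ζ x * f x) • tgrad M u x + (u x * f x) • tgrad M ζ x := by
  have h1 : DifferentiableWithinAt ℝ ζ M x :=
    (hζ.differentiable (by simp) x).differentiableWithinAt
  have h2 : DifferentiableWithinAt ℝ (fun y => u y * f y) M x :=
    (h.differentiableWithinAt hx).mul (hf x hx)
  rw [tgrad_mul h1 h2, tgrad_mul (h.differentiableWithinAt hx) (hf x hx), smul_add, smul_smul, smul_smul]

theorem integral_fluxDensity_test {ζ : Euc n → ℝ} (hζ : ContDiff ℝ ∞ ζ)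
    (hζR : tsupport ζ ⊆ Metric.ball 0 R) {φ : Euc n → ℝ} (hφ : IsTestFunction M univ φ) :
    ∫ x, fluxDensity M ρ qbar X u φ (ζ x) (tgrad M ζ x) x ∂(weightMeasure (m + 1) M ρ) = 0 := by
  rw [← h.flux_test hζ hζR hφ]
  refine integral_congr_ae ?_
  filter_upwards [ae_mem_weightMeasure h.measurableSet] with x hx
  by_cases hxR : x ∈ Metric.ball 0 R
  · rw [h.tgrad_cutoff_mul hζ (fun y hy => hφ.differentiableWithinAt hy.1) ⟨hx, hxR⟩,
      tgrad_mul (hζ.differentiable (by simp) x).differentiableWithinAt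
        (hφ.differentiableWithinAt hx), inner_add_right, inner_smul_right, inner_smul_right,
        fluxDensity]
    ring
  · have hz : x ∉ tsupport ζ := fun hh => hxR (hζR hh)
    have hz' : ∀ g : Euc n → ℝ, tgrad M (fun y => ζ y * g y) x = 0 := fun g =>
      tgrad_eq_zero_of_notMem_tsupport fun hh => hz (tsupport_mul_subset_left hh)
    rw [hz', hz', fluxDensity, tgrad_eq_zero_of_notMem_tsupport hz,
      image_eq_zero_of_notMem_tsupport hz]
    simp

theorem fluxDensity_sub {φ : Euc n → ℝ} {z : ℝ} {w x : Euc n} (hx : x ∈ M ∩ Metric.ball 0 R)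
    (hφ : DifferentiableWithinAt ℝ φ M x) :
    fluxDensity M ρ qbar X u (fun y => u y - φ y) z w x =
      fluxDensity M ρ qbar X u u z w x - fluxDensity M ρ qbar X u φ z w x := by
  simp only [fluxDensity, tgrad_sub (h.differentiableWithinAt hx) hφ, inner_sub_right,
    inner_add_right, inner_smul_right]
  ring

/-- The flux identity for `u`. -/
theorem integral_fluxDensity {ζ : Euc n → ℝ} (hζ : ContDiff ℝ ∞ ζ) (hc : HasCompactSupport ζ)
    (hζR : tsupport ζ ⊆ Metric.ball 0 R) :
    ∫ x in Metric.ball 0 R, fluxDensity M ρ qbar X u u (ζ x) (tgrad M ζ x) x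
      ∂(weightMeasure (m + 1) M ρ) = 0 := by
  set κ := weightMeasure (m + 1) M ρ
  -- Approximation in the form norm is only available on balls smaller than `B_R`, and the support
  -- of the cutoff fits into one of them.
  obtain ⟨b, hbR, hb⟩ := exists_lt_subset_ball (isClosed_tsupport ζ) hζR
  obtain ⟨c, hc0, hcζ⟩ := exists_bound_cutoff hζ hc
  have hB := Metric.isOpen_ball (x := (0 : Euc n)) (ε := R)
  have hBm := (Metric.isOpen_ball (x := (0 : Euc n)) (ε := b)).measurableSet
  have hbR' : Metric.ball (0 : Euc n) b ⊆ Metric.ball 0 R := Metric.ball_subset_ball hbR.le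
  have hgζ : ContinuousOn (tgrad M ζ) (M ∩ Metric.ball 0 R) :=
    h.continuousOn_tgrad hB hζ.contDiffOn
  have hint : IntegrableOn (fun x => fluxDensity M ρ qbar X u u (ζ x) (tgrad M ζ x) x)
      (Metric.ball 0 R) κ := by
    refine h.integrableOn_fluxDensity (c := c) ?_ (fun x _ => (hcζ M x).1) fun x _ => (hcζ M x).2
    exact aestronglyMeasurable_weightMeasure h.measurableSet hB.measurableSet
      (h.continuousOn_fluxDensity h.u_smooth hζ.continuous.continuousOn hgζ)
  have hout : ∀ f : Euc n → ℝ, ∀ x ∉ Metric.ball 0 b,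
      fluxDensity M ρ qbar X u f (ζ x) (tgrad M ζ x) x = 0 := fun f x hx => by
    have hz : x ∉ tsupport ζ := fun hh => hx (hb hh)
    rw [fluxDensity, tgrad_eq_zero_of_notMem_tsupport hz, image_eq_zero_of_notMem_tsupport hz]
    simp
  have hE : 0 ≤ ∫ x in Metric.ball 0 R, energy M ρ P u x ∂κ :=
    integral_nonneg_of_ae ((ae_restrict_of_ae (ae_mem_weightMeasure h.measurableSet)).mono
      fun x hx => energy_nonneg (h.P_pos x hx).le)
  refine eq_zero_of_abs_le_mul_add_div (C := 7 * c)
    (E := ∫ x in Metric.ball 0 R, energy M ρ P u x ∂κ) fun δ hδ τ hτ => ?_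
  obtain ⟨φ, hφ, hφi, hφδ⟩ := h.dom b hbR δ hδ
  have hφR : ContDiffOn ℝ ∞ φ (M ∩ Metric.ball 0 R) := hφ.1.mono inter_subset_left
  have hφint : Integrable (fun x => fluxDensity M ρ qbar X u φ (ζ x) (tgrad M ζ x) x) κ := by
    have h1 : IsTestFunction M (Metric.ball 0 R) fun x => ζ x * φ x := by
      simpa using hφ.cutoff_mul hζ hζR
    obtain ⟨-, K, hK, hKM, h0⟩ := hφ
    refine h.integrable_of_compact (K := K ∩ tsupport ζ) (hK.inter_right (isClosed_tsupport _))
      (fun x hx => (hKM hx.1).1)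
      ((h.continuousOn_fluxDensity hφR hζ.continuous.continuousOn hgζ).mono
        fun x hx => ⟨(hKM hx.1).1, hζR hx.2⟩) fun x hx => ?_
    by_cases hxK : x ∈ K
    · have hz : x ∉ tsupport ζ := fun hh => hx.2 ⟨hxK, hh⟩
      rw [fluxDensity, tgrad_eq_zero_of_notMem_tsupport hz, image_eq_zero_of_notMem_tsupport hz]
      simp
    · rw [fluxDensity, tgrad_eq_zero_of_compact hK h0 ⟨hx.1, hxK⟩, h0 x ⟨hx.1, hxK⟩]
      simp
  have e1 : ∫ x in Metric.ball 0 b, fluxDensity M ρ qbar X u φ (ζ x) (tgrad M ζ x) x ∂κ = 0 := by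
    rw [setIntegral_eq_integral_of_forall_compl_eq_zero (hout φ)]
    exact h.integral_fluxDensity_test hζ hζR hφ
  -- The density is linear in its second function and its integral vanishes for the test function
  -- `φ`, so only the approximation error `u - φ` contributes.
  have e2 : ∫ x in Metric.ball 0 R, fluxDensity M ρ qbar X u u (ζ x) (tgrad M ζ x) x ∂κ =
      ∫ x in Metric.ball 0 b,
        fluxDensity M ρ qbar X u (fun y => u y - φ y) (ζ x) (tgrad M ζ x) x ∂κ := by
    have e3 : ∫ x in Metric.ball 0 b,
        fluxDensity M ρ qbar X u (fun y => u y - φ y) (ζ x) (tgrad M ζ x) x ∂κ =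
        ∫ x in Metric.ball 0 b, (fluxDensity M ρ qbar X u u (ζ x) (tgrad M ζ x) x -
          fluxDensity M ρ qbar X u φ (ζ x) (tgrad M ζ x) x) ∂κ := by
      refine integral_congr_ae ?_
      filter_upwards [ae_restrict_of_ae (ae_mem_weightMeasure h.measurableSet),
        ae_restrict_mem hBm] with x hx hxb
      exact h.fluxDensity_sub ⟨hx, hbR' hxb⟩ (hφ.differentiableWithinAt hx)
    rw [e3, integral_sub (hint.mono_set hbR') hφint.integrableOn, e1, sub_zero]
    exact setIntegral_eq_of_subset_of_forall_sdiff_eq_zero hB.measurableSet hbR'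
      fun x hx => hout u x hx.2
  rw [e2]
  have hEi := h.integrable.mono_set hbR'
  calc |∫ x in Metric.ball 0 b,
        fluxDensity M ρ qbar X u (fun y => u y - φ y) (ζ x) (tgrad M ζ x) x ∂κ|
      ≤ ∫ x in Metric.ball 0 b, 7 * c * (τ * energy M ρ P u x +
          energy M ρ P (fun y => u y - φ y) x / τ) ∂κ := by
        rw [← Real.norm_eq_abs]
        refine norm_integral_le_of_norm_le
          (((hEi.const_mul τ).add (hφi.div_const τ)).const_mul _) ?_
        filter_upwards [ae_restrict_of_ae (ae_mem_weightMeasure h.measurableSet)] with x hx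
        refine (h.abs_fluxDensity_le u _ hx (hcζ M x).1 (hcζ M x).2).trans ?_
        have h1 := mul_le_amgm (s := √(energy M ρ P u x))
          (t := √(energy M ρ P (fun y => u y - φ y) x)) hτ
        rw [Real.sq_sqrt (energy_nonneg (h.P_pos x hx).le),
          Real.sq_sqrt (energy_nonneg (h.P_pos x hx).le)] at h1
        exact mul_le_mul_of_nonneg_left h1 (by positivity)
    _ = 7 * c * (τ * ∫ x in Metric.ball 0 b, energy M ρ P u x ∂κ +
          (∫ x in Metric.ball 0 b, energy M ρ P (fun y => u y - φ y) x ∂κ) / τ) := by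
        rw [integral_const_mul, integral_add (hEi.const_mul τ) (hφi.div_const τ),
          integral_const_mul, integral_div]
    _ ≤ 7 * c * (τ * (∫ x in Metric.ball 0 R, energy M ρ P u x ∂κ) + δ / τ) := by
        gcongr
        exacts [(ae_restrict_of_ae (ae_mem_weightMeasure h.measurableSet)).mono
          fun x hx => energy_nonneg (h.P_pos x hx).le, h.integrable]

end CriticalData

section TestFunctions

variable {n : ℕ} {M U : Set (Euc n)} {f g : Euc n → ℝ} {x : Euc n}

theorem IsTestFunction.eq_zero_of_notMem (hf : IsTestFunction M U f) (hx : x ∈ M) (hxU : x ∉ U) :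
    f x = 0 ∧ tgrad M f x = 0 := by
  obtain ⟨-, K, hK, hKM, h0⟩ := hf
  have hxK : x ∉ K := fun hh => hxU (hKM hh).2
  exact ⟨h0 x ⟨hx, hxK⟩, tgrad_eq_zero_of_compact hK h0 ⟨hx, hxK⟩⟩

theorem tgrad_const_mul (hf : DifferentiableWithinAt ℝ f M x) (c : ℝ) :
    tgrad M (fun y => c * f y) x = c • tgrad M f x := by
  have h1 : HasDerivAt (fun t : ℝ => c * t) c (f x) := by
    simpa using (hasDerivAt_id (f x)).const_mul c
  exact tgrad_comp h1 hf

theorem exists_smooth_cutoff (n : ℕ) {r r' : ℝ} (hr : 0 < r) (hrr : r < r') :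
    ∃ χ : Euc n → ℝ, ContDiff ℝ ∞ χ ∧ HasCompactSupport χ ∧ tsupport χ ⊆ Metric.ball 0 r' ∧
      ∀ x ∈ Metric.ball 0 r, χ x = 1 := by
  let b : ContDiffBump (0 : Euc n) := ⟨r, (r + r') / 2, hr, by linarith⟩
  refine ⟨b, b.contDiff, b.hasCompactSupport, ?_, fun x hx => ?_⟩
  · rw [b.tsupport_eq]
    exact Metric.closedBall_subset_ball (by change (r + r') / 2 < r'; linarith)
  · exact b.one_of_mem_closedBall (Metric.ball_subset_closedBall hx)

theorem energy_cutoff_mul_le {ρ P ζ : Euc n → ℝ} {c : ℝ} (hP : 0 ≤ P x)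
    (hζ : DifferentiableWithinAt ℝ ζ M x) (hf : DifferentiableWithinAt ℝ f M x)
    (hc : |ζ x| ≤ c) (hc' : ‖tgrad M ζ x‖ ≤ c) :
    energy M ρ P (fun y => ζ y * f y) x ≤ 3 * c ^ 2 * energy M ρ P f x := by
  have h1 : ‖tgrad M (fun y => ζ y * f y) x‖ ≤ c * (‖tgrad M f x‖ + |f x|) := by
    rw [tgrad_mul hζ hf]
    refine (norm_add_le _ _).trans ?_
    rw [norm_smul, norm_smul, Real.norm_eq_abs, Real.norm_eq_abs]
    have := mul_le_mul_of_nonneg_right hc (norm_nonneg (tgrad M f x))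
    have := mul_le_mul_of_nonneg_left hc' (abs_nonneg (f x))
    linarith
  have h2 : ‖tgrad M (fun y => ζ y * f y) x‖ ^ 2 ≤ c ^ 2 * (2 * ‖tgrad M f x‖ ^ 2 + 2 * f x ^ 2) := by
    refine (pow_le_pow_left₀ (norm_nonneg _) h1 2).trans ?_
    rw [mul_pow, ← sq_abs (f x)]
    refine mul_le_mul_of_nonneg_left ?_ (sq_nonneg c)
    nlinarith [sq_nonneg (‖tgrad M f x‖ - |f x|)]
  have h3 : ζ x ^ 2 ≤ c ^ 2 := by
    rw [← sq_abs]; exact pow_le_pow_left₀ (abs_nonneg _) hc 2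
  rw [energy, energy]
  set B := ‖tgrad M (fun y => Real.log (ρ y)) x‖ ^ 2
  have hB : 0 ≤ B := sq_nonneg _
  have h4 : (1 + B + P x) * (ζ x * f x) ^ 2 ≤ c ^ 2 * ((1 + B + P x) * f x ^ 2) := by
    rw [mul_pow]
    have : 0 ≤ (1 + B + P x) * f x ^ 2 := by positivity
    nlinarith [mul_le_mul_of_nonneg_right h3 this]
  have h5 : c ^ 2 * f x ^ 2 ≤ c ^ 2 * ((1 + B + P x) * f x ^ 2) := by
    refine mul_le_mul_of_nonneg_left ?_ (sq_nonneg c)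
    nlinarith [mul_nonneg (add_nonneg hB hP) (sq_nonneg (f x))]
  nlinarith [mul_nonneg (sq_nonneg c) (sq_nonneg ‖tgrad M f x‖)]

theorem energy_sub_le {ρ P : Euc n → ℝ} (hP : 0 ≤ P x)
    (hf : DifferentiableWithinAt ℝ f M x) (hg : DifferentiableWithinAt ℝ g M x) :
    energy M ρ P (fun y => f y - g y) x ≤ 2 * energy M ρ P f x + 2 * energy M ρ P g x := by
  have h1 : ‖tgrad M (fun y => f y - g y) x‖ ^ 2 ≤ 2 * ‖tgrad M f x‖ ^ 2 + 2 * ‖tgrad M g x‖ ^ 2 := by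
    rw [tgrad_sub hf hg]
    have := pow_le_pow_left₀ (norm_nonneg _) (norm_sub_le (tgrad M f x) (tgrad M g x)) 2
    nlinarith [sq_nonneg (‖tgrad M f x‖ - ‖tgrad M g x‖)]
  rw [energy, energy, energy]
  set B := ‖tgrad M (fun y => Real.log (ρ y)) x‖ ^ 2
  have hB : 0 ≤ B := sq_nonneg _
  have h2 : (f x - g x) ^ 2 ≤ 2 * f x ^ 2 + 2 * g x ^ 2 := by nlinarith [sq_nonneg (f x + g x)]
  have h3 : 0 ≤ 1 + B + P x := by positivity
  nlinarith [mul_le_mul_of_nonneg_left h2 h3]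

end TestFunctions

/-! ### The quadratic form on test functions: energy bound, positivity, Cauchy-Schwarz. -/

namespace ConeData

variable {n m : ℕ} {M : Set (Euc n)} {ρ : Euc n → ℝ} {p : ℝ} {q : Euc n → ℝ}
    {X : Euc n → Euc n} {qbar P : Euc n → ℝ} (h : ConeData m M ρ p q X qbar P)

include h

theorem ae_mem : ∀ᵐ x ∂(weightMeasure (m + 1) M ρ), x ∈ M := ae_mem_weightMeasure h.measurableSet

theorem formQ_add_mul_self {U : Set (Euc n)} (hU : IsOpen U) {f g : Euc n → ℝ}
    (hf : IsTestFunction M U f) (hg : IsTestFunction M U g) (t : ℝ) :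
    formQ m M ρ q (fun x => f x + t * g x) (fun x => f x + t * g x) =
      formQ m M ρ q g g * (t * t) + 2 * formQ m M ρ q f g * t + formQ m M ρ q f f := by
  have i1 := h.integrable_formQ hU (hf.1.mono inter_subset_left) hf
  have i2 := h.integrable_formQ hU (hf.1.mono inter_subset_left) hg
  have i3 := h.integrable_formQ hU (hg.1.mono inter_subset_left) hg
  have e : formQ m M ρ q g g * (t * t) + 2 * formQ m M ρ q f g * t + formQ m M ρ q f f =
      t * t * formQ m M ρ q g g + 2 * t * formQ m M ρ q f g + formQ m M ρ q f f := by ring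
  have i4 : Integrable (fun x => t * t * (inner ℝ (tgrad M g x) (tgrad M g x) - q x * g x * g x) +
      2 * t * (inner ℝ (tgrad M f x) (tgrad M g x) - q x * f x * g x)) (weightMeasure (m + 1) M ρ) :=
    (i3.const_mul _).add (i2.const_mul _)
  rw [e, formQ, formQ, formQ, formQ, ← integral_const_mul, ← integral_const_mul,
    ← integral_add (i3.const_mul _) (i2.const_mul _), ← integral_add i4 i1]
  refine integral_congr_ae ?_
  filter_upwards [h.ae_mem] with x hx
  have d1 := hf.differentiableWithinAt hx
  have d2 := hg.differentiableWithinAt hx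
  rw [tgrad_add d1 (d2.const_mul t), tgrad_const_mul d2]
  simp only [inner_add_left, inner_add_right, inner_smul_left, inner_smul_right,
    real_inner_comm (tgrad M f x) (tgrad M g x), conj_trivial]
  ring

theorem formQ_sub_left {U : Set (Euc n)} (hU : IsOpen U) {f f' g : Euc n → ℝ}
    (hf : ContDiffOn ℝ ∞ f (M ∩ U)) (hf' : ContDiffOn ℝ ∞ f' (M ∩ U)) (hg : IsTestFunction M U g) :
    formQ m M ρ q (fun x => f x - f' x) g = formQ m M ρ q f g - formQ m M ρ q f' g := by
  rw [formQ, formQ, formQ, ← integral_sub (h.integrable_formQ hU hf hg)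
    (h.integrable_formQ hU hf' hg)]
  refine integral_congr_ae ?_
  filter_upwards [h.ae_mem] with x hx
  by_cases hxU : x ∈ U
  · rw [tgrad_sub (differentiableWithinAt_of_contDiffOn_inter hU
      (hf.of_le (by exact_mod_cast le_top)) ⟨hx, hxU⟩) (differentiableWithinAt_of_contDiffOn_inter hU
      (hf'.of_le (by exact_mod_cast le_top)) ⟨hx, hxU⟩), inner_sub_left]
    ring
  · obtain ⟨h1, h2⟩ := hg.eq_zero_of_notMem hx hxU
    rw [h1, h2]; simp

theorem formQ_congr_left {U : Set (Euc n)} (hU : IsOpen U) {f f' g : Euc n → ℝ}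
    (hff : ∀ x ∈ U, f x = f' x) (hg : IsTestFunction M U g) :
    formQ m M ρ q f g = formQ m M ρ q f' g := by
  refine integral_congr_ae ?_
  filter_upwards [h.ae_mem] with x hx
  by_cases hxU : x ∈ U
  · rw [hff x hxU, tgrad_congr ?_ (hff x hxU)]
    filter_upwards [mem_nhdsWithin_of_mem_nhds (hU.mem_nhds hxU)] with y hy using hff y hy
  · obtain ⟨h1, h2⟩ := hg.eq_zero_of_notMem hx hxU
    rw [h1, h2]; simp

/-- The form is bounded by the energy. -/
theorem formQ_cutoff_le {ζ : Euc n → ℝ} (hζ : ContDiff ℝ ∞ ζ) {c b : ℝ}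
    (hc : ∀ x, |ζ x| ≤ c ∧ ‖tgrad M ζ x‖ ≤ c) (hb : tsupport ζ ⊆ Metric.ball 0 b)
    {f F : Euc n → ℝ} (hf : IsTestFunction M univ f)
    (hF : IntegrableOn F (Metric.ball 0 b) (weightMeasure (m + 1) M ρ))
    (hle : ∀ x ∈ M ∩ Metric.ball 0 b, energy M ρ P f x ≤ F x) :
    formQ m M ρ q (fun x => ζ x * f x) (fun x => ζ x * f x) ≤
      21 * c ^ 2 * ∫ x in Metric.ball 0 b, F x ∂(weightMeasure (m + 1) M ρ) := by
  have hg : IsTestFunction M (Metric.ball 0 b) fun x => ζ x * f x := by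
    simpa using hf.cutoff_mul hζ hb
  set g : Euc n → ℝ := fun x => ζ x * f x
  have hB := Metric.isOpen_ball (x := (0 : Euc n)) (ε := b)
  have hg2 : IsTestFunction M (Metric.ball 0 b) fun x => g x * g x :=
    hg.mul hB (hg.1.mono inter_subset_left)
  have i1 : Integrable (fun x => inner ℝ (tgrad M g x) (tgrad M g x)) (weightMeasure (m + 1) M ρ) := by
    refine h.integrable_test hg ?_ fun x _ h1 h2 => by rw [h2]; simp
    exact (h.continuousOn_tgrad hB (hg.1.mono inter_subset_left)).inner
      (h.continuousOn_tgrad hB (hg.1.mono inter_subset_left))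
  have i2 : Integrable (fun x => q x * (g x * g x)) (weightMeasure (m + 1) M ρ) :=
    h.integrable_test hg2 ((h.q_smooth.continuousOn.mul hg2.1.continuousOn).mono inter_subset_left)
      fun x _ h1 _ => by rw [h1, mul_zero]
  -- Integrating `div X` by parts expresses the form through the flux density with cutoff constantly
  -- `1`, in which no derivative of `X` is left.
  have e1 : formQ m M ρ q g g = ∫ x, fluxDensity M ρ qbar X g g 1 0 x ∂(weightMeasure (m + 1) M ρ) := by
    have e2 : formQ m M ρ q g g = ∫ x, (inner ℝ (tgrad M g x) (tgrad M g x) - q x * (g x * g x))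
        ∂(weightMeasure (m + 1) M ρ) :=
      integral_congr_ae (ae_of_all _ fun x => by simp only; ring)
    rw [e2, integral_sub i1 i2, h.integral_q_mul_test hg2, ← integral_sub i1 (h.integrable_parts hg2)]
    refine integral_congr_ae ?_
    filter_upwards [h.ae_mem] with x hx
    rw [tgrad_mul (hg.differentiableWithinAt hx) (hg.differentiableWithinAt hx), fluxDensity]
    simp only [inner_zero_right, one_mul, smul_zero, add_zero, mul_zero]
    ring
  have hint : Integrable (fun x => fluxDensity M ρ qbar X g g 1 0 x) (weightMeasure (m + 1) M ρ) := by
    refine (i1.sub (h.integrable_parts hg2)).congr ?_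
    filter_upwards [h.ae_mem] with x hx
    simp only [Pi.sub_apply]
    rw [tgrad_mul (hg.differentiableWithinAt hx) (hg.differentiableWithinAt hx), fluxDensity]
    simp only [inner_zero_right, one_mul, smul_zero, add_zero, mul_zero]
    ring
  have e3 : ∫ x, fluxDensity M ρ qbar X g g 1 0 x ∂(weightMeasure (m + 1) M ρ) =
      ∫ x in Metric.ball 0 b, fluxDensity M ρ qbar X g g 1 0 x ∂(weightMeasure (m + 1) M ρ) := by
    rw [← integral_indicator hB.measurableSet]
    refine integral_congr_ae ?_
    filter_upwards [h.ae_mem] with x hx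
    by_cases hxb : x ∈ Metric.ball (0 : Euc n) b
    · rw [indicator_of_mem hxb]
    · rw [indicator_of_notMem hxb]
      obtain ⟨h1, h2⟩ := hg.eq_zero_of_notMem hx hxb
      rw [fluxDensity, h1, h2]; simp
  -- The constant is `7 · 3c²`: seven terms of the flux density, and `3c²` for the energy of a
  -- product with the cutoff.
  rw [e1, e3, ← integral_const_mul]
  refine integral_mono_ae hint.integrableOn (hF.const_mul _) ?_
  filter_upwards [ae_restrict_of_ae h.ae_mem, ae_restrict_mem hB.measurableSet] with x hx hxb
  have hP := (h.P_pos x hx).le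
  have h1 := h.abs_fluxDensity_le g g hx (z := 1) (w := 0) (c := 1) (by simp) (by simp)
  rw [Real.mul_self_sqrt (energy_nonneg hP)] at h1
  have h2 : energy M ρ P g x ≤ 3 * c ^ 2 * energy M ρ P f x :=
    energy_cutoff_mul_le hP (hζ.differentiable (by simp) x).differentiableWithinAt
      (hf.differentiableWithinAt hx) (hc x).1 (hc x).2
  have h3 := mul_le_mul_of_nonneg_left (hle x ⟨hx, hxb⟩) (sq_nonneg c)
  have h4 := le_abs_self (fluxDensity M ρ qbar X g g 1 0 x)
  linarith

end ConeData

namespace CriticalData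

variable {n m : ℕ} {M : Set (Euc n)} {ρ : Euc n → ℝ} {p : ℝ} {q : Euc n → ℝ}
    {X : Euc n → Euc n} {qbar P : Euc n → ℝ} {R : ℝ} {u : Euc n → ℝ}
    (h : CriticalData m M ρ p q X qbar P R u)

include h

/-- A positive critical point is stable. -/
theorem formQ_self_nonneg {f : Euc n → ℝ} (hf : IsTestFunction M (Metric.ball 0 R) f) :
    0 ≤ formQ m M ρ q f f := by
  have hB := Metric.isOpen_ball (x := (0 : Euc n)) (ε := R)
  have hw : ContDiffOn ℝ ∞ (fun x => f x / u x) (M ∩ Metric.ball 0 R) :=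
    (hf.1.mono inter_subset_left).div h.u_smooth fun x hx => (h.u_pos x hx).ne'
  -- Testing the equation of `u` with `f² / u` removes the potential. What remains of the integrand
  -- is the square `|∇f - (f / u) ∇u|²`.
  have hg : IsTestFunction M (Metric.ball 0 R) fun x => f x / u x * f x := hf.mul hB hw
  have hsub : formQ m M ρ q f f = formQ m M ρ q f f - formQ m M ρ q u fun x => f x / u x * f x := by
    rw [h.crit _ hg, sub_zero]
  rw [hsub, formQ, formQ, ← integral_sub
    (h.integrable_formQ hB (hf.1.mono inter_subset_left) hf) (h.integrable_formQ hB h.u_smooth hg)]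
  refine integral_nonneg_of_ae ?_
  filter_upwards [h.ae_mem] with x hx
  simp only [Pi.zero_apply]
  by_cases hxR : x ∈ Metric.ball (0 : Euc n) R
  · have hu := (h.u_pos x ⟨hx, hxR⟩).ne'
    have d1 := h.differentiableWithinAt ⟨hx, hxR⟩
    have d2 := hf.differentiableWithinAt hx
    have e1 := tgrad_div d2 d1 hu
    have e2 : tgrad M (fun y => f y / u y) x =
        (u x)⁻¹ • (tgrad M f x - (f x / u x) • tgrad M u x) := by
      rw [← e1, inv_smul_smul₀ hu]
    have d3 : DifferentiableWithinAt ℝ (fun y => f y / u y) M x := by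
      simp only [div_eq_mul_inv]
      exact d2.mul (d1.inv hu)
    rw [tgrad_mul d3 d2, e2]
    have e3 : inner ℝ (tgrad M f x - (f x / u x) • tgrad M u x)
        (tgrad M f x - (f x / u x) • tgrad M u x) = inner ℝ (tgrad M f x) (tgrad M f x) -
        q x * f x * f x - (inner ℝ (tgrad M u x) ((f x / u x) • tgrad M f x +
          f x • (u x)⁻¹ • (tgrad M f x - (f x / u x) • tgrad M u x)) -
            q x * u x * (f x / u x * f x)) := by
      simp only [inner_sub_left, inner_sub_right, inner_add_right, inner_smul_left, inner_smul_right,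
        real_inner_comm (tgrad M f x) (tgrad M u x), conj_trivial]
      field_simp
      ring
    rw [← e3]
    exact real_inner_self_nonneg
  · obtain ⟨h1, h2⟩ := hf.eq_zero_of_notMem hx hxR
    obtain ⟨h1', h2'⟩ := hg.eq_zero_of_notMem hx hxR
    rw [h1', h2', h1, h2]; simp

/-- The discriminant of the nonnegative quadratic polynomial `t ↦ Q(f + t g, f + t g)`. -/
theorem sq_formQ_le_mul {f g : Euc n → ℝ} (hf : IsTestFunction M (Metric.ball 0 R) f)
    (hg : IsTestFunction M (Metric.ball 0 R) g) :
    formQ m M ρ q f g ^ 2 ≤ formQ m M ρ q f f * formQ m M ρ q g g := by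
  have h1 := discrim_le_zero (a := formQ m M ρ q g g) (b := 2 * formQ m M ρ q f g)
    (c := formQ m M ρ q f f) fun t => by
      rw [← h.formQ_add_mul_self Metric.isOpen_ball hf hg t]
      exact h.formQ_self_nonneg (hf.add (hg.const_mul t))
  rw [discrim] at h1
  linarith

/-- Test functions close to `u` are almost critical, with respect to the form itself. -/
theorem exists_sq_formQ_le {r r' : ℝ} (hr : 0 < r) (hrr : r < r') (hrR : r' < R) :
    ∃ C : ℝ, 0 < C ∧ ∀ φ, IsTestFunction M univ φ →
      IntegrableOn (energy M ρ P fun x => u x - φ x) (Metric.ball 0 r') (weightMeasure (m + 1) M ρ) →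
      ∀ g, IsTestFunction M (Metric.ball 0 r) g →
        formQ m M ρ q φ g ^ 2 ≤ C * (∫ x in Metric.ball 0 r', energy M ρ P (fun x => u x - φ x) x
          ∂(weightMeasure (m + 1) M ρ)) * formQ m M ρ q g g := by
  set κ := weightMeasure (m + 1) M ρ with hκ
  obtain ⟨χ, hχ, hχc, hχr, hχ1⟩ := exists_smooth_cutoff n hr hrr
  obtain ⟨c, hc0, hc⟩ := exists_bound_cutoff hχ hχc
  refine ⟨42 * c ^ 2, by positivity, fun φ hφ hφi g hg => ?_⟩
  have hBr := Metric.isOpen_ball (x := (0 : Euc n)) (ε := r)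
  have hB := Metric.isOpen_ball (x := (0 : Euc n)) (ε := r')
  have hsub : Metric.ball (0 : Euc n) r' ⊆ Metric.ball 0 R := Metric.ball_subset_ball hrR.le
  have hsub' : Metric.ball (0 : Euc n) r ⊆ Metric.ball 0 r' := Metric.ball_subset_ball hrr.le
  have hgR : IsTestFunction M (Metric.ball 0 R) g := hg.mono (hsub'.trans hsub)
  have hQg := h.formQ_self_nonneg hgR
  set E := ∫ x in Metric.ball 0 r', energy M ρ P (fun x => u x - φ x) x ∂κ
  set G : ℝ := ∫ x in Metric.ball 0 r', (‖tgrad M g x‖ + |q x * g x|) ^ 2 ∂κ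
  have hGi : Integrable (fun x => (‖tgrad M g x‖ + |q x * g x|) ^ 2) κ := by
    refine h.integrable_test hg ?_ fun x _ h1 h2 => by rw [h1, h2]; simp
    exact ((h.continuousOn_tgrad hBr (hg.1.mono inter_subset_left)).norm.add
      ((h.q_smooth.continuousOn.mul hg.1.continuousOn).mono inter_subset_left).abs).pow 2
  -- A second, much better approximation `φ'` of `u` is inserted. The pairing of `g` with `φ - φ'`
  -- is estimated by Cauchy-Schwarz for the form, the one with `φ'` by criticality of `u`.
  have key : ∀ τ > 0, |formQ m M ρ q φ g| ≤
      √(42 * c ^ 2 * (E + τ ^ 2) * formQ m M ρ q g g) + (τ * G + τ) := by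
    intro τ hτ
    obtain ⟨φ', hφ', hφi', hδ⟩ := h.dom r' hrR (τ ^ 2) (pow_pos hτ 2)
    -- Positivity of the form is known only inside `B_R`, hence the cutoff `χ`. It equals `1` on the
    -- ball containing the support of `g`, so it does not change the pairing.
    have hd := hφ.sub hφ'
    have hf : IsTestFunction M (Metric.ball 0 R) fun x => χ x * (φ x - φ' x) := by
      simpa using hd.cutoff_mul hχ (hχr.trans hsub)
    -- The constant is `21 · 2`: the energy of `φ - φ' = (u - φ') - (u - φ)` is at most twice the
    -- sum of the two energies.
    have h1 : formQ m M ρ q (fun x => χ x * (φ x - φ' x)) (fun x => χ x * (φ x - φ' x)) ≤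
        42 * c ^ 2 * (E + τ ^ 2) := by
      have := h.formQ_cutoff_le hχ (fun x => hc M x) hχr hd
        ((hφi'.const_mul 2).add (hφi.const_mul 2)) fun x hx => by
          have d1 := h.differentiableWithinAt ⟨hx.1, hsub hx.2⟩
          have := energy_sub_le (ρ := ρ) (h.P_pos x hx.1).le
            (d1.sub (hφ'.differentiableWithinAt hx.1)) (d1.sub (hφ.differentiableWithinAt hx.1))
          have e : (fun y => φ y - φ' y) = fun y => (u y - φ' y) - (u y - φ y) := by
            funext y; ring
          rw [e]
          exact this
      refine this.trans ?_
      simp only [Pi.add_apply]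
      rw [integral_add (hφi'.const_mul 2) (hφi.const_mul 2), integral_const_mul, integral_const_mul]
      nlinarith [mul_le_mul_of_nonneg_left hδ.le (sq_nonneg c)]
    have h2 := h.sq_formQ_le_mul hf hgR
    have h3 : formQ m M ρ q (fun x => χ x * (φ x - φ' x)) g =
        formQ m M ρ q φ g - formQ m M ρ q φ' g := by
      rw [← h.formQ_sub_left hBr (hφ.1.mono inter_subset_left) (hφ'.1.mono inter_subset_left) hg]
      exact h.formQ_congr_left hBr (fun x hx => by rw [hχ1 x hx, one_mul]) hg
    have h4 : |formQ m M ρ q (fun x => χ x * (φ x - φ' x)) g| ≤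
        √(42 * c ^ 2 * (E + τ ^ 2) * formQ m M ρ q g g) := by
      refine Real.abs_le_sqrt (h2.trans ?_)
      exact mul_le_mul_of_nonneg_right h1 hQg
    -- Here the estimate is crude and depends on `q` and `g` through `G`. This is harmless, since
    -- `φ'` may be taken arbitrarily close to `u` for fixed `g`, and `G` disappears as `τ → 0`.
    have h5 : |formQ m M ρ q φ' g| ≤ τ * G + τ := by
      have e1 : formQ m M ρ q (fun x => u x - φ' x) g = - formQ m M ρ q φ' g := by
        rw [h.formQ_sub_left Metric.isOpen_ball h.u_smooth (hφ'.1.mono inter_subset_left) hgR,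
          h.crit g hgR, zero_sub]
      have hFi : IntegrableOn (fun x => τ * (‖tgrad M g x‖ + |q x * g x|) ^ 2 +
          energy M ρ P (fun y => u y - φ' y) x / τ) (Metric.ball 0 r') κ :=
        (hGi.integrableOn.const_mul τ).add (hφi'.div_const τ)
      have e2 : formQ m M ρ q (fun x => u x - φ' x) g = ∫ x in Metric.ball 0 r',
          (inner ℝ (tgrad M (fun x => u x - φ' x) x) (tgrad M g x) -
            q x * (u x - φ' x) * g x) ∂κ := by
        rw [formQ, ← hκ, ← integral_indicator hB.measurableSet]
        refine integral_congr_ae ?_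
        filter_upwards [h.ae_mem] with x hx
        by_cases hxb : x ∈ Metric.ball (0 : Euc n) r'
        · rw [indicator_of_mem hxb]
        · rw [indicator_of_notMem hxb]
          obtain ⟨h1, h2⟩ := hg.eq_zero_of_notMem hx fun hh => hxb (hsub' hh)
          rw [h1, h2]; simp
      rw [← abs_neg, ← e1, e2]
      calc _ ≤ ∫ x in Metric.ball 0 r', (τ * (‖tgrad M g x‖ + |q x * g x|) ^ 2 +
          energy M ρ P (fun y => u y - φ' y) x / τ) ∂κ := by
            rw [← Real.norm_eq_abs]
            refine norm_integral_le_of_norm_le hFi ?_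
            filter_upwards [ae_restrict_of_ae h.ae_mem] with x hx
            have hP := (h.P_pos x hx).le
            set e := √(energy M ρ P (fun y => u y - φ' y) x)
            have a1 : ‖tgrad M (fun y => u y - φ' y) x‖ ≤ e := norm_tgrad_le_sqrt_energy hP
            have a2 : |u x - φ' x| ≤ e := abs_le_sqrt_energy (f := fun y => u y - φ' y) hP
            have h6 := mul_le_amgm (s := ‖tgrad M g x‖ + |q x * g x|) (t := e) hτ
            rw [Real.sq_sqrt (energy_nonneg hP)] at h6
            refine le_trans ?_ h6
            refine (norm_sub_le _ _).trans ?_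
            rw [Real.norm_eq_abs, Real.norm_eq_abs, add_mul]
            refine add_le_add ?_ ?_
            · refine (abs_real_inner_le_norm _ _).trans ?_
              rw [mul_comm]
              exact mul_le_mul_of_nonneg_left a1 (norm_nonneg _)
            · have : |q x * (u x - φ' x) * g x| = |q x * g x| * |u x - φ' x| := by
                rw [← abs_mul]; congr 1; ring
              rw [this]
              exact mul_le_mul_of_nonneg_left a2 (abs_nonneg _)
        _ = τ * G + (∫ x in Metric.ball 0 r', energy M ρ P (fun y => u y - φ' y) x ∂κ) / τ := by
            rw [integral_add (hGi.integrableOn.const_mul τ) (hφi'.div_const τ), integral_const_mul,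
              integral_div]
        _ ≤ τ * G + τ := by
            have : (∫ x in Metric.ball 0 r', energy M ρ P (fun y => u y - φ' y) x ∂κ) / τ ≤ τ := by
              rw [div_le_iff₀ hτ, ← pow_two]; exact hδ.le
            linarith
    have h6 : formQ m M ρ q φ g = formQ m M ρ q (fun x => χ x * (φ x - φ' x)) g +
        formQ m M ρ q φ' g := by rw [h3]; ring
    rw [h6]
    exact (abs_add_le _ _).trans (add_le_add h4 h5)
  have hE : 0 ≤ E := integral_nonneg_of_ae ((ae_restrict_of_ae h.ae_mem).mono
    fun x hx => energy_nonneg (h.P_pos x hx).le)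
  have h7 : |formQ m M ρ q φ g| ≤ √(42 * c ^ 2 * (E + 0 ^ 2) * formQ m M ρ q g g) + (0 * G + 0) := by
    have hcont : Continuous fun τ : ℝ =>
      √(42 * c ^ 2 * (E + τ ^ 2) * formQ m M ρ q g g) + (τ * G + τ) := by fun_prop
    refine ge_of_tendsto ((hcont.tendsto 0).mono_left (nhdsWithin_le_nhds (s := Ioi 0))) ?_
    filter_upwards [self_mem_nhdsWithin] with τ hτ using key τ hτ
  have h8 := pow_le_pow_left₀ (abs_nonneg _) h7 2
  rw [sq_abs, zero_mul, add_zero, add_zero, Real.sq_sqrt (by positivity)] at h8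
  simpa using h8

end CriticalData

theorem IsTestFunction.comp_smul {n : ℕ} {M U V : Set (Euc n)} {f : Euc n → ℝ} {l : ℝ}
    (hf : IsTestFunction M U f) (hM : IsCone M) (hl : 0 < l) (hV : ∀ x, l • x ∈ U → x ∈ V) :
    IsTestFunction M V fun x => f (l • x) := by
  obtain ⟨h1, K, hK, hKM, h0⟩ := hf
  refine ⟨h1.comp (contDiff_const_smul l).contDiffOn fun x hx => hM x hx l hl,
    (fun x => l⁻¹ • x) '' K, hK.image (continuous_const_smul l⁻¹), ?_, fun x hx => ?_⟩
  · rintro _ ⟨x, hx, rfl⟩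
    refine ⟨hM x (hKM hx).1 _ (inv_pos.2 hl), hV _ ?_⟩
    rw [smul_inv_smul₀ hl.ne']; exact (hKM hx).2
  · refine h0 _ ⟨hM x hx.1 l hl, fun hxK => hx.2 ⟨l • x, hxK, inv_smul_smul₀ hl.ne' x⟩⟩

theorem smul_mem_ball_iff {n : ℕ} {l r : ℝ} (hl : 0 < l) {x : Euc n} :
    l • x ∈ Metric.ball (0 : Euc n) (l * r) ↔ x ∈ Metric.ball (0 : Euc n) r := by
  rw [mem_ball_zero_iff, mem_ball_zero_iff, norm_smul, Real.norm_eq_abs, abs_of_pos hl,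
    mul_lt_mul_iff_right₀ hl]

/-! ### Dilations of the form and the Wronskian of `u` with its dilations. -/

namespace ConeData

variable {n m : ℕ} {M : Set (Euc n)} {ρ : Euc n → ℝ} {p : ℝ} {q : Euc n → ℝ}
    {X : Euc n → Euc n} {qbar P : Euc n → ℝ} (h : ConeData m M ρ p q X qbar P)

include h

theorem setIntegral_comp_smul {l r : ℝ} (hl : 0 < l) (F : Euc n → ℝ) :
    ∫ x in Metric.ball 0 r, F (l • x) ∂(weightMeasure (m + 1) M ρ) =
      (l ^ ((m : ℝ) + 1 + p))⁻¹ * ∫ x in Metric.ball 0 (l * r), F x ∂(weightMeasure (m + 1) M ρ) := by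
  rw [← integral_indicator Metric.isOpen_ball.measurableSet,
    ← integral_indicator Metric.isOpen_ball.measurableSet, ← h.integral_comp_smul hl]
  congr 1
  funext x
  by_cases hx : x ∈ Metric.ball (0 : Euc n) r
  · rw [indicator_of_mem hx, indicator_of_mem ((smul_mem_ball_iff hl).2 hx)]
  · rw [indicator_of_notMem hx, indicator_of_notMem fun hh => hx ((smul_mem_ball_iff hl).1 hh)]

theorem integrableOn_comp_smul {l r : ℝ} (hl : 0 < l) {F : Euc n → ℝ}
    (hF : IntegrableOn F (Metric.ball 0 (l * r)) (weightMeasure (m + 1) M ρ)) :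
    IntegrableOn (fun x => F (l • x)) (Metric.ball 0 r) (weightMeasure (m + 1) M ρ) := by
  rw [← integrable_indicator_iff Metric.isOpen_ball.measurableSet] at hF ⊢
  refine ((h.integrable_comp_smul hl).2 hF).congr (ae_of_all _ fun x => ?_)
  change (Metric.ball 0 (l * r)).indicator F (l • x) = _
  by_cases hx : x ∈ Metric.ball (0 : Euc n) r
  · rw [indicator_of_mem hx, indicator_of_mem ((smul_mem_ball_iff hl).2 hx)]
  · rw [indicator_of_notMem hx, indicator_of_notMem fun hh => hx ((smul_mem_ball_iff hl).1 hh)]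

/-- The squared gradient and the potential both have degree `-2`, so a dilation changes the form
only by a constant factor. The form norm has no such property, as `P` is not assumed homogeneous. -/
theorem formQ_comp_smul {l : ℝ} (hl : 0 < l) {f g : Euc n → ℝ}
    (hf : ∀ x ∈ M, DifferentiableWithinAt ℝ f M x) (hg : ∀ x ∈ M, DifferentiableWithinAt ℝ g M x) :
    formQ m M ρ q (fun x => f (l • x)) (fun x => g (l • x)) =
      l ^ 2 * (l ^ ((m : ℝ) + 1 + p))⁻¹ * formQ m M ρ q f g := by
  rw [mul_assoc, formQ, formQ, ← h.integral_comp_smul hl, ← integral_const_mul]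
  refine integral_congr_ae ?_
  filter_upwards [h.ae_mem] with x hx
  have hlx := h.cone x hx l hl
  rw [h.cone.tgrad_comp_smul hl (hf _ hlx), h.cone.tgrad_comp_smul hl (hg _ hlx), h.q_hom x hx l hl,
    inner_smul_left, inner_smul_right, conj_trivial]
  field_simp

end ConeData

/-- The density `⟨g ∇f - f ∇g, w⟩`. -/
noncomputable def wronskian {n : ℕ} (M : Set (Euc n)) (f g : Euc n → ℝ) (w x : Euc n) : ℝ :=
  g x * inner ℝ (tgrad M f x) w - f x * inner ℝ (tgrad M g x) w

theorem abs_wronskian_le {n : ℕ} {M : Set (Euc n)} {f g : Euc n → ℝ} {w x : Euc n} {a b c : ℝ}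
    (hf : |f x| ≤ a) (hf' : ‖tgrad M f x‖ ≤ a) (hg : |g x| ≤ b) (hg' : ‖tgrad M g x‖ ≤ b)
    (hw : ‖w‖ ≤ c) : |wronskian M f g w x| ≤ 2 * c * (a * b) := by
  have ha : 0 ≤ a := (abs_nonneg _).trans hf
  have hb : 0 ≤ b := (abs_nonneg _).trans hg
  have aux : ∀ {s t : ℝ} {v : Euc n}, 0 ≤ t → |s| ≤ t → ∀ {t'}, ‖v‖ ≤ t' →
      |s * inner ℝ v w| ≤ t * (t' * c) := by
    intro s t v ht hs t' hv
    rw [abs_mul]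
    refine mul_le_mul hs ((abs_real_inner_le_norm v w).trans ?_) (abs_nonneg _) ht
    exact mul_le_mul hv hw (norm_nonneg _) ((norm_nonneg _).trans hv)
  have h1 := aux hb hg hf'
  have h2 := aux ha hf hg'
  rw [wronskian]
  refine (abs_sub _ _).trans ?_
  linarith

section Wronskian

variable {n : ℕ} {M : Set (Euc n)} {f f' g : Euc n → ℝ} {w x : Euc n}

theorem wronskian_sub_left (hf : DifferentiableWithinAt ℝ f M x)
    (hf' : DifferentiableWithinAt ℝ f' M x) :
    wronskian M (fun y => f y - f' y) g w x = wronskian M f g w x - wronskian M f' g w x := by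
  rw [wronskian, wronskian, wronskian, tgrad_sub hf hf', inner_sub_left]; ring

theorem wronskian_sub_right (hf : DifferentiableWithinAt ℝ f M x)
    (hf' : DifferentiableWithinAt ℝ f' M x) :
    wronskian M g (fun y => f y - f' y) w x = wronskian M g f w x - wronskian M g f' w x := by
  rw [wronskian, wronskian, wronskian, tgrad_sub hf hf', inner_sub_left]; ring

end Wronskian

namespace CriticalData

variable {n m : ℕ} {M : Set (Euc n)} {ρ : Euc n → ℝ} {p : ℝ} {q : Euc n → ℝ}
    {X : Euc n → Euc n} {qbar P : Euc n → ℝ} {R : ℝ} {u : Euc n → ℝ}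
    (h : CriticalData m M ρ p q X qbar P R u)

include h

theorem integral_energy_nonneg (f : Euc n → ℝ) (A : Set (Euc n)) :
    0 ≤ ∫ x in A, energy M ρ P f x ∂(weightMeasure (m + 1) M ρ) :=
  integral_nonneg_of_ae ((ae_restrict_of_ae h.ae_mem).mono
    fun x hx => energy_nonneg (h.P_pos x hx).le)

/-- The almost criticality of `φ` costs only `Q(g, g)` for `g = ζ φ' (l ·)`, not the form norm of
`g`. Undoing the dilation turns `g` into `ζ (l⁻¹ ·) φ'`, where the form is bounded by the energy of
`φ'`, and that is bounded in terms of `u`. -/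
theorem exists_sq_formQ_comp_smul_le {l r r' : ℝ} (hl : 0 < l) (hr : 0 < r) (hrr : r < r')
    (hlr : l * r ≤ r') (hrR : r' < R) {ζ : Euc n → ℝ} (hζ : ContDiff ℝ ∞ ζ)
    (hζc : HasCompactSupport ζ) (hζr : tsupport ζ ⊆ Metric.ball 0 r) :
    ∃ C : ℝ, 0 < C ∧ ∀ δ > 0, δ ≤ 1 → ∀ φ φ', IsTestFunction M univ φ → IsTestFunction M univ φ' →
      IntegrableOn (energy M ρ P fun x => u x - φ x) (Metric.ball 0 r') (weightMeasure (m + 1) M ρ) →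
      IntegrableOn (energy M ρ P fun x => u x - φ' x) (Metric.ball 0 r') (weightMeasure (m + 1) M ρ) →
      ∫ x in Metric.ball 0 r', energy M ρ P (fun x => u x - φ x) x
          ∂(weightMeasure (m + 1) M ρ) < δ →
      ∫ x in Metric.ball 0 r', energy M ρ P (fun x => u x - φ' x) x
          ∂(weightMeasure (m + 1) M ρ) < δ →
      formQ m M ρ q φ (fun x => ζ x * φ' (l • x)) ^ 2 ≤ C * δ := by
  set κ := weightMeasure (m + 1) M ρ
  obtain ⟨C, hC0, hC⟩ := h.exists_sq_formQ_le hr hrr hrR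
  have hli : 0 < l⁻¹ := inv_pos.2 hl
  have hζ' : ContDiff ℝ ∞ fun x => ζ (l⁻¹ • x) := hζ.comp (contDiff_const_smul l⁻¹)
  have hζc' : HasCompactSupport fun x => ζ (l⁻¹ • x) :=
    hζc.comp_homeomorph (Homeomorph.smulOfNeZero l⁻¹ hli.ne')
  have hζr' : tsupport (fun x => ζ (l⁻¹ • x)) ⊆ Metric.ball 0 r' := by
    intro x hx
    have h1 := hζr (tsupport_comp_subset_preimage ζ (continuous_const_smul l⁻¹) hx)
    rw [← smul_mem_ball_iff hl, smul_inv_smul₀ hl.ne'] at h1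
    exact Metric.ball_subset_ball hlr h1
  obtain ⟨c, hc0, hc⟩ := exists_bound_cutoff hζ' hζc'
  set D := ∫ x in Metric.ball 0 r', energy M ρ P u x ∂κ
  have hD : 0 ≤ D := h.integral_energy_nonneg u _
  have hS : 0 < l ^ 2 * (l ^ ((m : ℝ) + 1 + p))⁻¹ := by positivity
  have hsub : Metric.ball (0 : Euc n) r' ⊆ Metric.ball 0 R := Metric.ball_subset_ball hrR.le
  refine ⟨C * (l ^ 2 * (l ^ ((m : ℝ) + 1 + p))⁻¹ * (21 * c ^ 2 * (2 * D + 2))), by positivity,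
    fun δ hδ hδ1 φ φ' hφ hφ' hφi hφi' hφδ hφδ' => ?_⟩
  have hg : IsTestFunction M (Metric.ball 0 r) fun x => ζ x * φ' (l • x) := by
    simpa using (hφ'.comp_smul h.cone hl fun x _ => mem_univ x).cutoff_mul hζ hζr
  have hg' : IsTestFunction M univ fun x => ζ (l⁻¹ • x) * φ' x :=
    (by simpa using hφ'.cutoff_mul hζ' hζr' :
      IsTestFunction M (Metric.ball 0 r') fun x => ζ (l⁻¹ • x) * φ' x).mono (subset_univ _)
  have e1 : formQ m M ρ q (fun x => ζ x * φ' (l • x)) (fun x => ζ x * φ' (l • x)) =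
      l ^ 2 * (l ^ ((m : ℝ) + 1 + p))⁻¹ *
        formQ m M ρ q (fun x => ζ (l⁻¹ • x) * φ' x) (fun x => ζ (l⁻¹ • x) * φ' x) := by
    rw [← h.formQ_comp_smul hl (fun x hx => hg'.differentiableWithinAt hx)
      fun x hx => hg'.differentiableWithinAt hx]
    simp only [inv_smul_smul₀ hl.ne']
  have hui : IntegrableOn (energy M ρ P u) (Metric.ball 0 r') κ := h.integrable.mono_set hsub
  have e2 : formQ m M ρ q (fun x => ζ (l⁻¹ • x) * φ' x) (fun x => ζ (l⁻¹ • x) * φ' x) ≤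
      21 * c ^ 2 * (2 * D + 2) := by
    have := h.formQ_cutoff_le hζ' (fun x => hc M x) hζr' hφ'
      ((hui.const_mul 2).add (hφi'.const_mul 2)) fun x hx => by
        have d1 := h.differentiableWithinAt ⟨hx.1, hsub hx.2⟩
        have d2 : DifferentiableWithinAt ℝ (fun y => u y - φ' y) M x :=
          d1.sub (hφ'.differentiableWithinAt hx.1)
        have := energy_sub_le (ρ := ρ) (h.P_pos x hx.1).le d1 d2
        simp only [sub_sub_cancel] at this
        exact this
    refine this.trans ?_
    simp only [Pi.add_apply]
    rw [integral_add (hui.const_mul 2) (hφi'.const_mul 2), integral_const_mul, integral_const_mul]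
    exact mul_le_mul_of_nonneg_left (by linarith) (by positivity)
  have e3 := hC φ hφ hφi _ hg
  rw [e1] at e3
  refine e3.trans ?_
  have h0 := h.integral_energy_nonneg (fun x => u x - φ x) (Metric.ball 0 r')
  calc _ ≤ C * (∫ x in Metric.ball 0 r', energy M ρ P (fun x => u x - φ x) x ∂κ) *
        (l ^ 2 * (l ^ ((m : ℝ) + 1 + p))⁻¹ * (21 * c ^ 2 * (2 * D + 2))) := by
        refine mul_le_mul_of_nonneg_left (mul_le_mul_of_nonneg_left e2 hS.le) (by positivity)
    _ ≤ C * δ * (l ^ 2 * (l ^ ((m : ℝ) + 1 + p))⁻¹ * (21 * c ^ 2 * (2 * D + 2))) := by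
        gcongr
    _ = _ := by ring

theorem continuousOn_wronskian {f g : Euc n → ℝ} {w : Euc n → Euc n} {O : Set (Euc n)}
    (hO : IsOpen O) (hf : ContDiffOn ℝ ∞ f (M ∩ O)) (hg : ContDiffOn ℝ ∞ g (M ∩ O))
    (hw : ContinuousOn w (M ∩ O)) :
    ContinuousOn (fun x => wronskian M f g (w x) x) (M ∩ O) :=
  (hg.continuousOn.mul ((h.continuousOn_tgrad hO hf).inner hw)).sub
    (hf.continuousOn.mul ((h.continuousOn_tgrad hO hg).inner hw))

/-- In the antisymmetric combination both the potential and `ζ ⟨∇φ, ∇ψ⟩` cancel, so only the terms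
with `∇ζ` survive. -/
theorem integral_wronskian_test {r : ℝ} {ζ : Euc n → ℝ} (hζ : ContDiff ℝ ∞ ζ)
    (hζr : tsupport ζ ⊆ Metric.ball 0 r) {φ ψ : Euc n → ℝ} (hφ : IsTestFunction M univ φ)
    (hψ : IsTestFunction M univ ψ) :
    ∫ x in Metric.ball 0 r, wronskian M φ ψ (tgrad M ζ x) x ∂(weightMeasure (m + 1) M ρ) =
      formQ m M ρ q φ (fun x => ζ x * ψ x) - formQ m M ρ q ψ (fun x => ζ x * φ x) := by
  have h1 : IsTestFunction M univ fun x => ζ x * ψ x :=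
    (hψ.cutoff_mul hζ hζr).mono (subset_univ _)
  have h2 : IsTestFunction M univ fun x => ζ x * φ x :=
    (hφ.cutoff_mul hζ hζr).mono (subset_univ _)
  rw [formQ, formQ, ← integral_sub (h.integrable_formQ isOpen_univ (hφ.1.mono inter_subset_left) h1)
    (h.integrable_formQ isOpen_univ (hψ.1.mono inter_subset_left) h2),
    setIntegral_eq_integral_of_forall_compl_eq_zero fun x hx => by
      have hz : x ∉ tsupport ζ := fun hh => hx (hζr hh)
      rw [wronskian, tgrad_eq_zero_of_notMem_tsupport hz]; simp]
  refine integral_congr_ae ?_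
  filter_upwards [h.ae_mem] with x hx
  have d := (hζ.differentiable (by simp) x).differentiableWithinAt (s := M)
  rw [tgrad_mul d (hψ.differentiableWithinAt hx), tgrad_mul d (hφ.differentiableWithinAt hx),
    wronskian]
  simp only [inner_add_right, inner_smul_right, real_inner_comm (tgrad M φ x) (tgrad M ψ x)]
  ring

/-- The Wronskian of `u` and its dilation `u (l ·)` is divergence free. -/
theorem integral_wronskian {l r : ℝ} (hl : 0 < l) (hr : 0 < r) (hrR : r < R) (hlr : l * r < R)
    {ζ : Euc n → ℝ} (hζ : ContDiff ℝ ∞ ζ) (hζc : HasCompactSupport ζ)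
    (hζr : tsupport ζ ⊆ Metric.ball 0 r) :
    ∫ x in Metric.ball 0 r, wronskian M u (fun y => u (l • y)) (tgrad M ζ x) x
      ∂(weightMeasure (m + 1) M ρ) = 0 := by
  set κ := weightMeasure (m + 1) M ρ with hκ
  obtain ⟨r', hr', hr'R⟩ := exists_between (max_lt hrR hlr)
  have hrr : r < r' := (le_max_left _ _).trans_lt hr'
  have hlrr : l * r < r' := (le_max_right _ _).trans_lt hr'
  have hli : 0 < l⁻¹ := inv_pos.2 hl
  have hζ' : ContDiff ℝ ∞ fun x => ζ (l⁻¹ • x) := hζ.comp (contDiff_const_smul l⁻¹)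
  have hζc' : HasCompactSupport fun x => ζ (l⁻¹ • x) :=
    hζc.comp_homeomorph (Homeomorph.smulOfNeZero l⁻¹ hli.ne')
  have hζr' : tsupport (fun x => ζ (l⁻¹ • x)) ⊆ Metric.ball 0 (l * r) := by
    intro x hx
    have h1 := hζr (tsupport_comp_subset_preimage ζ (continuous_const_smul l⁻¹) hx)
    rwa [← smul_mem_ball_iff hl, smul_inv_smul₀ hl.ne'] at h1
  obtain ⟨c, hc0, hc⟩ := exists_bound_cutoff hζ hζc
  obtain ⟨C, hC0, hC⟩ := h.exists_sq_formQ_comp_smul_le hl hr hrr hlrr.le hr'R hζ hζc hζr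
  obtain ⟨C', hC0', hC'⟩ := h.exists_sq_formQ_comp_smul_le hli (mul_pos hl hr) hlrr
    (by rw [inv_mul_cancel_left₀ hl.ne']; exact hrr.le) hr'R hζ' hζc' hζr'
  set S := l ^ 2 * (l ^ ((m : ℝ) + 1 + p))⁻¹ with hS
  set s := (l ^ ((m : ℝ) + 1 + p))⁻¹ with hs
  have hs0 : 0 < s := by positivity
  have hS0 : 0 < S := by positivity
  have hB := Metric.isOpen_ball (x := (0 : Euc n)) (ε := r)
  have hsub : Metric.ball (0 : Euc n) r ⊆ Metric.ball 0 r' := Metric.ball_subset_ball hrr.le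
  have hsubl : Metric.ball (0 : Euc n) (l * r) ⊆ Metric.ball 0 r' := Metric.ball_subset_ball hlrr.le
  have hsubR : Metric.ball (0 : Euc n) r' ⊆ Metric.ball 0 R := Metric.ball_subset_ball hr'R.le
  set D := ∫ x in Metric.ball 0 R, energy M ρ P u x ∂κ
  have hD : 0 ≤ D := h.integral_energy_nonneg u _
  have hmap : ∀ x ∈ M ∩ Metric.ball 0 r, l • x ∈ M ∩ Metric.ball 0 R := fun x hx =>
    ⟨h.cone x hx.1 l hl, hsubR (hsubl ((smul_mem_ball_iff hl).2 hx.2))⟩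
  have hv : ContDiffOn ℝ ∞ (fun y => u (l • y)) (M ∩ Metric.ball 0 r) :=
    h.u_smooth.comp (contDiff_const_smul l).contDiffOn hmap
  have hmono : ∀ (f : Euc n → ℝ) {A B : Set (Euc n)}, A ⊆ B → IntegrableOn (energy M ρ P f) B κ →
      ∫ x in A, energy M ρ P f x ∂κ ≤ ∫ x in B, energy M ρ P f x ∂κ := fun f A B hAB hi =>
    setIntegral_mono_set hi ((ae_restrict_of_ae h.ae_mem).mono
      fun x hx => energy_nonneg (h.P_pos x hx).le) hAB.eventuallyLE
  have key : ∀ τ > 0, τ ≤ 1 →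
      |∫ x in Metric.ball 0 r, wronskian M u (fun y => u (l • y)) (tgrad M ζ x) x ∂κ| ≤
        (√C + S * √C' + 2 * c * ((1 + l) ^ 2 * s * D + 1 + D + (1 + l) ^ 2 * s +
          1 + (1 + l) ^ 2 * s)) * τ := by
    intro τ hτ hτ1
    have hτ2 : 0 < τ ^ 2 := pow_pos hτ 2
    have hτ3 : τ ^ 2 ≤ 1 := pow_le_one₀ hτ.le hτ1
    obtain ⟨φ, hφ, hφi, hφδ⟩ := h.dom r' hr'R (τ ^ 2) hτ2
    have hψ : IsTestFunction M univ fun x => φ (l • x) :=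
      hφ.comp_smul h.cone hl fun x _ => mem_univ x
    have e1 := h.integral_wronskian_test hζ hζr hφ hψ
    have b1 : |formQ m M ρ q φ (fun x => ζ x * φ (l • x))| ≤ √C * τ := by
      have := Real.abs_le_sqrt (hC (τ ^ 2) hτ2 hτ3 φ φ hφ hφ hφi hφi hφδ hφδ)
      rwa [Real.sqrt_mul hC0.le, Real.sqrt_sq hτ.le] at this
    -- Here the dilated function is in the first slot. Scaling by `l⁻¹` returns it to `φ` and moves
    -- the dilation to the second slot, so the same estimate applies with `l⁻¹` in place of `l`.
    have b2 : |formQ m M ρ q (fun x => φ (l • x)) (fun x => ζ x * φ x)| ≤ S * √C' * τ := by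
      have := Real.abs_le_sqrt (hC' (τ ^ 2) hτ2 hτ3 φ φ hφ hφ hφi hφi hφδ hφδ)
      rw [Real.sqrt_mul hC0'.le, Real.sqrt_sq hτ.le] at this
      have hg : IsTestFunction M univ fun x => ζ (l⁻¹ • x) * φ (l⁻¹ • x) :=
        ((hφ.comp_smul h.cone hli fun x _ => mem_univ x).cutoff_mul hζ' hζr').mono (subset_univ _)
      have e2 := h.formQ_comp_smul hl (fun x hx => hφ.differentiableWithinAt hx)
        fun x hx => hg.differentiableWithinAt hx
      simp only [inv_smul_smul₀ hl.ne'] at e2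
      rw [e2]
      change |S * _| ≤ _
      rw [abs_mul, abs_of_pos hS0]
      exact (mul_le_mul_of_nonneg_left this hS0.le).trans_eq (mul_assoc _ _ _).symm
    have i1 : IntegrableOn (fun x => wronskian M φ (fun y => φ (l • y)) (tgrad M ζ x) x)
        (Metric.ball 0 r) κ := by
      refine (h.integrable_test hφ ((h.continuousOn_wronskian isOpen_univ
        (hφ.1.mono inter_subset_left) (hψ.1.mono inter_subset_left)
          (h.continuousOn_tgrad isOpen_univ hζ.contDiffOn))) fun x _ h1 h2 => ?_).integrableOn
      rw [wronskian, h1, h2]; simp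
    -- The Wronskian involves only values and gradients, at `x` and at `l x`, so the energies at
    -- both points dominate the error although `P` is not homogeneous. The factor `1 + l` bounds
    -- both `1` and the `l` from the chain rule.
    set F : Euc n → ℝ := fun x => 2 * c * ((τ * ((1 + l) ^ 2 * energy M ρ P u (l • x)) +
      energy M ρ P (fun y => u y - φ y) x / τ) + (τ * energy M ρ P u x +
        (1 + l) ^ 2 * energy M ρ P (fun y => u y - φ y) (l • x) / τ) +
          (energy M ρ P (fun y => u y - φ y) x +
            (1 + l) ^ 2 * energy M ρ P (fun y => u y - φ y) (l • x))) with hF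
    have j1 : IntegrableOn (energy M ρ P u) (Metric.ball 0 r) κ :=
      h.integrable.mono_set (hsub.trans hsubR)
    have j2 : IntegrableOn (energy M ρ P fun y => u y - φ y) (Metric.ball 0 r) κ :=
      hφi.mono_set hsub
    have j3 : IntegrableOn (fun x => energy M ρ P u (l • x)) (Metric.ball 0 r) κ :=
      h.integrableOn_comp_smul hl (h.integrable.mono_set (hsubl.trans hsubR))
    have j4 : IntegrableOn (fun x => energy M ρ P (fun y => u y - φ y) (l • x)) (Metric.ball 0 r) κ :=
      h.integrableOn_comp_smul hl (hφi.mono_set hsubl)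
    have k1 : IntegrableOn (fun x => τ * ((1 + l) ^ 2 * energy M ρ P u (l • x)) +
      energy M ρ P (fun y => u y - φ y) x / τ) (Metric.ball 0 r) κ :=
      ((j3.const_mul _).const_mul τ).add (j2.div_const τ)
    have k2 : IntegrableOn (fun x => τ * energy M ρ P u x +
        (1 + l) ^ 2 * energy M ρ P (fun y => u y - φ y) (l • x) / τ) (Metric.ball 0 r) κ :=
      (j1.const_mul τ).add ((j4.const_mul _).div_const τ)
    have k3 : IntegrableOn (fun x => energy M ρ P (fun y => u y - φ y) x +
            (1 + l) ^ 2 * energy M ρ P (fun y => u y - φ y) (l • x)) (Metric.ball 0 r) κ :=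
      j2.add (j4.const_mul _)
    have k12 : IntegrableOn (fun x => (τ * ((1 + l) ^ 2 * energy M ρ P u (l • x)) +
      energy M ρ P (fun y => u y - φ y) x / τ) + (τ * energy M ρ P u x +
        (1 + l) ^ 2 * energy M ρ P (fun y => u y - φ y) (l • x) / τ)) (Metric.ball 0 r) κ := k1.add k2
    have hFi : IntegrableOn F (Metric.ball 0 r) κ := (k12.add k3).const_mul _
    have hle : ∀ᵐ x ∂(κ.restrict (Metric.ball 0 r)),
        |wronskian M u (fun y => u (l • y)) (tgrad M ζ x) x -
          wronskian M φ (fun y => φ (l • y)) (tgrad M ζ x) x| ≤ F x := by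
      filter_upwards [ae_restrict_of_ae h.ae_mem, ae_restrict_mem hB.measurableSet] with x hx hxr
      have hxR : x ∈ M ∩ Metric.ball 0 R := ⟨hx, hsubR (hsub hxr)⟩
      have hlx := hmap x ⟨hx, hxr⟩
      have d1 := h.differentiableWithinAt hxR
      have d2 := hφ.differentiableWithinAt hx
      have d1' := h.differentiableWithinAt hlx
      have d2' := hφ.differentiableWithinAt hlx.1
      have d3 : DifferentiableWithinAt ℝ (fun y => u y - φ y) M (l • x) := d1'.sub d2'
      have dv : DifferentiableWithinAt ℝ (fun y => u (l • y)) M x :=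
        differentiableWithinAt_of_contDiffOn_inter hB (hv.of_le (by exact_mod_cast le_top)) ⟨hx, hxr⟩
      have dψ := hψ.differentiableWithinAt hx
      have hP := (h.P_pos x hx).le
      have hP' := (h.P_pos _ hlx.1).le
      have bnd : ∀ f : Euc n → ℝ, DifferentiableWithinAt ℝ f M (l • x) →
          |f (l • x)| ≤ (1 + l) * √(energy M ρ P f (l • x)) ∧
          ‖tgrad M (fun y => f (l • y)) x‖ ≤ (1 + l) * √(energy M ρ P f (l • x)) := by
        intro f hf
        have a1 : |f (l • x)| ≤ √(energy M ρ P f (l • x)) := abs_le_sqrt_energy hP'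
        have a2 : ‖tgrad M f (l • x)‖ ≤ √(energy M ρ P f (l • x)) := norm_tgrad_le_sqrt_energy hP'
        have a3 := Real.sqrt_nonneg (energy M ρ P f (l • x))
        rw [h.cone.tgrad_comp_smul hl hf, norm_smul, Real.norm_eq_abs, abs_of_pos hl]
        constructor <;> nlinarith
      -- Bilinear expansion of the error: each of the three terms contains `u - φ`, at `x` or at `l
      -- x`, at least once.
      have e3 : wronskian M u (fun y => u (l • y)) (tgrad M ζ x) x -
          wronskian M φ (fun y => φ (l • y)) (tgrad M ζ x) x =
          wronskian M (fun y => u y - φ y) (fun y => u (l • y)) (tgrad M ζ x) x +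
          wronskian M u (fun y => u (l • y) - φ (l • y)) (tgrad M ζ x) x -
          wronskian M (fun y => u y - φ y) (fun y => u (l • y) - φ (l • y)) (tgrad M ζ x) x := by
        rw [wronskian_sub_left d1 d2, wronskian_sub_right dv dψ, wronskian_sub_left d1 d2,
          wronskian_sub_right dv dψ, wronskian_sub_right dv dψ]
        ring
      have a1 : |u x| ≤ √(energy M ρ P u x) := abs_le_sqrt_energy hP
      have a2 : ‖tgrad M u x‖ ≤ √(energy M ρ P u x) := norm_tgrad_le_sqrt_energy hP
      have a3 : |u x - φ x| ≤ √(energy M ρ P (fun y => u y - φ y) x) :=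
        abs_le_sqrt_energy (f := fun y => u y - φ y) hP
      have a4 : ‖tgrad M (fun y => u y - φ y) x‖ ≤ √(energy M ρ P (fun y => u y - φ y) x) :=
        norm_tgrad_le_sqrt_energy hP
      obtain ⟨a5, a6⟩ := bnd u d1'
      obtain ⟨a7, a8⟩ := bnd (fun y => u y - φ y) d3
      have w1 := abs_wronskian_le a3 a4 a5 a6 (hc M x).2
      have w2 := abs_wronskian_le a1 a2 a7 a8 (hc M x).2
      have w3 := abs_wronskian_le a3 a4 a7 a8 (hc M x).2
      have m1 := mul_le_amgm (s := (1 + l) * √(energy M ρ P u (l • x)))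
        (t := √(energy M ρ P (fun y => u y - φ y) x)) hτ
      have m2 := mul_le_amgm (s := √(energy M ρ P u x))
        (t := (1 + l) * √(energy M ρ P (fun y => u y - φ y) (l • x))) hτ
      have m3 := mul_le_amgm (s := √(energy M ρ P (fun y => u y - φ y) x))
        (t := (1 + l) * √(energy M ρ P (fun y => u y - φ y) (l • x))) one_pos
      simp only [mul_pow, Real.sq_sqrt (energy_nonneg hP), Real.sq_sqrt (energy_nonneg hP'),
        one_mul, div_one] at m1 m2 m3
      rw [e3]
      refine (abs_sub _ _).trans ((add_le_add_left (abs_add_le _ _) _).trans ?_)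
      rw [hF]
      rw [mul_comm ((1 + l) * √(energy M ρ P u (l • x)))] at m1
      have n1 := w1.trans (mul_le_mul_of_nonneg_left m1 (by positivity))
      have n2 := w2.trans (mul_le_mul_of_nonneg_left m2 (by positivity))
      have n3 := w3.trans (mul_le_mul_of_nonneg_left m3 (by positivity))
      linarith
    have i2 : IntegrableOn (fun x => wronskian M u (fun y => u (l • y)) (tgrad M ζ x) x -
        wronskian M φ (fun y => φ (l • y)) (tgrad M ζ x) x) (Metric.ball 0 r) κ := by
      refine hFi.mono' (AEStronglyMeasurable.sub ?_ i1.aestronglyMeasurable) hle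
      exact aestronglyMeasurable_weightMeasure h.measurableSet hB.measurableSet
        (h.continuousOn_wronskian hB (h.u_smooth.mono (inter_subset_inter_right M (hsub.trans hsubR)))
          hv (h.continuousOn_tgrad hB hζ.contDiffOn))
    have e4 : ∫ x in Metric.ball 0 r, wronskian M u (fun y => u (l • y)) (tgrad M ζ x) x ∂κ =
        ∫ x in Metric.ball 0 r, (wronskian M u (fun y => u (l • y)) (tgrad M ζ x) x -
          wronskian M φ (fun y => φ (l • y)) (tgrad M ζ x) x) ∂κ +
        ∫ x in Metric.ball 0 r, wronskian M φ (fun y => φ (l • y)) (tgrad M ζ x) x ∂κ := by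
      rw [← integral_add i2 i1]
      simp only [sub_add_cancel]
    have e5 : ∫ x in Metric.ball 0 r, F x ∂κ = 2 * c * (
        (τ * ((1 + l) ^ 2 * (s * ∫ x in Metric.ball 0 (l * r), energy M ρ P u x ∂κ)) +
          (∫ x in Metric.ball 0 r, energy M ρ P (fun y => u y - φ y) x ∂κ) / τ) +
        (τ * (∫ x in Metric.ball 0 r, energy M ρ P u x ∂κ) + (1 + l) ^ 2 * (s *
          ∫ x in Metric.ball 0 (l * r), energy M ρ P (fun y => u y - φ y) x ∂κ) / τ) +
        ((∫ x in Metric.ball 0 r, energy M ρ P (fun y => u y - φ y) x ∂κ) + (1 + l) ^ 2 * (s *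
          ∫ x in Metric.ball 0 (l * r), energy M ρ P (fun y => u y - φ y) x ∂κ))) := by
      rw [← h.setIntegral_comp_smul hl, ← h.setIntegral_comp_smul hl, hF, integral_const_mul,
        integral_add k12 k3, integral_add k1 k2,
        integral_add ((j3.const_mul _).const_mul τ) (j2.div_const τ),
        integral_add (j1.const_mul τ) ((j4.const_mul _).div_const τ),
        integral_add j2 (j4.const_mul _)]
      simp only [integral_const_mul, integral_div]
      rfl
    have b3 : |∫ x in Metric.ball 0 r, (wronskian M u (fun y => u (l • y)) (tgrad M ζ x) x -
          wronskian M φ (fun y => φ (l • y)) (tgrad M ζ x) x) ∂κ| ≤ 2 * c * (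
            (τ * ((1 + l) ^ 2 * (s * D)) + τ ^ 2 / τ) + (τ * D + (1 + l) ^ 2 * (s * τ ^ 2) / τ) +
              (τ ^ 2 + (1 + l) ^ 2 * (s * τ ^ 2))) := by
      rw [← Real.norm_eq_abs]
      refine (norm_integral_le_of_norm_le hFi hle).trans (e5.trans_le ?_)
      have f1 := hmono u (hsubl.trans hsubR) h.integrable
      have f2 := hmono u (hsub.trans hsubR) h.integrable
      have f3 := (hmono _ hsub hφi).trans hφδ.le
      have f4 := (hmono _ hsubl hφi).trans hφδ.le
      gcongr
    have e6 : 2 * c * ((τ * ((1 + l) ^ 2 * (s * D)) + τ ^ 2 / τ) +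
        (τ * D + (1 + l) ^ 2 * (s * τ ^ 2) / τ) + (τ ^ 2 + (1 + l) ^ 2 * (s * τ ^ 2))) =
        2 * c * ((1 + l) ^ 2 * s * D + 1 + D + (1 + l) ^ 2 * s +
          (1 + (1 + l) ^ 2 * s) * τ) * τ := by
      field_simp
      ring
    have e7 : 2 * c * ((1 + l) ^ 2 * s * D + 1 + D + (1 + l) ^ 2 * s +
          (1 + (1 + l) ^ 2 * s) * τ) * τ ≤ 2 * c * ((1 + l) ^ 2 * s * D + 1 + D + (1 + l) ^ 2 * s +
          (1 + (1 + l) ^ 2 * s) * 1) * τ := by gcongr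
    rw [e4, e1]
    refine (abs_add_le _ _).trans ?_
    have := abs_sub (formQ m M ρ q φ fun x => ζ x * φ (l • x))
      (formQ m M ρ q (fun x => φ (l • x)) fun x => ζ x * φ x)
    linarith
  set A := ∫ x in Metric.ball 0 r, wronskian M u (fun y => u (l • y)) (tgrad M ζ x) x ∂κ
  set K := √C + S * √C' + 2 * c * ((1 + l) ^ 2 * s * D + 1 + D + (1 + l) ^ 2 * s +
          1 + (1 + l) ^ 2 * s)
  have hcont : Continuous fun τ : ℝ => K * τ := by fun_prop
  have h1 : |A| ≤ K * 0 := by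
    refine ge_of_tendsto ((hcont.tendsto 0).mono_left (nhdsWithin_le_nhds (s := Ioi 0))) ?_
    filter_upwards [Ioc_mem_nhdsGT one_pos] with τ hτ using key τ hτ.1 hτ.2
  rw [mul_zero] at h1
  exact abs_nonpos_iff.1 h1

end CriticalData

/-! ### The classical flux identity when `q u²` is integrable. -/

theorem ae_tendsto_zero_of_integral_lt {α : Type*} [MeasurableSpace α] {μ : Measure α}
    {e : ℕ → α → ℝ} (he : ∀ j, Integrable (e j) μ) (he0 : ∀ j, 0 ≤ᵐ[μ] e j)
    (hle : ∀ j, ∫ x, e j x ∂μ < (1 / 4) ^ j) : ∀ᵐ x ∂μ, Tendsto (fun j => e j x) atTop (𝓝 0) := by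
  -- The integrals are summable, so the series converges almost everywhere and its terms tend to
  -- zero.
  have h1 : ∫⁻ x, ∑' j, ENNReal.ofReal (e j x) ∂μ ≠ ⊤ := by
    rw [lintegral_tsum fun j => (he j).aemeasurable.ennreal_ofReal]
    refine ne_top_of_le_ne_top (b := ∑' j : ℕ, ENNReal.ofReal ((1 / 4 : ℝ) ^ j)) ?_
      (ENNReal.tsum_le_tsum fun j => ?_)
    · rw [← ENNReal.ofReal_tsum_of_nonneg (fun j => by positivity)
        (summable_geometric_of_lt_one (by norm_num) (by norm_num))]
      exact ENNReal.ofReal_ne_top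
    · rw [← ofReal_integral_eq_lintegral_ofReal (he j) (he0 j)]
      exact ENNReal.ofReal_le_ofReal (hle j).le
  have h2 := ae_lt_top' (AEMeasurable.tsum fun j => (he j).aemeasurable.ennreal_ofReal) h1
  filter_upwards [h2, ae_all_iff.2 he0] with x hx hx0
  have h3 := (ENNReal.tendsto_toReal ENNReal.zero_ne_top).comp
    (ENNReal.tendsto_atTop_zero_of_tsum_ne_top hx.ne)
  refine h3.congr fun j => ?_
  exact ENNReal.toReal_ofReal (hx0 j)

/-- The function `s ↦ 2 s / (1 + s²)`, equal to `1` to second order at `s = 1`. -/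
noncomputable def rationalBump (s : ℝ) : ℝ := 2 * s / (1 + s ^ 2)

theorem contDiff_rationalBump : ContDiff ℝ ∞ rationalBump := by
  unfold rationalBump
  exact ContDiff.div (by fun_prop) (by fun_prop) fun s => by positivity

theorem hasDerivAt_rationalBump (s : ℝ) :
    HasDerivAt rationalBump (2 * (1 - s ^ 2) / (1 + s ^ 2) ^ 2) s := by
  have h1 : HasDerivAt (fun s : ℝ => 2 * s) 2 s := by simpa using (hasDerivAt_id s).const_mul 2
  have h2 : HasDerivAt (fun s : ℝ => 1 + s ^ 2) (2 * s) s := by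
    simpa using (hasDerivAt_pow 2 s).const_add 1
  have h3 := h1.div h2 (by positivity)
  have e : 2 * (1 - s ^ 2) = 2 * (1 + s ^ 2) - 2 * s * (2 * s) := by ring
  rw [e]
  exact h3

theorem abs_rationalBump_le (s : ℝ) : |rationalBump s| ≤ 1 := by
  rw [rationalBump, abs_div, abs_of_pos (by positivity : 0 < 1 + s ^ 2), div_le_one (by positivity),
    abs_le]
  constructor <;> nlinarith [sq_nonneg (s - 1), sq_nonneg (s + 1)]

theorem abs_deriv_rationalBump_le (s : ℝ) : |2 * (1 - s ^ 2) / (1 + s ^ 2) ^ 2| ≤ 2 := by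
  rw [abs_div, abs_of_pos (by positivity : 0 < (1 + s ^ 2) ^ 2), div_le_iff₀ (by positivity), abs_le]
  constructor <;> nlinarith [sq_nonneg s, sq_nonneg (s ^ 2)]

theorem abs_deriv_rationalBump_mul_le (s : ℝ) :
    |2 * (1 - s ^ 2) / (1 + s ^ 2) ^ 2 * (1 - s)| ≤ 4 := by
  rw [div_mul_eq_mul_div, abs_div, abs_of_pos (by positivity : 0 < (1 + s ^ 2) ^ 2),
    div_le_iff₀ (by positivity), abs_mul]
  have h1 : |2 * (1 - s ^ 2)| ≤ 2 * (1 + s ^ 2) := by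
    rw [abs_le]; constructor <;> nlinarith [sq_nonneg s]
  have h2 : |1 - s| ≤ 2 * (1 + s ^ 2) := by
    rw [abs_le]; constructor <;> nlinarith [sq_nonneg (s - 1), sq_nonneg (s + 1), sq_nonneg s]
  calc _ ≤ 2 * (1 + s ^ 2) * (2 * (1 + s ^ 2)) :=
        mul_le_mul h1 h2 (abs_nonneg _) (by positivity)
    _ = _ := by ring

namespace CriticalData

variable {n m : ℕ} {M : Set (Euc n)} {ρ : Euc n → ℝ} {p : ℝ} {q : Euc n → ℝ}
    {X : Euc n → Euc n} {qbar P : Euc n → ℝ} {R : ℝ} {u : Euc n → ℝ}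
    (h : CriticalData m M ρ p q X qbar P R u)

include h

/-- The flux identity in its classical form, when `q u²` is integrable. -/
theorem integral_flux_of_integrable {b : ℝ} (hbR : b < R)
    (hq : IntegrableOn (fun x => q x * u x ^ 2) (Metric.ball 0 b) (weightMeasure (m + 1) M ρ))
    {ζ : Euc n → ℝ} (hζ : ContDiff ℝ ∞ ζ) (hζc : HasCompactSupport ζ)
    (hζb : tsupport ζ ⊆ Metric.ball 0 b) :
    ∫ x in Metric.ball 0 b, (ζ x * (‖tgrad M u x‖ ^ 2 - q x * u x ^ 2) +
      u x * inner ℝ (tgrad M u x) (tgrad M ζ x)) ∂(weightMeasure (m + 1) M ρ) = 0 := by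
  set κ := weightMeasure (m + 1) M ρ with hκ
  obtain ⟨c, hc0, hc⟩ := exists_bound_cutoff hζ hζc
  have hB := Metric.isOpen_ball (x := (0 : Euc n)) (ε := b)
  have hBR := Metric.isOpen_ball (x := (0 : Euc n)) (ε := R)
  have hsub : Metric.ball (0 : Euc n) b ⊆ Metric.ball 0 R := Metric.ball_subset_ball hbR.le
  have hsubM : M ∩ Metric.ball 0 b ⊆ M ∩ Metric.ball 0 R := inter_subset_inter_right M hsub
  -- Geometric decay of the energies makes the whole sequence converge almost everywhere, with no
  -- passage to a subsequence.
  have hdom : ∀ j : ℕ, ∃ φ, IsTestFunction M univ φ ∧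
    IntegrableOn (energy M ρ P fun x => u x - φ x) (Metric.ball 0 b) κ ∧
    ∫ x in Metric.ball 0 b, energy M ρ P (fun x => u x - φ x) x ∂κ < (1 / 4) ^ j := fun j =>
    h.dom b hbR _ (by positivity)
  choose φ hφ hφi hφδ using hdom
  have hae : ∀ᵐ x ∂(κ.restrict (Metric.ball 0 b)), x ∈ M ∩ Metric.ball 0 b := by
    filter_upwards [ae_restrict_of_ae h.ae_mem, ae_restrict_mem hB.measurableSet] with x h1 h2
      using ⟨h1, h2⟩
  have hlim : ∀ᵐ x ∂(κ.restrict (Metric.ball 0 b)), Tendsto (fun j => φ j x) atTop (𝓝 (u x)) := by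
    have h1 := ae_tendsto_zero_of_integral_lt hφi
      (fun j => hae.mono fun x hx => energy_nonneg (h.P_pos x hx.1).le) hφδ
    filter_upwards [h1, hae] with x hx hxM
    have h2 : Tendsto (fun j => √(energy M ρ P (fun x => u x - φ j x) x)) atTop (𝓝 0) := by
      simpa using hx.sqrt
    rw [tendsto_iff_dist_tendsto_zero]
    refine squeeze_zero (fun _ => dist_nonneg) (fun j => ?_) h2
    rw [Real.dist_eq, abs_sub_comm]
    exact abs_le_sqrt_energy (f := fun y => u y - φ j y) (h.P_pos x hxM.1).le
  set G : Euc n → ℝ := fun x => ζ x * (‖tgrad M u x‖ ^ 2 - q x * u x ^ 2) +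
      u x * inner ℝ (tgrad M u x) (tgrad M ζ x) with hG
  have cu := h.u_smooth.continuousOn.mono hsubM
  have cg := (h.continuousOn_tgrad hBR h.u_smooth).mono hsubM
  have cζ : ContinuousOn ζ (M ∩ Metric.ball 0 b) := hζ.continuous.continuousOn
  have cζ' := h.continuousOn_tgrad hB (hζ.contDiffOn (s := M ∩ Metric.ball 0 b))
  have cq : ContinuousOn q (M ∩ Metric.ball 0 b) := h.q_smooth.continuousOn.mono inter_subset_left
  have cG : ContinuousOn G (M ∩ Metric.ball 0 b) :=
    (cζ.mul ((cg.norm.pow 2).sub (cq.mul (cu.pow 2)))).add (cu.mul (cg.inner cζ'))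
  have hEi : IntegrableOn (energy M ρ P u) (Metric.ball 0 b) κ := h.integrable.mono_set hsub
  have bu : ∀ x ∈ M, ‖tgrad M u x‖ ^ 2 ≤ energy M ρ P u x := fun x hx => by
    have := pow_le_pow_left₀ (norm_nonneg _)
      (norm_tgrad_le_sqrt_energy (M := M) (ρ := ρ) (f := u) (h.P_pos x hx).le) 2
    rwa [Real.sq_sqrt (energy_nonneg (h.P_pos x hx).le)] at this
  have hGi : IntegrableOn G (Metric.ball 0 b) κ := by
    refine ((hEi.const_mul (2 * c)).add (hq.abs.const_mul c)).mono'
      (aestronglyMeasurable_weightMeasure h.measurableSet hB.measurableSet cG) ?_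
    filter_upwards [hae] with x hx
    have a1 : ‖tgrad M u x‖ ≤ √(energy M ρ P u x) := norm_tgrad_le_sqrt_energy (h.P_pos x hx.1).le
    have a2 : |u x| ≤ √(energy M ρ P u x) := abs_le_sqrt_energy (h.P_pos x hx.1).le
    have a3 : |ζ x * (‖tgrad M u x‖ ^ 2 - q x * u x ^ 2)| ≤
        c * (energy M ρ P u x + |q x * u x ^ 2|) := by
      rw [abs_mul]
      refine mul_le_mul (hc M x).1 ((abs_sub _ _).trans ?_) (abs_nonneg _) hc0.le
      rw [abs_of_nonneg (sq_nonneg ‖tgrad M u x‖)]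
      linarith [bu x hx.1]
    have a4 : |1 * (u x * inner ℝ (tgrad M u x) (tgrad M ζ x))| ≤
        1 * (√(energy M ρ P u x) * √(energy M ρ P u x) * c) :=
      abs_mul_inner_le (by simp) (mul_le_mul a2 a1 (norm_nonneg _) (Real.sqrt_nonneg _)) (hc M x).2
    rw [Real.mul_self_sqrt (energy_nonneg (h.P_pos x hx.1).le), one_mul, one_mul] at a4
    simp only [Pi.add_apply, Real.norm_eq_abs]
    refine (abs_add_le _ _).trans ?_
    linarith
  set T' : ℝ → ℝ := fun s => 2 * (1 - s ^ 2) / (1 + s ^ 2) ^ 2 with hT'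
  have cT' : Continuous T' := by
    rw [hT']
    exact Continuous.div (by fun_prop) (by fun_prop) fun s => by positivity
  -- With `T = rationalBump` and `w = φ j / u`, this is the integrand obtained by testing with `ζ u
  -- T(w)`, up to a term small with the energy of `u - φ j`. Boundedness of `T(s)` and `T'(s) (1 -
  -- s)` gives an integrable majorant, and `w → 1` with `T 1 = 1` gives the limit `G`.
  set A : ℕ → Euc n → ℝ := fun j x => rationalBump (φ j x / u x) * G x +
    ζ x * (T' (φ j x / u x) * (1 - φ j x / u x)) * ‖tgrad M u x‖ ^ 2 with hA
  have cw : ∀ j, ContinuousOn (fun x => φ j x / u x) (M ∩ Metric.ball 0 b) := fun j =>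
    ((hφ j).1.continuousOn.mono inter_subset_left).div cu
      fun x hx => (h.u_pos x (hsubM hx)).ne'
  have cA : ∀ j, ContinuousOn (A j) (M ∩ Metric.ball 0 b) := fun j =>
    ((contDiff_rationalBump.continuous.comp_continuousOn (cw j)).mul cG).add
      ((cζ.mul ((cT'.comp_continuousOn (cw j)).mul (continuousOn_const.sub (cw j)))).mul
        (cg.norm.pow 2))
  have mA : ∀ j, AEStronglyMeasurable (A j) (κ.restrict (Metric.ball 0 b)) := fun j =>
    aestronglyMeasurable_weightMeasure h.measurableSet hB.measurableSet (cA j)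
  have bi : IntegrableOn (fun x => |G x| + c * 4 * energy M ρ P u x) (Metric.ball 0 b) κ :=
    hGi.abs.add (hEi.const_mul _)
  have bA : ∀ j, ∀ᵐ x ∂(κ.restrict (Metric.ball 0 b)),
      ‖A j x‖ ≤ |G x| + c * 4 * energy M ρ P u x := fun j => by
    filter_upwards [hae] with x hx
    refine (norm_add_le _ _).trans (add_le_add ?_ ?_)
    · rw [Real.norm_eq_abs, abs_mul]
      exact mul_le_of_le_one_left (abs_nonneg _) (abs_rationalBump_le _)
    · rw [Real.norm_eq_abs, abs_mul, abs_mul, abs_of_nonneg (sq_nonneg ‖tgrad M u x‖)]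
      exact mul_le_mul (mul_le_mul (hc M x).1 (abs_deriv_rationalBump_mul_le _) (abs_nonneg _) hc0.le)
        (bu x hx.1) (sq_nonneg _) (by positivity)
  have lim1 : Tendsto (fun j => ∫ x in Metric.ball 0 b, A j x ∂κ) atTop
      (𝓝 (∫ x in Metric.ball 0 b, G x ∂κ)) := by
    refine tendsto_integral_of_dominated_convergence _ mA bi bA ?_
    filter_upwards [hlim, hae] with x hx hxM
    have hu := (h.u_pos x (hsubM hxM)).ne'
    have l1 : Tendsto (fun j => φ j x / u x) atTop (𝓝 1) := by
      simpa [div_self hu] using hx.div_const (u x)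
    have l2 : Tendsto (fun j => rationalBump (φ j x / u x)) atTop (𝓝 1) := by
      have := (contDiff_rationalBump.continuous.tendsto 1).comp l1
      have e : rationalBump 1 = 1 := by norm_num [rationalBump]
      rwa [e] at this
    have l3 : Tendsto (fun j => T' (φ j x / u x) * (1 - φ j x / u x)) atTop (𝓝 0) := by
      have := ((cT'.tendsto 1).comp l1).mul (l1.const_sub 1)
      simpa using this
    have := (l2.mul_const (G x)).add ((l3.const_mul (ζ x)).mul_const (‖tgrad M u x‖ ^ 2))
    simpa [hA] using this
  set E := ∫ x in Metric.ball 0 b, energy M ρ P u x ∂κ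
  have key : ∀ j, |∫ x in Metric.ball 0 b, A j x ∂κ| ≤ 2 * c * (E + 1) * (1 / 2) ^ j := by
    intro j
    set τ : ℝ := (1 / 2) ^ j with hτ
    have hτ0 : 0 < τ := by positivity
    have hττ : (1 / 4 : ℝ) ^ j = τ ^ 2 := by
      rw [hτ, ← pow_mul, mul_comm, pow_mul]; norm_num
    have hTs : ContDiffOn ℝ ∞ (fun x => u x * rationalBump (φ j x / u x)) (M ∩ Metric.ball 0 b) :=
      (h.u_smooth.mono hsubM).mul (contDiff_rationalBump.comp_contDiffOn
        (((hφ j).1.mono inter_subset_left).div (h.u_smooth.mono hsubM)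
          fun x hx => (h.u_pos x (hsubM hx)).ne'))
    -- The test function has compact support because `T 0 = 0`: it vanishes where `φ j` does.
    have hf : IsTestFunction M (Metric.ball 0 b) fun x =>
        ζ x * (u x * rationalBump (φ j x / u x)) := by
      obtain ⟨h1, K, hK, hKM, h0⟩ := hφ j
      refine .of_contDiffOn hB (hζ.contDiffOn.mul hTs) (K := K ∩ tsupport ζ)
        (hK.inter_right (isClosed_tsupport _)) (fun x hx => ⟨(hKM hx.1).1, hζb hx.2⟩) fun x hx => ?_
      by_cases hxK : x ∈ K
      · rw [image_eq_zero_of_notMem_tsupport fun hh => hx.2 ⟨hxK, hh⟩, zero_mul]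
      · rw [h0 x ⟨hx.1, hxK⟩]; simp [rationalBump]
    have i1 := h.integrable_formQ hB (h.u_smooth.mono hsubM) hf
    have e1 : ∫ x in Metric.ball 0 b, (inner ℝ (tgrad M u x)
        (tgrad M (fun x => ζ x * (u x * rationalBump (φ j x / u x))) x) -
          q x * u x * (ζ x * (u x * rationalBump (φ j x / u x)))) ∂κ = 0 := by
      rw [← h.crit _ (hf.mono hsub), formQ, ← hκ, ← integral_indicator hB.measurableSet]
      refine integral_congr_ae ?_
      filter_upwards [h.ae_mem] with x hx
      by_cases hxb : x ∈ Metric.ball (0 : Euc n) b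
      · rw [indicator_of_mem hxb]
      · rw [indicator_of_notMem hxb]
        obtain ⟨h1, h2⟩ := hf.eq_zero_of_notMem hx hxb
        rw [h1, h2]; simp
    have iA : IntegrableOn (A j) (Metric.ball 0 b) κ := bi.mono' (mA j) (bA j)
    have e2 : ∫ x in Metric.ball 0 b, A j x ∂κ = ∫ x in Metric.ball 0 b, (A j x -
        (inner ℝ (tgrad M u x) (tgrad M (fun x => ζ x * (u x * rationalBump (φ j x / u x))) x) -
          q x * u x * (ζ x * (u x * rationalBump (φ j x / u x))))) ∂κ := by
      rw [integral_sub iA i1.integrableOn, e1, sub_zero]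
    have k1 : IntegrableOn (fun x => 2 * c * (τ * energy M ρ P u x +
        energy M ρ P (fun y => u y - φ j y) x / τ)) (Metric.ball 0 b) κ :=
      ((hEi.const_mul τ).add ((hφi j).div_const τ)).const_mul _
    rw [e2, ← Real.norm_eq_abs]
    refine (norm_integral_le_of_norm_le k1 ?_).trans ?_
    · filter_upwards [hae] with x hx
      have hP := (h.P_pos x hx.1).le
      have hu := (h.u_pos x (hsubM hx)).ne'
      have d1 := h.differentiableWithinAt (hsubM hx)
      have d2 := (hφ j).differentiableWithinAt hx.1
      have d3 : DifferentiableWithinAt ℝ (fun y => φ j y / u y) M x := by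
        simp only [div_eq_mul_inv]
        exact d2.mul (d1.inv hu)
      have d4 : DifferentiableWithinAt ℝ (fun y => rationalBump (φ j y / u y)) M x :=
        (hasDerivAt_rationalBump _).differentiableAt.comp_differentiableWithinAt x d3
      have d5 : DifferentiableWithinAt ℝ (fun y => u y * rationalBump (φ j y / u y)) M x :=
        d1.mul d4
      have t1 := tgrad_div d2 d1 hu
      have t2 : tgrad M (fun y => φ j y / u y) x =
          (u x)⁻¹ • (tgrad M (φ j) x - (φ j x / u x) • tgrad M u x) := by
        rw [← t1, inv_smul_smul₀ hu]
      -- The discrepancy is exactly `ζ T'(w) ⟨∇u, ∇(u - φ j)⟩`. It contains no potential, and `T'`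
      -- is bounded.
      have e3 : A j x - (inner ℝ (tgrad M u x)
          (tgrad M (fun x => ζ x * (u x * rationalBump (φ j x / u x))) x) -
            q x * u x * (ζ x * (u x * rationalBump (φ j x / u x)))) =
          (ζ x * T' (φ j x / u x)) *
            (1 * inner ℝ (tgrad M u x) (tgrad M (fun y => u y - φ j y) x)) := by
        rw [tgrad_mul (hζ.differentiable (by simp) x).differentiableWithinAt d5, tgrad_mul d1 d4,
          tgrad_comp (hasDerivAt_rationalBump (φ j x / u x)) d3, t2, tgrad_sub d1 d2]
        simp only [hA, hG, inner_add_right, inner_smul_right, inner_sub_right,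
          real_inner_self_eq_norm_sq]
        change _ - (ζ x * (u x * (T' (φ j x / u x) * _) + _) + _ - _) = _
        field_simp
        ring
      rw [e3]
      have a1 : ‖tgrad M u x‖ ≤ √(energy M ρ P u x) := norm_tgrad_le_sqrt_energy hP
      have a2 : ‖tgrad M (fun y => u y - φ j y) x‖ ≤ √(energy M ρ P (fun y => u y - φ j y) x) :=
        norm_tgrad_le_sqrt_energy hP
      have a3 : |ζ x * T' (φ j x / u x)| ≤ 2 * c := by
        rw [abs_mul, mul_comm 2 c]
        exact mul_le_mul (hc M x).1 (abs_deriv_rationalBump_le _) (abs_nonneg _) hc0.le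
      refine (abs_mul_inner_le a3 (by simpa using a1) a2).trans ?_
      have h1 := mul_le_amgm (s := √(energy M ρ P u x))
        (t := √(energy M ρ P (fun y => u y - φ j y) x)) hτ0
      rw [Real.sq_sqrt (energy_nonneg hP), Real.sq_sqrt (energy_nonneg hP)] at h1
      exact mul_le_mul_of_nonneg_left h1 (by positivity)
    · rw [integral_const_mul, integral_add (hEi.const_mul τ) ((hφi j).div_const τ),
        integral_const_mul, integral_div]
      have h1 : (∫ x in Metric.ball 0 b, energy M ρ P (fun y => u y - φ j y) x ∂κ) / τ ≤ τ := by
        rw [div_le_iff₀ hτ0, ← pow_two, ← hττ]; exact (hφδ j).le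
      have h2 : 2 * c * (τ * E + (∫ x in Metric.ball 0 b,
          energy M ρ P (fun y => u y - φ j y) x ∂κ) / τ) ≤ 2 * c * (τ * E + τ) :=
        mul_le_mul_of_nonneg_left (by linarith) (by positivity)
      refine h2.trans_eq ?_
      ring
  have lim2 : Tendsto (fun j => ∫ x in Metric.ball 0 b, A j x ∂κ) atTop (𝓝 0) := by
    refine squeeze_zero_norm key ?_
    have := (tendsto_pow_atTop_nhds_zero_of_lt_one (r := (1 / 2 : ℝ)) (by norm_num)
      (by norm_num)).const_mul (2 * c * (E + 1))
    simpa using this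
  exact tendsto_nhds_unique lim1 lim2

end CriticalData

end WeightedCone

/-! ### Smooth radial cutoffs and their piecewise linear limits. -/

/-- Smooth approximations of the indicator function of `(a, b)`. -/
noncomputable def smoothIndicator (a b : ℝ) (i : ℕ) (t : ℝ) : ℝ :=
  Real.smoothTransition (i * (t - a)) * Real.smoothTransition (i * (b - t))

/-- The primitive of `-smoothIndicator a b i` which vanishes at `b`. -/
noncomputable def smoothRamp (a b : ℝ) (i : ℕ) (t : ℝ) : ℝ := ∫ s in t..b, smoothIndicator a b i s

section SmoothRamp

variable {a b : ℝ} {i : ℕ} {t : ℝ}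

theorem contDiff_smoothIndicator : ContDiff ℝ ∞ (smoothIndicator a b i) := by
  unfold smoothIndicator
  exact (Real.smoothTransition.contDiff.comp (by fun_prop)).mul
    (Real.smoothTransition.contDiff.comp (by fun_prop))

theorem smoothIndicator_nonneg : 0 ≤ smoothIndicator a b i t :=
  mul_nonneg (Real.smoothTransition.nonneg _) (Real.smoothTransition.nonneg _)

theorem smoothIndicator_le_one : smoothIndicator a b i t ≤ 1 :=
  mul_le_one₀ (Real.smoothTransition.le_one _) (Real.smoothTransition.nonneg _)
    (Real.smoothTransition.le_one _)

theorem abs_smoothIndicator_le_one : |smoothIndicator a b i t| ≤ 1 := by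
  rw [abs_of_nonneg smoothIndicator_nonneg]; exact smoothIndicator_le_one

theorem smoothIndicator_of_le (ht : t ≤ a) : smoothIndicator a b i t = 0 := by
  rw [smoothIndicator, Real.smoothTransition.zero_of_nonpos, zero_mul]
  exact mul_nonpos_of_nonneg_of_nonpos (Nat.cast_nonneg i) (by linarith)

theorem smoothIndicator_of_ge (ht : b ≤ t) : smoothIndicator a b i t = 0 := by
  rw [smoothIndicator, mul_comm, Real.smoothTransition.zero_of_nonpos, zero_mul]
  exact mul_nonpos_of_nonneg_of_nonpos (Nat.cast_nonneg i) (by linarith)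

theorem tendsto_smoothIndicator (a b t : ℝ) :
    Tendsto (fun i => smoothIndicator a b i t) atTop (𝓝 ((Ioo a b).indicator (fun _ => 1) t)) := by
  by_cases ht : t ∈ Ioo a b
  · rw [indicator_of_mem ht]
    have h1 : ∀ d : ℝ, 0 < d → ∀ᶠ i : ℕ in atTop, Real.smoothTransition (i * d) = 1 := by
      intro d hd
      filter_upwards [(tendsto_natCast_atTop_atTop (R := ℝ)).eventually_ge_atTop (1 / d)] with i hi
      refine Real.smoothTransition.one_of_one_le ?_
      rwa [div_le_iff₀ hd] at hi
    refine tendsto_const_nhds.congr' ?_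
    filter_upwards [h1 (t - a) (by linarith [ht.1]), h1 (b - t) (by linarith [ht.2])] with i h2 h3
    rw [smoothIndicator, h2, h3, mul_one]
  · rw [indicator_of_notMem ht]
    refine tendsto_const_nhds.congr fun i => ?_
    rw [mem_Ioo, not_and_or, not_lt, not_lt] at ht
    rcases ht with ht | ht
    · exact (smoothIndicator_of_le ht).symm
    · exact (smoothIndicator_of_ge ht).symm

theorem intervalIntegrable_smoothIndicator (s t : ℝ) :
    IntervalIntegrable (smoothIndicator a b i) volume s t :=
  contDiff_smoothIndicator.continuous.intervalIntegrable s t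

theorem hasDerivAt_smoothRamp : HasDerivAt (smoothRamp a b i) (-smoothIndicator a b i t) t :=
  intervalIntegral.integral_hasDerivAt_left (intervalIntegrable_smoothIndicator t b)
    contDiff_smoothIndicator.continuous.stronglyMeasurable.stronglyMeasurableAtFilter
    contDiff_smoothIndicator.continuous.continuousAt

theorem contDiff_smoothRamp : ContDiff ℝ ∞ (smoothRamp a b i) := by
  rw [contDiff_infty_iff_deriv]
  refine ⟨fun t => hasDerivAt_smoothRamp.differentiableAt, ?_⟩
  have : deriv (smoothRamp a b i) = fun t => -smoothIndicator a b i t :=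
    funext fun t => hasDerivAt_smoothRamp.deriv
  rw [this]
  exact contDiff_smoothIndicator.neg

theorem smoothRamp_of_ge (ht : b ≤ t) : smoothRamp a b i t = 0 := by
  rw [smoothRamp, intervalIntegral.integral_congr (g := fun _ => 0), intervalIntegral.integral_zero]
  intro s hs
  rw [uIcc_of_ge ht] at hs
  exact smoothIndicator_of_ge hs.1

theorem smoothRamp_of_le (ht : t ≤ a) : smoothRamp a b i t = smoothRamp a b i a := by
  rw [smoothRamp, ← intervalIntegral.integral_add_adjacent_intervals
    (intervalIntegrable_smoothIndicator t a) (intervalIntegrable_smoothIndicator a b), ← smoothRamp,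
    intervalIntegral.integral_congr (g := fun _ => 0), intervalIntegral.integral_zero, zero_add]
  intro s hs
  rw [uIcc_of_le ht] at hs
  exact smoothIndicator_of_le hs.2

theorem abs_smoothRamp_le (hab : a < b) : |smoothRamp a b i t| ≤ b - a := by
  have key : ∀ s, a ≤ s → s ≤ b → |smoothRamp a b i s| ≤ b - a := by
    intro s hs hs'
    rw [← Real.norm_eq_abs]
    refine (intervalIntegral.norm_integral_le_of_norm_le_const (C := 1) fun x _ => ?_).trans ?_
    · exact abs_smoothIndicator_le_one
    · rw [one_mul, abs_of_nonneg (by linarith)]; linarith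
  rcases le_total t a with h | h
  · rw [smoothRamp_of_le h]; exact key a le_rfl hab.le
  rcases le_total t b with h' | h'
  · exact key t h h'
  · rw [smoothRamp_of_ge h', abs_zero]; linarith

/-- Dominated convergence in the primitive. The limit is `b - a` times the linear profile of
`radialCutoff b (b - a)`, so identities tested with smooth functions reach the cutoff in the
definition of `Q_σ`. -/
theorem tendsto_smoothRamp (hab : a < b) (t : ℝ) : Tendsto (fun i => smoothRamp a b i t) atTop
    (𝓝 ((b - a) * max 0 (min 1 ((b - t) / (b - a))))) := by
  have hba : 0 < b - a := by linarith
  have key : ∀ s, a ≤ s → s ≤ b → Tendsto (fun i => smoothRamp a b i s) atTop (𝓝 (b - s)) := by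
    intro s hs hs'
    have h1 : ∫ x in s..b, (1 : ℝ) = b - s := by simp
    rw [← h1]
    refine intervalIntegral.tendsto_integral_filter_of_dominated_convergence (fun _ => 1)
      (.of_forall fun i => contDiff_smoothIndicator.continuous.aestronglyMeasurable)
      (.of_forall fun i => ae_of_all _ fun x _ => abs_smoothIndicator_le_one) (by simp) ?_
    have h2 : ∀ᵐ x : ℝ, x ≠ b := by simp [ae_iff]
    filter_upwards [h2] with x hx hxs
    rw [uIoc_of_le hs'] at hxs
    have := tendsto_smoothIndicator a b x
    rwa [indicator_of_mem (show x ∈ Ioo a b from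
      ⟨hs.trans_lt hxs.1, lt_of_le_of_ne hxs.2 hx⟩)] at this
  rcases le_total t a with h | h
  · have h1 : 1 ≤ (b - t) / (b - a) := by rw [le_div_iff₀ hba]; linarith
    rw [min_eq_left h1, max_eq_right zero_le_one, mul_one]
    exact (key a le_rfl hab.le).congr fun i => (smoothRamp_of_le h).symm
  rcases le_total t b with h' | h'
  · have h1 : (b - t) / (b - a) ≤ 1 := by rw [div_le_iff₀ hba]; linarith
    have h2 : 0 ≤ (b - t) / (b - a) := div_nonneg (by linarith) hba.le
    rw [min_eq_right h1, max_eq_right h2, mul_div_cancel₀ _ hba.ne']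
    exact key t h h'
  · have h2 : (b - t) / (b - a) ≤ 0 := div_nonpos_of_nonpos_of_nonneg (by linarith) hba.le
    rw [min_eq_right (h2.trans zero_le_one), max_eq_left h2, mul_zero]
    exact tendsto_const_nhds.congr fun i => (smoothRamp_of_ge h').symm

end SmoothRamp

namespace WeightedCone

section RadialCutoff

variable {n : ℕ} {a b : ℝ} {i : ℕ}

/-- The ramp is constant up to radius `a > 0`, so the singularity of the norm at the vertex does no
harm. -/
theorem contDiff_smoothRamp_norm (ha : 0 < a) :
    ContDiff ℝ ∞ fun x : Euc n => smoothRamp a b i ‖x‖ := by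
  rw [contDiff_iff_contDiffAt]
  intro x
  by_cases hx : x = 0
  · refine contDiffAt_const.congr_of_eventuallyEq (f := fun _ => smoothRamp a b i a) ?_
    filter_upwards [Metric.ball_mem_nhds x ha] with y hy
    rw [hx, mem_ball_zero_iff] at hy
    exact smoothRamp_of_le hy.le
  · exact contDiff_smoothRamp.contDiffAt.comp x (contDiffAt_norm ℝ hx)

theorem tsupport_smoothRamp_norm_subset :
    tsupport (fun x : Euc n => smoothRamp a b i ‖x‖) ⊆ Metric.closedBall 0 b := by
  refine closure_minimal (fun x hx => ?_) Metric.isClosed_closedBall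
  rw [mem_closedBall_zero_iff]
  by_contra hxb
  exact hx (smoothRamp_of_ge (not_le.1 hxb).le)

theorem hasCompactSupport_smoothRamp_norm :
    HasCompactSupport fun x : Euc n => smoothRamp a b i ‖x‖ :=
  (isCompact_closedBall 0 b).of_isClosed_subset (isClosed_tsupport _)
    tsupport_smoothRamp_norm_subset

theorem tgrad_smoothRamp_norm {M : Set (Euc n)} (hM : IsCone M) (ha : 0 < a) {x : Euc n}
    (hx : x ∈ M) : tgrad M (fun y => smoothRamp a b i ‖y‖) x =
      -(smoothIndicator a b i ‖x‖ • ‖x‖⁻¹ • x) := by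
  by_cases hx0 : x = 0
  · have h1 : (fun y : Euc n => smoothRamp a b i ‖y‖) =ᶠ[𝓝 x] fun _ => smoothRamp a b i a := by
      filter_upwards [Metric.ball_mem_nhds x ha] with y hy
      rw [hx0, mem_ball_zero_iff] at hy
      exact smoothRamp_of_le hy.le
    rw [tgrad_congr (h1.filter_mono nhdsWithin_le_nhds) h1.eq_of_nhds, tgrad]
    simp [hx0]
  · rw [tgrad_radial hasDerivAt_smoothRamp hx0 (hM.self_mem_tangentSpaceAt hx), neg_mul, neg_smul,
      smul_smul]

/-- Identities tested with smooth cutoffs extend to the radial cutoffs. -/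
theorem ConeData.mul_integral_radialCutoff {m : ℕ} {M : Set (Euc n)} {ρ : Euc n → ℝ} {p : ℝ}
    {q : Euc n → ℝ} {X : Euc n → Euc n} {qbar P : Euc n → ℝ} (h : ConeData m M ρ p q X qbar P)
    {r : ℝ} (ha : 0 < a) (hab : a < b) (hbr : b < r) {A : Euc n → ℝ} {B : Euc n → Euc n}
    (hA : IntegrableOn A (Metric.ball 0 r) (weightMeasure (m + 1) M ρ))
    (hB : IntegrableOn (fun x => inner ℝ (B x) (‖x‖⁻¹ • x)) (Metric.ball 0 r)
      (weightMeasure (m + 1) M ρ))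
    (H : ∀ ζ : Euc n → ℝ, ContDiff ℝ ∞ ζ → HasCompactSupport ζ → tsupport ζ ⊆ Metric.ball 0 r →
      ∫ x in Metric.ball 0 r, (ζ x * A x + inner ℝ (B x) (tgrad M ζ x))
        ∂(weightMeasure (m + 1) M ρ) = 0) :
    (b - a) * ∫ x in Metric.ball 0 r, radialCutoff b (b - a) x * A x ∂(weightMeasure (m + 1) M ρ) =
      ∫ x in Metric.ball 0 r, (Ioo a b).indicator (fun _ => 1) ‖x‖ * inner ℝ (B x) (‖x‖⁻¹ • x)
        ∂(weightMeasure (m + 1) M ρ) := by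
  set κ := weightMeasure (m + 1) M ρ
  set β : Euc n → ℝ := fun x => inner ℝ (B x) (‖x‖⁻¹ • x)
  have hae : ∀ᵐ x ∂(κ.restrict (Metric.ball 0 r)), x ∈ M := ae_restrict_of_ae h.ae_mem
  have m1 : ∀ i, AEStronglyMeasurable (fun x => smoothRamp a b i ‖x‖ * A x)
      (κ.restrict (Metric.ball 0 r)) := fun i =>
    (contDiff_smoothRamp.continuous.comp continuous_norm).aestronglyMeasurable.mul
      hA.aestronglyMeasurable
  have m2 : ∀ i, AEStronglyMeasurable (fun x => smoothIndicator a b i ‖x‖ * β x)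
      (κ.restrict (Metric.ball 0 r)) := fun i =>
    (contDiff_smoothIndicator.continuous.comp continuous_norm).aestronglyMeasurable.mul
      hB.aestronglyMeasurable
  have b1 : ∀ i, ∀ᵐ x ∂(κ.restrict (Metric.ball 0 r)), ‖smoothRamp a b i ‖x‖ * A x‖ ≤
      (b - a) * |A x| := fun i => ae_of_all _ fun x => by
    rw [Real.norm_eq_abs, abs_mul]
    exact mul_le_mul_of_nonneg_right (abs_smoothRamp_le hab) (abs_nonneg _)
  have b2 : ∀ i, ∀ᵐ x ∂(κ.restrict (Metric.ball 0 r)), ‖smoothIndicator a b i ‖x‖ * β x‖ ≤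
      |β x| := fun i => ae_of_all _ fun x => by
    rw [Real.norm_eq_abs, abs_mul]
    exact mul_le_of_le_one_left (abs_nonneg _) abs_smoothIndicator_le_one
  have l1 : Tendsto (fun i => ∫ x in Metric.ball 0 r, smoothRamp a b i ‖x‖ * A x ∂κ) atTop
      (𝓝 (∫ x in Metric.ball 0 r, (b - a) * (radialCutoff b (b - a) x * A x) ∂κ)) := by
    refine tendsto_integral_of_dominated_convergence _ m1 (hA.abs.const_mul _) b1 ?_
    refine ae_of_all _ fun x => ?_
    rw [← mul_assoc]
    exact (tendsto_smoothRamp hab ‖x‖).mul_const (A x)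
  have l2 : Tendsto (fun i => ∫ x in Metric.ball 0 r, smoothIndicator a b i ‖x‖ * β x ∂κ) atTop
      (𝓝 (∫ x in Metric.ball 0 r, (Ioo a b).indicator (fun _ => 1) ‖x‖ * β x ∂κ)) := by
    refine tendsto_integral_of_dominated_convergence _ m2 hB.abs b2 ?_
    exact ae_of_all _ fun x => (tendsto_smoothIndicator a b ‖x‖).mul_const (β x)
  have e1 : ∀ i, ∫ x in Metric.ball 0 r, smoothRamp a b i ‖x‖ * A x ∂κ =
      ∫ x in Metric.ball 0 r, smoothIndicator a b i ‖x‖ * β x ∂κ := fun i => by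
    have h1 := H (fun x => smoothRamp a b i ‖x‖) (contDiff_smoothRamp_norm ha)
      hasCompactSupport_smoothRamp_norm (tsupport_smoothRamp_norm_subset.trans
        (Metric.closedBall_subset_ball hbr))
    have h2 : ∫ x in Metric.ball 0 r, (smoothRamp a b i ‖x‖ * A x +
        inner ℝ (B x) (tgrad M (fun x => smoothRamp a b i ‖x‖) x)) ∂κ =
        ∫ x in Metric.ball 0 r, (smoothRamp a b i ‖x‖ * A x -
          smoothIndicator a b i ‖x‖ * β x) ∂κ := by
      refine integral_congr_ae ?_
      filter_upwards [hae] with x hx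
      rw [tgrad_smoothRamp_norm h.cone ha hx, inner_neg_right, inner_smul_right, ← sub_eq_add_neg]
    rw [h2, integral_sub ((hA.abs.const_mul _).mono' (m1 i) (b1 i)) (hB.abs.mono' (m2 i) (b2 i))] at h1
    exact sub_eq_zero.1 h1
  rw [← integral_const_mul]
  exact tendsto_nhds_unique (l1.congr e1) l2

end RadialCutoff

theorem euclideanHausdorffMeasure_eq_zero_of_dimH_lt {n d : ℕ} {A : Set (Euc n)}
    (hA : dimH A < (d : ENNReal)) : μHE[d] A = 0 := by
  have h1 : Measure.hausdorffMeasure (d : ℝ) A = 0 := by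
    have := hausdorffMeasure_of_dimH_lt (s := A) (d := (d : NNReal)) (by exact_mod_cast hA)
    simpa using this
  rw [Measure.euclideanHausdorffMeasure_def, Measure.smul_apply, h1, smul_zero]

theorem withDensity_pow_eq_map_exp (m : ℕ) :
    (volume.restrict (Ioi (0 : ℝ))).withDensity (fun r => ENNReal.ofReal (r ^ m)) =
      Measure.map Real.exp
        (volume.withDensity fun x => ENNReal.ofReal (Real.exp (((m : ℝ) + 1) * x))) := by
  have hpow : Measurable fun r : ℝ => ENNReal.ofReal (r ^ m) := by fun_prop
  have hexp : Measurable fun x : ℝ => ENNReal.ofReal (Real.exp (((m : ℝ) + 1) * x)) := by fun_prop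
  refine Measure.ext_of_lintegral _ fun g hg => ?_
  rw [lintegral_map hg Real.measurable_exp, lintegral_withDensity_eq_lintegral_mul _ hpow hg,
    lintegral_withDensity_eq_lintegral_mul (f := fun x : ℝ => ENNReal.ofReal (Real.exp (((m : ℝ) + 1) * x)))
      (g := fun x => g (Real.exp x)) _ hexp (hg.comp Real.measurable_exp),
    ← Real.range_exp, ← image_univ, lintegral_image_eq_lintegral_abs_deriv_mul MeasurableSet.univ
      (fun x _ => (Real.hasDerivAt_exp x).hasDerivWithinAt) Real.exp_injective.injOn,
    Measure.restrict_univ]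
  refine lintegral_congr fun x => ?_
  simp only [Pi.mul_apply]
  rw [← mul_assoc, ← ENNReal.ofReal_mul (abs_nonneg _), abs_of_pos (Real.exp_pos x),
    ← Real.exp_nat_mul, ← Real.exp_add]
  congr 3
  ring

/-! ### Logarithmic polar coordinates for the weighted measure. -/

namespace ConeData

variable {n m : ℕ} {M : Set (Euc n)} {ρ : Euc n → ℝ} {p : ℝ} {q : Euc n → ℝ}
    {X : Euc n → Euc n} {qbar P : Euc n → ℝ} (h : ConeData m M ρ p q X qbar P)

include h

theorem isParametrizable_link : IsParametrizable m (link M) := h.param.isParametrizable_link h.cone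

theorem measurableSet_link : MeasurableSet (link M) := h.isParametrizable_link.measurableSet

theorem rho_continuousOn_link : ContinuousOn ρ (link M) :=
  h.rho_smooth.continuousOn.mono inter_subset_left

theorem sigmaFinite_link : SigmaFinite (weightMeasure m (link M) ρ) :=
  sigmaFinite_weightMeasure h.measurableSet_link h.rho_continuousOn_link h.isParametrizable_link.sigmaFinite

theorem ae_mem_link : ∀ᵐ θ ∂(weightMeasure m (link M) ρ), θ ∈ link M :=
  ae_mem_weightMeasure h.measurableSet_link

/-- Integration in logarithmic polar coordinates. -/
theorem integral_polar_log {F : Euc n → ℝ} (hF : Integrable F (weightMeasure (m + 1) M ρ)) :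
    Integrable (fun z : ℝ × Euc n => Real.exp (((m : ℝ) + 1 + p) * z.1) * F (Real.exp z.1 • z.2))
      (volume.prod (weightMeasure m (link M) ρ)) ∧
    ∫ x, F x ∂(weightMeasure (m + 1) M ρ) =
      ∫ z : ℝ × Euc n, Real.exp (((m : ℝ) + 1 + p) * z.1) * F (Real.exp z.1 • z.2)
        ∂(volume.prod (weightMeasure m (link M) ρ)) := by
  have hsf := h.isParametrizable_link.sigmaFinite
  have hsf' := h.sigmaFinite_link
  set μ := μHE[m].restrict (link M)
  -- The vertex is negligible, as a point has dimension `0 < m + 1`.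
  have h0 : μHE[m + 1] ({0} : Set (Euc n)) = 0 :=
    euclideanHausdorffMeasure_eq_zero_of_dimH_lt (by rw [dimH_singleton]; simp)
  have h1 : μHE[m + 1].restrict M = μHE[m + 1].restrict (M \ {0}) :=
    Measure.restrict_congr_set (sdiff_null_ae_eq_self h0).symm
  have hmul : Measurable fun z : ℝ × Euc n => z.1 • z.2 := by fun_prop
  have hG := (integrable_weightMeasure h.measurableSet h.rho_smooth.continuousOn h.rho_nonneg).1 hF
  rw [integral_weightMeasure h.measurableSet h.rho_smooth.continuousOn h.rho_nonneg]
  have hexp : Measurable fun x : ℝ => ENNReal.ofReal (Real.exp (((m : ℝ) + 1) * x)) := by fun_prop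
  have h2 : μHE[m + 1].restrict M = Measure.map (fun z : ℝ × Euc n => Real.exp z.1 • z.2)
      ((volume.prod μ).withDensity fun z => ENNReal.ofReal (Real.exp (((m : ℝ) + 1) * z.1))) := by
    have h3 : (Measure.map Real.exp (volume.withDensity fun x =>
        ENNReal.ofReal (Real.exp (((m : ℝ) + 1) * x)))).prod μ = Measure.map (Prod.map Real.exp id)
          ((volume.withDensity fun x => ENNReal.ofReal (Real.exp (((m : ℝ) + 1) * x))).prod μ) := by
      conv_lhs => rw [← Measure.map_id (μ := μ)]
      exact Measure.map_prod_map _ _ Real.measurable_exp measurable_id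
    rw [h1, h.param.restrict_eq_map h.cone, withDensity_pow_eq_map_exp, h3,
      Measure.map_map hmul (by fun_prop), prod_withDensity_left hexp]
    rfl
  have hφ : Measurable fun z : ℝ × Euc n => Real.exp z.1 • z.2 := by fun_prop
  have hd : AEMeasurable (fun z : ℝ × Euc n => ENNReal.ofReal (Real.exp (((m : ℝ) + 1) * z.1)))
      (volume.prod μ) := (hexp.comp measurable_fst).aemeasurable
  have hρm : AEMeasurable (fun x => ENNReal.ofReal (ρ x)) μ :=
    (h.rho_continuousOn_link.aemeasurable h.measurableSet_link).ennreal_ofReal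
  have hρm' : AEMeasurable (fun z : ℝ × Euc n => ENNReal.ofReal (ρ z.2)) (volume.prod μ) :=
    hρm.comp_quasiMeasurePreserving Measure.quasiMeasurePreserving_snd
  have hae : ∀ᵐ z ∂((volume : Measure ℝ).prod μ), z.2 ∈ link M :=
    Measure.quasiMeasurePreserving_snd.ae (ae_restrict_mem h.measurableSet_link)
  -- Homogeneity splits the weight at `eˣ θ` into `e^{p x}`, which joins the Jacobian, and `ρ θ`,
  -- which becomes the weight on the link.
  have hcongr : (fun z : ℝ × Euc n => Real.exp (((m : ℝ) + 1) * z.1) *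
      (F (Real.exp z.1 • z.2) * ρ (Real.exp z.1 • z.2))) =ᵐ[volume.prod μ]
      fun z => ρ z.2 * (Real.exp (((m : ℝ) + 1 + p) * z.1) * F (Real.exp z.1 • z.2)) := by
    filter_upwards [hae] with z hz
    rw [h.rho_hom _ hz.1 _ (Real.exp_pos _), ← Real.exp_mul, add_mul _ p, Real.exp_add, mul_comm z.1 p]
    ring
  have hν : volume.prod (weightMeasure m (link M) ρ) =
      (volume.prod μ).withDensity fun z : ℝ × Euc n => ENNReal.ofReal (ρ z.2) :=
    prod_withDensity_right₀ hρm
  have hρz : ∀ᵐ z ∂((volume : Measure ℝ).prod μ), (ENNReal.ofReal (ρ z.2)).toReal = ρ z.2 := by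
    filter_upwards [hae] with z hz using ENNReal.toReal_ofReal (h.rho_nonneg _ hz.1)
  constructor
  · rw [hν, integrable_withDensity_iff_integrable_smul₀' hρm' (ae_of_all _ fun _ =>
      ENNReal.ofReal_lt_top)]
    rw [IntegrableOn, h2, integrable_map_measure hG.aestronglyMeasurable hφ.aemeasurable, integrable_withDensity_iff_integrable_smul₀' hd (ae_of_all _ fun _ =>
      ENNReal.ofReal_lt_top)] at hG
    refine hG.congr ?_
    filter_upwards [hcongr, hρz] with z hz hz'
    rw [hz', ENNReal.toReal_ofReal (Real.exp_pos _).le, smul_eq_mul, smul_eq_mul, ← hz]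
    rfl
  · rw [hν, integral_withDensity_eq_integral_toReal_smul₀ hρm' (ae_of_all _ fun _ =>
      ENNReal.ofReal_lt_top), h2, integral_map hφ.aemeasurable
      (by rw [← h2]; exact hG.aestronglyMeasurable),
      integral_withDensity_eq_integral_toReal_smul₀ hd (ae_of_all _ fun _ => ENNReal.ofReal_lt_top)]
    refine integral_congr_ae ?_
    filter_upwards [hcongr, hρz] with z hz hz'
    rw [hz', ENNReal.toReal_ofReal (Real.exp_pos _).le, smul_eq_mul, smul_eq_mul, ← hz]

omit h in
theorem image_smul_link (hM : IsCone M) {s : ℝ} (hs : 0 < s) :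
    (fun x => s • x) '' link M = M ∩ Metric.sphere 0 s := by
  ext x
  constructor
  · rintro ⟨y, hy, rfl⟩
    refine ⟨hM y hy.1 s hs, ?_⟩
    have h1 : ‖y‖ = 1 := norm_of_mem_link hy
    rw [mem_sphere_zero_iff_norm, norm_smul, h1, mul_one, Real.norm_eq_abs, abs_of_pos hs]
  · rintro ⟨hx, hxs⟩
    rw [mem_sphere_zero_iff_norm] at hxs
    refine ⟨s⁻¹ • x, ⟨hM x hx _ (inv_pos.2 hs), ?_⟩, smul_inv_smul₀ hs.ne' x⟩
    rw [mem_sphere_zero_iff_norm, norm_smul, hxs, Real.norm_eq_abs, abs_of_pos (inv_pos.2 hs),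
      inv_mul_cancel₀ hs.ne']

theorem setIntegral_sphere {s : ℝ} (hs : 0 < s) (F : Euc n → ℝ) :
    ∫ x in M ∩ Metric.sphere 0 s, F x * ρ x ∂μHE[m] =
      s ^ ((m : ℝ) + p) * ∫ θ, F (s • θ) ∂(weightMeasure m (link M) ρ) := by
  rw [← image_smul_link h.cone hs, setIntegral_image_dilation hs,
    integral_weightMeasure h.measurableSet_link h.rho_continuousOn_link fun x hx => h.rho_nonneg x hx.1,
    ← integral_const_mul, ← integral_const_mul]
  refine setIntegral_congr_fun h.measurableSet_link fun x hx => ?_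
  rw [h.rho_hom x hx.1 s hs, Real.rpow_add hs, Real.rpow_natCast]
  ring

theorem integrableOn_sphere {s : ℝ} (hs : 0 < s) {F : Euc n → ℝ} :
    IntegrableOn (fun x => F x * ρ x) (M ∩ Metric.sphere 0 s) μHE[m] ↔
      Integrable (fun θ => F (s • θ)) (weightMeasure m (link M) ρ) := by
  rw [← image_smul_link h.cone hs, integrableOn_image_dilation hs,
    integrable_weightMeasure h.measurableSet_link h.rho_continuousOn_link fun x hx => h.rho_nonneg x hx.1]
  have h1 : IntegrableOn (fun x => F (s • x) * ρ (s • x)) (link M) μHE[m] ↔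
      IntegrableOn (fun x => s ^ p * (F (s • x) * ρ x)) (link M) μHE[m] :=
    integrableOn_congr_fun (fun x hx => by rw [h.rho_hom x hx.1 s hs]; ring) h.measurableSet_link
  rw [h1, IntegrableOn, IntegrableOn,
    integrable_const_mul_iff (Real.rpow_pos_of_pos hs p).ne'.isUnit]

end ConeData

end WeightedCone

/-- Lebesgue differentiation of a primitive that is constant, on a countable family of intervals
exhausting the half-line. -/
theorem ae_eq_zero_of_intervalIntegral_eq_zero {g : ℝ → ℝ} {L : ℝ}
    (hg : ∀ a b, a < b → b < L → IntervalIntegrable g volume a b)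
    (h0 : ∀ a b, a < b → b < L → ∫ x in a..b, g x = 0) : ∀ᵐ x, x < L → g x = 0 := by
  -- The denominator `n + 2` keeps the interval nonempty already for `n = 0`.
  have hcount : ∀ᵐ x, ∀ n : ℕ, x ∈ Ioo (L - (n + 1)) (L - 1 / (n + 2)) → g x = 0 := by
    rw [ae_all_iff]
    intro n
    have hn : (0 : ℝ) < 1 / (n + 2) := by positivity
    have hab : L - ((n : ℝ) + 1) < L - 1 / (n + 2) := by
      have : 1 / ((n : ℝ) + 2) < 1 := by
        rw [div_lt_one (by positivity)]; have := Nat.cast_nonneg (α := ℝ) n; linarith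
      have := Nat.cast_nonneg (α := ℝ) n
      linarith
    have h1 := (hg _ _ hab (by linarith)).ae_hasDerivAt_integral
    filter_upwards [h1] with x hx hxI
    have h2 := hx (by rw [uIcc_of_le hab.le]; exact Ioo_subset_Icc_self hxI) (L - ((n : ℝ) + 1))
      (left_mem_uIcc)
    have h3 : (fun y => ∫ t in (L - ((n : ℝ) + 1))..y, g t) =ᶠ[𝓝 x] fun _ => 0 := by
      filter_upwards [Ioo_mem_nhds hxI.1 hxI.2] with y hy
      exact h0 _ _ hy.1 (hy.2.trans (by linarith))
    exact h2.unique ((hasDerivAt_const x 0).congr_of_eventuallyEq h3)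
  filter_upwards [hcount] with x hx hxL
  obtain ⟨n, hn⟩ := exists_nat_gt (max (L - x) (1 / (L - x)))
  have h1 := (le_max_left _ _).trans_lt hn
  have h2 := (le_max_right _ _).trans_lt hn
  refine hx n ⟨by linarith, ?_⟩
  have h3 : 0 < L - x := by linarith
  rw [div_lt_iff₀ h3] at h2
  have h4 : 1 / ((n : ℝ) + 2) < L - x := by
    rw [div_lt_iff₀ (by positivity)]; nlinarith
  linarith

/-! ### Slices of `u` over the link. -/

namespace WeightedCone

theorem norm_exp_smul {n : ℕ} {M : Set (Euc n)} {θ : Euc n} (hθ : θ ∈ link M) (x : ℝ) :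
    ‖Real.exp x • θ‖ = Real.exp x := by
  rw [norm_smul, norm_of_mem_link hθ, mul_one, Real.norm_of_nonneg (Real.exp_pos x).le]

theorem exp_smul_mem {n : ℕ} {M : Set (Euc n)} (hM : IsCone M) {θ : Euc n} (hθ : θ ∈ link M)
    {R x : ℝ} (hR : 0 < R) (hx : x < Real.log R) : Real.exp x • θ ∈ M ∩ Metric.ball 0 R := by
  refine ⟨hM _ hθ.1 _ (Real.exp_pos x), ?_⟩
  rw [mem_ball_zero_iff, norm_exp_smul hθ]
  exact (Real.lt_log_iff_exp_lt hR).1 hx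

namespace ConeData

variable {n m : ℕ} {M : Set (Euc n)} {ρ : Euc n → ℝ} {p : ℝ} {q : Euc n → ℝ}
    {X : Euc n → Euc n} {qbar P : Euc n → ℝ} (h : ConeData m M ρ p q X qbar P)

include h

theorem ae_prod_mem_link {s : Set ℝ} : ∀ᵐ z : ℝ × Euc n
    ∂((volume.restrict s).prod (weightMeasure m (link M) ρ)), z.2 ∈ link M :=
  Measure.quasiMeasurePreserving_snd.ae h.ae_mem_link

/-- On a bounded range of logarithmic radii the weight `e^{(m + 1 + p) x}` is bounded away from
zero, so it can be divided out. The condition `b < log R` keeps the points inside the ball. -/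
theorem integrable_prod_of_integrableOn {R : ℝ} (hR : 0 < R) {F : Euc n → ℝ}
    (hF : IntegrableOn F (Metric.ball 0 R) (weightMeasure (m + 1) M ρ)) {a b : ℝ}
    (hb : b < Real.log R) : Integrable (fun z : ℝ × Euc n => F (Real.exp z.1 • z.2))
      ((volume.restrict (Ioc a b)).prod (weightMeasure m (link M) ρ)) := by
  have hsf := h.sigmaFinite_link
  rw [← integrable_indicator_iff Metric.isOpen_ball.measurableSet] at hF
  have h1 := (h.integral_polar_log hF).1
  set D := (m : ℝ) + 1 + p
  have h2 : Integrable (fun z : ℝ × Euc n => Real.exp (D * z.1) *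
      (Metric.ball 0 R).indicator F (Real.exp z.1 • z.2))
      ((volume.restrict (Ioc a b)).prod (weightMeasure m (link M) ρ)) :=
    by
      have e : (volume.restrict (Ioc a b)).prod (weightMeasure m (link M) ρ) =
          (volume.prod (weightMeasure m (link M) ρ)).restrict (Ioc a b ×ˢ univ) := by
        rw [← Measure.prod_restrict, Measure.restrict_univ]
      rw [e]
      exact h1.restrict
  have hae : ∀ᵐ z : ℝ × Euc n ∂((volume.restrict (Ioc a b)).prod (weightMeasure m (link M) ρ)),
      z.1 ∈ Ioc a b := Measure.quasiMeasurePreserving_fst.ae (ae_restrict_mem measurableSet_Ioc)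
  have h3 : (fun z : ℝ × Euc n => F (Real.exp z.1 • z.2)) =ᵐ[(volume.restrict (Ioc a b)).prod
      (weightMeasure m (link M) ρ)] fun z => Real.exp (-(D * z.1)) * (Real.exp (D * z.1) *
      (Metric.ball 0 R).indicator F (Real.exp z.1 • z.2)) := by
    filter_upwards [h.ae_prod_mem_link, hae] with z hz hz'
    rw [← mul_assoc, ← Real.exp_add, neg_add_cancel, Real.exp_zero, one_mul,
      indicator_of_mem (exp_smul_mem h.cone hz hR (hz'.2.trans_lt hb)).2]
  refine Integrable.congr ?_ h3.symm
  refine (h2.norm.const_mul (Real.exp (|D| * (|a| + |b|)))).mono' ?_ ?_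
  · refine AEStronglyMeasurable.mul ?_ h2.aestronglyMeasurable
    exact (by fun_prop : Continuous fun z : ℝ × Euc n => Real.exp (-(D * z.1))).aestronglyMeasurable
  · filter_upwards [hae] with z hz
    rw [norm_mul, Real.norm_of_nonneg (Real.exp_pos _).le]
    refine mul_le_mul_of_nonneg_right (Real.exp_le_exp.2 ?_) (norm_nonneg _)
    have h4 : |z.1| ≤ |a| + |b| := by
      rw [abs_le]
      constructor
      · linarith [hz.1, neg_abs_le a, abs_nonneg b]
      · linarith [hz.2, le_abs_self b, abs_nonneg a]
    calc -(D * z.1) ≤ |D * z.1| := neg_le_abs _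
      _ = |D| * |z.1| := abs_mul _ _
      _ ≤ _ := mul_le_mul_of_nonneg_left h4 (abs_nonneg _)

theorem intervalIntegrable_integral_link {R : ℝ} (hR : 0 < R) {F : Euc n → ℝ}
    (hF : IntegrableOn F (Metric.ball 0 R) (weightMeasure (m + 1) M ρ)) {a b c : ℝ} (hab : a < b)
    (hb : b < Real.log R) : IntervalIntegrable (fun x => Real.exp (c * x) *
      ∫ θ, F (Real.exp x • θ) ∂(weightMeasure m (link M) ρ)) volume a b := by
  have hsf := h.sigmaFinite_link
  have h1 : IntervalIntegrable (fun x => ∫ θ, F (Real.exp x • θ) ∂(weightMeasure m (link M) ρ))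
      volume a b := by
    rw [intervalIntegrable_iff_integrableOn_Ioc_of_le hab.le]
    exact (h.integrable_prod_of_integrableOn hR hF hb).integral_prod_left
  exact h1.continuousOn_mul (by fun_prop)

/-- Integration over a spherical shell. -/
theorem setIntegral_shell {R : ℝ} {F : Euc n → ℝ}
    (hF : IntegrableOn F (Metric.ball 0 R) (weightMeasure (m + 1) M ρ)) {s t : ℝ} (hs : 0 < s)
    (hst : s < t) (ht : t ≤ R) :
    ∫ x in Metric.ball 0 R, (Ioo s t).indicator (fun _ => 1) ‖x‖ * F x
      ∂(weightMeasure (m + 1) M ρ) = ∫ x in (Real.log s)..(Real.log t),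
        Real.exp (((m : ℝ) + 1 + p) * x) *
          ∫ θ, F (Real.exp x • θ) ∂(weightMeasure m (link M) ρ) := by
  have hsf := h.sigmaFinite_link
  have ht0 : 0 < t := hs.trans hst
  rw [← integrable_indicator_iff Metric.isOpen_ball.measurableSet] at hF
  set G : Euc n → ℝ := fun x => (Ioo s t).indicator (fun _ => 1) ‖x‖ *
    (Metric.ball 0 R).indicator F x
  have hG : Integrable G (weightMeasure (m + 1) M ρ) := by
    refine hF.norm.mono' (AEStronglyMeasurable.mul ?_ hF.aestronglyMeasurable) ?_
    · exact ((measurable_const.indicator measurableSet_Ioo).comp measurable_norm).aestronglyMeasurable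
    · refine ae_of_all _ fun x => ?_
      rw [norm_mul]
      refine mul_le_of_le_one_left (norm_nonneg _) ?_
      by_cases hx : ‖x‖ ∈ Ioo s t
      · rw [indicator_of_mem hx]; simp
      · rw [indicator_of_notMem hx]; simp
  have e1 : ∫ x in Metric.ball 0 R, (Ioo s t).indicator (fun _ => 1) ‖x‖ * F x
      ∂(weightMeasure (m + 1) M ρ) = ∫ x, G x ∂(weightMeasure (m + 1) M ρ) := by
    rw [← integral_indicator Metric.isOpen_ball.measurableSet]
    congr 1
    funext x
    by_cases hx : x ∈ Metric.ball (0 : Euc n) R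
    · simp only [G, indicator_of_mem hx]
    · simp only [G, indicator_of_notMem hx, mul_zero]
  obtain ⟨h1, h2⟩ := h.integral_polar_log hG
  have hlog : Real.log s < Real.log t := Real.log_lt_log hs hst
  rw [e1, h2, integral_prod _ h1, intervalIntegral.integral_of_le hlog.le, integral_Ioc_eq_integral_Ioo,
    ← integral_indicator measurableSet_Ioo]
  congr 1
  funext x
  by_cases hx : x ∈ Ioo (Real.log s) (Real.log t)
  · rw [indicator_of_mem hx, ← integral_const_mul]
    refine integral_congr_ae ?_
    filter_upwards [h.ae_mem_link] with θ hθ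
    have h3 : Real.exp x ∈ Ioo s t :=
      ⟨(Real.log_lt_iff_lt_exp hs).1 hx.1, (Real.lt_log_iff_exp_lt ht0).1 hx.2⟩
    have h4 : Real.exp x • θ ∈ Metric.ball (0 : Euc n) R := by
      rw [mem_ball_zero_iff, norm_exp_smul hθ]; exact h3.2.trans_le ht
    simp only [G, norm_exp_smul hθ, indicator_of_mem h3, indicator_of_mem h4, one_mul]
  · rw [indicator_of_notMem hx, integral_eq_zero_of_ae]
    filter_upwards [h.ae_mem_link] with θ hθ
    have h3 : Real.exp x ∉ Ioo s t := fun hh => hx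
      ⟨(Real.log_lt_iff_lt_exp hs).2 hh.1, (Real.lt_log_iff_exp_lt ht0).2 hh.2⟩
    simp only [G, norm_exp_smul hθ, indicator_of_notMem h3, zero_mul, mul_zero, Pi.zero_apply]

end ConeData

/-- The restriction of `u` to spheres, pulled back to the link. -/
noncomputable def slice {n : ℕ} (u : Euc n → ℝ) (x : ℝ) (θ : Euc n) : ℝ := u (Real.exp x • θ)

/-- The derivative of `slice` in the logarithmic radius. -/
noncomputable def sliceDeriv {n : ℕ} (M : Set (Euc n)) (u : Euc n → ℝ) (x : ℝ) (θ : Euc n) : ℝ :=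
  Real.exp x * radialDeriv M u (Real.exp x • θ)

/-- The curve of the slices of `u` in `L²` of the link. -/
noncomputable def sliceCurve {n : ℕ} (m : ℕ) (M : Set (Euc n)) (ρ u : Euc n → ℝ) (x : ℝ) :
    Lp ℝ 2 (weightMeasure m (link M) ρ) := toL2 _ (slice u x)

/-- The velocity of `sliceCurve`. -/
noncomputable def sliceCurveDeriv {n : ℕ} (m : ℕ) (M : Set (Euc n)) (ρ u : Euc n → ℝ) (x : ℝ) :
    Lp ℝ 2 (weightMeasure m (link M) ρ) := toL2 _ (sliceDeriv M u x)

theorem radialDeriv_exp_smul {n : ℕ} {M : Set (Euc n)} {u : Euc n → ℝ} {θ : Euc n}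
    (hθ : θ ∈ link M) (x : ℝ) :
    radialDeriv M u (Real.exp x • θ) = inner ℝ (tgrad M u (Real.exp x • θ)) θ :=
  radialDeriv_smul (Real.exp_pos x) (norm_of_mem_link hθ)

namespace CriticalData

variable {n m : ℕ} {M : Set (Euc n)} {ρ : Euc n → ℝ} {p : ℝ} {q : Euc n → ℝ}
    {X : Euc n → Euc n} {qbar P : Euc n → ℝ} {R : ℝ} {u : Euc n → ℝ}
    (h : CriticalData m M ρ p q X qbar P R u)

include h

theorem hasDerivAt_slice {θ : Euc n} (hθ : θ ∈ link M) {x : ℝ} (hx : x < Real.log R) :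
    HasDerivAt (fun x => slice u x θ) (sliceDeriv M u x θ) x := by
  have h1 := h.cone.hasDerivAt_ray (Real.exp_pos x) hθ.1
    (h.differentiableWithinAt (exp_smul_mem h.cone hθ h.R_pos hx))
  have h2 := h1.comp x (Real.hasDerivAt_exp x)
  rw [sliceDeriv, radialDeriv_exp_smul hθ, mul_comm]
  exact h2

theorem continuousOn_tgrad_ball : ContinuousOn (tgrad M u) (M ∩ Metric.ball 0 R) :=
  h.continuousOn_tgrad Metric.isOpen_ball h.u_smooth

theorem continuousOn_sliceDeriv {θ : Euc n} (hθ : θ ∈ link M) :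
    ContinuousOn (fun x => sliceDeriv M u x θ) (Iio (Real.log R)) := by
  have h1 : ContinuousOn (fun x => Real.exp x * inner ℝ (tgrad M u (Real.exp x • θ)) θ)
      (Iio (Real.log R)) := by
    refine Real.continuous_exp.continuousOn.mul (ContinuousOn.inner ?_ continuousOn_const)
    exact h.continuousOn_tgrad_ball.comp (by fun_prop) fun x hx =>
      exp_smul_mem h.cone hθ h.R_pos hx
  refine h1.congr fun x hx => ?_
  rw [sliceDeriv, radialDeriv_exp_smul hθ]

theorem continuousOn_slice {x : ℝ} (hx : x < Real.log R) : ContinuousOn (slice u x) (link M) :=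
  h.u_smooth.continuousOn.comp (by fun_prop) fun θ hθ => exp_smul_mem h.cone hθ h.R_pos hx

theorem aestronglyMeasurable_slice {x : ℝ} (hx : x < Real.log R) :
    AEStronglyMeasurable (slice u x) (weightMeasure m (link M) ρ) :=
  ((h.continuousOn_slice hx).aestronglyMeasurable h.measurableSet_link).mono_ac
    weightMeasure_absolutelyContinuous

theorem aestronglyMeasurable_sliceDeriv {x : ℝ} (hx : x < Real.log R) :
    AEStronglyMeasurable (sliceDeriv M u x) (weightMeasure m (link M) ρ) := by
  have h1 : ContinuousOn (fun θ => Real.exp x * inner ℝ (tgrad M u (Real.exp x • θ)) θ) (link M) := by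
    refine continuousOn_const.mul (ContinuousOn.inner ?_ continuousOn_id)
    exact h.continuousOn_tgrad_ball.comp (by fun_prop) fun θ hθ =>
      exp_smul_mem h.cone hθ h.R_pos hx
  refine ((h1.congr fun θ hθ => ?_).aestronglyMeasurable h.measurableSet_link).mono_ac
    weightMeasure_absolutelyContinuous
  rw [sliceDeriv, radialDeriv_exp_smul hθ]

omit h in
theorem abs_radialDeriv_le (x : Euc n) : |radialDeriv M u x| ≤ ‖tgrad M u x‖ := by
  rw [radialDeriv]
  refine (abs_real_inner_le_norm _ _).trans (mul_le_of_le_one_right (norm_nonneg _) ?_)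
  rw [norm_smul, norm_inv, norm_norm]
  exact inv_mul_le_one

theorem ae_mem_ball : ∀ᵐ x ∂((weightMeasure (m + 1) M ρ).restrict (Metric.ball 0 R)),
    x ∈ M ∩ Metric.ball 0 R := by
  filter_upwards [ae_restrict_of_ae h.ae_mem, ae_restrict_mem Metric.isOpen_ball.measurableSet]
    with x h1 h2 using ⟨h1, h2⟩

theorem aestronglyMeasurable_unit {r : ℝ} {B : Euc n → Euc n}
    (hB : ContinuousOn B (M ∩ Metric.ball 0 r)) :
    AEStronglyMeasurable (fun x => inner ℝ (B x) (‖x‖⁻¹ • x))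
      ((weightMeasure (m + 1) M ρ).restrict (Metric.ball 0 r)) := by
  refine AEStronglyMeasurable.inner (aestronglyMeasurable_weightMeasure h.measurableSet
    Metric.isOpen_ball.measurableSet hB) ?_
  exact (by fun_prop : Measurable fun x : Euc n => ‖x‖⁻¹ • x).aestronglyMeasurable

theorem integrableOn_sq : IntegrableOn (fun x => u x ^ 2) (Metric.ball 0 R)
    (weightMeasure (m + 1) M ρ) := by
  refine h.integrable.mono' (aestronglyMeasurable_weightMeasure h.measurableSet
    Metric.isOpen_ball.measurableSet (h.u_smooth.continuousOn.pow 2)) ?_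
  filter_upwards [h.ae_mem_ball] with x hx
  have h1 := pow_le_pow_left₀ (abs_nonneg _) (abs_le_sqrt_energy (M := M) (ρ := ρ) (f := u)
    (h.P_pos x hx.1).le) 2
  rwa [Real.sq_sqrt (energy_nonneg (h.P_pos x hx.1).le), sq_abs, ← Real.norm_of_nonneg
    (sq_nonneg (u x))] at h1

theorem integrableOn_radialDeriv_sq : IntegrableOn (fun x => radialDeriv M u x ^ 2)
    (Metric.ball 0 R) (weightMeasure (m + 1) M ρ) := by
  refine h.integrable.mono' ((h.aestronglyMeasurable_unit h.continuousOn_tgrad_ball).pow 2) ?_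
  filter_upwards [h.ae_mem_ball] with x hx
  have h1 := pow_le_pow_left₀ (abs_nonneg _) ((abs_radialDeriv_le x).trans
    (norm_tgrad_le_sqrt_energy (M := M) (ρ := ρ) (f := u) (h.P_pos x hx.1).le)) 2
  rwa [Real.sq_sqrt (energy_nonneg (h.P_pos x hx.1).le), sq_abs, ← Real.norm_of_nonneg
    (sq_nonneg (radialDeriv M u x))] at h1

theorem integrableOn_mul_radialDeriv : IntegrableOn (fun x => u x * radialDeriv M u x)
    (Metric.ball 0 R) (weightMeasure (m + 1) M ρ) := by
  refine (h.integrableOn_sq.add h.integrableOn_radialDeriv_sq).mono'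
    ((aestronglyMeasurable_weightMeasure h.measurableSet Metric.isOpen_ball.measurableSet
      h.u_smooth.continuousOn).mul (h.aestronglyMeasurable_unit h.continuousOn_tgrad_ball)) ?_
  refine ae_of_all _ fun x => ?_
  rw [Real.norm_eq_abs, abs_le, Pi.add_apply]
  constructor <;> nlinarith [sq_nonneg (u x - radialDeriv M u x), sq_nonneg (u x + radialDeriv M u x)]

theorem integrable_slice_sq (a b : ℝ) (hb : b < Real.log R) :
    Integrable (fun z : ℝ × Euc n => slice u z.1 z.2 ^ 2)
      ((volume.restrict (Ioc a b)).prod (weightMeasure m (link M) ρ)) :=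
  h.integrable_prod_of_integrableOn h.R_pos h.integrableOn_sq hb

theorem integrable_sliceDeriv_sq (a b : ℝ) (hb : b < Real.log R) :
    Integrable (fun z : ℝ × Euc n => sliceDeriv M u z.1 z.2 ^ 2)
      ((volume.restrict (Ioc a b)).prod (weightMeasure m (link M) ρ)) := by
  have hsf := h.sigmaFinite_link
  have h1 := h.integrable_prod_of_integrableOn h.R_pos h.integrableOn_radialDeriv_sq
    (a := a) hb
  have e : (fun z : ℝ × Euc n => sliceDeriv M u z.1 z.2 ^ 2) = fun z : ℝ × Euc n =>
      Real.exp z.1 ^ 2 * radialDeriv M u (Real.exp z.1 • z.2) ^ 2 := by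
    funext z; rw [sliceDeriv, mul_pow]
  rw [e]
  refine (h1.const_mul (Real.exp b ^ 2)).mono' (AEStronglyMeasurable.mul
    (by fun_prop : Continuous fun z : ℝ × Euc n => Real.exp z.1 ^ 2).aestronglyMeasurable
    h1.aestronglyMeasurable) ?_
  have hae : ∀ᵐ z : ℝ × Euc n ∂((volume.restrict (Ioc a b)).prod (weightMeasure m (link M) ρ)),
      z.1 ∈ Ioc a b := Measure.quasiMeasurePreserving_fst.ae (ae_restrict_mem measurableSet_Ioc)
  filter_upwards [hae] with z hz
  rw [Real.norm_of_nonneg (by positivity)]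
  exact mul_le_mul_of_nonneg_right (pow_le_pow_left₀ (Real.exp_pos _).le (Real.exp_le_exp.2 hz.2) 2)
    (sq_nonneg _)

theorem memLp_slice {x : ℝ} (hx : x < Real.log R) :
    MemLp (slice u x) 2 (weightMeasure m (link M) ρ) := by
  have hsf := h.sigmaFinite_link
  exact memLp_two_of_integrable_prod (L := Real.log R) (f := slice u) (f' := sliceDeriv M u)
    (h.ae_mem_link.mono fun θ hθ x hx => h.hasDerivAt_slice hθ hx)
    (h.ae_mem_link.mono fun θ hθ => h.continuousOn_sliceDeriv hθ)
    (fun x hx => h.aestronglyMeasurable_slice hx) (fun a b _ hb => h.integrable_slice_sq a b hb)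
    (fun a b _ hb => h.integrable_sliceDeriv_sq a b hb) hx

theorem absolutelyContinuousOnInterval_sliceCurve {a b : ℝ} (ha : a < Real.log R)
    (hb : b < Real.log R) : AbsolutelyContinuousOnInterval (sliceCurve m M ρ u) a b := by
  have hsf := h.sigmaFinite_link
  exact absolutelyContinuousOnInterval_toL2 (L := Real.log R) (f := slice u) (f' := sliceDeriv M u)
    (h.ae_mem_link.mono fun θ hθ x hx => h.hasDerivAt_slice hθ hx)
    (h.ae_mem_link.mono fun θ hθ => h.continuousOn_sliceDeriv hθ)
    (fun x hx => h.aestronglyMeasurable_slice hx) (fun a b _ hb => h.integrable_slice_sq a b hb)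
    (fun a b _ hb => h.integrable_sliceDeriv_sq a b hb) ha hb

theorem ae_hasDerivAt_sliceCurve : ∀ᵐ x, x < Real.log R →
    MemLp (sliceDeriv M u x) 2 (weightMeasure m (link M) ρ) ∧
      HasDerivAt (sliceCurve m M ρ u) (sliceCurveDeriv m M ρ u x) x := by
  have hsf := h.sigmaFinite_link
  exact ae_hasDerivAt_toL2 (L := Real.log R) (f := slice u) (f' := sliceDeriv M u)
    (h.ae_mem_link.mono fun θ hθ x hx => h.hasDerivAt_slice hθ hx)
    (h.ae_mem_link.mono fun θ hθ => h.continuousOn_sliceDeriv hθ)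
    (fun x hx => h.aestronglyMeasurable_slice hx) (fun x hx => h.aestronglyMeasurable_sliceDeriv hx)
    (fun a b _ hb => h.integrable_slice_sq a b hb)
    (fun a b _ hb => h.integrable_sliceDeriv_sq a b hb)

end CriticalData

theorem wronskian_eq_inner {n : ℕ} (M : Set (Euc n)) (f g : Euc n → ℝ) (w x : Euc n) :
    wronskian M f g w x = inner ℝ (g x • tgrad M f x - f x • tgrad M g x) w := by
  rw [wronskian, inner_sub_left, inner_smul_left, inner_smul_left]
  simp

theorem inv_norm_smul_exp_smul {n : ℕ} {M : Set (Euc n)} {θ : Euc n} (hθ : θ ∈ link M) (x : ℝ) :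
    ‖Real.exp x • θ‖⁻¹ • Real.exp x • θ = θ := by
  rw [norm_exp_smul hθ, inv_smul_smul₀ (Real.exp_pos x).ne']

/-! ### The Wronskian identity for the curve of slices. -/

namespace CriticalData

variable {n m : ℕ} {M : Set (Euc n)} {ρ : Euc n → ℝ} {p : ℝ} {q : Euc n → ℝ}
    {X : Euc n → Euc n} {qbar P : Euc n → ℝ} {R : ℝ} {u : Euc n → ℝ}
    (h : CriticalData m M ρ p q X qbar P R u)

include h

section

variable {l r : ℝ} (hl : 0 < l) (hrR : r < R) (hlr : l * r < R)

include hl hrR hlr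

omit hrR in
theorem contDiffOn_comp_smul : ContDiffOn ℝ ∞ (fun y => u (l • y)) (M ∩ Metric.ball 0 r) := by
  refine h.u_smooth.comp (contDiff_const_smul l).contDiffOn fun x hx => ⟨h.cone x hx.1 l hl, ?_⟩
  exact Metric.ball_subset_ball hlr.le ((smul_mem_ball_iff hl).2 hx.2)

theorem continuousOn_wronskian_field :
    ContinuousOn (fun x => u (l • x) • tgrad M u x - u x • tgrad M (fun y => u (l • y)) x)
      (M ∩ Metric.ball 0 r) := by
  have hB := Metric.isOpen_ball (x := (0 : Euc n)) (ε := r)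
  have hv := h.contDiffOn_comp_smul hl hlr
  have hu := h.u_smooth.mono (inter_subset_inter_right M (Metric.ball_subset_ball hrR.le))
  exact (hv.continuousOn.smul (h.continuousOn_tgrad hB hu)).sub
    (hu.continuousOn.smul (h.continuousOn_tgrad hB hv))

theorem integrableOn_wronskian :
    IntegrableOn (fun x => wronskian M u (fun y => u (l • y)) (‖x‖⁻¹ • x) x) (Metric.ball 0 r)
      (weightMeasure (m + 1) M ρ) := by
  have hsub : Metric.ball (0 : Euc n) r ⊆ Metric.ball 0 R := Metric.ball_subset_ball hrR.le
  have j1 := h.integrable.mono_set hsub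
  have j2 := h.integrableOn_comp_smul (r := r) hl
    (h.integrable.mono_set (Metric.ball_subset_ball hlr.le))
  refine (j1.add (j2.const_mul ((1 + l) ^ 2))).mono' ?_ ?_
  · simp only [wronskian_eq_inner]
    exact h.aestronglyMeasurable_unit (h.continuousOn_wronskian_field hl hrR hlr)
  · filter_upwards [ae_restrict_of_ae h.ae_mem,
      ae_restrict_mem Metric.isOpen_ball.measurableSet] with x hx hxr
    have hlx : l • x ∈ M ∩ Metric.ball 0 R := ⟨h.cone x hx l hl,
      Metric.ball_subset_ball hlr.le ((smul_mem_ball_iff hl).2 hxr)⟩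
    have hP := (h.P_pos x hx).le
    have hP' := (h.P_pos _ hlx.1).le
    have a1 : |u x| ≤ √(energy M ρ P u x) := abs_le_sqrt_energy hP
    have a2 : ‖tgrad M u x‖ ≤ √(energy M ρ P u x) := norm_tgrad_le_sqrt_energy hP
    have a3 : |u (l • x)| ≤ √(energy M ρ P u (l • x)) := abs_le_sqrt_energy hP'
    have a4 : ‖tgrad M u (l • x)‖ ≤ √(energy M ρ P u (l • x)) := norm_tgrad_le_sqrt_energy hP'
    have a5 := Real.sqrt_nonneg (energy M ρ P u (l • x))
    have a6 : ‖tgrad M (fun y => u (l • y)) x‖ ≤ (1 + l) * √(energy M ρ P u (l • x)) := by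
      rw [h.cone.tgrad_comp_smul hl (h.differentiableWithinAt hlx), norm_smul, Real.norm_eq_abs,
        abs_of_pos hl]
      nlinarith
    have a7 : |u (l • x)| ≤ (1 + l) * √(energy M ρ P u (l • x)) := by nlinarith
    have a8 : ‖‖x‖⁻¹ • x‖ ≤ 1 := by
      rw [norm_smul, norm_inv, norm_norm]; exact inv_mul_le_one
    have := abs_wronskian_le (g := fun y => u (l • y)) a1 a2 a7 a6 a8
    rw [Real.norm_eq_abs, Pi.add_apply]
    refine this.trans ?_
    have e1 := Real.sq_sqrt (energy_nonneg (M := M) (ρ := ρ) (f := u) hP)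
    have e2 := Real.sq_sqrt (energy_nonneg (M := M) (ρ := ρ) (f := u) hP')
    nlinarith [sq_nonneg (√(energy M ρ P u x) - (1 + l) * √(energy M ρ P u (l • x)))]

/-- The divergence free identity has no term multiplying the value of the cutoff. Its limit for the
radial cutoff is therefore a statement about the flux over the shell alone, where the gradient of
the cutoff lives. -/
theorem integral_shell_wronskian {a b : ℝ} (ha : 0 < a) (hab : a < b) (hbr : b < r) :
    ∫ x in Metric.ball 0 r, (Ioo a b).indicator (fun _ => 1) ‖x‖ *
      wronskian M u (fun y => u (l • y)) (‖x‖⁻¹ • x) x ∂(weightMeasure (m + 1) M ρ) = 0 := by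
  have h1 := h.mul_integral_radialCutoff ha hab hbr (A := fun _ => 0)
    (B := fun x => u (l • x) • tgrad M u x - u x • tgrad M (fun y => u (l • y)) x)
    integrableOn_zero ?_ fun ζ h1 h2 h3 => ?_
  · simp only [mul_zero, integral_zero] at h1
    simp only [wronskian_eq_inner]
    exact h1.symm
  · have := h.integrableOn_wronskian hl hrR hlr
    simpa only [wronskian_eq_inner] using this
  · have := h.integral_wronskian hl (ha.trans (hab.trans hbr)) hrR hlr h1 h2 h3
    simpa only [wronskian_eq_inner, mul_zero, zero_add] using this

end

/-- The flux of the Wronskian field for `l = eᶜ` vanishes over all shells, hence through almost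
every sphere. In slices, the normal derivatives of `u` and of `u (l ·)` become the velocities at `x`
and at `x + c`, because `sliceDeriv` carries the factor of the logarithmic radius. -/
theorem ae_inner_sliceCurve (c : ℝ) : ∀ᵐ x, x < Real.log R → x + c < Real.log R →
    inner ℝ (sliceCurveDeriv m M ρ u x) (sliceCurve m M ρ u (x + c)) =
      inner ℝ (sliceCurve m M ρ u x) (sliceCurveDeriv m M ρ u (x + c)) := by
  have hl := Real.exp_pos c
  set F : Euc n → ℝ := fun x => wronskian M u (fun y => u (Real.exp c • y)) (‖x‖⁻¹ • x) x with hF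
  set ν := weightMeasure m (link M) ρ
  have hrad : ∀ b, b < min (Real.log R) (Real.log R - c) →
      Real.exp b < R ∧ Real.exp c * Real.exp b < R := fun b hb => by
    have h1 := hb.trans_le (min_le_left _ _)
    have h2 := hb.trans_le (min_le_right _ _)
    rw [← Real.exp_add]
    exact ⟨(Real.lt_log_iff_exp_lt h.R_pos).1 h1, (Real.lt_log_iff_exp_lt h.R_pos).1 (by linarith)⟩
  -- The minimum ensures that both `eˣ` and `e^{x + c}` are radii below `R`.
  have h0 : ∀ᵐ x, x < min (Real.log R) (Real.log R - c) →
      Real.exp (((m : ℝ) + 1 + p) * x) * ∫ θ, F (Real.exp x • θ) ∂ν = 0 := by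
    refine ae_eq_zero_of_intervalIntegral_eq_zero (fun a b hab hb => ?_) fun a b hab hb => ?_
    · obtain ⟨b', hb1, hb2⟩ := exists_between hb
      obtain ⟨r1, r2⟩ := hrad b' hb2
      exact h.intervalIntegrable_integral_link (Real.exp_pos b')
        (h.integrableOn_wronskian hl r1 r2) hab (by rwa [Real.log_exp])
    · obtain ⟨b', hb1, hb2⟩ := exists_between hb
      obtain ⟨r1, r2⟩ := hrad b' hb2
      have e1 := h.setIntegral_shell (h.integrableOn_wronskian hl r1 r2) (Real.exp_pos a)
        (Real.exp_lt_exp.2 hab) (Real.exp_le_exp.2 hb1.le)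
      rw [Real.log_exp, Real.log_exp, h.integral_shell_wronskian hl r1 r2 (Real.exp_pos a)
        (Real.exp_lt_exp.2 hab) (Real.exp_lt_exp.2 hb1)] at e1
      exact e1.symm
  have hshift : ∀ᵐ x, x + c < Real.log R → MemLp (sliceDeriv M u (x + c)) 2 ν :=
    ((measurePreserving_add_right volume c).quasiMeasurePreserving.ae
      h.ae_hasDerivAt_sliceCurve).mono fun x hx hxc => (hx hxc).1
  filter_upwards [h0, h.ae_hasDerivAt_sliceCurve, hshift] with x hx1 hx2 hx3 hxR hxc
  have m1 := h.memLp_slice hxR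
  have m2 := h.memLp_slice hxc
  have m3 := (hx2 hxR).1
  have m4 := hx3 hxc
  have hx5 : ∫ θ, F (Real.exp x • θ) ∂ν = 0 :=
    (mul_eq_zero.1 (hx1 (lt_min hxR (by linarith)))).resolve_left (Real.exp_pos _).ne'
  have i1 : Integrable (fun θ => sliceDeriv M u x θ * slice u (x + c) θ) ν := m3.integrable_mul m2
  have i2 : Integrable (fun θ => slice u x θ * sliceDeriv M u (x + c) θ) ν := m1.integrable_mul m4
  rw [sliceCurveDeriv, sliceCurveDeriv, sliceCurve, sliceCurve, inner_toL2 m3 m2, inner_toL2 m1 m4,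
    ← sub_eq_zero, ← integral_sub i1 i2,
    ← mul_zero (Real.exp x), ← hx5, ← integral_const_mul]
  refine integral_congr_ae ?_
  filter_upwards [h.ae_mem_link] with θ hθ
  have e1 : Real.exp c • Real.exp x • θ = Real.exp (x + c) • θ := by
    rw [smul_smul, ← Real.exp_add, add_comm]
  have hd : DifferentiableWithinAt ℝ u M (Real.exp c • Real.exp x • θ) := by
    rw [e1]; exact h.differentiableWithinAt (exp_smul_mem h.cone hθ h.R_pos hxc)
  simp only [hF, wronskian, inv_norm_smul_exp_smul hθ]
  rw [h.cone.tgrad_comp_smul hl hd, e1, inner_smul_left, sliceDeriv, sliceDeriv, slice, slice,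
    radialDeriv_exp_smul hθ, radialDeriv_exp_smul hθ, Real.exp_add]
  simp only [conj_trivial]
  ring

end CriticalData

/-- The part of the flux density which multiplies the value of the cutoff. -/
theorem fluxDensity_eq {n : ℕ} (M : Set (Euc n)) (ρ qbar : Euc n → ℝ) (X : Euc n → Euc n)
    (u : Euc n → ℝ) (z : ℝ) (w x : Euc n) : fluxDensity M ρ qbar X u u z w x =
      z * fluxDensity M ρ qbar X u u 1 0 x + inner ℝ (u x • tgrad M u x + u x ^ 2 • X x) w := by
  simp only [fluxDensity, inner_add_left, inner_add_right, inner_smul_left, inner_smul_right,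
    inner_zero_right, conj_trivial]
  ring

/-- In polar coordinates a sphere is a single radius. This makes the kinks of the piecewise linear
cutoff negligible. -/
theorem IsParametrizable.ae_norm_ne {n m : ℕ} {M : Set (Euc n)} (hM : IsParametrizable (m + 1) M)
    (hc : IsCone M) {s : ℝ} (hs : 0 < s) : ∀ᵐ x ∂(μHE[m + 1].restrict M), ‖x‖ ≠ s := by
  have hS : MeasurableSet (Metric.sphere (0 : Euc n) s) := Metric.isClosed_sphere.measurableSet
  have h1 := hM.lintegral_polar hc (g := (Metric.sphere 0 s).indicator 1)
    (measurable_one.indicator hS)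
  have h2 : ∫⁻ r in Ioi (0 : ℝ), ENNReal.ofReal (r ^ m) * ∫⁻ θ in link M,
      (Metric.sphere 0 s).indicator (1 : Euc n → ENNReal) (r • θ) ∂μHE[m] = 0 := by
    rw [lintegral_eq_zero_of_ae_eq_zero]
    have h3 : ∀ᵐ r : ℝ ∂(volume.restrict (Ioi (0 : ℝ))), r ≠ s :=
      ae_restrict_of_ae (by simp [ae_iff])
    filter_upwards [h3, ae_restrict_mem measurableSet_Ioi] with r hr hr0
    have h4 : ∫⁻ θ in link M, (Metric.sphere 0 s).indicator (1 : Euc n → ENNReal) (r • θ) ∂μHE[m] =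
        ∫⁻ θ in link M, 0 ∂μHE[m] := by
      refine setLIntegral_congr_fun (hM.isParametrizable_link hc).measurableSet fun θ hθ => ?_
      refine indicator_of_notMem (fun hh => hr ?_) _
      rwa [mem_sphere_zero_iff_norm, norm_smul, norm_of_mem_link hθ, mul_one,
        Real.norm_of_nonneg (le_of_lt hr0)] at hh
    rw [h4, lintegral_zero, mul_zero, Pi.zero_apply]
  rw [h2, lintegral_indicator_one hS, Measure.restrict_apply hS] at h1
  rw [ae_iff]
  simp only [not_not]
  have e : {x : Euc n | ‖x‖ = s} = Metric.sphere 0 s := by ext x; simp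
  rw [e, Measure.restrict_apply hS, ← h1]
  congr 1
  ext x
  simp only [mem_inter_iff, mem_sphere_zero_iff_norm, Set.mem_sdiff, mem_singleton_iff]
  refine ⟨fun ⟨a, b⟩ => ⟨a, b, fun hx => ?_⟩, fun ⟨a, b, _⟩ => ⟨a, b⟩⟩
  rw [hx, norm_zero] at a
  exact hs.ne a

theorem hasDerivAt_radial_profile {σ ε t : ℝ} (hε : 0 < ε) (h1 : t ≠ σ) (h2 : t ≠ σ - ε) :
    HasDerivAt (fun t => max 0 (min 1 ((σ - t) / ε)))
      (-(ε⁻¹ * (Ioo (σ - ε) σ).indicator (fun _ => 1) t)) t := by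
  rcases lt_or_gt_of_ne h2 with h2 | h2
  · have hn : t ∉ Ioo (σ - ε) σ := fun hh => by linarith [hh.1]
    rw [indicator_of_notMem hn, mul_zero, neg_zero]
    refine (hasDerivAt_const t (1 : ℝ)).congr_of_eventuallyEq ?_
    filter_upwards [Iio_mem_nhds h2] with s hs
    have : 1 ≤ (σ - s) / ε := by rw [le_div_iff₀ hε]; linarith [mem_Iio.1 hs]
    rw [min_eq_left this, max_eq_right zero_le_one]
  rcases lt_or_gt_of_ne h1 with h1 | h1
  · rw [indicator_of_mem (show t ∈ Ioo (σ - ε) σ from ⟨h2, h1⟩), mul_one]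
    have h3 : HasDerivAt (fun t => (σ - t) / ε) (-ε⁻¹) t := by
      have := ((hasDerivAt_id t).const_sub σ).div_const ε
      simpa [neg_div] using this
    refine h3.congr_of_eventuallyEq ?_
    filter_upwards [Ioo_mem_nhds h2 h1] with s hs
    have h4 : (σ - s) / ε ≤ 1 := by rw [div_le_iff₀ hε]; linarith [hs.1]
    have h5 : 0 ≤ (σ - s) / ε := div_nonneg (by linarith [hs.2]) hε.le
    rw [min_eq_right h4, max_eq_right h5]
  · have hn : t ∉ Ioo (σ - ε) σ := fun hh => by linarith [hh.2]
    rw [indicator_of_notMem hn, mul_zero, neg_zero]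
    refine (hasDerivAt_const t (0 : ℝ)).congr_of_eventuallyEq ?_
    filter_upwards [Ioi_mem_nhds h1] with s hs
    have : (σ - s) / ε ≤ 0 := div_nonpos_of_nonpos_of_nonneg (by linarith [mem_Ioi.1 hs]) hε.le
    rw [min_eq_right (this.trans zero_le_one), max_eq_left this]

theorem tgrad_radialCutoff {n : ℕ} {M : Set (Euc n)} (hM : IsCone M) {σ ε : ℝ} (hε : 0 < ε)
    (hεσ : ε < σ) {x : Euc n} (hx : x ∈ M) (h1 : ‖x‖ ≠ σ) (h2 : ‖x‖ ≠ σ - ε) :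
    DifferentiableWithinAt ℝ (radialCutoff σ ε) M x ∧ tgrad M (radialCutoff σ ε) x =
      -((ε⁻¹ * (Ioo (σ - ε) σ).indicator (fun _ => 1) ‖x‖) • ‖x‖⁻¹ • x) := by
  by_cases hx0 : x = 0
  · have h3 : (radialCutoff σ ε : Euc n → ℝ) =ᶠ[𝓝 x] fun _ => 1 := by
      filter_upwards [Metric.ball_mem_nhds x (sub_pos.2 hεσ)] with y hy
      rw [hx0, mem_ball_zero_iff] at hy
      have : 1 ≤ (σ - ‖y‖) / ε := by rw [le_div_iff₀ hε]; linarith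
      rw [radialCutoff, min_eq_left this, max_eq_right zero_le_one]
    refine ⟨((differentiableAt_const 1).congr_of_eventuallyEq h3).differentiableWithinAt, ?_⟩
    rw [tgrad_congr (h3.filter_mono nhdsWithin_le_nhds) h3.eq_of_nhds, tgrad]
    simp [hx0]
  · have h3 := hasDerivAt_radial_profile hε h1 h2
    refine ⟨?_, ?_⟩
    · have h4 : DifferentiableAt ℝ (fun y : Euc n => ‖y‖) x :=
        (contDiffAt_norm ℝ hx0 (n := 1)).differentiableAt one_ne_zero
      exact (h3.differentiableAt.comp x h4).differentiableWithinAt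
    · have h4 := tgrad_radial h3 hx0 (hM.self_mem_tangentSpaceAt hx)
      change tgrad M (fun y => max 0 (min 1 ((σ - ‖y‖) / ε))) x = _
      rw [h4, neg_mul, neg_smul, smul_smul]

/-! ### The regularized form as a mean flux over a shell. -/

namespace CriticalData

variable {n m : ℕ} {M : Set (Euc n)} {ρ : Euc n → ℝ} {p : ℝ} {q : Euc n → ℝ}
    {X : Euc n → Euc n} {qbar P : Euc n → ℝ} {R : ℝ} {u : Euc n → ℝ}
    (h : CriticalData m M ρ p q X qbar P R u)

include h

theorem ae_norm_ne {s : ℝ} (hs : 0 < s) : ∀ᵐ x ∂(weightMeasure (m + 1) M ρ), ‖x‖ ≠ s :=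
  weightMeasure_absolutelyContinuous.ae_le (h.param.ae_norm_ne h.cone hs)

theorem integrableOn_sq_mul_inner_X :
    IntegrableOn (fun x => inner ℝ (u x ^ 2 • X x) (‖x‖⁻¹ • x)) (Metric.ball 0 R)
      (weightMeasure (m + 1) M ρ) := by
  refine h.integrable.mono' (h.aestronglyMeasurable_unit ((h.u_smooth.continuousOn.pow 2).smul
    (h.X_smooth.continuousOn.mono inter_subset_left))) ?_
  filter_upwards [h.ae_mem_ball] with x hx
  have hP := (h.P_pos x hx.1).le
  have a1 : |u x| ≤ √(energy M ρ P u x) := abs_le_sqrt_energy hP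
  have a2 : ‖X x‖ * |u x| ≤ √(energy M ρ P u x) := h.norm_X_mul_le hx.1 u
  have a3 : ‖‖x‖⁻¹ • x‖ ≤ 1 := by
    rw [norm_smul, norm_inv, norm_norm]; exact inv_mul_le_one
  refine (abs_real_inner_le_norm _ _).trans ((mul_le_of_le_one_right (norm_nonneg _) a3).trans ?_)
  rw [norm_smul, norm_pow, Real.norm_eq_abs]
  have := mul_le_mul a1 a2 (by positivity) (Real.sqrt_nonneg _)
  rw [Real.mul_self_sqrt (energy_nonneg hP)] at this
  calc |u x| ^ 2 * ‖X x‖ = |u x| * (‖X x‖ * |u x|) := by ring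
    _ ≤ _ := this

/-- The flux identity gives the integral of `ζ` times the bulk density as a mean over the shell of
`u u_r + u² ⟨X, x / |x|⟩`. The density in the definition of `Q_σ` differs from the bulk one by the
derivative of the cutoff in direction `X`, which cancels precisely the term with `X`. -/
theorem integral_cutoffDensity {σ ε : ℝ} (hε : 0 < ε) (hεσ : ε < σ) (hσ : σ < R) :
    ∫ x in M ∩ Metric.ball 0 σ, cutoffDensity M ρ qbar X (radialCutoff σ ε) u x ∂μHE[m + 1] =
      ε⁻¹ * ∫ x in (Real.log (σ - ε))..(Real.log σ), Real.exp (((m : ℝ) + 1 + p) * x) *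
        ∫ θ, u (Real.exp x • θ) * radialDeriv M u (Real.exp x • θ)
          ∂(weightMeasure m (link M) ρ) := by
  set κ := weightMeasure (m + 1) M ρ with hκ
  have hs : 0 < σ - ε := sub_pos.2 hεσ
  have hst : σ - ε < σ := by linarith
  have hsubR : Metric.ball (0 : Euc n) σ ⊆ Metric.ball 0 R := Metric.ball_subset_ball hσ.le
  set A : Euc n → ℝ := fluxDensity M ρ qbar X u u 1 0
  set χ : ℝ → ℝ := (Ioo (σ - ε) σ).indicator (fun _ => 1)
  have hA : IntegrableOn A (Metric.ball 0 R) κ := by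
    refine h.integrableOn_fluxDensity (z := fun _ => 1) (w := fun _ => 0) (c := 1) ?_
      (by simp) (by simp)
    exact aestronglyMeasurable_weightMeasure h.measurableSet Metric.isOpen_ball.measurableSet
      (h.continuousOn_fluxDensity h.u_smooth continuousOn_const continuousOn_const)
  have hX := h.integrableOn_sq_mul_inner_X
  have hur := h.integrableOn_mul_radialDeriv
  have hχ : ∀ f : Euc n → ℝ, IntegrableOn f (Metric.ball 0 R) κ →
      IntegrableOn (fun x => χ ‖x‖ * f x) (Metric.ball 0 R) κ := fun f hf => by
    refine hf.norm.mono' (AEStronglyMeasurable.mul ?_ hf.aestronglyMeasurable)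
      (ae_of_all _ fun x => ?_)
    · exact ((measurable_const.indicator measurableSet_Ioo).comp
        measurable_norm).aestronglyMeasurable
    · rw [norm_mul]
      refine mul_le_of_le_one_left (norm_nonneg _) ?_
      by_cases hx : ‖x‖ ∈ Ioo (σ - ε) σ
      · simp only [χ, indicator_of_mem hx]; simp
      · simp only [χ, indicator_of_notMem hx]; simp
  have hζ0 : ∀ x : Euc n, 0 ≤ radialCutoff σ ε x ∧ radialCutoff σ ε x ≤ 1 := fun x =>
    ⟨le_max_left _ _, max_le zero_le_one (min_le_left _ _)⟩
  have hζA : IntegrableOn (fun x => radialCutoff σ ε x * A x) (Metric.ball 0 R) κ := by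
    refine hA.norm.mono' (AEStronglyMeasurable.mul ?_ hA.aestronglyMeasurable)
      (ae_of_all _ fun x => ?_)
    · have : Continuous (radialCutoff σ ε : Euc n → ℝ) := by unfold radialCutoff; fun_prop
      exact this.aestronglyMeasurable
    · rw [norm_mul, Real.norm_of_nonneg (hζ0 x).1]
      exact mul_le_of_le_one_left (norm_nonneg _) (hζ0 x).2
  have e1 := h.mul_integral_radialCutoff hs hst hσ (A := A)
    (B := fun x => u x • tgrad M u x + u x ^ 2 • X x) hA
    (by
      refine (hur.add hX).congr (ae_of_all _ fun x => ?_)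
      change _ = inner ℝ (u x • tgrad M u x + u x ^ 2 • X x) (‖x‖⁻¹ • x)
      simp only [Pi.add_apply, inner_add_left, inner_smul_left, radialDeriv, conj_trivial])
    fun ζ z1 z2 z3 => by
      have := h.integral_fluxDensity z1 z2 z3
      simp only [fluxDensity_eq M ρ qbar X u (_ : ℝ) (tgrad M ζ _)] at this
      exact this
  rw [sub_sub_cancel] at e1
  have e2 : ∫ x in Metric.ball 0 R, χ ‖x‖ * inner ℝ (u x • tgrad M u x + u x ^ 2 • X x) (‖x‖⁻¹ • x) ∂κ =
      ∫ x in Metric.ball 0 R, χ ‖x‖ * (u x * radialDeriv M u x) ∂κ +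
        ∫ x in Metric.ball 0 R, χ ‖x‖ * inner ℝ (u x ^ 2 • X x) (‖x‖⁻¹ • x) ∂κ := by
    rw [← integral_add (hχ _ hur) (hχ _ hX)]
    refine integral_congr_ae (ae_of_all _ fun x => ?_)
    simp only [inner_add_left, inner_smul_left, radialDeriv, conj_trivial]
    ring
  -- Off the two spheres where the profile has a kink, the product rule isolates the derivative of
  -- the cutoff.
  have e3 : ∫ x in M ∩ Metric.ball 0 σ, cutoffDensity M ρ qbar X (radialCutoff σ ε) u x ∂μHE[m + 1] =
      ∫ x in Metric.ball 0 σ, (radialCutoff σ ε x * A x -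
        ε⁻¹ * (χ ‖x‖ * inner ℝ (u x ^ 2 • X x) (‖x‖⁻¹ • x))) ∂κ := by
    have e4 := setIntegral_weightMeasure (k := m + 1) h.measurableSet h.rho_smooth.continuousOn
      h.rho_nonneg (A := Metric.ball 0 σ) Metric.isOpen_ball.measurableSet fun x =>
        radialCutoff σ ε x * (‖tgrad M u x‖ ^ 2 - qbar x * u x ^ 2)
          + inner ℝ (X x) (tgrad M (fun y => radialCutoff σ ε y * u y ^ 2) x)
          + radialCutoff σ ε x * u x ^ 2 * inner ℝ (X x) (tgrad M (fun y => Real.log (ρ y)) x)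
    refine Eq.trans ?_ (e4.symm.trans ?_)
    · rfl
    refine integral_congr_ae ?_
    filter_upwards [ae_restrict_of_ae h.ae_mem, ae_restrict_mem Metric.isOpen_ball.measurableSet,
      ae_restrict_of_ae (h.ae_norm_ne hs), ae_restrict_of_ae (h.ae_norm_ne (hε.trans hεσ))]
      with x hx hxσ hx1 hx2
    obtain ⟨d1, d2⟩ := tgrad_radialCutoff h.cone hε hεσ hx hx2 hx1
    have d3 := h.differentiableWithinAt ⟨hx, hsubR hxσ⟩
    have d4 : DifferentiableWithinAt ℝ (fun y => u y ^ 2) M x := d3.pow 2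
    rw [tgrad_mul d1 d4, tgrad_pow_two d3, d2]
    simp only [A, χ, fluxDensity, inner_add_right, inner_smul_right, inner_neg_right, inner_smul_left,
      inner_zero_right, real_inner_self_eq_norm_sq, conj_trivial]
    ring
  have e5 : ∫ x in Metric.ball 0 σ, (radialCutoff σ ε x * A x -
        ε⁻¹ * (χ ‖x‖ * inner ℝ (u x ^ 2 • X x) (‖x‖⁻¹ • x))) ∂κ =
      ∫ x in Metric.ball 0 R, (radialCutoff σ ε x * A x -
        ε⁻¹ * (χ ‖x‖ * inner ℝ (u x ^ 2 • X x) (‖x‖⁻¹ • x))) ∂κ := by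
    refine (setIntegral_eq_of_subset_of_forall_sdiff_eq_zero Metric.isOpen_ball.measurableSet hsubR
      fun x hx => ?_).symm
    have hx1 : σ ≤ ‖x‖ := by
      have := hx.2; rwa [mem_ball_zero_iff, not_lt] at this
    have hn : ‖x‖ ∉ Ioo (σ - ε) σ := fun hh => by linarith [hh.2]
    have hd : (σ - ‖x‖) / ε ≤ 0 := div_nonpos_of_nonpos_of_nonneg (by linarith) hε.le
    simp only [χ, indicator_of_notMem hn, radialCutoff, min_eq_right (hd.trans zero_le_one),
      max_eq_left hd]
    ring
  have e6 := h.setIntegral_shell hur hs hst hσ.le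
  rw [e3, e5, integral_sub hζA ((hχ _ hX).const_mul _), integral_const_mul, ← e6]
  rw [e2] at e1
  rw [eq_inv_mul_iff_mul_eq₀ hε.ne', mul_sub, mul_inv_cancel_left₀ hε.ne', e1]
  simp only [χ, hκ]
  ring

end CriticalData

/-! ### Open pieces of a weighted submanifold have positive measure. -/

section Positivity

variable {n k : ℕ} {M : Set (Euc n)}

theorem IsParametrizable.measure_inter_ne_zero (hM : IsParametrizable k M) {O : Set (Euc n)}
    (hO : IsOpen O) {x : Euc n} (hx : x ∈ M) (hxO : x ∈ O) : μHE[k] (M ∩ O) ≠ 0 := by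
  obtain ⟨W, U, ψ, e, h, hxW⟩ := hM x hx
  have hU' : IsOpen (U ∩ ψ ⁻¹' O) :=
    h.contDiffOn.continuousOn.isOpen_inter_preimage h.isOpen_source hO
  have hsub : ψ '' (U ∩ ψ ⁻¹' O) ⊆ M ∩ O := by
    rintro _ ⟨y, ⟨hy, hyO⟩, rfl⟩
    exact ⟨(h.mapsTo y hy).1, hyO⟩
  intro h0
  have h1 := measure_mono_null hsub h0
  rw [euclideanHausdorffMeasure_image_eq_lintegral h.isOpen_source h.contDiffOn_one h.injOn
    h.injective_fderiv hU'.measurableSet inter_subset_left, lintegral_eq_zero_iff'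
    (((continuousOn_areaDensity h.isOpen_source h.contDiffOn_one).mono
      inter_subset_left).aemeasurable hU'.measurableSet).ennreal_ofReal] at h1
  have h2 : ∀ᵐ y ∂(volume.restrict (U ∩ ψ ⁻¹' O)), False := by
    filter_upwards [h1, ae_restrict_mem hU'.measurableSet] with y hy hyU
    have : 0 < areaDensity ψ y := ContinuousLinearMap.normDet_pos (h.injective_fderiv y hyU.1)
    rw [Pi.zero_apply, ENNReal.ofReal_eq_zero] at hy
    exact absurd this (not_lt.2 hy)
  rw [ae_iff] at h2
  simp only [not_false_eq_true, Set.ofPred_true, Measure.restrict_apply_univ] at h2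
  have hne : (U ∩ ψ ⁻¹' O).Nonempty :=
    ⟨e x, h.inv_mem x ⟨hx, hxW⟩, by rw [mem_preimage, h.right_inv x ⟨hx, hxW⟩]; exact hxO⟩
  exact (hU'.measure_pos volume hne).ne' h2

variable {ρ : Euc n → ℝ}

theorem IsParametrizable.weightMeasure_ne_zero (hM : IsParametrizable k M)
    (hρ : ContinuousOn ρ M) (hρ0 : ∀ x ∈ M, 0 < ρ x) {O : Set (Euc n)}
    (hO : IsOpen O) {x : Euc n} (hx : x ∈ M) (hxO : x ∈ O) : weightMeasure k M ρ O ≠ 0 := by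
  rw [weightMeasure, Ne, withDensity_apply_eq_zero' (hρ.aemeasurable hM.measurableSet).ennreal_ofReal]
  intro h0
  refine hM.measure_inter_ne_zero hO hx hxO (measure_mono_null ?_
    (le_antisymm ((Measure.le_restrict_apply _ _).trans h0.le) (zero_le)))
  intro z hz
  exact ⟨⟨by simpa using hρ0 z hz.1, hz.2⟩, hz.1⟩

theorem IsParametrizable.eqOn_of_ae_eq (hM : IsParametrizable k M)
    (hρ : ContinuousOn ρ M) (hρ0 : ∀ x ∈ M, 0 < ρ x) {f g : Euc n → ℝ} (hf : ContinuousOn f M)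
    (hg : ContinuousOn g M) (hfg : f =ᵐ[weightMeasure k M ρ] g) : EqOn f g M := by
  intro x hx
  by_contra hne
  obtain ⟨O, hO, hOM⟩ := continuousOn_iff'.1 (hf.sub hg) {0}ᶜ isOpen_compl_singleton
  have hmem : ∀ z ∈ M, f z ≠ g z → z ∈ O := fun z hz hzne =>
    (hOM.subset ⟨by simpa [sub_eq_zero] using hzne, hz⟩).1
  have hOne : ∀ z ∈ M, z ∈ O → f z ≠ g z := fun z hz hzO => by
    have := (hOM.superset ⟨hzO, hz⟩).1
    simpa [sub_eq_zero] using this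
  refine hM.weightMeasure_ne_zero hρ hρ0 hO hx (hmem x hx hne) ?_
  rw [← compl_compl O]
  change ∀ᵐ z ∂(weightMeasure k M ρ), z ∈ Oᶜ
  filter_upwards [hfg, ae_mem_weightMeasure hM.measurableSet] with z hz hzM hzO
  exact hOne z hzM hzO hz

end Positivity

namespace ConeData

variable {n m : ℕ} {M : Set (Euc n)} {ρ : Euc n → ℝ} {p : ℝ} {q : Euc n → ℝ}
    {X : Euc n → Euc n} {qbar P : Euc n → ℝ} (h : ConeData m M ρ p q X qbar P)

include h

theorem nonempty_link (hne : M.Nonempty) : (link M).Nonempty := by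
  obtain ⟨x, hx⟩ := hne
  have h1 := h.param.measure_inter_ne_zero isOpen_univ hx (mem_univ x)
  -- A nonempty `M` has positive measure in the positive dimension `m + 1`, so it cannot reduce to
  -- the vertex.
  have h2 : ∃ y ∈ M, y ≠ 0 := by
    by_contra! hcon
    refine h1 (measure_mono_null (t := {0}) (fun z hz => hcon z hz.1) ?_)
    exact euclideanHausdorffMeasure_eq_zero_of_dimH_lt (by rw [dimH_singleton]; simp)
  obtain ⟨y, hy, hy0⟩ := h2
  have hn := norm_pos_iff.2 hy0
  refine ⟨‖y‖⁻¹ • y, h.cone y hy _ (inv_pos.2 hn), ?_⟩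
  rw [mem_sphere_zero_iff_norm, norm_smul, norm_inv, norm_norm, inv_mul_cancel₀ hn.ne']

theorem weightMeasure_link_ne_zero (hne : M.Nonempty) : weightMeasure m (link M) ρ ≠ 0 := by
  obtain ⟨θ, hθ⟩ := h.nonempty_link hne
  intro h0
  refine h.isParametrizable_link.weightMeasure_ne_zero h.rho_continuousOn_link
    (fun x hx => h.rho_pos x hx.1) isOpen_univ hθ (mem_univ θ) ?_
  rw [h0]; simp

end ConeData

/-! ### The midpoint identity for `u`, and `Q_σ` as a continuous radial flux. -/

namespace CriticalData

variable {n m : ℕ} {M : Set (Euc n)} {ρ : Euc n → ℝ} {p : ℝ} {q : Euc n → ℝ}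
    {X : Euc n → Euc n} {qbar P : Euc n → ℝ} {R : ℝ} {u : Euc n → ℝ}
    (h : CriticalData m M ρ p q X qbar P R u)

include h

theorem integrableOn_tgrad_sq : IntegrableOn (fun x => ‖tgrad M u x‖ ^ 2)
    (Metric.ball 0 R) (weightMeasure (m + 1) M ρ) := by
  refine h.integrable.mono' ((aestronglyMeasurable_weightMeasure h.measurableSet
    Metric.isOpen_ball.measurableSet h.continuousOn_tgrad_ball).norm.pow 2) ?_
  filter_upwards [h.ae_mem_ball] with x hx
  have h1 := pow_le_pow_left₀ (norm_nonneg _)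
    (norm_tgrad_le_sqrt_energy (M := M) (ρ := ρ) (f := u) (h.P_pos x hx.1).le) 2
  rwa [Real.sq_sqrt (energy_nonneg (h.P_pos x hx.1).le), ← Real.norm_of_nonneg
    (sq_nonneg ‖tgrad M u x‖)] at h1

theorem inner_sliceCurve (x y : ℝ) (hx : x < Real.log R) (hy : y < Real.log R) :
    inner ℝ (sliceCurve m M ρ u x) (sliceCurve m M ρ u y) =
      ‖sliceCurve m M ρ u ((x + y) / 2)‖ ^ 2 :=
  inner_eq_norm_sq_midpoint (fun _ _ ha hb => h.absolutelyContinuousOnInterval_sliceCurve ha hb)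
    (h.ae_hasDerivAt_sliceCurve.mono fun _ hx hx' => (hx hx').2) h.ae_inner_sliceCurve hx hy

theorem ae_hasDerivAt_sliceCurve' : ∀ᵐ x, x < Real.log R →
    HasDerivAt (sliceCurve m M ρ u) (sliceCurveDeriv m M ρ u x) x :=
  h.ae_hasDerivAt_sliceCurve.mono fun _ hx hx' => (hx hx').2

theorem continuousOn_sliceCurve : ContinuousOn (sliceCurve m M ρ u) (Iio (Real.log R)) := by
  intro x hx
  obtain ⟨b, hb, hbR⟩ := exists_between (mem_Iio.1 hx)
  have h1 := (h.absolutelyContinuousOnInterval_sliceCurve (a := x - 1) (b := b)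
    (by linarith) hbR).continuousOn
  rw [uIcc_of_le (by linarith)] at h1
  exact (h1.continuousAt (Icc_mem_nhds (by linarith) hb)).continuousWithinAt

theorem sliceCurve_ne_zero (hne : M.Nonempty) {x : ℝ} (hx : x < Real.log R) :
    sliceCurve m M ρ u x ≠ 0 := by
  intro h0
  have : NeBot (ae (weightMeasure m (link M) ρ)) := ae_neBot.2 (h.weightMeasure_link_ne_zero hne)
  have h1 := coeFn_toL2 (h.memLp_slice hx)
  change (sliceCurve m M ρ u x : Euc n → ℝ) =ᵐ[_] _ at h1
  rw [h0] at h1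
  have h2 : ∀ᵐ θ ∂(weightMeasure m (link M) ρ), False := by
    filter_upwards [h1, Lp.coeFn_zero ℝ 2 (weightMeasure m (link M) ρ), h.ae_mem_link]
      with θ h2 h3 h4
    rw [h3, Pi.zero_apply] at h2
    exact (h.u_pos _ (exp_smul_mem h.cone h4 h.R_pos hx)).ne h2
  exact h2.exists.choose_spec

/-- The radial flux through the sphere of radius `exp x`, up to a power of the radius. -/
noncomputable def _root_.WeightedCone.radialFlux {n : ℕ} (m : ℕ) (M : Set (Euc n))
    (ρ : Euc n → ℝ) (p : ℝ) (u : Euc n → ℝ) (x : ℝ) : ℝ :=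
  Real.exp (((m : ℝ) + p) * x) * deriv (fun z => ‖sliceCurve m M ρ u (z / 2)‖ ^ 2) (2 * x)

theorem continuousOn_radialFlux : ContinuousOn (radialFlux m M ρ p u) (Iio (Real.log R)) := by
  intro x hx
  have h1 := continuousAt_deriv_norm_sq_half (V := sliceCurve m M ρ u) h.inner_sliceCurve
    h.ae_hasDerivAt_sliceCurve' h.continuousOn_sliceCurve (z := 2 * x) (by linarith [mem_Iio.1 hx])
  have h2 : ContinuousAt (fun x : ℝ => 2 * x) x := by fun_prop
  have h3 : ContinuousAt (fun x : ℝ => Real.exp (((m : ℝ) + p) * x)) x := by fun_prop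
  have h4 : ContinuousAt (fun x : ℝ => deriv (fun z => ‖sliceCurve m M ρ u (z / 2)‖ ^ 2) (2 * x)) x :=
    ContinuousAt.comp (f := fun x : ℝ => 2 * x) h1 h2
  exact (h3.mul h4).continuousWithinAt

/-- The integral of `u u_r` over a sphere is controlled only for almost every radius. `radialFlux`
is its continuous representative, so the limit defining `Q_σ` exists for every `σ`. -/
theorem ae_integral_mul_radialDeriv : ∀ᵐ x, x < Real.log R →
    Real.exp (((m : ℝ) + 1 + p) * x) * ∫ θ, u (Real.exp x • θ) * radialDeriv M u (Real.exp x • θ)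
      ∂(weightMeasure m (link M) ρ) = radialFlux m M ρ p u x := by
  filter_upwards [h.ae_hasDerivAt_sliceCurve] with x hx hxR
  obtain ⟨h1, h2⟩ := hx hxR
  have h3 := (hasDerivAt_norm_sq_half (V := sliceCurve m M ρ u) h.inner_sliceCurve hxR h2
    (z := 2 * x) (by linarith)).deriv
  rw [show 2 * x - x = x by ring] at h3
  rw [radialFlux, h3, sliceCurveDeriv, sliceCurve, inner_toL2 h1 (h.memLp_slice hxR)]
  have h4 : ∫ θ, sliceDeriv M u x θ * slice u x θ ∂(weightMeasure m (link M) ρ) = Real.exp x *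
      ∫ θ, u (Real.exp x • θ) * radialDeriv M u (Real.exp x • θ) ∂(weightMeasure m (link M) ρ) := by
    rw [← integral_const_mul]
    refine integral_congr_ae (ae_of_all _ fun θ => ?_)
    simp only [sliceDeriv, slice]
    ring
  rw [h4, ← mul_assoc, ← Real.exp_add, show ((m : ℝ) + p) * x + x = ((m : ℝ) + 1 + p) * x by ring]

theorem intervalIntegral_mul_radialDeriv {a b : ℝ} (ha : a < Real.log R) (hb : b < Real.log R) :
    ∫ x in a..b, Real.exp (((m : ℝ) + 1 + p) * x) *
      ∫ θ, u (Real.exp x • θ) * radialDeriv M u (Real.exp x • θ) ∂(weightMeasure m (link M) ρ) =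
    ∫ x in a..b, radialFlux m M ρ p u x := by
  refine intervalIntegral.integral_congr_ae (h.ae_integral_mul_radialDeriv.mono fun x hx hxi => ?_)
  exact hx (hxi.2.trans_lt (max_lt ha hb))

/-- The fundamental theorem of calculus for a continuous integrand; the factor `σ⁻¹` is the
derivative of the logarithm. -/
theorem tendsto_inv_mul_intervalIntegral_radialFlux {σ : ℝ} (hσ : 0 < σ) (hσR : σ < R) :
    Tendsto (fun ε => ε⁻¹ * ∫ x in (Real.log (σ - ε))..(Real.log σ), radialFlux m M ρ p u x)
      (𝓝[>] 0) (𝓝 (σ⁻¹ * radialFlux m M ρ p u (Real.log σ))) := by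
  have hlog : Real.log σ < Real.log R := Real.log_lt_log hσ hσR
  have h1 : HasDerivAt (fun y => ∫ x in (Real.log σ)..y, radialFlux m M ρ p u x)
      (radialFlux m M ρ p u (Real.log σ)) (Real.log σ) :=
    intervalIntegral.integral_hasDerivAt_right (by simp)
      (h.continuousOn_radialFlux.stronglyMeasurableAtFilter isOpen_Iio _ hlog)
      (h.continuousOn_radialFlux.continuousAt (Iio_mem_nhds hlog))
  have h2 := (h1.comp σ (Real.hasDerivAt_log hσ.ne')).tendsto_slope_zero
  have h3 : Tendsto (fun ε : ℝ => -ε) (𝓝[>] 0) (𝓝[≠] 0) := by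
    refine tendsto_nhdsWithin_iff.2 ⟨?_, ?_⟩
    · exact (Continuous.tendsto' (by fun_prop) _ _ (by simp)).mono_left nhdsWithin_le_nhds
    · filter_upwards [self_mem_nhdsWithin] with ε hε
      simpa using (mem_Ioi.1 hε).ne'
  have h4 := h2.comp h3
  rw [mul_comm] at h4
  refine h4.congr fun ε => ?_
  simp only [Function.comp_apply, intervalIntegral.integral_same, sub_zero, smul_eq_mul,
    ← sub_eq_add_neg]
  rw [intervalIntegral.integral_symm (Real.log (σ - ε)), inv_neg]
  ring

theorem tendsto_integral_cutoffDensity {σ : ℝ} (hσ : 0 < σ) (hσR : σ < R) :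
    Tendsto (fun ε => ∫ x in M ∩ Metric.ball 0 σ,
      cutoffDensity M ρ qbar X (radialCutoff σ ε) u x ∂μHE[m + 1]) (𝓝[>] 0)
      (𝓝 (σ⁻¹ * radialFlux m M ρ p u (Real.log σ))) := by
  refine (h.tendsto_inv_mul_intervalIntegral_radialFlux hσ hσR).congr' ?_
  filter_upwards [Ioo_mem_nhdsGT hσ] with ε hε
  rw [h.integral_cutoffDensity hε.1 hε.2 hσR, h.intervalIntegral_mul_radialDeriv
    (Real.log_lt_log (by linarith [hε.2]) (by linarith [hε.1])) (Real.log_lt_log hσ hσR)]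

/-- The classical flux identity needs cutoffs supported strictly inside `B_σ`, hence the cutoff
ending at `σ - ε`. The mean over the shell from `σ - 2ε` to `σ - ε` is rewritten with two shells
ending at `σ`, whose limits are known; twice the limit minus the limit is the limit. -/
theorem radialCutoff_integral_of_integrable {σ ε : ℝ} (hε : 0 < ε) (hεσ : 2 * ε < σ) (hσR : σ < R)
    (hq : IntegrableOn (fun x => q x * u x ^ 2) (Metric.ball 0 σ) (weightMeasure (m + 1) M ρ)) :
    ∫ x in Metric.ball 0 σ, radialCutoff (σ - ε) ε x * (‖tgrad M u x‖ ^ 2 - q x * u x ^ 2)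
      ∂(weightMeasure (m + 1) M ρ) =
    2 * ((2 * ε)⁻¹ * ∫ x in (Real.log (σ - 2 * ε))..(Real.log σ), radialFlux m M ρ p u x) -
      ε⁻¹ * ∫ x in (Real.log (σ - ε))..(Real.log σ), radialFlux m M ρ p u x := by
  have hsub : Metric.ball (0 : Euc n) σ ⊆ Metric.ball 0 R := Metric.ball_subset_ball hσR.le
  have hA : IntegrableOn (fun x => ‖tgrad M u x‖ ^ 2 - q x * u x ^ 2) (Metric.ball 0 σ)
      (weightMeasure (m + 1) M ρ) := (h.integrableOn_tgrad_sq.mono_set hsub).sub hq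
  have hB := h.integrableOn_mul_radialDeriv.mono_set hsub
  have e1 := h.mul_integral_radialCutoff (a := σ - 2 * ε) (b := σ - ε) (r := σ) (by linarith)
    (by linarith) (by linarith) (A := fun x => ‖tgrad M u x‖ ^ 2 - q x * u x ^ 2)
    (B := fun x => u x • tgrad M u x) hA
    (by simpa only [inner_smul_left, radialDeriv, conj_trivial] using hB) fun ζ z1 z2 z3 => by
      have := h.integral_flux_of_integrable hσR hq z1 z2 z3
      simpa only [inner_smul_left, conj_trivial] using this
  have e2 := h.setIntegral_shell hB (s := σ - 2 * ε) (t := σ - ε) (by linarith) (by linarith)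
    (by linarith)
  simp only [inner_smul_left, conj_trivial] at e1
  simp only [radialDeriv] at e2
  rw [e2] at e1
  have l1 : Real.log (σ - 2 * ε) < Real.log R := Real.log_lt_log (by linarith) (by linarith)
  have l2 : Real.log (σ - ε) < Real.log R := Real.log_lt_log (by linarith) (by linarith)
  have l3 : Real.log σ < Real.log R := Real.log_lt_log (by linarith) (by linarith)
  have e3 := h.intervalIntegral_mul_radialDeriv l1 l2
  simp only [radialDeriv] at e3
  have hi : ∀ a b, a < Real.log R → b < Real.log R →
      IntervalIntegrable (radialFlux m M ρ p u) volume a b := fun a b ha hb =>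
    (h.continuousOn_radialFlux.mono fun x hx => hx.2.trans_lt (max_lt ha hb)).intervalIntegrable
  have e4 := intervalIntegral.integral_add_adjacent_intervals (hi _ _ l1 l2) (hi _ _ l2 l3)
  rw [e3, show σ - ε - (σ - 2 * ε) = ε by ring] at e1
  rw [← e4, ← e1]
  field_simp
  ring

theorem setIntegral_eq_radialFlux {σ : ℝ} (hσ : 0 < σ) (hσR : σ < R)
    (hq : IntegrableOn (fun x => q x * u x ^ 2) (Metric.ball 0 σ) (weightMeasure (m + 1) M ρ)) :
    ∫ x in Metric.ball 0 σ, (‖tgrad M u x‖ ^ 2 - q x * u x ^ 2) ∂(weightMeasure (m + 1) M ρ) =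
      σ⁻¹ * radialFlux m M ρ p u (Real.log σ) := by
  have hsub : Metric.ball (0 : Euc n) σ ⊆ Metric.ball 0 R := Metric.ball_subset_ball hσR.le
  have hA : IntegrableOn (fun x => ‖tgrad M u x‖ ^ 2 - q x * u x ^ 2) (Metric.ball 0 σ)
      (weightMeasure (m + 1) M ρ) := (h.integrableOn_tgrad_sq.mono_set hsub).sub hq
  have h1 := h.tendsto_inv_mul_intervalIntegral_radialFlux hσ hσR
  have h2 : Tendsto (fun ε : ℝ => 2 * ε) (𝓝[>] 0) (𝓝[>] 0) := by
    refine tendsto_nhdsWithin_iff.2 ⟨?_, ?_⟩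
    · exact (Continuous.tendsto' (by fun_prop) _ _ (by simp)).mono_left nhdsWithin_le_nhds
    · filter_upwards [self_mem_nhdsWithin] with ε hε
      simpa using hε
  have h3 := ((h1.comp h2).const_mul 2).sub h1
  have h4 : Tendsto (fun ε => ∫ x in Metric.ball 0 σ, radialCutoff (σ - ε) ε x *
      (‖tgrad M u x‖ ^ 2 - q x * u x ^ 2) ∂(weightMeasure (m + 1) M ρ)) (𝓝[>] 0)
      (𝓝 (∫ x in Metric.ball 0 σ, (‖tgrad M u x‖ ^ 2 - q x * u x ^ 2)
        ∂(weightMeasure (m + 1) M ρ))) := by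
    refine tendsto_integral_filter_of_dominated_convergence
      (fun x => ‖(‖tgrad M u x‖ ^ 2 - q x * u x ^ 2)‖) ?_ ?_ hA.norm ?_
    · refine Eventually.of_forall fun ε => AEStronglyMeasurable.mul ?_ hA.aestronglyMeasurable
      have : Continuous (radialCutoff (σ - ε) ε : Euc n → ℝ) := by unfold radialCutoff; fun_prop
      exact this.aestronglyMeasurable
    · refine Eventually.of_forall fun ε => ae_of_all _ fun x => ?_
      have hc : 0 ≤ radialCutoff (σ - ε) ε x := le_max_left _ _
      rw [norm_mul, Real.norm_of_nonneg hc]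
      exact mul_le_of_le_one_left (norm_nonneg _) (max_le zero_le_one (min_le_left _ _))
    · filter_upwards [ae_restrict_mem Metric.isOpen_ball.measurableSet] with x hx
      rw [mem_ball_zero_iff] at hx
      refine tendsto_const_nhds.congr' ?_
      filter_upwards [Ioo_mem_nhdsGT (show 0 < (σ - ‖x‖) / 2 by linarith)] with ε hε
      have h5 : 1 ≤ (σ - ε - ‖x‖) / ε := by rw [le_div_iff₀ hε.1]; linarith [hε.2]
      rw [radialCutoff, min_eq_left h5, max_eq_right zero_le_one, one_mul]
  refine tendsto_nhds_unique h4 ((h3.congr' ?_).trans (le_of_eq (by congr 1; ring)))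
  filter_upwards [Ioo_mem_nhdsGT (half_pos hσ)] with ε hε
  exact (h.radialCutoff_integral_of_integrable hε.1 (by linarith [hε.2]) hσR hq).symm

end CriticalData

theorem ae_comp_log {Q : ℝ → Prop} (hQ : ∀ᵐ x, Q x) : ∀ᵐ σ, 0 < σ → Q (Real.log σ) := by
  rw [ae_iff] at hQ ⊢
  refine measure_mono_null ?_ (addHaar_image_eq_zero_of_differentiableOn_of_addHaar_eq_zero volume
    (f := Real.exp) Real.differentiable_exp.differentiableOn hQ)
  intro σ hσ
  rw [Set.mem_ofPred_eq, Classical.not_imp] at hσ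
  exact ⟨Real.log σ, hσ.2, Real.exp_log hσ.1⟩

theorem _root_.MonotoneOn.tendsto_atBot_of_le {f : ℝ → ℝ} {L c : ℝ} (hf : MonotoneOn f (Iio L))
    (hc : ∀ x < L, c ≤ f x) : ∃ N, Tendsto f atBot (𝓝 N) := by
  have hbdd : BddBelow (f '' Iio L) := ⟨c, by rintro _ ⟨x, hx, rfl⟩; exact hc x hx⟩
  refine ⟨sInf (f '' Iio L), tendsto_order.2 ⟨fun a ha => ?_, fun a ha => ?_⟩⟩
  · filter_upwards [Iio_mem_atBot L] with x hx
    exact ha.trans_le (csInf_le hbdd ⟨x, hx, rfl⟩)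
  · obtain ⟨_, ⟨y, hy, rfl⟩, hya⟩ := exists_lt_of_csInf_lt (nonempty_Iio.image f) ha
    filter_upwards [Iic_mem_atBot y] with x hx
    exact (hf (mem_Iio.2 (lt_of_le_of_lt hx hy)) hy hx).trans_lt hya

/-! ### Sphere integrals, the limit at the vertex, and homogeneity. -/

namespace CriticalData

variable {n m : ℕ} {M : Set (Euc n)} {ρ : Euc n → ℝ} {p : ℝ} {q : Euc n → ℝ}
    {X : Euc n → Euc n} {qbar P : Euc n → ℝ} {R : ℝ} {u : Euc n → ℝ}
    (h : CriticalData m M ρ p q X qbar P R u)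

include h

theorem integrableOn_sphere_sq {σ : ℝ} (hσ : 0 < σ) (hσR : σ < R) :
    IntegrableOn (fun x => u x * u x * ρ x) (M ∩ Metric.sphere 0 σ) μHE[m] := by
  rw [h.integrableOn_sphere hσ (F := fun x => u x * u x)]
  have h1 := h.memLp_slice (Real.log_lt_log hσ hσR)
  have h2 := h1.integrable_mul h1
  simpa only [Pi.mul_def, slice, Real.exp_log hσ] using h2

theorem setIntegral_sphere_sq {σ : ℝ} (hσ : 0 < σ) (hσR : σ < R) :
    ∫ x in M ∩ Metric.sphere 0 σ, u x * u x * ρ x ∂μHE[m] =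
      σ ^ ((m : ℝ) + p) * ‖sliceCurve m M ρ u (Real.log σ)‖ ^ 2 := by
  rw [h.setIntegral_sphere hσ (fun x => u x * u x), sliceCurve,
    norm_toL2_sq (h.memLp_slice (Real.log_lt_log hσ hσR))]
  simp only [slice, Real.exp_log hσ, sq]

theorem integrableOn_sphere_radialDeriv {σ : ℝ} (hσ : 0 < σ) (hσR : σ < R)
    (hd : MemLp (sliceDeriv M u (Real.log σ)) 2 (weightMeasure m (link M) ρ)) :
    IntegrableOn (fun x => radialDeriv M u x * radialDeriv M u x * ρ x) (M ∩ Metric.sphere 0 σ)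
        μHE[m] ∧
      IntegrableOn (fun x => radialDeriv M u x * u x * ρ x) (M ∩ Metric.sphere 0 σ) μHE[m] := by
  rw [h.integrableOn_sphere hσ (F := fun x => radialDeriv M u x * radialDeriv M u x),
    h.integrableOn_sphere hσ (F := fun x => radialDeriv M u x * u x)]
  have h1 := h.memLp_slice (Real.log_lt_log hσ hσR)
  have h2 : Integrable (fun θ => sliceDeriv M u (Real.log σ) θ * sliceDeriv M u (Real.log σ) θ)
    (weightMeasure m (link M) ρ) := hd.integrable_mul hd
  have h3 : Integrable (fun θ => sliceDeriv M u (Real.log σ) θ * slice u (Real.log σ) θ)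
    (weightMeasure m (link M) ρ) := hd.integrable_mul h1
  simp only [sliceDeriv, slice, Real.exp_log hσ] at h2 h3
  constructor
  · refine (h2.const_mul (σ ^ 2)⁻¹).congr (ae_of_all _ fun θ => ?_)
    field_simp
  · refine (h3.const_mul σ⁻¹).congr (ae_of_all _ fun θ => ?_)
    field_simp

theorem setIntegral_sphere_radialDeriv_sq {σ : ℝ} (hσ : 0 < σ)
    (hd : MemLp (sliceDeriv M u (Real.log σ)) 2 (weightMeasure m (link M) ρ)) :
    ∫ x in M ∩ Metric.sphere 0 σ, radialDeriv M u x * radialDeriv M u x * ρ x ∂μHE[m] =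
      σ ^ ((m : ℝ) + p) * ((σ ^ 2)⁻¹ * ‖sliceCurveDeriv m M ρ u (Real.log σ)‖ ^ 2) := by
  rw [h.setIntegral_sphere hσ (fun x => radialDeriv M u x * radialDeriv M u x), sliceCurveDeriv,
    norm_toL2_sq hd, ← integral_const_mul (σ ^ 2)⁻¹]
  congr 1
  refine integral_congr_ae (ae_of_all _ fun θ => ?_)
  simp only [sliceDeriv, Real.exp_log hσ]
  field_simp

theorem setIntegral_sphere_radialDeriv_mul {σ : ℝ} (hσ : 0 < σ) (hσR : σ < R)
    (hd : MemLp (sliceDeriv M u (Real.log σ)) 2 (weightMeasure m (link M) ρ)) :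
    ∫ x in M ∩ Metric.sphere 0 σ, radialDeriv M u x * u x * ρ x ∂μHE[m] = σ ^ ((m : ℝ) + p) *
      (σ⁻¹ * inner ℝ (sliceCurveDeriv m M ρ u (Real.log σ)) (sliceCurve m M ρ u (Real.log σ))) := by
  rw [h.setIntegral_sphere hσ (fun x => radialDeriv M u x * u x), sliceCurveDeriv, sliceCurve,
    inner_toL2 hd (h.memLp_slice (Real.log_lt_log hσ hσR)), ← integral_const_mul σ⁻¹]
  congr 1
  refine integral_congr_ae (ae_of_all _ fun θ => ?_)
  simp only [sliceDeriv, slice, Real.exp_log hσ]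
  field_simp

theorem integrableOn_exp_mul_norm_sq {a : ℝ} (ha : a < Real.log R) :
    IntegrableOn (fun x => Real.exp (((m : ℝ) + 1 + p) * x) * ‖sliceCurve m M ρ u x‖ ^ 2)
      (Iic a) := by
  have hsf := h.sigmaFinite_link
  have h1 := (h.integral_polar_log ((integrable_indicator_iff
    Metric.isOpen_ball.measurableSet).2 h.integrableOn_sq)).1.integral_prod_left
  refine (h1.integrableOn (s := Iic a)).congr_fun (fun x hx => ?_) measurableSet_Iic
  have hxR : x < Real.log R := lt_of_le_of_lt hx ha
  simp only
  rw [integral_const_mul, sliceCurve, norm_toL2_sq (h.memLp_slice hxR)]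
  congr 1
  refine integral_congr_ae ?_
  filter_upwards [h.ae_mem_link] with θ hθ
  rw [indicator_of_mem (exp_smul_mem h.cone hθ h.R_pos hxR).2]
  rfl

/-- If the rate were below `-(m + 1 + p) / 2` somewhere, then by monotonicity it would be so all the
way to `-∞`. The squared norm times `e^{(m + 1 + p) x}` would stay above a positive constant on a
half-line, against the integrability of `u² ρ` near the vertex. -/
theorem neg_le_logRate (hne : M.Nonempty) {x : ℝ} (hx : x < Real.log R) :
    -(((m : ℝ) + 1 + p) / 2) ≤ logRate (sliceCurve m M ρ u) x := by
  by_contra! hcon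
  have h1 := fun y => exp_mul_le_norm_sq_of_logRate_le (V := sliceCurve m M ρ u)
    h.inner_sliceCurve h.ae_hasDerivAt_sliceCurve' (fun _ => h.sliceCurve_ne_zero hne) hx hcon.le
    (x := y)
  have hpos : 0 < ‖sliceCurve m M ρ u x‖ ^ 2 * Real.exp (((m : ℝ) + 1 + p) * x) :=
    mul_pos (pow_pos (norm_pos_iff.2 (h.sliceCurve_ne_zero hne hx)) 2) (Real.exp_pos _)
  have h2 : IntegrableOn (fun _ : ℝ => ‖sliceCurve m M ρ u x‖ ^ 2 *
      Real.exp (((m : ℝ) + 1 + p) * x)) (Iic x) := by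
    refine (h.integrableOn_exp_mul_norm_sq hx).mono' aestronglyMeasurable_const ?_
    filter_upwards [ae_restrict_mem measurableSet_Iic] with y hy
    rw [Real.norm_of_nonneg hpos.le]
    refine le_trans (le_of_eq ?_) (mul_le_mul_of_nonneg_left (h1 y hy) (Real.exp_pos _).le)
    rw [mul_left_comm, ← Real.exp_add]
    congr 2
    ring
  rw [integrableOn_const_iff] at h2
  simp [h.sliceCurve_ne_zero hne hx] at h2

theorem monotoneOn_logRate_log (hne : M.Nonempty) :
    MonotoneOn (fun σ => logRate (sliceCurve m M ρ u) (Real.log σ)) (Ioo 0 R) :=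
  fun _ ha _ hb hab => monotoneOn_logRate (V := sliceCurve m M ρ u) h.inner_sliceCurve
    h.ae_hasDerivAt_sliceCurve' (fun _ => h.sliceCurve_ne_zero hne) (Real.log_lt_log ha.1 ha.2)
    (Real.log_lt_log hb.1 hb.2) (Real.log_le_log ha.1 hab)

theorem exists_tendsto_logRate_log (hne : M.Nonempty) :
    ∃ N, Tendsto (fun σ => logRate (sliceCurve m M ρ u) (Real.log σ)) (𝓝[>] 0) (𝓝 N) := by
  obtain ⟨N, hN⟩ := MonotoneOn.tendsto_atBot_of_le
    (monotoneOn_logRate (V := sliceCurve m M ρ u) h.inner_sliceCurve h.ae_hasDerivAt_sliceCurve'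
      fun _ => h.sliceCurve_ne_zero hne) fun x hx => h.neg_le_logRate hne hx
  exact ⟨N, hN.comp Real.tendsto_log_nhdsGT_zero⟩

/-- Equality in `L²` becomes equality at every point, since slices are continuous and the weighted
measure of the link charges every relatively open set. -/
theorem slice_eq_of_sliceCurve_eq {x y c : ℝ} (hx : x < Real.log R) (hy : y < Real.log R)
    (hc : sliceCurve m M ρ u y = c • sliceCurve m M ρ u x) {θ : Euc n} (hθ : θ ∈ link M) :
    slice u y θ = c * slice u x θ := by
  refine h.isParametrizable_link.eqOn_of_ae_eq h.rho_continuousOn_link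
    (fun x hx => h.rho_pos x hx.1) (h.continuousOn_slice hy)
    ((h.continuousOn_slice hx).const_mul c) ?_ hθ
  have h1 := coeFn_toL2 (h.memLp_slice hx)
  have h2 := coeFn_toL2 (h.memLp_slice hy)
  change (sliceCurve m M ρ u x : Euc n → ℝ) =ᵐ[_] _ at h1
  change (sliceCurve m M ρ u y : Euc n → ℝ) =ᵐ[_] _ at h2
  rw [hc] at h2
  filter_upwards [h1, h2, Lp.coeFn_smul c (sliceCurve m M ρ u x)] with θ e1 e2 e3
  rw [← e2, e3, Pi.smul_apply, e1, smul_eq_mul]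

theorem homogeneous_of_logRate_eq (hne : M.Nonempty) {N : ℝ}
    (hN : ∀ x < Real.log R, logRate (sliceCurve m M ρ u) x = N) :
    ∀ x ∈ M ∩ Metric.ball 0 R, ∀ l : ℝ, 0 < l → l • x ∈ Metric.ball 0 R →
      u (l • x) = l ^ N * u x := by
  have hray : ∀ θ ∈ link M, ∀ s l : ℝ, 0 < s → 0 < l → s < R → l * s < R →
      u (l • s • θ) = l ^ N * u (s • θ) := by
    intro θ hθ s l hs hl hsR hlR
    have h1 := Real.log_lt_log hs hsR
    have h2 := Real.log_lt_log (mul_pos hl hs) hlR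
    have h3 := h.slice_eq_of_sliceCurve_eq h1 h2 (eq_exp_smul_of_logRate_eq
      (V := sliceCurve m M ρ u) h.inner_sliceCurve h.ae_hasDerivAt_sliceCurve'
      (fun _ => h.sliceCurve_ne_zero hne) hN h1 h2) hθ
    rw [slice, slice, Real.exp_log hs, Real.exp_log (mul_pos hl hs), Real.log_mul hl.ne' hs.ne',
      add_sub_cancel_right, mul_comm N, ← Real.rpow_def_of_pos hl, mul_smul] at h3
    exact h3
  intro x hx l hl hlx
  -- The vertex may be a regular point. Homogeneity there is obtained as a limit along a ray.
  rcases eq_or_ne x 0 with rfl | hx0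
  · obtain ⟨θ, hθ⟩ := h.nonempty_link hne
    have ht : ∀ c : ℝ, 0 < c → Tendsto (fun s : ℝ => u (c • s • θ)) (𝓝[>] 0) (𝓝 (u 0)) := by
      intro c hc
      refine (h.u_smooth.continuousOn 0 hx).tendsto.comp (tendsto_nhdsWithin_iff.2 ⟨?_, ?_⟩)
      · exact (Continuous.tendsto' (by fun_prop) _ _ (by simp)).mono_left nhdsWithin_le_nhds
      · filter_upwards [Ioo_mem_nhdsGT (div_pos h.R_pos hc)] with s hs
        refine ⟨h.cone _ (h.cone θ hθ.1 s hs.1) c hc, ?_⟩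
        rw [mem_ball_zero_iff, norm_smul, norm_smul, norm_of_mem_link hθ, mul_one,
          Real.norm_of_nonneg hc.le, Real.norm_of_nonneg hs.1.le, mul_comm]
        exact (lt_div_iff₀ hc).1 hs.2
    have h1 := (ht 1 one_pos).const_mul (l ^ N)
    rw [smul_zero]
    refine tendsto_nhds_unique (ht l hl) (h1.congr' ?_)
    filter_upwards [Ioo_mem_nhdsGT (div_pos h.R_pos hl), Ioo_mem_nhdsGT h.R_pos] with s hs hs'
    rw [one_smul, hray θ hθ s l hs.1 hl hs'.2 (by rw [mul_comm]; exact (lt_div_iff₀ hl).1 hs.2)]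
  · have hn := norm_pos_iff.2 hx0
    have hθ : ‖x‖⁻¹ • x ∈ link M := by
      refine ⟨h.cone x hx.1 _ (inv_pos.2 hn), ?_⟩
      rw [mem_sphere_zero_iff_norm, norm_smul, norm_inv, norm_norm, inv_mul_cancel₀ hn.ne']
    rw [mem_ball_zero_iff, norm_smul, Real.norm_of_nonneg hl.le] at hlx
    have := hray _ hθ ‖x‖ l hn hl (mem_ball_zero_iff.1 hx.2) hlx
    rwa [smul_inv_smul₀ hn.ne'] at this

theorem logRate_eq_of_homogeneous (hne : M.Nonempty) {N : ℝ}
    (hN : ∀ x ∈ M ∩ Metric.ball 0 R, ∀ l : ℝ, 0 < l → l • x ∈ Metric.ball 0 R →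
      u (l • x) = l ^ N * u x) {x : ℝ} (hx : x < Real.log R) :
    logRate (sliceCurve m M ρ u) x = N := by
  have h1 : ∀ y < Real.log R, ‖sliceCurve m M ρ u y‖ ^ 2 =
      Real.exp (N * (2 * y - 2 * x)) * ‖sliceCurve m M ρ u x‖ ^ 2 := by
    intro y hy
    rw [sliceCurve, sliceCurve, norm_toL2_sq (h.memLp_slice hy), norm_toL2_sq (h.memLp_slice hx),
      ← integral_const_mul]
    refine integral_congr_ae ?_
    filter_upwards [h.ae_mem_link] with θ hθ
    have e1 : Real.exp y • θ = Real.exp (y - x) • Real.exp x • θ := by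
      rw [smul_smul, ← Real.exp_add, sub_add_cancel]
    have e2 := hN _ (exp_smul_mem h.cone hθ h.R_pos hx) _ (Real.exp_pos (y - x))
      (by rw [← e1]; exact (exp_smul_mem h.cone hθ h.R_pos hy).2)
    rw [slice, slice, e1, e2, mul_pow, ← Real.exp_mul, ← Real.exp_nat_mul]
    congr 2
    push_cast
    ring
  have h2 : (fun z => ‖sliceCurve m M ρ u (z / 2)‖ ^ 2) =ᶠ[𝓝 (2 * x)]
      fun z => Real.exp (N * (z - 2 * x)) * ‖sliceCurve m M ρ u x‖ ^ 2 := by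
    filter_upwards [Iio_mem_nhds (show 2 * x < 2 * Real.log R by linarith)] with z hz
    rw [h1 (z / 2) (by linarith [mem_Iio.1 hz]), mul_div_cancel₀ z two_ne_zero]
  have h3 : HasDerivAt (fun z => Real.exp (N * (z - 2 * x)) * ‖sliceCurve m M ρ u x‖ ^ 2)
      (N * ‖sliceCurve m M ρ u x‖ ^ 2) (2 * x) := by
    have := ((((hasDerivAt_id (2 * x)).sub_const (2 * x)).const_mul N).exp).mul_const
      (‖sliceCurve m M ρ u x‖ ^ 2)
    simpa using this
  rw [logRate, (h3.congr_of_eventuallyEq h2).deriv, mul_div_cancel_right₀]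
  exact (pow_pos (norm_pos_iff.2 (h.sliceCurve_ne_zero hne hx)) 2).ne'

theorem ae_hasDerivAt_logRate_log (hne : M.Nonempty) : ∀ᵐ σ, σ ∈ Ioo 0 R →
    MemLp (sliceDeriv M u (Real.log σ)) 2 (weightMeasure m (link M) ρ) ∧
    HasDerivAt (fun σ => logRate (sliceCurve m M ρ u) (Real.log σ))
      (2 / (‖sliceCurve m M ρ u (Real.log σ)‖ ^ 2) ^ 2 *
        (‖sliceCurveDeriv m M ρ u (Real.log σ)‖ ^ 2 * ‖sliceCurve m M ρ u (Real.log σ)‖ ^ 2 -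
          inner ℝ (sliceCurveDeriv m M ρ u (Real.log σ)) (sliceCurve m M ρ u (Real.log σ)) ^ 2) *
        σ⁻¹) σ := by
  filter_upwards [ae_comp_log h.ae_hasDerivAt_sliceCurve] with σ hσ hσR
  have hlog := Real.log_lt_log hσR.1 hσR.2
  obtain ⟨h1, h2⟩ := hσ hσR.1 hlog
  exact ⟨h1, (hasDerivAt_logRate (V := sliceCurve m M ρ u) h.inner_sliceCurve
    (fun _ => h.sliceCurve_ne_zero hne) hlog h2).comp σ (Real.hasDerivAt_log hσR.1.ne')⟩

end CriticalData

/-- With `k = m + 1`, the bound on the dimension makes `S` null in dimension `k` and also in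
dimension `k - 1`. Integrals over `C` and over its regular part then agree, on balls as well as on
spheres. -/
theorem euclideanHausdorffMeasure_eq_zero_of_dimH_add_le {n m d : ℕ} {S : Set (Euc n)}
    (hdim : S = ∅ ∨ dimH S + 3 ≤ ((m + 1 : ℕ) : ENNReal)) (hd : m ≤ d) : μHE[d] S = 0 := by
  rcases hdim with rfl | hdim
  · simp
  refine euclideanHausdorffMeasure_eq_zero_of_dimH_lt ?_
  by_contra! hcon
  have h1 : ((d : ENNReal) + 3) ≤ ((m + 1 : ℕ) : ENNReal) := (add_le_add_left hcon 3).trans hdim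
  have h2 : d + 3 ≤ m + 1 := by exact_mod_cast h1
  omega

theorem restrict_inter_eq_restrict_sdiff_inter {α : Type*} [MeasurableSpace α] {μ : Measure α}
    {C S : Set α} (hS : μ S = 0) (A : Set α) : μ.restrict (C ∩ A) = μ.restrict ((C \ S) ∩ A) :=
  Measure.restrict_congr_set ((sdiff_null_ae_eq_self hS).symm.inter (ae_eq_refl A))

/-! ### From the cone with its singular set to the regular part. -/

section FormDomain

variable {n m : ℕ} {M : Set (Euc n)} {ρ : Euc n → ℝ} {p : ℝ} {q : Euc n → ℝ}
    {X : Euc n → Euc n} {qbar P : Euc n → ℝ} {R : ℝ} {u : Euc n → ℝ}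
    (h : ConeData m M ρ p q X qbar P)

include h

/-- The potential in the form norm is measurable, because the form density of `u` is. -/
theorem ConeData.aestronglyMeasurable_formDensity
    (husmooth : ContDiffOn ℝ ∞ u (M ∩ Metric.ball 0 R))
    (hupos : ∀ x ∈ M ∩ Metric.ball 0 R, 0 < u x)
    (huint : IntegrableOn (formDensity M ρ P u) (M ∩ Metric.ball 0 R) μHE[m + 1])
    {f : Euc n → ℝ} (hf : ContDiffOn ℝ ∞ f (M ∩ Metric.ball 0 R)) :
    AEStronglyMeasurable (formDensity M ρ P f) (μHE[m + 1].restrict (M ∩ Metric.ball 0 R)) := by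
  have hm : MeasurableSet (M ∩ Metric.ball 0 R) :=
    h.measurableSet.inter Metric.isOpen_ball.measurableSet
  have hgrad : ∀ g : Euc n → ℝ, ContDiffOn ℝ ∞ g (M ∩ Metric.ball 0 R) →
      ContinuousOn (fun x => ‖tgrad M g x‖ ^ 2) (M ∩ Metric.ball 0 R) := fun g hg =>
    (h.param.continuousOn_tgrad Metric.isOpen_ball (hg.of_le (by exact_mod_cast le_top))).norm.pow 2
  have hρ : ContinuousOn ρ (M ∩ Metric.ball 0 R) :=
    h.rho_smooth.continuousOn.mono inter_subset_left
  -- `P` is not assumed measurable. Since `u > 0`, its product with the weight is recovered,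
  -- together with the other zeroth order coefficients, from the form density of `u` by subtracting
  -- the gradient part and dividing by `u²`.
  have h1 : AEStronglyMeasurable (fun x => ‖tgrad M f x‖ ^ 2 * ρ x +
      (formDensity M ρ P u x - ‖tgrad M u x‖ ^ 2 * ρ x) * (f x ^ 2 * (u x ^ 2)⁻¹))
      (μHE[m + 1].restrict (M ∩ Metric.ball 0 R)) := by
    refine (((hgrad f hf).mul hρ).aestronglyMeasurable hm).add
      ((huint.aestronglyMeasurable.sub (((hgrad u husmooth).mul hρ).aestronglyMeasurable hm)).mul
        (ContinuousOn.aestronglyMeasurable ?_ hm))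
    exact (hf.continuousOn.pow 2).mul ((husmooth.continuousOn.pow 2).inv₀ fun x hx =>
      (pow_pos (hupos x hx) 2).ne')
  refine h1.congr ?_
  filter_upwards [ae_restrict_mem hm] with x hx
  have := (hupos x hx).ne'
  simp only [formDensity]
  field_simp
  ring

/-- Since `S` is null, every integral over `C` is one over `M`. Approximation is assumed for lower
integrals of the density, and measurability of that density turns it into approximation for genuine
integrals. -/
theorem ConeData.criticalData {C S : Set (Euc n)} (hM : M = C \ S) (hS : μHE[m + 1] S = 0)
    (hR : 0 < R) (husmooth : ContDiffOn ℝ ∞ u (M ∩ Metric.ball 0 R))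
    (hupos : ∀ x ∈ M ∩ Metric.ball 0 R, 0 < u x)
    (huint : IntegrableOn (formDensity M ρ P u) (C ∩ Metric.ball 0 R) μHE[m + 1])
    (hudom : MemFormDomain (m + 1) C S ρ P R u) (hucrit : IsCriticalPoint (m + 1) C S ρ q R u) :
    CriticalData m M ρ p q X qbar P R u := by
  have hres := restrict_inter_eq_restrict_sdiff_inter (C := C) hS
  have hball : ∀ r, MeasurableSet (Metric.ball (0 : Euc n) r) := fun r =>
    Metric.isOpen_ball.measurableSet
  rw [← hM] at hres
  rw [IntegrableOn, hres] at huint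
  have hcont := h.rho_smooth.continuousOn
  refine { h with
    R_pos := hR
    u_smooth := husmooth
    u_pos := hupos
    integrable := (integrableOn_weightMeasure h.measurableSet hcont h.rho_nonneg (hball R)).2 huint
    dom := fun r hr ε hε => ?_
    crit := fun φ hφ => ?_ }
  · obtain ⟨φ, hφ, hlt⟩ := hudom r hr (ENNReal.ofReal ε) (ENNReal.ofReal_pos.2 hε)
    rw [hres, ← hM] at hlt
    rw [← hM] at hφ
    refine ⟨φ, hφ, ?_⟩
    have hsub : M ∩ Metric.ball 0 r ⊆ M ∩ Metric.ball 0 R :=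
      inter_subset_inter_right M (Metric.ball_subset_ball hr.le)
    have hmeas := (h.aestronglyMeasurable_formDensity husmooth hupos huint
      (husmooth.sub (hφ.1.mono inter_subset_left))).mono_measure (Measure.restrict_mono hsub le_rfl)
    have hnn : 0 ≤ᵐ[μHE[m + 1].restrict (M ∩ Metric.ball 0 r)]
        formDensity M ρ P fun y => u y - φ y := by
      filter_upwards [ae_restrict_mem (h.measurableSet.inter (hball r))] with x hx
      exact mul_nonneg (energy_nonneg (h.P_pos x hx.1).le) (h.rho_nonneg x hx.1)
    rw [integrableOn_weightMeasure h.measurableSet hcont h.rho_nonneg (hball r),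
      setIntegral_weightMeasure h.measurableSet hcont h.rho_nonneg (hball r)]
    refine ⟨⟨hmeas, (hasFiniteIntegral_iff_ofReal hnn).2 (hlt.trans ENNReal.ofReal_lt_top)⟩, ?_⟩
    have h1 := integral_eq_lintegral_of_nonneg_ae hnn hmeas
    exact h1.trans_lt (ENNReal.toReal_lt_of_lt_ofReal hlt)
  · have h1 := hucrit φ (hM ▸ hφ)
    rw [hres, ← hM, ← setIntegral_weightMeasure h.measurableSet hcont h.rho_nonneg (hball R)
      (fun x => inner ℝ (tgrad M u x) (tgrad M φ x) - q x * u x * φ x)] at h1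
    rw [formQ, ← h1]
    refine (setIntegral_eq_integral_of_ae_compl_eq_zero ?_).symm
    filter_upwards [h.ae_mem] with x hx hxR
    obtain ⟨e1, e2⟩ := hφ.eq_zero_of_notMem hx hxR
    rw [e1, e2, inner_zero_right, mul_zero, sub_zero]

end FormDomain

namespace CriticalData

variable {n m : ℕ} {C S : Set (Euc n)} {ρ : Euc n → ℝ} {p : ℝ} {q : Euc n → ℝ}
    {X : Euc n → Euc n} {qbar P : Euc n → ℝ} {R : ℝ} {u : Euc n → ℝ}
    (h : CriticalData m (C \ S) ρ p q X qbar P R u) (hS : ∀ d, m ≤ d → μHE[d] S = 0)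

include h hS

theorem tendsto_cutoffForm {σ : ℝ} (hσ : 0 < σ) (hσR : σ < R) :
    Tendsto (fun ε => cutoffForm (m + 1) C S ρ qbar X u σ ε) (𝓝[>] 0)
      (𝓝 (σ⁻¹ * radialFlux m (C \ S) ρ p u (Real.log σ))) := by
  simpa only [cutoffForm, restrict_inter_eq_restrict_sdiff_inter (C := C) (hS _ m.le_succ)]
    using h.tendsto_integral_cutoffDensity hσ hσR

theorem localForm_eq {σ : ℝ} (hσ : 0 < σ) (hσR : σ < R) :
    localForm (m + 1) C S ρ qbar X u σ = σ⁻¹ * radialFlux m (C \ S) ρ p u (Real.log σ) :=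
  (h.tendsto_cutoffForm hS hσ hσR).limUnder_eq

theorem localForm_eq_setIntegral {σ : ℝ} (hσ : 0 < σ) (hσR : σ < R)
    (hq : IntegrableOn (fun x => q x * u x ^ 2 * ρ x) (C ∩ Metric.ball 0 σ) μHE[m + 1]) :
    localForm (m + 1) C S ρ qbar X u σ =
      ∫ x in C ∩ Metric.ball 0 σ, (‖tgrad (C \ S) u x‖ ^ 2 - q x * u x ^ 2) * ρ x ∂μHE[m + 1] := by
  have hres := restrict_inter_eq_restrict_sdiff_inter (C := C) (hS (m + 1) m.le_succ)
  have hb : MeasurableSet (Metric.ball (0 : Euc n) σ) := Metric.isOpen_ball.measurableSet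
  rw [IntegrableOn, hres] at hq
  rw [h.localForm_eq hS hσ hσR, hres, ← h.setIntegral_eq_radialFlux hσ hσR
    ((integrableOn_weightMeasure h.measurableSet h.rho_smooth.continuousOn h.rho_nonneg hb).2 hq),
    setIntegral_weightMeasure h.measurableSet h.rho_smooth.continuousOn h.rho_nonneg hb]

theorem sphereNormSq_eq {σ : ℝ} (hσ : 0 < σ) (hσR : σ < R) : sphereNormSq (m + 1) C ρ u σ =
    σ ^ ((m : ℝ) + p) * ‖sliceCurve m (C \ S) ρ u (Real.log σ)‖ ^ 2 := by
  rw [sphereNormSq, sphereInner, Nat.add_sub_cancel,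
    restrict_inter_eq_restrict_sdiff_inter (hS m le_rfl), h.setIntegral_sphere_sq hσ hσR]

theorem sphereNormSq_pos (hne : (C \ S).Nonempty) {σ : ℝ} (hσ : 0 < σ) (hσR : σ < R) :
    0 < sphereNormSq (m + 1) C ρ u σ := by
  rw [h.sphereNormSq_eq hS hσ hσR]
  exact mul_pos (Real.rpow_pos_of_pos hσ _)
    (pow_pos (norm_pos_iff.2 (h.sliceCurve_ne_zero hne (Real.log_lt_log hσ hσR))) 2)

/-- The numerator and the denominator carry the same power `σ^{m + p}`, from the area of spheres and
the degree of `ρ`. After cancelling it, the quotient is the logarithmic derivative of the curve of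
slices. -/
theorem frequency_eq {σ : ℝ} (hσ : σ ∈ Ioo 0 R) : frequency (m + 1) C S ρ qbar X u σ =
    logRate (sliceCurve m (C \ S) ρ u) (Real.log σ) := by
  rw [frequency, h.localForm_eq hS hσ.1 hσ.2, h.sphereNormSq_eq hS hσ.1 hσ.2,
    mul_inv_cancel_left₀ hσ.1.ne', radialFlux, logRate, mul_comm _ (Real.log σ),
    ← Real.rpow_def_of_pos hσ.1, mul_div_mul_left _ _ (Real.rpow_pos_of_pos hσ.1 _).ne']

theorem ae_hasDerivAt_frequency (hne : (C \ S).Nonempty) : ∀ᵐ σ ∂(volume.restrict (Ioo 0 R)),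
    IntegrableOn (fun x => radialDeriv (C \ S) u x * radialDeriv (C \ S) u x * ρ x)
      (C ∩ Metric.sphere 0 σ) μHE[m] ∧
    IntegrableOn (fun x => radialDeriv (C \ S) u x * u x * ρ x) (C ∩ Metric.sphere 0 σ) μHE[m] ∧
    HasDerivAt (frequency (m + 1) C S ρ qbar X u)
      (2 * σ / sphereNormSq (m + 1) C ρ u σ ^ 2 *
        (sphereNormSq (m + 1) C ρ (radialDeriv (C \ S) u) σ * sphereNormSq (m + 1) C ρ u σ -
          sphereInner (m + 1) C ρ (radialDeriv (C \ S) u) u σ ^ 2)) σ := by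
  have hres := restrict_inter_eq_restrict_sdiff_inter (C := C) (hS m le_rfl)
  rw [ae_restrict_iff' measurableSet_Ioo]
  filter_upwards [h.ae_hasDerivAt_logRate_log hne] with σ hσ hσR
  obtain ⟨h1, h2⟩ := hσ hσR
  obtain ⟨h3, h4⟩ := h.integrableOn_sphere_radialDeriv hσR.1 hσR.2 h1
  rw [IntegrableOn, IntegrableOn, hres]
  refine ⟨h3, h4, ?_⟩
  have h5 : frequency (m + 1) C S ρ qbar X u =ᶠ[𝓝 σ]
      fun σ => logRate (sliceCurve m (C \ S) ρ u) (Real.log σ) := by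
    filter_upwards [isOpen_Ioo.mem_nhds hσR] with s hs using h.frequency_eq hS hs
  refine (h2.congr_of_eventuallyEq h5).congr_deriv ?_
  have e1 : sphereNormSq (m + 1) C ρ (radialDeriv (C \ S) u) σ = σ ^ ((m : ℝ) + p) *
      ((σ ^ 2)⁻¹ * ‖sliceCurveDeriv m (C \ S) ρ u (Real.log σ)‖ ^ 2) := by
    rw [sphereNormSq, sphereInner, Nat.add_sub_cancel, hres,
      h.setIntegral_sphere_radialDeriv_sq hσR.1 h1]
  have e2 : sphereInner (m + 1) C ρ (radialDeriv (C \ S) u) u σ = σ ^ ((m : ℝ) + p) *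
      (σ⁻¹ * inner ℝ (sliceCurveDeriv m (C \ S) ρ u (Real.log σ))
        (sliceCurve m (C \ S) ρ u (Real.log σ))) := by
    rw [sphereInner, Nat.add_sub_cancel, hres, h.setIntegral_sphere_radialDeriv_mul hσR.1 hσR.2 h1]
  rw [e1, e2, h.sphereNormSq_eq hS hσR.1 hσR.2]
  have p1 := (Real.rpow_pos_of_pos hσR.1 ((m : ℝ) + p)).ne'
  have p2 := norm_ne_zero_iff.2 (h.sliceCurve_ne_zero hne (Real.log_lt_log hσR.1 hσR.2))
  have p3 := hσR.1.ne'
  generalize σ ^ ((m : ℝ) + p) = t at p1 ⊢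
  generalize ‖sliceCurve m (C \ S) ρ u (Real.log σ)‖ = a at p2 ⊢
  generalize ‖sliceCurveDeriv m (C \ S) ρ u (Real.log σ)‖ = b
  generalize inner ℝ (sliceCurveDeriv m (C \ S) ρ u (Real.log σ))
    (sliceCurve m (C \ S) ρ u (Real.log σ)) = c
  field_simp

end CriticalData

end WeightedCone

/-! ### The theorem. -/

theorem theorem3p6 {n k : ℕ} (hk : 1 ≤ k)
    -- `C` is a cone, with a singular set `S` invariant under dilations and `C \ S` smooth
    (C S : Set (WeightedCone.Euc n)) (hSC : S ⊆ C)
    (hC : ∀ x ∈ C, ∀ l : ℝ, 0 < l → l • x ∈ C)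
    (hS : ∀ x ∈ S, ∀ l : ℝ, 0 < l → l • x ∈ S)
    (hreg : WeightedCone.IsSmoothSubmanifold k (C \ S))
    (hne : (C \ S).Nonempty)
    -- `dim S ≤ k - 3` (in particular `S` is empty for `k ≤ 2`)
    (hdim : S = ∅ ∨ dimH S + 3 ≤ (k : ENNReal))
    -- the weight, homogeneous of degree `p`
    (ρ : WeightedCone.Euc n → ℝ) (p : ℝ)
    (hρsmooth : ContDiffOn ℝ ∞ ρ (C \ S))
    (hρpos : ∀ x ∈ C \ S, 0 < ρ x)
    (hρhom : ∀ x ∈ C \ S, ∀ l : ℝ, 0 < l → ρ (l • x) = l ^ p * ρ x)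
    (hρint : LocallyIntegrable ρ (μHE[k].restrict C))
    -- the potential, homogeneous of degree `-2`
    (q : WeightedCone.Euc n → ℝ)
    (hqsmooth : ContDiffOn ℝ ∞ q (C \ S))
    (hqhom : ∀ x ∈ C \ S, ∀ l : ℝ, 0 < l → q (l • x) = (l ^ 2)⁻¹ * q x)
    -- `q = div X + q̄` with `|X|² + |q̄| ≤ P`
    (X : WeightedCone.Euc n → WeightedCone.Euc n) (qbar P : WeightedCone.Euc n → ℝ)
    (hXsmooth : ContDiffOn ℝ 1 X (C \ S))
    (hXtan : ∀ x ∈ C \ S, X x ∈ WeightedCone.tangentSpaceAt (C \ S) x)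
    (hq : ∀ x ∈ C \ S, q x = WeightedCone.tdiv (C \ S) X x + qbar x)
    (hP : ∀ x ∈ C \ S, 0 < P x)
    (hXP : ∀ x ∈ C \ S, ‖X x‖ ^ 2 + |qbar x| ≤ P x)
    -- the critical point `u`, defined in `B_R`
    (R : ℝ) (hR : 0 < R) (u : WeightedCone.Euc n → ℝ)
    (husmooth : ContDiffOn ℝ ∞ u ((C \ S) ∩ Metric.ball 0 R))
    (hupos : ∀ x ∈ (C \ S) ∩ Metric.ball 0 R, 0 < u x)
    (huint : IntegrableOn (WeightedCone.formDensity (C \ S) ρ P u) (C ∩ Metric.ball 0 R) μHE[k])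
    (hudom : WeightedCone.MemFormDomain k C S ρ P R u)
    (hucrit : WeightedCone.IsCriticalPoint k C S ρ q R u) :
    -- the frequency function is well defined on `(0, R)`
    (∀ σ ∈ Ioo 0 R,
      Tendsto (fun ε => WeightedCone.cutoffForm k C S ρ qbar X u σ ε) (𝓝[>] (0 : ℝ))
        (𝓝 (WeightedCone.localForm k C S ρ qbar X u σ)) ∧
      (IntegrableOn (fun x => q x * u x ^ 2 * ρ x) (C ∩ Metric.ball 0 σ) μHE[k] →
        WeightedCone.localForm k C S ρ qbar X u σ =
          ∫ x in C ∩ Metric.ball 0 σ,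
            (‖WeightedCone.tgrad (C \ S) u x‖ ^ 2 - q x * u x ^ 2) * ρ x ∂μHE[k]) ∧
      IntegrableOn (fun x => u x * u x * ρ x) (C ∩ Metric.sphere 0 σ) μHE[k - 1] ∧
      0 < WeightedCone.sphereNormSq k C ρ u σ) ∧
    -- monotonicity
    MonotoneOn (WeightedCone.frequency k C S ρ qbar X u) (Ioo 0 R) ∧
    -- the formula for the derivative
    (∀ᵐ σ ∂(volume.restrict (Ioo 0 R)),
      IntegrableOn (fun x => WeightedCone.radialDeriv (C \ S) u x *
        WeightedCone.radialDeriv (C \ S) u x * ρ x) (C ∩ Metric.sphere 0 σ) μHE[k - 1] ∧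
      IntegrableOn (fun x => WeightedCone.radialDeriv (C \ S) u x * u x * ρ x)
        (C ∩ Metric.sphere 0 σ) μHE[k - 1] ∧
      HasDerivAt (WeightedCone.frequency k C S ρ qbar X u)
        (2 * σ / WeightedCone.sphereNormSq k C ρ u σ ^ 2 *
          (WeightedCone.sphereNormSq k C ρ (WeightedCone.radialDeriv (C \ S) u) σ *
              WeightedCone.sphereNormSq k C ρ u σ -
            WeightedCone.sphereInner k C ρ (WeightedCone.radialDeriv (C \ S) u) u σ ^ 2)) σ) ∧
    -- the limit at `0`, and the case of equality
    ∃ N₀ : ℝ,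
      Tendsto (WeightedCone.frequency k C S ρ qbar X u) (𝓝[>] (0 : ℝ)) (𝓝 N₀) ∧
      ((∀ σ ∈ Ioo 0 R, WeightedCone.frequency k C S ρ qbar X u σ = N₀) ↔
        ∀ x ∈ (C \ S) ∩ Metric.ball 0 R, ∀ l : ℝ, 0 < l → l • x ∈ Metric.ball 0 R →
          u (l • x) = l ^ N₀ * u x) := by
  obtain ⟨m, rfl⟩ : ∃ m, k = m + 1 := ⟨k - 1, (Nat.sub_add_cancel hk).symm⟩
  have hS0 : ∀ d, m ≤ d → μHE[d] S = 0 := fun d hd =>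
    WeightedCone.euclideanHausdorffMeasure_eq_zero_of_dimH_add_le hdim hd
  have hcone : WeightedCone.IsCone (C \ S) := fun x hx l hl => ⟨hC x hx.1 l hl, fun hlx => hx.2 (by
    have := hS _ hlx l⁻¹ (inv_pos.2 hl)
    rwa [inv_smul_smul₀ hl.ne'] at this)⟩
  have hdata : WeightedCone.ConeData m (C \ S) ρ p q X qbar P :=
    ⟨hreg.isParametrizable, hcone, hρsmooth, hρpos, hρhom, hqsmooth, hqhom, hXsmooth, hXtan, hq, hP,
      hXP⟩
  have h := hdata.criticalData rfl (hS0 _ m.le_succ) hR husmooth hupos huint hudom hucrit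
  refine ⟨fun σ hσ => ⟨?_, fun hint => h.localForm_eq_setIntegral hS0 hσ.1 hσ.2 hint, ?_,
    h.sphereNormSq_pos hS0 hne hσ.1 hσ.2⟩, ?_, h.ae_hasDerivAt_frequency hS0 hne, ?_⟩
  · rw [h.localForm_eq hS0 hσ.1 hσ.2]
    exact h.tendsto_cutoffForm hS0 hσ.1 hσ.2
  · rw [IntegrableOn, Nat.add_sub_cancel,
      WeightedCone.restrict_inter_eq_restrict_sdiff_inter (hS0 m le_rfl)]
    exact h.integrableOn_sphere_sq hσ.1 hσ.2
  · exact (h.monotoneOn_logRate_log hne).congr fun σ hσ => (h.frequency_eq hS0 hσ).symm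
  · obtain ⟨N, hN⟩ := h.exists_tendsto_logRate_log hne
    refine ⟨N, hN.congr' ?_, fun hfreq => h.homogeneous_of_logRate_eq hne fun x hx => ?_,
      fun hhom σ hσ => ?_⟩
    · filter_upwards [Ioo_mem_nhdsGT hR] with σ hσ using (h.frequency_eq hS0 hσ).symm
    · have hx' : Real.exp x ∈ Ioo 0 R := ⟨Real.exp_pos x, (Real.lt_log_iff_exp_lt hR).1 hx⟩
      have := h.frequency_eq hS0 hx'
      rwa [hfreq _ hx', Real.log_exp, eq_comm] at this
    · rw [h.frequency_eq hS0 hσ]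
      exact h.logRate_eq_of_homogeneous hne hhom (Real.log_lt_log hσ.1 hσ.2)
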